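/- **Theorem 6.1.** Let $X$ be a connected Riemann surface (for example a compact one) and let $S=x_1+\dots+x_d$ be a reduced effective divisor on $X$, that is, a finite set of distinct points. *Branched projective structures.* Consider triples $(\gamma,\mathcal H,s)$, where $\gamma:\mathbf P\to X$ is a holomorphic $\mathbb{CP}^1$-bundle, $\mathcal H\subset T\mathbf P$ is a holomorphic connection (a holomorphic line subbundle with $T_\gamma\oplus\mathcal H=T\mathbf P$, where $T_\gamma=\ker d\gamma$), and $s:X\to\mathbf P$ is a holomorphic section of $\gamma$, such that the divisor of the homomorphism $\widehat{ds}:TX\to s^*T_\gamma$ ($ds$ followed by the projection along $\mathcal H$) is $S$. Two triples are equivalent if there is a biholomorphism $\mathbf P_1\to\mathbf P_2$ over $X$ taking $\mathcal H_1$ to $\mathcal H_2$ and $s_1$ to $s_2$. A branched holomorphic projective structure on $X$ with branching divisor $S$ is an equivalence class of such triples. *Branched opers.* A branched $\mathrm{SO}(3,\mathbb C)$-oper of type $S$ consists of: 1. a rank three holomorphic vector bundle $W$ on $X$ with a holomorphic fibrewise nondegenerate symmetric bilinear form $B_W$ and an isomorphism $\bigwedge^3W\cong\mathcal O_X$ taking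 the form induced by $B_W$ to the standard form on $\mathcal O_X$; 2. holomorphic subbundles $F_1\subset F_2\subset W$ of ranks one and two with $B_W(F_1\otimes F_1)=0$ and $B_W(F_1\otimes F_2)=0$ (so $F_1^\perp=F_2$), with isomorphisms $F_1\cong K_X\otimes\mathcal O_X(-S)$ and $F_2/F_1\cong\mathcal O_X$; 3. a holomorphic connection $D_W$ on $W$ which preserves $B_W$, induces the de Rham differential on $\bigwedge^3W\cong\mathcal O_X$, satisfies $D_W(F_1)\subset F_2\otimes K_X$, and for which the second fundamental form of $F_1$, a section of $\mathrm{Hom}(K_X\otimes\mathcal O_X(-S),\mathcal O_X)\otimes K_X=\mathcal O_X(S)$, is the section given by the constant function $1$. Two such opers are isomorphic if there is a holomorphic isomorphism of the vector bundles that respects the bilinear forms, the trivializations of $\bigwedge^3$, the filtrations and the connections. Compatibility with the chosen isomorphisms $F_1\cong K_X\otimes\mathcal O_X(-S)$ and $F_2/F_1\cong\mathcal O_X$ is not required. *Statement.* There is a bijection from the set of branched holomorphic projective structures on $X$ with branching divisor $S$ to the set of isomorphism classes of branched $\mathrm{SO}(3,\mathbb C)$-opers of type $S$ on $X$. It sends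 the class of $(\gamma,\mathcal H,s)$ to the class of the opers whose bundle, form, filtration and connection are, up to a holomorphic isomorphism of vector bundles, the following: $W=\gamma_*T_\gamma$; $B_W$ is the fibrewise Killing form of the Lie bracket of vertical vector fields; the filtration is $\gamma_*(T_\gamma\otimes\mathcal O_{\mathbf P}(-2s(X)))\subset\gamma_*(T_\gamma\otimes\mathcal O_{\mathbf P}(-s(X)))\subset\gamma_*T_\gamma$; and the connection is the one induced by $\mathcal H$, that is, the Lie derivative of vertical vector fields along $\mathcal H$-horizontal lifts of vector fields on $X$. -/

import Mathlib

open Set Filter Topology Bundle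
open scoped Manifold ContDiff Topology

universe u

noncomputable section

/-- The complex projective line `ℂℙ¹ = ℂ ∪ {∞}`, topologised as the one-point compactification. -/
def CP1 : Type := OnePoint ℂ

namespace CP1

instance : TopologicalSpace CP1 := inferInstanceAs (TopologicalSpace (OnePoint ℂ))
instance : CompactSpace CP1 := inferInstanceAs (CompactSpace (OnePoint ℂ))
instance : T2Space CP1 := inferInstanceAs (T2Space (OnePoint ℂ))

/-- The inclusion of the affine line. -/
def ofComplex (z : ℂ) : CP1 := (z : OnePoint ℂ)

/-- The point at infinity. -/
def infinity : CP1 := (OnePoint.infty : OnePoint ℂ)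

lemma ofComplex_ne_infinity (z : ℂ) : ofComplex z ≠ infinity := OnePoint.coe_ne_infty z

lemma ofComplex_injective : Function.Injective ofComplex := OnePoint.coe_injective

lemma eq_infinity_or (p : CP1) : p = infinity ∨ ∃ z, p = ofComplex z := by
  induction p using OnePoint.rec with
  | infty => exact Or.inl rfl
  | coe z => exact Or.inr ⟨z, rfl⟩

lemma isOpenEmbedding_ofComplex : IsOpenEmbedding ofComplex :=
  OnePoint.isOpenEmbedding_coe

/-- The involution `z ↦ 1 / z` of `ℂℙ¹`, which exchanges `0` and `∞`. -/
def inv (p : CP1) : CP1 :=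
  OnePoint.elim (X := ℂ) p (ofComplex 0) fun z => if z = 0 then infinity else ofComplex z⁻¹

@[simp] lemma inv_infinity : inv infinity = ofComplex 0 := rfl

lemma inv_ofComplex (z : ℂ) :
    inv (ofComplex z) = if z = 0 then infinity else ofComplex z⁻¹ := rfl

@[simp] lemma inv_zero : inv (ofComplex 0) = infinity := by simp [inv_ofComplex]

lemma inv_ofComplex_of_ne {z : ℂ} (hz : z ≠ 0) : inv (ofComplex z) = ofComplex z⁻¹ := by
  simp [inv_ofComplex, hz]

@[simp] lemma inv_inv (p : CP1) : inv (inv p) = p := by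
  rcases eq_infinity_or p with rfl | ⟨z, rfl⟩
  · simp
  · by_cases hz : z = 0
    · subst hz; simp
    · rw [inv_ofComplex_of_ne hz, inv_ofComplex_of_ne (inv_ne_zero hz), _root_.inv_inv]

lemma continuous_inv : Continuous inv := by
  refine (OnePoint.continuous_iff (X := ℂ) inv).2 ⟨?_, ?_⟩
  · have h : Tendsto (fun z : ℂ => ofComplex z⁻¹) (cocompact ℂ) (𝓝 (ofComplex 0)) := by
      refine (isOpenEmbedding_ofComplex.continuous.tendsto 0).comp ?_
      rw [← Metric.cobounded_eq_cocompact]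
      exact tendsto_inv₀_cobounded
    rw [coclosedCompact_eq_cocompact]
    refine h.congr' ?_
    have : ({0}ᶜ : Set ℂ) ∈ cocompact ℂ := isCompact_singleton.compl_mem_cocompact
    filter_upwards [this] with z hz
    exact (inv_ofComplex_of_ne hz).symm
  · refine continuous_iff_continuousAt.2 fun z => ?_
    by_cases hz : z = 0
    · subst hz
      have h : Tendsto (fun z : ℂ => inv (ofComplex z)) (𝓝[≠] 0) (𝓝 infinity) := by
        have h1 : Tendsto (fun z : ℂ => ofComplex z⁻¹) (𝓝[≠] 0) (𝓝 infinity) := by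
          have h2 : Tendsto ofComplex (cocompact ℂ) (𝓝 infinity) := by
            have := OnePoint.tendsto_coe_infty (X := ℂ)
            rwa [coclosedCompact_eq_cocompact] at this
          refine h2.comp ?_
          rw [← Metric.cobounded_eq_cocompact]
          exact tendsto_inv₀_nhdsNE_zero
        refine h1.congr' ?_
        filter_upwards [self_mem_nhdsWithin] with z hz
        exact (inv_ofComplex_of_ne hz).symm
      have h0 : inv (ofComplex 0) = infinity := inv_zero
      refine continuousAt_iff_punctured_nhds.2 ?_
      change Tendsto (fun z : ℂ => inv (ofComplex z)) (𝓝[≠] 0) (𝓝 (inv (ofComplex 0)))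
      rw [h0]
      exact h
    · have h : ContinuousAt (fun z : ℂ => ofComplex z⁻¹) z :=
        isOpenEmbedding_ofComplex.continuous.continuousAt.comp (continuousAt_inv₀ hz)
      refine h.congr ?_
      filter_upwards [isOpen_ne.mem_nhds hz] with y hy
      exact (inv_ofComplex_of_ne hy).symm

/-- `z ↦ 1 / z` as a homeomorphism. -/
def invHomeomorph : CP1 ≃ₜ CP1 where
  toFun := inv
  invFun := inv
  left_inv := inv_inv
  right_inv := inv_inv
  continuous_toFun := continuous_inv
  continuous_invFun := continuous_inv

/-- The affine coordinate `z`, defined off `∞`. -/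
def chartZero : OpenPartialHomeomorph CP1 ℂ :=
  (isOpenEmbedding_ofComplex.toOpenPartialHomeomorph ofComplex).symm

/-- The coordinate `1 / z`, defined off `0`. -/
def chartInfinity : OpenPartialHomeomorph CP1 ℂ :=
  invHomeomorph.transOpenPartialHomeomorph chartZero

lemma chartZero_source : chartZero.source = range ofComplex := by
  simp [chartZero]

lemma chartZero_symm_apply (z : ℂ) : chartZero.symm z = ofComplex z := by
  simp [chartZero]

lemma chartZero_ofComplex (z : ℂ) : chartZero (ofComplex z) = z := by
  have := chartZero.right_inv (x := z) (by simp [chartZero])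
  rwa [chartZero_symm_apply] at this

lemma chartInfinity_apply (p : CP1) : chartInfinity p = chartZero (inv p) := rfl

lemma chartInfinity_symm_apply (z : ℂ) : chartInfinity.symm z = inv (ofComplex z) := by
  change inv (chartZero.symm z) = _
  rw [chartZero_symm_apply]

open Classical in
instance : ChartedSpace ℂ CP1 where
  atlas := {chartZero, chartInfinity}
  chartAt p := if p = infinity then chartInfinity else chartZero
  mem_chart_source p := by
    rcases eq_infinity_or p with rfl | ⟨z, rfl⟩
    · simp only [if_true]
      change inv infinity ∈ chartZero.source
      rw [chartZero_source, inv_infinity]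
      exact ⟨0, rfl⟩
    · simp only [ofComplex_ne_infinity, if_false]
      rw [chartZero_source]
      exact ⟨z, rfl⟩
  chart_mem_atlas p := by
    by_cases hp : p = infinity <;> simp [hp]

lemma transition_contDiffOn {s : Set ℂ} (hs : ∀ z ∈ s, z ≠ 0) :
    ContDiffOn ℂ ω (fun z : ℂ => chartZero (inv (ofComplex z))) s := by
  have h : ContDiffOn ℂ ω (fun z : ℂ => z⁻¹) s := fun z hz =>
    (contDiffAt_inv ℂ (hs z hz)).contDiffWithinAt
  refine h.congr fun z hz => ?_
  rw [inv_ofComplex_of_ne (hs z hz), chartZero_ofComplex]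

lemma ne_zero_of_inv_mem {z : ℂ} (h : inv (ofComplex z) ∈ chartZero.source) : z ≠ 0 := by
  rintro rfl
  rw [chartZero_source, inv_zero] at h
  obtain ⟨w, hw⟩ := h
  exact ofComplex_ne_infinity w hw

instance : IsManifold 𝓘(ℂ) ω CP1 := by
  refine isManifold_of_contDiffOn 𝓘(ℂ) ω CP1 ?_
  rintro e e' (rfl | rfl) (rfl | rfl)
  · refine (contDiffOn_id (𝕜 := ℂ)).congr fun z hz => ?_
    simp [chartZero_symm_apply, chartZero_ofComplex]
  · simp only [modelWithCornersSelf_coe, modelWithCornersSelf_coe_symm, Function.comp_id,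
      Function.id_comp, preimage_id, range_id, inter_univ]
    refine (transition_contDiffOn fun z hz => ?_).congr fun z hz => ?_
    · have h1 := hz.2
      change inv (chartZero.symm z) ∈ chartZero.source at h1
      rw [chartZero_symm_apply] at h1
      exact ne_zero_of_inv_mem h1
    · simp [chartZero_symm_apply, chartInfinity_apply]
  · simp only [modelWithCornersSelf_coe, modelWithCornersSelf_coe_symm, Function.comp_id,
      Function.id_comp, preimage_id, range_id, inter_univ]
    refine (transition_contDiffOn fun z hz => ?_).congr fun z hz => ?_
    · have h1 := hz.2
      change chartInfinity.symm z ∈ chartZero.source at h1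
      rw [chartInfinity_symm_apply] at h1
      exact ne_zero_of_inv_mem h1
    · simp [chartInfinity_symm_apply]
  · refine (contDiffOn_id (𝕜 := ℂ)).congr fun z hz => ?_
    simp [chartInfinity_symm_apply, chartInfinity_apply, chartZero_ofComplex]

end CP1

/-! ### Holomorphic sections, subbundles and forms -/

section Holomorphic

variable (E : Type*) [NormedAddCommGroup E] [NormedSpace ℂ E]
  {M : Type*} [TopologicalSpace M] [ChartedSpace E M]

/-- `f` is a holomorphic function on the subset `U` of the complex manifold `M`. -/
def HolFun (f : M → ℂ) (U : Set M) : Prop :=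
  ContMDiffOn 𝓘(ℂ, E) 𝓘(ℂ) ω f U

/-- `σ` is holomorphic on `U`, as a section of the vector bundle `V` with fibre `F`.
(Sections are functions on all of `M`; their values off `U` are irrelevant.) -/
def HolSection (F : Type*) [NormedAddCommGroup F] [NormedSpace ℂ F] {V : M → Type*}
    [TopologicalSpace (TotalSpace F V)] [∀ x, TopologicalSpace (V x)] [FiberBundle F V]
    (σ : ∀ x, V x) (U : Set M) : Prop :=
  ContMDiffOn 𝓘(ℂ, E) (𝓘(ℂ, E).prod 𝓘(ℂ, F)) ω (fun x => TotalSpace.mk' F x (σ x)) U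

variable {E}

/-- `v` is holomorphic on `U`, as a vector field on `M`. -/
def HolVectorField [IsManifold 𝓘(ℂ, E) ω M] (v : ∀ x : M, TangentSpace 𝓘(ℂ, E) x)
    (U : Set M) : Prop :=
  HolSection E E (V := fun x : M => TangentSpace 𝓘(ℂ, E) x) v U

/-- A family of subspaces of the fibres of `V` is a holomorphic subbundle of rank `k`: locally it
has a frame consisting of `k` holomorphic sections of `V`. -/
def IsHolSubbundle (E : Type*) [NormedAddCommGroup E] [NormedSpace ℂ E]
    {M : Type*} [TopologicalSpace M] [ChartedSpace E M]
    (F : Type*) [NormedAddCommGroup F] [NormedSpace ℂ F] {V : M → Type*}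
    [∀ x, AddCommGroup (V x)] [∀ x, Module ℂ (V x)]
    [TopologicalSpace (TotalSpace F V)] [∀ x, TopologicalSpace (V x)] [FiberBundle F V]
    (k : ℕ) (L : ∀ x, Submodule ℂ (V x)) : Prop :=
  ∀ x₀ : M, ∃ U : Set M, IsOpen U ∧ x₀ ∈ U ∧ ∃ e : Fin k → ∀ x, V x,
    (∀ i, HolSection E F (e i) U) ∧
    ∀ x ∈ U, LinearIndependent ℂ (fun i => e i x) ∧
      Submodule.span ℂ (range fun i => e i x) = L x

/-- `θ` is holomorphic on the open set `U`, as a `1`-form on `M`. -/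
def HolOneForm [IsManifold 𝓘(ℂ, E) ω M] (θ : ∀ x : M, TangentSpace 𝓘(ℂ, E) x →ₗ[ℂ] ℂ)
    (U : Set M) : Prop :=
  ∀ V ⊆ U, IsOpen V → ∀ v : ∀ x : M, TangentSpace 𝓘(ℂ, E) x, HolVectorField v V →
    HolFun E (fun x => θ x (v x)) V

end Holomorphic

/-! ### Branched projective structures -/

section ProjectiveBundle

variable {X : Type*} [TopologicalSpace X] [ChartedSpace ℂ X]
  {P : Type*} [TopologicalSpace P] [ChartedSpace (ℂ × ℂ) P]

/-- The complex surface `P` is a holomorphic `ℂℙ¹`-bundle over the Riemann surface `X` with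
projection `γ`: every point of `X` has a neighbourhood over which there is a
biholomorphic trivialization with fibre `ℂℙ¹`. -/
def IsHolCP1Bundle (γ : P → X) : Prop :=
  ContMDiff 𝓘(ℂ, ℂ × ℂ) 𝓘(ℂ) ω γ ∧
  ∀ x : X, ∃ e : Trivialization CP1 γ, x ∈ e.baseSet ∧
    ContMDiffOn 𝓘(ℂ, ℂ × ℂ) (𝓘(ℂ).prod 𝓘(ℂ)) ω e e.source ∧
    ContMDiffOn (𝓘(ℂ).prod 𝓘(ℂ)) 𝓘(ℂ, ℂ × ℂ) ω e.toOpenPartialHomeomorph.symm e.target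

/-- The relative tangent bundle `T_γ = ker dγ`. -/
def relTangent (γ : P → X) (p : P) : Submodule ℂ (TangentSpace 𝓘(ℂ, ℂ × ℂ) p) :=
  (mfderiv 𝓘(ℂ, ℂ × ℂ) 𝓘(ℂ) γ p).ker

/-- A holomorphic connection on `P`: a holomorphic line subbundle `H` of `TP` with
`T_γ ⊕ H = TP`. -/
structure IsHolConnection [IsManifold 𝓘(ℂ, ℂ × ℂ) ω P] (γ : P → X)
    (H : ∀ p : P, Submodule ℂ (TangentSpace 𝓘(ℂ, ℂ × ℂ) p)) : Prop where
  isCompl : ∀ p, IsCompl (relTangent γ p) (H p)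
  holomorphic : IsHolSubbundle (ℂ × ℂ) (ℂ × ℂ) (V := fun p : P => TangentSpace 𝓘(ℂ, ℂ × ℂ) p) 1 H

/-- The homomorphism `TX → s^* T_γ`: the differential of the section `s` followed by the
projection of `TP` onto `T_γ` along `H`. -/
def verticalDifferential [IsManifold 𝓘(ℂ, ℂ × ℂ) ω P] {γ : P → X}
    {H : ∀ p : P, Submodule ℂ (TangentSpace 𝓘(ℂ, ℂ × ℂ) p)} (hH : IsHolConnection γ H)
    (s : X → P) (x : X) (v : TangentSpace 𝓘(ℂ) x) : TangentSpace 𝓘(ℂ, ℂ × ℂ) (s x) :=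
  (relTangent γ (s x)).projection (H (s x)) (hH.isCompl (s x)) (mfderiv 𝓘(ℂ) 𝓘(ℂ, ℂ × ℂ) s x v)

/-- The homomorphism of line bundles `TX → s^* T_γ` vanishes at `x` to order exactly `n`: in terms
of holomorphic frames of `TX` and of `s^* T_γ` near `x` it is multiplication by a holomorphic
function which vanishes at `x` to order `n`. -/
def VerticalDifferentialOrder [IsManifold 𝓘(ℂ) ω X] [IsManifold 𝓘(ℂ, ℂ × ℂ) ω P] {γ : P → X}
    {H : ∀ p : P, Submodule ℂ (TangentSpace 𝓘(ℂ, ℂ × ℂ) p)} (hH : IsHolConnection γ H)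
    (s : X → P) (x : X) (n : ℕ∞) : Prop :=
  ∃ U : Set X, IsOpen U ∧ x ∈ U ∧
    ∃ (v : ∀ y : X, TangentSpace 𝓘(ℂ) y) (w : ∀ y : X, TangentSpace 𝓘(ℂ, ℂ × ℂ) (s y))
      (f : X → ℂ),
      HolVectorField v U ∧ (∀ y ∈ U, v y ≠ 0) ∧
      ContMDiffOn 𝓘(ℂ) (𝓘(ℂ, ℂ × ℂ).prod 𝓘(ℂ, ℂ × ℂ)) ω
        (fun y => (⟨s y, w y⟩ : TangentBundle 𝓘(ℂ, ℂ × ℂ) P)) U ∧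
      (∀ y ∈ U, w y ∈ relTangent γ (s y) ∧ w y ≠ 0) ∧
      HolFun ℂ f U ∧
      (∀ y ∈ U, verticalDifferential hH s y (v y) = f y • w y) ∧
      analyticOrderAt (f ∘ (chartAt ℂ x).symm) (chartAt ℂ x x) = n

end ProjectiveBundle

section Main

variable (X : Type u) [TopologicalSpace X] [ChartedSpace ℂ X] [IsManifold 𝓘(ℂ) ω X]

open Classical in
/-- A triple `(γ : P → X, H, s)` defining a branched projective structure on the Riemann surface
`X` with branching divisor `S` (a finite set of points, regarded as a reduced divisor): a
holomorphic `ℂℙ¹`-bundle with a holomorphic connection and a holomorphic section, such that the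
divisor of the homomorphism `TX → s^* T_γ` is `S`. -/
structure BranchedTriple (S : Finset X) : Type (u + 1) where
  P : Type u
  [top : TopologicalSpace P]
  [charted : ChartedSpace (ℂ × ℂ) P]
  [manifold : IsManifold 𝓘(ℂ, ℂ × ℂ) ω P]
  γ : P → X
  isBundle : IsHolCP1Bundle γ
  H : ∀ p : P, Submodule ℂ (TangentSpace 𝓘(ℂ, ℂ × ℂ) p)
  isConnection : IsHolConnection γ H
  s : X → P
  s_holomorphic : ContMDiff 𝓘(ℂ) 𝓘(ℂ, ℂ × ℂ) ω s
  s_section : ∀ x, γ (s x) = x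
  divisor_eq : ∀ x, VerticalDifferentialOrder isConnection s x (if x ∈ S then 1 else 0)

attribute [instance] BranchedTriple.top BranchedTriple.charted BranchedTriple.manifold

/-- A holomorphic `SO(3, ℂ)`-bundle on `X`: a holomorphic vector bundle `W` of rank three with a
holomorphic fibrewise nondegenerate symmetric bilinear form `B` and an isomorphism `⋀³ W ≅ 𝒪`
(equivalently a nowhere vanishing holomorphic alternating `3`-form `vol`) that takes the form
induced by `B` on `⋀³ W` to the standard one. -/
structure SO3Bundle : Type (u + 1) where
  W : X → Type u
  [addCommGroup : ∀ x, AddCommGroup (W x)]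
  [module : ∀ x, Module ℂ (W x)]
  [topFibre : ∀ x, TopologicalSpace (W x)]
  [topAddGroup : ∀ x, IsTopologicalAddGroup (W x)]
  [continuousSMul : ∀ x, ContinuousSMul ℂ (W x)]
  [topTotal : TopologicalSpace (TotalSpace (Fin 3 → ℂ) W)]
  [fiberBundle : FiberBundle (Fin 3 → ℂ) W]
  [vectorBundle : VectorBundle ℂ (Fin 3 → ℂ) W]
  [holomorphic : ContMDiffVectorBundle ω (Fin 3 → ℂ) W 𝓘(ℂ)]
  B : ∀ x, W x →ₗ[ℂ] W x →ₗ[ℂ] ℂ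
  B_symm : ∀ x a b, B x a b = B x b a
  B_nondegenerate : ∀ x a, (∀ b, B x a b = 0) → a = 0
  B_holomorphic : ∀ U : Set X, IsOpen U → ∀ a b : ∀ x, W x,
    HolSection ℂ (Fin 3 → ℂ) a U → HolSection ℂ (Fin 3 → ℂ) b U →
    HolFun ℂ (fun x => B x (a x) (b x)) U
  vol : ∀ x, W x [⋀^Fin 3]→ₗ[ℂ] ℂ
  vol_ne_zero : ∀ x, vol x ≠ 0
  vol_holomorphic : ∀ U : Set X, IsOpen U → ∀ a : Fin 3 → ∀ x, W x,
    (∀ i, HolSection ℂ (Fin 3 → ℂ) (a i) U) → HolFun ℂ (fun x => vol x fun i => a i x) U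
  vol_normalized : ∀ x (a b : Fin 3 → W x),
    Matrix.det (Matrix.of fun i j => B x (a i) (b j)) = vol x a * vol x b

attribute [instance] SO3Bundle.addCommGroup SO3Bundle.module SO3Bundle.topFibre
  SO3Bundle.topAddGroup SO3Bundle.continuousSMul SO3Bundle.topTotal SO3Bundle.fiberBundle
  SO3Bundle.vectorBundle SO3Bundle.holomorphic

variable {X}

/-- `σ` is holomorphic on `U` as a section of the underlying vector bundle. -/
def SO3Bundle.Hol (𝒲 : SO3Bundle X) (σ : ∀ x, 𝒲.W x) (U : Set X) : Prop :=
  HolSection ℂ (Fin 3 → ℂ) σ U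

/-- A branched filtration of type `S`: holomorphic subbundles `F₁ ⊆ F₂` of ranks one and two, with
`B(F₁, F₁) = 0` and `B(F₁, F₂) = 0`, with an isomorphism `F₁ ≅ K_X ⊗ 𝒪(-S)` and an
isomorphism `F₂ / F₁ ≅ 𝒪`.

Sections of `K_X ⊗ 𝒪(-S)` are the holomorphic `1`-forms that vanish on `S`. The isomorphism from
`F₁` is the one induced on sections by the bundle map `α : F₁ → K_X`. The isomorphism from
`F₂ / F₁` is the one induced by `β : F₂ → 𝒪`. -/
structure BranchedFiltration (S : Finset X) (𝒲 : SO3Bundle X) : Type u where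
  F₁ : ∀ x, Submodule ℂ (𝒲.W x)
  F₂ : ∀ x, Submodule ℂ (𝒲.W x)
  F₁_le_F₂ : ∀ x, F₁ x ≤ F₂ x
  F₁_subbundle : IsHolSubbundle ℂ (Fin 3 → ℂ) 1 F₁
  F₂_subbundle : IsHolSubbundle ℂ (Fin 3 → ℂ) 2 F₂
  isotropic : ∀ x, ∀ a ∈ F₁ x, ∀ b ∈ F₁ x, 𝒲.B x a b = 0
  orthogonal : ∀ x, ∀ a ∈ F₁ x, ∀ b ∈ F₂ x, 𝒲.B x a b = 0
  α : ∀ x, F₁ x →ₗ[ℂ] TangentSpace 𝓘(ℂ) x →ₗ[ℂ] ℂ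
  α_holomorphic : ∀ U : Set X, IsOpen U → ∀ σ : ∀ x, F₁ x, 𝒲.Hol (fun x => σ x) U →
    HolOneForm (fun x => α x (σ x)) U
  α_vanishes : ∀ x ∈ S, α x = 0
  α_injective : ∀ U : Set X, IsOpen U → ∀ σ : ∀ x, F₁ x, 𝒲.Hol (fun x => σ x) U →
    (∀ x ∈ U, α x (σ x) = 0) → ∀ x ∈ U, σ x = 0
  α_surjective : ∀ U : Set X, IsOpen U → ∀ θ : ∀ x : X, TangentSpace 𝓘(ℂ) x →ₗ[ℂ] ℂ,
    HolOneForm θ U → (∀ x ∈ S, x ∈ U → θ x = 0) →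
    ∃ σ : ∀ x, F₁ x, 𝒲.Hol (fun x => σ x) U ∧ ∀ x ∈ U, α x (σ x) = θ x
  β : ∀ x, F₂ x →ₗ[ℂ] ℂ
  β_holomorphic : ∀ U : Set X, IsOpen U → ∀ σ : ∀ x, F₂ x, 𝒲.Hol (fun x => σ x) U →
    HolFun ℂ (fun x => β x (σ x)) U
  β_ker : ∀ x (a : F₂ x), β x a = 0 ↔ (a : 𝒲.W x) ∈ F₁ x
  β_surjective : ∀ x, Function.Surjective (β x)

/-- A branched holomorphic connection on a branched filtered `SO(3, ℂ)`-bundle: a holomorphic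
connection `D` on `W` that preserves `B`, induces the de Rham differential on `⋀³ W ≅ 𝒪`, maps
`F₁` to `F₂ ⊗ K_X`, and for which the second fundamental form of `F₁`, a section of
`Hom(K_X ⊗ 𝒪(-S), 𝒪) ⊗ K_X = 𝒪(S)`, is the section `1`. The last condition means that,
for `σ` in `F₁`, the class of `D σ` in `(F₂ / F₁) ⊗ K_X = K_X` is the `1`-form corresponding to
`σ`. -/
structure BranchedConnection {S : Finset X} (𝒲 : SO3Bundle X) (ℱ : BranchedFiltration S 𝒲) :
    Type u where
  /-- `D σ x v` is the derivative of the section `σ` at `x` in the direction `v`; only the values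
  on sections that are holomorphic near `x` matter. -/
  D : (∀ x, 𝒲.W x) → ∀ x : X, TangentSpace 𝓘(ℂ) x →L[ℂ] 𝒲.W x
  isCovariantDerivative : IsCovariantDerivativeOn (Fin 3 → ℂ) D
  D_holomorphic : ∀ U : Set X, IsOpen U → ∀ (σ : ∀ x, 𝒲.W x)
    (v : ∀ x : X, TangentSpace 𝓘(ℂ) x), 𝒲.Hol σ U → HolVectorField v U →
    𝒲.Hol (fun x => D σ x (v x)) U
  D_B : ∀ U : Set X, IsOpen U → ∀ a b : ∀ x, 𝒲.W x, 𝒲.Hol a U → 𝒲.Hol b U →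
    ∀ x ∈ U, ∀ v : TangentSpace 𝓘(ℂ) x,
      mvfderiv 𝓘(ℂ) (fun y => 𝒲.B y (a y) (b y)) x v
        = 𝒲.B x (D a x v) (b x) + 𝒲.B x (a x) (D b x v)
  D_vol : ∀ U : Set X, IsOpen U → ∀ a : Fin 3 → ∀ x, 𝒲.W x, (∀ i, 𝒲.Hol (a i) U) →
    ∀ x ∈ U, ∀ v : TangentSpace 𝓘(ℂ) x,
      mvfderiv 𝓘(ℂ) (fun y => 𝒲.vol y fun i => a i y) x v
        = ∑ i, 𝒲.vol x (Function.update (fun j => a j x) i (D (a i) x v))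
  D_F₁ : ∀ U : Set X, IsOpen U → ∀ σ : ∀ x, ℱ.F₁ x, 𝒲.Hol (fun x => σ x) U →
    ∀ x ∈ U, ∀ v : TangentSpace 𝓘(ℂ) x, D (fun y => σ y) x v ∈ ℱ.F₂ x
  secondFundamentalForm_eq_one : ∀ (U : Set X) (hU : IsOpen U) (σ : ∀ x, ℱ.F₁ x)
    (hσ : 𝒲.Hol (fun x => σ x) U) (x : X) (hx : x ∈ U) (v : TangentSpace 𝓘(ℂ) x),
      ℱ.β x ⟨D (fun y => σ y) x v, D_F₁ U hU σ hσ x hx v⟩ = ℱ.α x (σ x) v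

variable (X) in
/-- A branched `SO(3, ℂ)`-oper of type `S` on `X`. -/
structure BranchedOper (S : Finset X) : Type (u + 1) where
  bundle : SO3Bundle X
  filtration : BranchedFiltration S bundle
  connection : BranchedConnection bundle filtration

variable {S : Finset X}

/-! ### Equivalences -/

/-- Equivalence of triples: a biholomorphism `P₁ ≅ P₂` over `X` that takes `H₁` to `H₂` and `s₁` to
`s₂`. -/
def BranchedTriple.Equivalent (T₁ T₂ : BranchedTriple X S) : Prop :=
  ∃ Φ : T₁.P ≃ₘ^ω⟮𝓘(ℂ, ℂ × ℂ), 𝓘(ℂ, ℂ × ℂ)⟯ T₂.P,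
    (∀ p, T₂.γ (Φ p) = T₁.γ p) ∧
    (∀ p, (T₁.H p).map (mfderiv 𝓘(ℂ, ℂ × ℂ) 𝓘(ℂ, ℂ × ℂ) Φ p).toLinearMap = T₂.H (Φ p)) ∧
    ∀ x, Φ (T₁.s x) = T₂.s x

/-- Isomorphism of branched opers: a holomorphic isomorphism of `SO(3, ℂ)`-bundles which respects
filtrations and connections.

No compatibility with the chosen identifications `F₁ ≅ K_X ⊗ 𝒪(-S)` and `F₂ / F₁ ≅ 𝒪` is required.
Those are determined by the other data up to multiplying both of them by the same nowhere vanishing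
holomorphic function. -/
def BranchedOper.Isomorphic (O₁ O₂ : BranchedOper X S) : Prop :=
  ∃ φ : ∀ x, O₁.bundle.W x ≃ₗ[ℂ] O₂.bundle.W x,
    (∀ U : Set X, IsOpen U → ∀ σ, O₁.bundle.Hol σ U ↔ O₂.bundle.Hol (fun x => φ x (σ x)) U) ∧
    (∀ x a b, O₂.bundle.B x (φ x a) (φ x b) = O₁.bundle.B x a b) ∧
    (∀ x (a : Fin 3 → O₁.bundle.W x), O₂.bundle.vol x (fun i => φ x (a i)) = O₁.bundle.vol x a) ∧
    (∀ x a, φ x a ∈ O₂.filtration.F₁ x ↔ a ∈ O₁.filtration.F₁ x) ∧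
    (∀ x a, φ x a ∈ O₂.filtration.F₂ x ↔ a ∈ O₁.filtration.F₂ x) ∧
    (∀ U : Set X, IsOpen U → ∀ σ, O₁.bundle.Hol σ U → ∀ x ∈ U, ∀ v : TangentSpace 𝓘(ℂ) x,
      O₂.connection.D (fun y => φ y (σ y)) x v = φ x (O₁.connection.D σ x v))

lemma BranchedTriple.equivalent_equivalence :
    Equivalence (BranchedTriple.Equivalent (X := X) (S := S)) where
  refl T := ⟨Diffeomorph.refl _ _ _, fun _ => rfl, fun p => by
    rw [Diffeomorph.coe_refl, mfderiv_id]; exact Submodule.map_id _, fun _ => rfl⟩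
  symm := by
    rintro T₁ T₂ ⟨Φ, hγ, hH, hs⟩
    refine ⟨Φ.symm, fun p => ?_, fun p => ?_, fun x => ?_⟩
    · rw [← hγ, Φ.apply_symm_apply]
    · obtain ⟨q, rfl⟩ := Φ.surjective p
      change (T₂.H (Φ q)).map (mfderiv 𝓘(ℂ, ℂ × ℂ) 𝓘(ℂ, ℂ × ℂ) Φ.symm (Φ q)).toLinearMap
        = T₁.H (Φ.symm (Φ q))
      have h1 : MDifferentiableAt 𝓘(ℂ, ℂ × ℂ) 𝓘(ℂ, ℂ × ℂ) Φ q :=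
        (Φ.contMDiff q).mdifferentiableAt (by simp)
      have h2 : MDifferentiableAt 𝓘(ℂ, ℂ × ℂ) 𝓘(ℂ, ℂ × ℂ) Φ.symm (Φ q) :=
        (Φ.symm.contMDiff (Φ q)).mdifferentiableAt (by simp)
      have h3 := mfderiv_comp q h2 h1
      have h4 : (Φ.symm ∘ Φ : T₁.P → T₁.P) = id := funext fun y => Φ.symm_apply_apply y
      rw [h4, mfderiv_id] at h3
      have h5 : Φ.symm (Φ q) = q := Φ.symm_apply_apply q
      rw [← hH q]
      have h6 : ∀ q' : T₁.P, q' = q →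
          (show Submodule ℂ (ℂ × ℂ) from T₁.H q) = (show Submodule ℂ (ℂ × ℂ) from T₁.H q') := by
        rintro _ rfl; rfl
      refine Eq.trans ?_ (h6 _ h5)
      refine (Submodule.map_comp _ _ _).symm.trans ?_
      refine Eq.trans ?_ (Submodule.map_id (show Submodule ℂ (ℂ × ℂ) from T₁.H q))
      exact congrArg (fun L : ℂ × ℂ →L[ℂ] ℂ × ℂ =>
        Submodule.map L.toLinearMap (show Submodule ℂ (ℂ × ℂ) from T₁.H q)) h3.symm
    · rw [← hs, Φ.symm_apply_apply]
  trans := by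
    rintro T₁ T₂ T₃ ⟨Φ, hγ, hH, hs⟩ ⟨Ψ, hγ', hH', hs'⟩
    refine ⟨Φ.trans Ψ, fun p => ?_, fun p => ?_, fun x => ?_⟩
    · simp [hγ, hγ']
    · have h1 : MDifferentiableAt 𝓘(ℂ, ℂ × ℂ) 𝓘(ℂ, ℂ × ℂ) Φ p :=
        (Φ.contMDiff p).mdifferentiableAt (by simp)
      have h2 : MDifferentiableAt 𝓘(ℂ, ℂ × ℂ) 𝓘(ℂ, ℂ × ℂ) Ψ (Φ p) :=
        (Ψ.contMDiff (Φ p)).mdifferentiableAt (by simp)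
      rw [Diffeomorph.coe_trans, mfderiv_comp p h2 h1]
      change _ = T₃.H (Ψ (Φ p))
      rw [← hH', ← hH, ← Submodule.map_comp]
      rfl
    · simp [hs, hs']

lemma BranchedOper.isomorphic_equivalence :
    Equivalence (BranchedOper.Isomorphic (X := X) (S := S)) where
  refl O := ⟨fun x => LinearEquiv.refl ℂ _, fun _ _ _ => Iff.rfl, fun _ _ _ => rfl,
    fun _ _ => rfl, fun _ _ => Iff.rfl, fun _ _ => Iff.rfl, fun _ _ _ _ _ _ _ => rfl⟩
  symm := by
    rintro O₁ O₂ ⟨φ, hol, hB, hvol, h1, h2, hD⟩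
    refine ⟨fun x => (φ x).symm, fun U hU σ => ?_, fun x a b => ?_, fun x a => ?_,
      fun x a => ?_, fun x a => ?_, fun U hU σ hσ x hx v => ?_⟩
    · rw [hol U hU]; simp
    · rw [← hB]; simp
    · rw [← hvol]; simp
    · rw [← h1]; simp
    · rw [← h2]; simp
    · have := hD U hU (fun y => (φ y).symm (σ y)) ((hol U hU _).2 (by simpa using hσ)) x hx v
      rw [LinearEquiv.eq_symm_apply, ← this]
      simp
  trans := by
    rintro O₁ O₂ O₃ ⟨φ, hol, hB, hvol, h1, h2, hD⟩ ⟨φ', hol', hB', hvol', h1', h2', hD'⟩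
    refine ⟨fun x => (φ x).trans (φ' x), fun U hU σ => ?_, fun x a b => ?_, fun x a => ?_,
      fun x a => ?_, fun x a => ?_, fun U hU σ hσ x hx v => ?_⟩
    · rw [hol U hU, hol' U hU]; rfl
    · simp [hB, hB']
    · simp [hvol, hvol']
    · simp [h1, h1']
    · simp [h2, h2']
    · simp only [LinearEquiv.trans_apply]
      rw [← hD U hU σ hσ x hx v, ← hD' U hU _ ((hol U hU σ).1 hσ) x hx v]

/-- Branched projective structures on `X` with branching divisor `S`, as equivalence classes of
triples. -/
def BranchedProjectiveStructure (X : Type u) [TopologicalSpace X] [ChartedSpace ℂ X]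
    [IsManifold 𝓘(ℂ) ω X] (S : Finset X) : Type (u + 1) :=
  Quotient (⟨BranchedTriple.Equivalent, BranchedTriple.equivalent_equivalence⟩ :
    Setoid (BranchedTriple X S))

/-- The branched projective structure given by a triple. -/
def BranchedTriple.toStructure (T : BranchedTriple X S) : BranchedProjectiveStructure X S :=
  Quotient.mk _ T

/-- Isomorphism classes of branched `SO(3, ℂ)`-opers of type `S` on `X`. -/
def BranchedOperClass (X : Type u) [TopologicalSpace X] [ChartedSpace ℂ X]
    [IsManifold 𝓘(ℂ) ω X] (S : Finset X) : Type (u + 1) :=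
  Quotient (⟨BranchedOper.Isomorphic, BranchedOper.isomorphic_equivalence⟩ :
    Setoid (BranchedOper X S))

/-- The isomorphism class of a branched oper. -/
def BranchedOper.toClass (O : BranchedOper X S) : BranchedOperClass X S :=
  Quotient.mk _ O

/-! ### The oper of a branched projective structure -/

namespace BranchedTriple

variable (T : BranchedTriple X S)

/-- `ξ` is a holomorphic section over `V ⊆ P` of the relative tangent bundle `T_γ`. -/
def HolRelField (ξ : ∀ p : T.P, TangentSpace 𝓘(ℂ, ℂ × ℂ) p) (V : Set T.P) : Prop :=
  HolVectorField ξ V ∧ ∀ p ∈ V, ξ p ∈ relTangent T.γ p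

/-- Near the point `s x`, the field `ξ` is a section of `T_γ ⊗ 𝒪_P(-k s(X))`, that is, it
vanishes along the divisor `s(X)` to order at least `k`. -/
def VanishesAlong (k : ℕ) (ξ : ∀ p : T.P, TangentSpace 𝓘(ℂ, ℂ × ℂ) p) (x : X) : Prop :=
  ∃ V : Set T.P, IsOpen V ∧ T.s x ∈ V ∧
    ∃ (f : T.P → ℂ) (ζ : ∀ p : T.P, TangentSpace 𝓘(ℂ, ℂ × ℂ) p),
      HolFun (ℂ × ℂ) f V ∧ (∀ y, T.s y ∈ V → f (T.s y) = 0) ∧ T.HolRelField ζ V ∧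
      ∀ p ∈ V, ξ p = f p ^ k • ζ p

/-- Over `U`, the vector field `η` on `P` is the horizontal lift of the vector field `v` on `X`
for the connection `H`. -/
def IsHorizontalLift (v : ∀ x : X, TangentSpace 𝓘(ℂ) x)
    (η : ∀ p : T.P, TangentSpace 𝓘(ℂ, ℂ × ℂ) p) (U : Set X) : Prop :=
  ∀ p, T.γ p ∈ U → η p ∈ T.H p ∧ mfderiv 𝓘(ℂ, ℂ × ℂ) 𝓘(ℂ) T.γ p (η p) = v (T.γ p)

/-- The oper `O` is isomorphic to `γ_* T_γ` with the fibrewise Killing form, the filtration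
`γ_* (T_γ(-2 s(X))) ⊆ γ_* (T_γ(-s(X)))` and the connection induced by `H`.

The isomorphism `W ≅ γ_* T_γ` is the map of sections `w ↦ field w` given by fibrewise linear maps
`ψ p : W_{γ(p)} → T_p P`; a section of `γ_* T_γ` over `U` is a holomorphic section of `T_γ` over
`γ⁻¹(U)`. The Lie bracket `ad` on the fibres of `W` is the one induced by the Lie bracket of vector
fields on `P`. The connection induced by `H` is the Lie derivative along horizontal lifts. -/
def IsAssociatedOper (O : BranchedOper X S) : Prop :=
  ∃ (ψ : ∀ p : T.P, O.bundle.W (T.γ p) →ₗ[ℂ] TangentSpace 𝓘(ℂ, ℂ × ℂ) p)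
    (ad : ∀ x, O.bundle.W x →ₗ[ℂ] O.bundle.W x →ₗ[ℂ] O.bundle.W x),
    let field : (∀ x, O.bundle.W x) → ∀ p : T.P, TangentSpace 𝓘(ℂ, ℂ × ℂ) p :=
      fun w p => ψ p (w (T.γ p))
    -- `W ≅ γ_* T_γ`
    (∀ U : Set X, IsOpen U →
      (∀ w, O.bundle.Hol w U → T.HolRelField (field w) (T.γ ⁻¹' U)) ∧
      (∀ w, O.bundle.Hol w U → (∀ p, T.γ p ∈ U → field w p = 0) → ∀ x ∈ U, w x = 0) ∧
      (∀ ξ, T.HolRelField ξ (T.γ ⁻¹' U) →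
        ∃ w, O.bundle.Hol w U ∧ ∀ p, T.γ p ∈ U → field w p = ξ p)) ∧
    -- `B` is the Killing form of the Lie bracket of vector fields
    (∀ U : Set X, IsOpen U → ∀ a b, O.bundle.Hol a U → O.bundle.Hol b U →
      ∀ p, T.γ p ∈ U → field (fun x => ad x (a x) (b x)) p =
        VectorField.mlieBracket 𝓘(ℂ, ℂ × ℂ) (field a) (field b) p) ∧
    (∀ x a b, O.bundle.B x a b = LinearMap.trace ℂ (O.bundle.W x) (ad x a ∘ₗ ad x b)) ∧
    -- the filtration is given by the order of vanishing along `s`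
    (∀ U : Set X, IsOpen U → ∀ w, O.bundle.Hol w U →
      ((∀ x ∈ U, w x ∈ O.filtration.F₁ x) ↔ ∀ x ∈ U, T.VanishesAlong 2 (field w) x) ∧
      ((∀ x ∈ U, w x ∈ O.filtration.F₂ x) ↔ ∀ x ∈ U, T.VanishesAlong 1 (field w) x)) ∧
    -- the connection is induced by `H`
    (∀ U : Set X, IsOpen U → ∀ v w η, HolVectorField v U → O.bundle.Hol w U →
      T.IsHorizontalLift v η U → ∀ p, T.γ p ∈ U →
        field (fun x => O.connection.D w x (v x)) p =
          VectorField.mlieBracket 𝓘(ℂ, ℂ × ℂ) η (field w) p)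

end BranchedTriple

end Main

end

/-! A holomorphic vector field on `ℂℙ¹` is `(w₀ + w₁ z + w₂ z²) ∂_z`, so the fibres of `γ_* T_γ` are
copies of `ℂ³` with the bracket `brk` of `sl₂` and its Killing form `killing`. A point of `ℂℙ¹` is
the same as the line of fields with a double zero there, and these lines are exactly the isotropic
ones: `ℂℙ¹` is a conic in the projective plane of `ℂ³`, and the matrices that preserve form and
orientation (`IsSO`) act on it by Möbius transformations (`CP1.act`). Hence a `ℂℙ¹`-bundle with
connection and an `SO(3, ℂ)`-bundle with connection are two descriptions of one locally constant
`SO(3, ℂ)`-cocycle. The section `s` becomes an isotropic line subbundle `F₁` (fields with a double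
zero at `s`), and `F₂ = F₁^⊥` consists of the fields that vanish at `s`.

The cocycle is locally constant because connections over a curve are flat. On the projective side, a
holomorphic field restricted to the fibres is quadratic by Liouville (`IsFibreCoord.exists_quad`),
so the horizontal lift of a coordinate field has the form `∂_t + w(t)`. A solution of `M' = M ad_w`
is a family of isometries (`exists_isSO_ode`) that straightens this lift, which gives flat
coordinates (`IsHolConnection.exists_isFlatCoord`). On the oper side the same linear differential
equation gives parallel frames (`BranchedOper.exists_flat_section`).

The branching conditions also agree. In a flat coordinate the section is a function `z`, and `TX →
s^* T_γ` is multiplication by `dz` (`IsFlatCoord.verticalDifferentialOrder_iff`); the divisor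
condition says that `dz` has simple zeros on `S` and no others. In a flat frame `F₁` is generated by
`(Z - z)²`, whose derivative is `-2 (Z - z) dz`. Thus `D` maps `F₁` to `F₂`, the second fundamental
form is `dz` up to a unit, and the identification of `F₁` with the forms that vanish on `S` amounts
to the same condition on `dz` (`SOCocycle.Developing.α_surjective`,
`IsFlatFrame.analyticOrderAt_deriv`).

Association of an oper with a triple is a local matter. A `LocalModel` is a flat coordinate with a
flat frame in which evaluation of vector fields and the filtration have normal form;
`isAssociatedOper_of_localModels` and `BranchedTriple.IsAssociatedOper.exists_localModel` show that
association means having local models everywhere. The bijection then rests on four facts. Every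
triple has an associated oper and every oper is associated with a triple; both are built from a
cocycle with a developing map (`SOCocycle.Developing`). Two opers associated with one triple are
isomorphic: the evident comparison respects everything except perhaps the volume form, which it
changes by a sign, constant because `X` is connected, and a scalar absorbs it. Two triples
associated with one oper are equivalent: a point `p` of the projective bundle is recovered from the
plane of fields that vanish at `p`, the orthogonal of an isotropic line. -/

noncomputable section

/-! ### Quadratic vector fields and the conic of null vectors -/

/-- The value at `z` of the coefficient of the vector field `(w₀ + w₁ z + w₂ z²) ∂_z`. -/
def quad (w : Fin 3 → ℂ) (z : ℂ) : ℂ := w 0 + w 1 * z + w 2 * z ^ 2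

/-- The Lie bracket of quadratic vector fields. -/
def brk : (Fin 3 → ℂ) →ₗ[ℂ] (Fin 3 → ℂ) →ₗ[ℂ] (Fin 3 → ℂ) :=
  LinearMap.mk₂ ℂ (fun a b => ![a 0 * b 1 - a 1 * b 0, 2 * (a 0 * b 2 - a 2 * b 0),
      a 1 * b 2 - a 2 * b 1])
    (fun a a' b => by ext i; fin_cases i <;> simp <;> ring)
    (fun c a b => by ext i; fin_cases i <;> simp <;> ring)
    (fun a b b' => by ext i; fin_cases i <;> simp <;> ring)
    (fun c a b => by ext i; fin_cases i <;> simp <;> ring)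

lemma brk_apply (a b : Fin 3 → ℂ) : brk a b =
    ![a 0 * b 1 - a 1 * b 0, 2 * (a 0 * b 2 - a 2 * b 0), a 1 * b 2 - a 2 * b 1] := rfl

/-- The Killing form of the Lie algebra of quadratic vector fields. -/
def killing : (Fin 3 → ℂ) →ₗ[ℂ] (Fin 3 → ℂ) →ₗ[ℂ] ℂ :=
  LinearMap.mk₂ ℂ (fun a b => 2 * a 1 * b 1 - 4 * (a 0 * b 2 + a 2 * b 0))
    (fun a a' b => by simp; ring) (fun c a b => by simp; ring)
    (fun a b b' => by simp; ring) (fun c a b => by simp; ring)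

lemma killing_apply (a b : Fin 3 → ℂ) :
    killing a b = 2 * a 1 * b 1 - 4 * (a 0 * b 2 + a 2 * b 0) := rfl

lemma killing_comm (a b : Fin 3 → ℂ) : killing a b = killing b a := by
  simp only [killing_apply]; ring

lemma killing_eq_trace (a b : Fin 3 → ℂ) :
    killing a b = LinearMap.trace ℂ (Fin 3 → ℂ) (brk a ∘ₗ brk b) := by
  rw [LinearMap.trace_eq_matrix_trace ℂ (Pi.basisFun ℂ (Fin 3))]
  simp [Matrix.trace, Fin.sum_univ_three, brk_apply, killing_apply]
  ring

lemma killing_nondegenerate {a : Fin 3 → ℂ} (h : ∀ b, killing a b = 0) : a = 0 := by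
  have h0 := h ![1, 0, 0]
  have h1 := h ![0, 1, 0]
  have h2 := h ![0, 0, 1]
  simp [killing_apply] at h0 h1 h2
  ext i; fin_cases i <;> simp [h0, h1, h2]

/-- The form `κ([a, b], c)` is alternating, hence a multiple of the determinant; `-4` is its value
on `∂, z∂, z²∂`. It expresses the bracket through the form and the orientation, so isometries of
determinant one and automorphisms of the Lie algebra coincide. -/
lemma killing_brk (a b c : Fin 3 → ℂ) :
    killing (brk a b) c = -4 * Matrix.det (Matrix.of ![a, b, c]) := by
  simp [killing_apply, brk_apply, Matrix.det_fin_three]; ring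

/-- The matrices that preserve the Killing form and the orientation. -/
def IsSO (A : Matrix (Fin 3) (Fin 3) ℂ) : Prop :=
  (∀ a b, killing (A.mulVec a) (A.mulVec b) = killing a b) ∧ A.det = 1

lemma det_of_mulVec (A : Matrix (Fin 3) (Fin 3) ℂ) (a b c : Fin 3 → ℂ) :
    Matrix.det (Matrix.of ![A.mulVec a, A.mulVec b, A.mulVec c])
      = A.det * Matrix.det (Matrix.of ![a, b, c]) := by
  have : Matrix.of ![A.mulVec a, A.mulVec b, A.mulVec c]
      = Matrix.of ![a, b, c] * A.transpose := by
    ext i j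
    fin_cases i <;> simp [Matrix.mul_apply, Matrix.mulVec, dotProduct, mul_comm]
  rw [this, Matrix.det_mul, Matrix.det_transpose, mul_comm]

/-! ### The isometry group of the Killing form and its action on the Lie algebra -/

namespace IsSO

variable {A B : Matrix (Fin 3) (Fin 3) ℂ}

lemma one : IsSO 1 := by simp [IsSO]

lemma mul (hA : IsSO A) (hB : IsSO B) : IsSO (A * B) := by
  refine ⟨fun a b => ?_, by simp [hA.2, hB.2]⟩
  rw [← Matrix.mulVec_mulVec, ← Matrix.mulVec_mulVec, hA.1, hB.1]

lemma mul_inv (hA : IsSO A) : A * A⁻¹ = 1 := Matrix.mul_nonsing_inv _ (by simp [hA.2])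

lemma inv_mul (hA : IsSO A) : A⁻¹ * A = 1 := Matrix.nonsing_inv_mul _ (by simp [hA.2])

lemma inv (hA : IsSO A) : IsSO A⁻¹ := by
  refine ⟨fun a b => ?_, by simp [Matrix.det_nonsing_inv, hA.2]⟩
  rw [← hA.1, Matrix.mulVec_mulVec, Matrix.mulVec_mulVec, hA.mul_inv, Matrix.one_mulVec,
    Matrix.one_mulVec]

lemma inv_mulVec_mulVec (hA : IsSO A) (a : Fin 3 → ℂ) : A⁻¹.mulVec (A.mulVec a) = a := by
  rw [Matrix.mulVec_mulVec, hA.inv_mul, Matrix.one_mulVec]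

lemma mulVec_inv_mulVec (hA : IsSO A) (a : Fin 3 → ℂ) : A.mulVec (A⁻¹.mulVec a) = a := by
  rw [Matrix.mulVec_mulVec, hA.mul_inv, Matrix.one_mulVec]

/-- Pairing with a third vector turns the bracket into a determinant by `killing_brk`. Form and
determinant are both invariant, and the form is nondegenerate. -/
lemma brk_mulVec (hA : IsSO A) (a b : Fin 3 → ℂ) :
    brk (A.mulVec a) (A.mulVec b) = A.mulVec (brk a b) := by
  rw [← sub_eq_zero]
  refine killing_nondegenerate fun c => ?_
  rw [← hA.mulVec_inv_mulVec c]
  generalize A⁻¹.mulVec c = c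
  rw [map_sub, LinearMap.sub_apply, killing_brk, hA.1, killing_brk, det_of_mulVec, hA.2]
  ring

/-- An automorphism conjugates `ad a` to `ad (A a)`, so it preserves the trace form. It then also
preserves `κ([a, b], c)`, a multiple of the determinant, which excludes determinant `-1`. -/
lemma of_brk (hdet : A.det ≠ 0) (h : ∀ a b, brk (A.mulVec a) (A.mulVec b) = A.mulVec (brk a b)) :
    IsSO A := by
  have hu : IsUnit A.det := hdet.isUnit
  have h1 : ∀ a b, killing (A.mulVec a) (A.mulVec b) = killing a b := fun a b => by
    have key : ∀ a, brk (A.mulVec a) = A.mulVecLin ∘ₗ brk a ∘ₗ A⁻¹.mulVecLin := by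
      intro a
      refine LinearMap.ext fun c => ?_
      simp only [LinearMap.comp_apply, Matrix.mulVecLin_apply, ← h, Matrix.mulVec_mulVec]
      rw [Matrix.mul_nonsing_inv _ hu, Matrix.one_mulVec]
    have inv : A⁻¹.mulVecLin ∘ₗ A.mulVecLin = LinearMap.id := by
      rw [← Matrix.mulVecLin_mul, Matrix.nonsing_inv_mul _ hu, Matrix.mulVecLin_one]
    have e : (A.mulVecLin ∘ₗ brk a ∘ₗ A⁻¹.mulVecLin) ∘ₗ (A.mulVecLin ∘ₗ brk b ∘ₗ A⁻¹.mulVecLin)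
        = A.mulVecLin ∘ₗ (brk a ∘ₗ brk b ∘ₗ A⁻¹.mulVecLin) := by
      refine LinearMap.ext fun c => ?_
      have := fun c => LinearMap.congr_fun inv c
      simp only [LinearMap.comp_apply, LinearMap.id_apply] at this ⊢
      rw [this]
    rw [killing_eq_trace, killing_eq_trace, key, key, e, LinearMap.trace_comp_comm']
    simp only [LinearMap.comp_assoc]
    rw [inv, LinearMap.comp_id]
  refine ⟨h1, ?_⟩
  have h2 := killing_brk (A.mulVec ![1, 0, 0]) (A.mulVec ![0, 1, 0]) (A.mulVec ![0, 0, 1])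
  rw [h, h1, killing_brk, det_of_mulVec] at h2
  have h3 : Matrix.det (Matrix.of ![![1, 0, 0], ![0, 1, 0], ![0, 0, (1 : ℂ)]]) = 1 := by
    simp [Matrix.det_fin_three]
  rw [h3] at h2
  linear_combination (1 / 4) * h2

end IsSO

/-- The isotropic vectors of the Killing form: the squares of linear polynomials. -/
def IsNull (n : Fin 3 → ℂ) : Prop := n 1 ^ 2 = 4 * n 0 * n 2

lemma isNull_iff {n : Fin 3 → ℂ} : IsNull n ↔ killing n n = 0 := by
  rw [IsNull, killing_apply, ← sub_eq_zero]
  exact ⟨fun h => by linear_combination 2 * h, fun h => by linear_combination h / 2⟩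

lemma IsSO.isNull {A : Matrix (Fin 3) (Fin 3) ℂ} (hA : IsSO A) {n : Fin 3 → ℂ} (hn : IsNull n) :
    IsNull (A.mulVec n) := by
  rw [isNull_iff] at hn ⊢; rw [hA.1, hn]

lemma IsSO.mulVec_ne_zero {A : Matrix (Fin 3) (Fin 3) ℂ} (hA : IsSO A) {n : Fin 3 → ℂ}
    (hn : n ≠ 0) : A.mulVec n ≠ 0 := fun h => hn <| by
  rw [← hA.inv_mulVec_mulVec n, h, Matrix.mulVec_zero]

lemma IsNull.ne_zero_of {n : Fin 3 → ℂ} (hn : IsNull n) (h0 : n ≠ 0) (h2 : n 2 = 0) :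
    n 1 = 0 ∧ n 0 ≠ 0 := by
  have h1 : n 1 = 0 := by
    have : n 1 ^ 2 = 0 := by rw [hn, h2, mul_zero]
    exact pow_eq_zero_iff two_ne_zero |>.1 this
  refine ⟨h1, fun h => h0 ?_⟩
  ext i; fin_cases i <;> simp [h, h1, h2]

/-! ### The projective line as the conic of isotropic lines -/

namespace CP1

/-- The polynomial `(Z - z)²`. -/
def nulC (z : ℂ) : Fin 3 → ℂ := ![z ^ 2, -2 * z, 1]

/-- A quadratic vector field with a double zero at the given point. -/
def nul (p : CP1) : Fin 3 → ℂ := OnePoint.elim (X := ℂ) p ![1, 0, 0] nulC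

@[simp] lemma nul_infinity : nul infinity = ![1, 0, 0] := rfl

@[simp] lemma nul_ofComplex (z : ℂ) : nul (ofComplex z) = nulC z := rfl

/-- The double zero of an isotropic vector. -/
def pt (n : Fin 3 → ℂ) : CP1 := if n 2 = 0 then infinity else ofComplex (-(n 1) / (2 * n 2))

/-- The affine coordinate, with a meaningless value at `∞`. -/
def toC (p : CP1) : ℂ := chartZero p

@[simp] lemma toC_ofComplex (z : ℂ) : toC (ofComplex z) = z := chartZero_ofComplex z

lemma ofComplex_toC {p : CP1} (hp : p ≠ infinity) : ofComplex (toC p) = p := by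
  rcases eq_infinity_or p with rfl | ⟨z, rfl⟩
  · exact absurd rfl hp
  · simp

lemma isNull_nul (p : CP1) : IsNull (nul p) := by
  rcases eq_infinity_or p with rfl | ⟨z, rfl⟩ <;> simp [IsNull, nulC] <;> ring

lemma nul_ne_zero (p : CP1) : nul p ≠ 0 := by
  rcases eq_infinity_or p with rfl | ⟨z, rfl⟩ <;> intro h
  · simpa using congrFun h 0
  · simpa [nulC] using congrFun h 2

@[simp] lemma pt_nul (p : CP1) : pt (nul p) = p := by
  rcases eq_infinity_or p with rfl | ⟨z, rfl⟩ <;> simp [pt, nulC]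

lemma pt_smul {c : ℂ} (hc : c ≠ 0) (n : Fin 3 → ℂ) : pt (c • n) = pt n := by
  by_cases h : n 2 = 0
  · simp [pt, h]
  · simp only [pt, Pi.smul_apply, smul_eq_mul, mul_eq_zero, hc, h, or_self, if_false]
    congr 1
    field_simp

lemma exists_smul_nul_pt {n : Fin 3 → ℂ} (hn : IsNull n) (h0 : n ≠ 0) :
    ∃ c : ℂ, c ≠ 0 ∧ n = c • nul (pt n) := by
  by_cases h : n 2 = 0
  · obtain ⟨h1, h2⟩ := hn.ne_zero_of h0 h
    refine ⟨n 0, h2, ?_⟩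
    ext i; fin_cases i <;> simp [pt, h, h1]
  · refine ⟨n 2, h, ?_⟩
    have hn' : n 1 ^ 2 = 4 * n 0 * n 2 := hn
    ext i; fin_cases i <;> simp [pt, h, nulC] <;> field_simp
    linear_combination -hn'

lemma pt_ne_infinity_iff {n : Fin 3 → ℂ} : pt n ≠ infinity ↔ n 2 ≠ 0 := by
  by_cases h : n 2 = 0 <;> simp [pt, h, ofComplex_ne_infinity]

/-- The action of an isometry on the conic of isotropic lines. -/
def act (A : Matrix (Fin 3) (Fin 3) ℂ) (p : CP1) : CP1 := pt (A.mulVec (nul p))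

/-- Any isotropic representative computes the action, because `pt` does not see scalars. This makes
`act` multiplicative. -/
lemma act_pt {A : Matrix (Fin 3) (Fin 3) ℂ} {n : Fin 3 → ℂ} (hn : IsNull n) (h0 : n ≠ 0) :
    act A (pt n) = pt (A.mulVec n) := by
  obtain ⟨c, hc, h⟩ := exists_smul_nul_pt hn h0
  conv_rhs => rw [h, Matrix.mulVec_smul, pt_smul hc]
  rfl

@[simp] lemma act_one (p : CP1) : act 1 p = p := by simp [act]

lemma act_act {A B : Matrix (Fin 3) (Fin 3) ℂ} (hB : IsSO B) (p : CP1) :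
    act A (act B p) = act (A * B) p := by
  rw [show act B p = pt (B.mulVec (nul p)) from rfl, act_pt, Matrix.mulVec_mulVec]
  · rfl
  · exact hB.isNull (isNull_nul p)
  · exact hB.mulVec_ne_zero (nul_ne_zero p)

lemma exists_mulVec_nul {A : Matrix (Fin 3) (Fin 3) ℂ} (hA : IsSO A) (p : CP1) :
    ∃ c : ℂ, c ≠ 0 ∧ A.mulVec (nul p) = c • nul (act A p) :=
  exists_smul_nul_pt (hA.isNull (isNull_nul p)) (hA.mulVec_ne_zero (nul_ne_zero p))

/-- Evaluation at a point is pairing with the isotropic vector of that point, so vanishing of a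
field becomes orthogonality, a condition that also makes sense at `∞`. -/
lemma killing_nulC (w : Fin 3 → ℂ) (z : ℂ) : killing w (nulC z) = -4 * quad w z := by
  simp [killing_apply, nulC, quad]; ring

/-- The matrix of the involution `z ↦ 1 / z`. -/
def flip : Matrix (Fin 3) (Fin 3) ℂ := !![0, 0, -1; 0, -1, 0; -1, 0, 0]

/-- The signs come from `∂_z = -u² ∂_u` for `u = 1 / z`; with them the determinant is `1`. -/
lemma flip_mulVec (w : Fin 3 → ℂ) : flip.mulVec w = ![-(w 2), -(w 1), -(w 0)] := by
  ext i; fin_cases i <;> simp [flip, Matrix.mulVec, dotProduct, Fin.sum_univ_three]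

lemma isSO_flip : IsSO flip := by
  refine ⟨fun a b => ?_, by simp [flip, Matrix.det_fin_three]⟩
  simp [flip_mulVec, killing_apply]; ring

lemma act_flip (p : CP1) : act flip p = inv p := by
  rcases eq_infinity_or p with rfl | ⟨z, rfl⟩
  · simp [act, pt, flip_mulVec]
  · by_cases hz : z = 0
    · simp [act, pt, flip_mulVec, nulC, hz]
    · rw [inv_ofComplex_of_ne hz]
      simp only [act, nul_ofComplex, pt, flip_mulVec, nulC]
      simp [hz]
      congr 1; field_simp

lemma act_flip_infinity : act flip infinity ≠ infinity := by
  rw [act_flip, inv_infinity]; exact ofComplex_ne_infinity 0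

/-- The action of an isometry in the affine coordinate. -/
def mob (A : Matrix (Fin 3) (Fin 3) ℂ) (z : ℂ) : ℂ := toC (act A (ofComplex z))

lemma mulVec_nulC {A : Matrix (Fin 3) (Fin 3) ℂ} (hA : IsSO A) {z : ℂ}
    (hz : act A (ofComplex z) ≠ infinity) : A.mulVec (nulC z) = (A.mulVec (nulC z) 2) • nulC (mob A z) := by
  obtain ⟨c, hc, h⟩ := exists_mulVec_nul hA (ofComplex z)
  rw [← ofComplex_toC hz] at h
  simp only [nul_ofComplex] at h
  have : A.mulVec (nulC z) 2 = c := by rw [h]; simp [nulC]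
  rw [this]; exact h

/-- Invariance of the pairing with an isotropic vector, read in the affine coordinate. By
`hasDerivAt_mob` the factor is the derivative of the Möbius map, so `A` acts on quadratic fields as
push-forward. -/
lemma quad_mob {A : Matrix (Fin 3) (Fin 3) ℂ} (hA : IsSO A) {z : ℂ}
    (hz : act A (ofComplex z) ≠ infinity) (w : Fin 3 → ℂ) :
    quad (A.mulVec w) (mob A z) = quad w z / A.mulVec (nulC z) 2 := by
  have h2 : A.mulVec (nulC z) 2 ≠ 0 := pt_ne_infinity_iff.1 hz
  have h := hA.1 w (nulC z)
  rw [killing_nulC, mulVec_nulC hA hz, map_smul, killing_nulC, smul_eq_mul] at h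
  field_simp
  linear_combination -h / 4

/-- The quotient rule for `-n₁ / (2 n₂)` produces the last component of the bracket of `n = A (nulC
z)` with its derivative. That bracket is `2 n`, because it is so before applying `A`. -/
lemma hasDerivAt_mob {A : Matrix (Fin 3) (Fin 3) ℂ} (hA : IsSO A) {z : ℂ}
    (hz : act A (ofComplex z) ≠ infinity) : HasDerivAt (mob A) (1 / A.mulVec (nulC z) 2) z := by
  have h2 : A.mulVec (nulC z) 2 ≠ 0 := pt_ne_infinity_iff.1 hz
  have hd : ∀ i, HasDerivAt (fun z => A.mulVec (nulC z) i) (A.mulVec ![2 * z, -2, 0] i) z := by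
    intro i
    simp only [Matrix.mulVec, dotProduct, Fin.sum_univ_three, nulC]
    simp
    have h1 : HasDerivAt (fun z : ℂ => z ^ 2) (2 * z) z := by simpa using hasDerivAt_pow 2 z
    have h3 : HasDerivAt (fun z : ℂ => 2 * z) 2 z := by
      simpa using (hasDerivAt_id z).const_mul (2 : ℂ)
    have := ((h1.const_mul (A i 0)).sub (h3.const_mul (A i 1)))
    convert this using 1
    · funext y; simp; ring
    · ring
  have hq := ((hd 1).fun_neg.fun_div ((hd 2).const_mul 2) (by simpa using h2))
  have he : mob A =ᶠ[𝓝 z] fun z => -(A.mulVec (nulC z) 1) / (2 * A.mulVec (nulC z) 2) := by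
    filter_upwards [(hd 2).continuousAt.eventually_ne h2] with y hy
    rw [mob, act, nul_ofComplex, pt, if_neg hy, toC_ofComplex]
  refine (hq.congr_of_eventuallyEq he).congr_deriv ?_
  -- The numerator of the quotient rule is this component of the bracket, since `brk a b 2 = a₁ b₂ -
  -- a₂ b₁`.
  have hb := congrFun (hA.brk_mulVec (nulC z) ![2 * z, -2, 0]) 2
  have h3 : brk (nulC z) ![2 * z, -2, 0] = (2 : ℂ) • nulC z := by
    ext i; fin_cases i <;> simp [brk_apply, nulC] <;> ring
  rw [h3, Matrix.mulVec_smul, brk_apply] at hb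
  simp only [Matrix.cons_val, Pi.smul_apply, smul_eq_mul] at hb
  field_simp
  linear_combination hb

end CP1

/-! ### Holomorphic maps to the projective line -/

namespace CP1

lemma chartZero_mem : chartZero ∈ IsManifold.maximalAtlas 𝓘(ℂ) ω CP1 :=
  IsManifold.subset_maximalAtlas (Or.inl rfl)

lemma chartInfinity_mem : chartInfinity ∈ IsManifold.maximalAtlas 𝓘(ℂ) ω CP1 :=
  IsManifold.subset_maximalAtlas (Or.inr rfl)

lemma mem_chartZero_source {p : CP1} : p ∈ chartZero.source ↔ p ≠ infinity := by
  rw [chartZero_source]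
  rcases eq_infinity_or p with rfl | ⟨z, rfl⟩
  · simp [ofComplex_ne_infinity]
  · simp [ofComplex_ne_infinity]

lemma isOpen_ne_infinity : IsOpen {p : CP1 | p ≠ infinity} := isOpen_ne

lemma contMDiffAt_toC {p : CP1} (hp : p ≠ infinity) : ContMDiffAt 𝓘(ℂ) 𝓘(ℂ) ω toC p :=
  contMDiffAt_of_mem_maximalAtlas chartZero_mem (mem_chartZero_source.2 hp)

lemma contMDiff_ofComplex : ContMDiff 𝓘(ℂ) 𝓘(ℂ) ω ofComplex := by
  intro z
  have := contMDiffAt_symm_of_mem_maximalAtlas (n := ω) (I := 𝓘(ℂ)) (x := z) chartZero_mem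
    (by simp [chartZero])
  exact this.congr_of_eventuallyEq (Eventually.of_forall fun y => (chartZero_symm_apply y).symm)

lemma contMDiff_inv : ContMDiff 𝓘(ℂ) 𝓘(ℂ) ω inv := by
  intro p
  by_cases hp : inv p = infinity
  · have hp' : p ≠ infinity := by
      rintro rfl
      rw [inv_infinity] at hp
      exact ofComplex_ne_infinity 0 hp
    have h1 := contMDiffAt_symm_of_mem_maximalAtlas (n := ω) (I := 𝓘(ℂ)) (x := toC p)
      chartInfinity_mem (by simp [chartInfinity, chartZero])
    refine (h1.comp p (contMDiffAt_toC hp')).congr_of_eventuallyEq ?_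
    filter_upwards [isOpen_ne_infinity.mem_nhds hp'] with q hq
    rw [Function.comp_apply, chartInfinity_symm_apply, ofComplex_toC hq]
  · have h1 := contMDiffAt_of_mem_maximalAtlas (n := ω) (I := 𝓘(ℂ)) (x := p)
      chartInfinity_mem (mem_chartZero_source.2 hp)
    refine ((contMDiff_ofComplex _).comp p h1).congr_of_eventuallyEq ?_
    filter_upwards [(isOpen_ne_infinity.preimage continuous_inv).mem_nhds hp] with q hq
    rw [Function.comp_apply, chartInfinity_apply]
    exact (ofComplex_toC hq).symm

variable {E H M : Type*} [NormedAddCommGroup E] [NormedSpace ℂ E] [TopologicalSpace H]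
  {I : ModelWithCorners ℂ E H} [TopologicalSpace M] [ChartedSpace H M]

/-- Near `∞` the quotient `-n₁ / (2 n₂)` degenerates, but isotropy `n₁² = 4 n₀ n₂` turns its inverse
into `-n₁ / (2 n₀)`, which is regular there. -/
lemma contMDiffAt_pt {n : M → Fin 3 → ℂ} {m : M} (hn : ∀ i, ContMDiffAt I 𝓘(ℂ) ω (n · i) m)
    (hnull : ∀ᶠ y in 𝓝 m, IsNull (n y)) (h0 : n m ≠ 0) :
    ContMDiffAt I 𝓘(ℂ) ω (fun y => pt (n y)) m := by
  by_cases h2 : n m 2 = 0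
  · obtain ⟨h1, h0'⟩ := hnull.self_of_nhds.ne_zero_of h0 h2
    have hq : ContMDiffAt I 𝓘(ℂ) ω (fun y => -(n y 1) / (2 * n y 0)) m := by
      refine ContMDiffAt.div₀ (hn 1).neg ((contMDiffAt_const).mul (hn 0)) (by simpa using h0')
    refine ((contMDiff_inv _).comp m ((contMDiff_ofComplex _).comp m hq)).congr_of_eventuallyEq ?_
    filter_upwards [hnull, (hn 0).continuousAt.eventually_ne h0'] with y hy hy0
    have hy' : n y 1 ^ 2 = 4 * n y 0 * n y 2 := hy
    simp only [Function.comp_apply]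
    by_cases h2 : n y 2 = 0
    · have h1 : n y 1 = 0 := by
        refine pow_eq_zero_iff two_ne_zero |>.1 ?_
        rw [hy', h2, mul_zero]
      simp [pt, h2, h1]
    · have h1 : n y 1 ≠ 0 := fun h => by
        rw [h] at hy'
        have : (4 : ℂ) * n y 0 * n y 2 ≠ 0 := mul_ne_zero (mul_ne_zero (by norm_num) hy0) h2
        exact this (by rw [← hy']; ring)
      rw [inv_ofComplex_of_ne (div_ne_zero (neg_ne_zero.2 h1) (mul_ne_zero two_ne_zero hy0)),
        pt, if_neg h2]
      congr 1
      field_simp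
      linear_combination -hy'
  · have hq : ContMDiffAt I 𝓘(ℂ) ω (fun y => -(n y 1) / (2 * n y 2)) m := by
      refine ContMDiffAt.div₀ (hn 1).neg ((contMDiffAt_const).mul (hn 2)) (by simpa using h2)
    refine ((contMDiff_ofComplex _).comp m hq).congr_of_eventuallyEq ?_
    filter_upwards [(hn 2).continuousAt.eventually_ne h2] with y hy
    simp [pt, hy]

/-- A holomorphic map to the projective line lifts locally to isotropic vectors. -/
lemma exists_null_lift {ζ : M → CP1} {m : M} (hζ : ContMDiffAt I 𝓘(ℂ) ω ζ m) :
    ∃ n : M → Fin 3 → ℂ, (∀ i, ContMDiffAt I 𝓘(ℂ) ω (n · i) m) ∧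
      ∀ᶠ y in 𝓝 m, IsNull (n y) ∧ n y ≠ 0 ∧ pt (n y) = ζ y := by
  by_cases hm : ζ m = infinity
  · have hm' : inv (ζ m) ≠ infinity := by rw [hm, inv_infinity]; exact ofComplex_ne_infinity 0
    have h1 : ContMDiffAt I 𝓘(ℂ) ω (fun y => toC (inv (ζ y))) m :=
      (contMDiffAt_toC hm').comp m ((contMDiff_inv _).comp m hζ)
    refine ⟨fun y => flip.mulVec (nulC (toC (inv (ζ y)))), fun i => ?_, ?_⟩
    · simp only [flip_mulVec, nulC]
      fin_cases i
      · exact contMDiffAt_const (c := (-1 : ℂ)) (I := I) (I' := 𝓘(ℂ))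
      · exact ((contMDiffAt_const (c := (-2 : ℂ)) (I := I) (I' := 𝓘(ℂ))).mul h1).neg
      · have h2 : ContMDiffAt I 𝓘(ℂ) ω (fun y => toC (inv (ζ y)) ^ 2) m := h1.pow 2
        exact h2.neg
    · have hc : ContinuousAt (fun y => inv (ζ y)) m :=
        continuous_inv.continuousAt.comp hζ.continuousAt
      filter_upwards [hc.eventually_ne hm'] with y hy
      have e : nulC (toC (inv (ζ y))) = nul (inv (ζ y)) := by
        rw [← nul_ofComplex, ofComplex_toC hy]
      rw [e]
      refine ⟨isSO_flip.isNull (isNull_nul _), isSO_flip.mulVec_ne_zero (nul_ne_zero _), ?_⟩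
      change act flip (inv (ζ y)) = _
      rw [act_flip, inv_inv]
  · have h1 : ContMDiffAt I 𝓘(ℂ) ω (fun y => toC (ζ y)) m := (contMDiffAt_toC hm).comp m hζ
    refine ⟨fun y => nulC (toC (ζ y)), fun i => ?_, ?_⟩
    · simp only [nulC]
      fin_cases i
      · exact h1.pow 2
      · exact (contMDiffAt_const (c := (-2 : ℂ)) (I := I) (I' := 𝓘(ℂ))).mul h1
      · exact contMDiffAt_const
    · filter_upwards [hζ.continuousAt.eventually_ne hm] with y hy
      have e : nulC (toC (ζ y)) = nul (ζ y) := by rw [← nul_ofComplex, ofComplex_toC hy]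
      rw [e]
      exact ⟨isNull_nul _, nul_ne_zero _, pt_nul _⟩

/-- After lifting the map to isotropic vectors the action is linear, so no case distinction at `∞`
is left. -/
lemma contMDiffAt_act {A : M → Matrix (Fin 3) (Fin 3) ℂ} {ζ : M → CP1} {m : M}
    (hA : ∀ i j, ContMDiffAt I 𝓘(ℂ) ω (A · i j) m) (hSO : ∀ᶠ y in 𝓝 m, IsSO (A y))
    (hζ : ContMDiffAt I 𝓘(ℂ) ω ζ m) : ContMDiffAt I 𝓘(ℂ) ω (fun y => act (A y) (ζ y)) m := by
  obtain ⟨n, hn, hn'⟩ := exists_null_lift hζ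
  have h : ContMDiffAt I 𝓘(ℂ) ω (fun y => pt ((A y).mulVec (n y))) m := by
    refine contMDiffAt_pt (fun i => ?_) ?_ ?_
    · simp only [Matrix.mulVec, dotProduct, Fin.sum_univ_three]
      exact (((hA i 0).mul (hn 0)).add ((hA i 1).mul (hn 1))).add ((hA i 2).mul (hn 2))
    · filter_upwards [hn', hSO] with y hy hy'
      exact hy'.isNull hy.1
    · exact hSO.self_of_nhds.mulVec_ne_zero hn'.self_of_nhds.2.1
  · refine h.congr_of_eventuallyEq ?_
    filter_upwards [hn'] with y hy
    rw [← hy.2.2, act_pt hy.1 hy.2.1]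

end CP1

/-! ### Vector fields in holomorphic charts -/

section HolChart

variable {E : Type*} [NormedAddCommGroup E] [NormedSpace ℂ E]
  {M : Type*} [TopologicalSpace M] [ChartedSpace E M]

lemma mlieBracket_eq_lieBracket (V W : ∀ x : E, TangentSpace 𝓘(ℂ, E) x) (x : E) :
    VectorField.mlieBracket 𝓘(ℂ, E) V W x = VectorField.lieBracket ℂ V W x := by
  rw [← VectorField.mlieBracketWithin_univ, VectorField.mlieBracketWithin_eq_lieBracketWithin]
  exact congrFun VectorField.lieBracketWithin_univ x

/-- A local homeomorphism to the model space that is biholomorphic. -/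
structure IsHolChart (c : OpenPartialHomeomorph M E) : Prop where
  hol : ContMDiffOn 𝓘(ℂ, E) 𝓘(ℂ, E) ω c c.source
  symm : ContMDiffOn 𝓘(ℂ, E) 𝓘(ℂ, E) ω c.symm c.target

namespace IsHolChart

variable {c : OpenPartialHomeomorph M E} {p : M}

lemma contMDiffAt (hc : IsHolChart c) (hp : p ∈ c.source) :
    ContMDiffAt 𝓘(ℂ, E) 𝓘(ℂ, E) ω c p := hc.hol.contMDiffAt (c.open_source.mem_nhds hp)

lemma contMDiffAt_symm (hc : IsHolChart c) {y : E} (hy : y ∈ c.target) :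
    ContMDiffAt 𝓘(ℂ, E) 𝓘(ℂ, E) ω c.symm y := hc.symm.contMDiffAt (c.open_target.mem_nhds hy)

lemma mfderiv_symm_mfderiv (hc : IsHolChart c) (hp : p ∈ c.source) (v : TangentSpace 𝓘(ℂ, E) p) :
    mfderiv 𝓘(ℂ, E) 𝓘(ℂ, E) c.symm (c p) (mfderiv 𝓘(ℂ, E) 𝓘(ℂ, E) c p v) = v := by
  have h1 := (hc.contMDiffAt hp).mdifferentiableAt (by simp)
  have h2 := (hc.contMDiffAt_symm (c.map_source hp)).mdifferentiableAt (by simp)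
  have h3 := mfderiv_comp p h2 h1
  have h4 : mfderiv 𝓘(ℂ, E) 𝓘(ℂ, E) (c.symm ∘ c) p = mfderiv 𝓘(ℂ, E) 𝓘(ℂ, E) id p := by
    refine Filter.EventuallyEq.mfderiv_eq ?_
    filter_upwards [c.open_source.mem_nhds hp] with q hq
    exact c.left_inv hq
  rw [h3, mfderiv_id] at h4
  exact congrArg (fun L : E →L[ℂ] E => L v) h4

lemma mfderiv_mfderiv_symm (hc : IsHolChart c) (hp : p ∈ c.source) (v : E) :
    mfderiv 𝓘(ℂ, E) 𝓘(ℂ, E) c p (show E from mfderiv 𝓘(ℂ, E) 𝓘(ℂ, E) c.symm (c p) v) = v := by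
  have h1 := (hc.contMDiffAt hp).mdifferentiableAt (by simp)
  rw [← c.left_inv hp] at h1
  have h2 := (hc.contMDiffAt_symm (c.map_source hp)).mdifferentiableAt (by simp)
  have h3 := mfderiv_comp (c p) h1 h2
  have h4 : mfderiv 𝓘(ℂ, E) 𝓘(ℂ, E) (c ∘ c.symm) (c p) = mfderiv 𝓘(ℂ, E) 𝓘(ℂ, E) id (c p) := by
    refine Filter.EventuallyEq.mfderiv_eq ?_
    filter_upwards [c.open_target.mem_nhds (c.map_source hp)] with q hq
    exact c.right_inv hq
  rw [h3, mfderiv_id] at h4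
  have h5 := congrArg (fun L : E →L[ℂ] E => L v) h4
  have h6 : ∀ q, q = p → mfderiv 𝓘(ℂ, E) 𝓘(ℂ, E) c q (show E from mfderiv 𝓘(ℂ, E) 𝓘(ℂ, E) c.symm (c p) v) = v → mfderiv 𝓘(ℂ, E) 𝓘(ℂ, E) c p (show E from mfderiv 𝓘(ℂ, E) 𝓘(ℂ, E) c.symm (c p) v) = v := by
    rintro _ rfl h; exact h
  exact h6 _ (c.left_inv hp) h5

/-- The derivative of a holomorphic chart, as an isomorphism. -/
def tangentEquiv (hc : IsHolChart c) (hp : p ∈ c.source) : TangentSpace 𝓘(ℂ, E) p ≃L[ℂ] E :=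
  ContinuousLinearEquiv.equivOfInverse (M₁ := TangentSpace 𝓘(ℂ, E) p) (M₂ := E)
    (mvfderiv 𝓘(ℂ, E) c p) (show E →L[ℂ] TangentSpace 𝓘(ℂ, E) p from
      (show E →L[ℂ] E from mfderiv 𝓘(ℂ, E) 𝓘(ℂ, E) c.symm (c p)))
    (hc.mfderiv_symm_mfderiv hp) (hc.mfderiv_mfderiv_symm hp)

lemma tangentEquiv_apply (hc : IsHolChart c) (hp : p ∈ c.source) (v : TangentSpace 𝓘(ℂ, E) p) :
    hc.tangentEquiv hp v = mvfderiv 𝓘(ℂ, E) c p v := rfl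

lemma mvfderiv_symm_apply (hc : IsHolChart c) (hp : p ∈ c.source) (y : E) :
    mvfderiv 𝓘(ℂ, E) c p ((hc.tangentEquiv hp).symm y) = y :=
  (hc.tangentEquiv hp).apply_symm_apply y

lemma mvfderiv_injective (hc : IsHolChart c) (hp : p ∈ c.source) :
    Function.Injective (mvfderiv 𝓘(ℂ, E) c p) := (hc.tangentEquiv hp).injective

lemma isInvertible (hc : IsHolChart c) (hp : p ∈ c.source) :
    (mfderiv 𝓘(ℂ, E) 𝓘(ℂ, E) c p).IsInvertible := ⟨hc.tangentEquiv hp, rfl⟩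

lemma mfderiv_symm_eq (hc : IsHolChart c) {y : E} (hy : y ∈ c.target) :
    mfderiv 𝓘(ℂ, E) 𝓘(ℂ, E) c.symm y
      = ((hc.tangentEquiv (c.map_target hy)).symm : E →L[ℂ] TangentSpace 𝓘(ℂ, E) (c.symm y)) := by
  have e : mfderiv 𝓘(ℂ, E) 𝓘(ℂ, E) c.symm (c (c.symm y))
      = ((hc.tangentEquiv (c.map_target hy)).symm :
        E →L[ℂ] TangentSpace 𝓘(ℂ, E) (c.symm y)) := rfl
  have h : ∀ y', y' = y → (mfderiv 𝓘(ℂ, E) 𝓘(ℂ, E) c.symm y' : E →L[ℂ] E)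
      = (mfderiv 𝓘(ℂ, E) 𝓘(ℂ, E) c.symm y : E →L[ℂ] E) := by rintro _ rfl; rfl
  exact (h _ (c.right_inv hy)).symm.trans e

lemma isInvertible_symm (hc : IsHolChart c) {y : E} (hy : y ∈ c.target) :
    (mfderiv 𝓘(ℂ, E) 𝓘(ℂ, E) c.symm y).IsInvertible :=
  ⟨(hc.tangentEquiv (c.map_target hy)).symm, (hc.mfderiv_symm_eq hy).symm⟩

lemma mpullback_symm_apply (hc : IsHolChart c) {y : E} (hy : y ∈ c.target)
    (ξ : ∀ x : M, TangentSpace 𝓘(ℂ, E) x) :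
    (VectorField.mpullback 𝓘(ℂ, E) 𝓘(ℂ, E) c.symm ξ y : E)
      = mvfderiv 𝓘(ℂ, E) c (c.symm y) (ξ (c.symm y)) := by
  rw [VectorField.mpullback_apply, hc.mfderiv_symm_eq hy]
  exact congrArg (fun L : TangentSpace 𝓘(ℂ, E) (c.symm y) →L[ℂ] E => L (ξ (c.symm y)))
    (ContinuousLinearMap.inverse_equiv (hc.tangentEquiv (c.map_target hy)).symm)

lemma mpullback_apply (hc : IsHolChart c) (hp : p ∈ c.source)
    (g : ∀ y : E, TangentSpace 𝓘(ℂ, E) y) :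
    VectorField.mpullback 𝓘(ℂ, E) 𝓘(ℂ, E) c g p = (hc.tangentEquiv hp).symm (g (c p)) := by
  rw [VectorField.mpullback_apply]
  exact congrArg (fun L : E →L[ℂ] TangentSpace 𝓘(ℂ, E) p => L (g (c p)))
    (ContinuousLinearMap.inverse_equiv (hc.tangentEquiv hp))

variable [CompleteSpace E] [IsManifold 𝓘(ℂ, E) ω M]

/-- Pulling the field back along the chart and its inverse reduces holomorphy to that of its
components. The chart need not belong to the atlas, so charts made from fibre coordinates are
allowed. -/
lemma holAt_iff (hc : IsHolChart c) (hp : p ∈ c.source)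
    (ξ : ∀ x : M, TangentSpace 𝓘(ℂ, E) x) :
    ContMDiffAt 𝓘(ℂ, E) (𝓘(ℂ, E).prod 𝓘(ℂ, E)) ω
      (fun x => TotalSpace.mk' E (E := fun x : M => TangentSpace 𝓘(ℂ, E) x) x (ξ x)) p ↔
    ContMDiffAt 𝓘(ℂ, E) 𝓘(ℂ, E) ω (fun q => mvfderiv 𝓘(ℂ, E) c q (ξ q)) p := by
  have : IsManifold 𝓘(ℂ, E) (ω + 1) M := ‹IsManifold 𝓘(ℂ, E) ω M›
  constructor
  · intro h
    rw [← c.left_inv hp] at h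
    have h1 := h.mpullback_vectorField_preimage (hc.contMDiffAt_symm (c.map_source hp))
      (hc.isInvertible_symm (c.map_source hp)) le_rfl
    rw [contMDiffAt_vectorSpace_iff_contDiffAt] at h1
    refine (h1.contMDiffAt.comp p (hc.contMDiffAt hp)).congr_of_eventuallyEq ?_
    filter_upwards [c.open_source.mem_nhds hp] with q hq
    have h2 := hc.mpullback_symm_apply (c.map_source hq) ξ
    have h3 : ∀ q', q' = q → mvfderiv 𝓘(ℂ, E) c q (ξ q) = mvfderiv 𝓘(ℂ, E) c q' (ξ q') := by
      rintro _ rfl; rfl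
    exact (h3 _ (c.left_inv hq)).trans h2.symm
  · intro h
    rw [← c.left_inv hp] at h
    have h1 := h.comp (c p) (hc.contMDiffAt_symm (c.map_source hp))
    have h2 := (contMDiffAt_vectorSpace_iff_contDiffAt (V := (fun y =>
      mvfderiv 𝓘(ℂ, E) c (c.symm y) (ξ (c.symm y)) : ∀ y : E, TangentSpace 𝓘(ℂ, E) y))).2
        h1.contDiffAt
    have h3 := h2.mpullback_vectorField_preimage (hc.contMDiffAt hp)
      (hc.isInvertible hp) le_rfl
    refine h3.congr_of_eventuallyEq ?_
    filter_upwards [c.open_source.mem_nhds hp] with q hq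
    have h6 := hc.mpullback_apply hq (fun y => mvfderiv 𝓘(ℂ, E) c (c.symm y) (ξ (c.symm y)))
    refine congrArg (TotalSpace.mk' E q) (Eq.trans ?_ h6.symm)
    have h4 : ∀ q', q' = q → mvfderiv 𝓘(ℂ, E) c q (ξ q) = mvfderiv 𝓘(ℂ, E) c q' (ξ q') := by
      rintro _ rfl; rfl
    have h5 := (hc.tangentEquiv hq).symm_apply_apply (ξ q)
    rw [hc.tangentEquiv_apply, h4 _ (c.left_inv hq)] at h5
    exact h5.symm

/-- The Lie bracket of vector fields, computed in a holomorphic chart. -/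
lemma mlieBracket_eq (hc : IsHolChart c) (hp : p ∈ c.source)
    {ξ η : ∀ x : M, TangentSpace 𝓘(ℂ, E) x} {f g : E → E}
    (hξ : ∀ᶠ q in 𝓝 p, mvfderiv 𝓘(ℂ, E) c q (ξ q) = f (c q))
    (hη : ∀ᶠ q in 𝓝 p, mvfderiv 𝓘(ℂ, E) c q (η q) = g (c q))
    (hf : ContDiffAt ℂ ω f (c p)) (hg : ContDiffAt ℂ ω g (c p)) :
    mvfderiv 𝓘(ℂ, E) c p (VectorField.mlieBracket 𝓘(ℂ, E) ξ η p)
      = fderiv ℂ g (c p) (f (c p)) - fderiv ℂ f (c p) (g (c p)) := by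
  have key : ∀ {ξ : ∀ x : M, TangentSpace 𝓘(ℂ, E) x} {f : E → E},
      (∀ᶠ q in 𝓝 p, mvfderiv 𝓘(ℂ, E) c q (ξ q) = f (c q)) → ContDiffAt ℂ ω f (c p) →
      MDifferentiableAt 𝓘(ℂ, E) (𝓘(ℂ, E).prod 𝓘(ℂ, E)) (fun x =>
        TotalSpace.mk' E (E := fun x : M => TangentSpace 𝓘(ℂ, E) x) x (ξ x)) (c.symm (c p)) ∧
      (fun y => (VectorField.mpullback 𝓘(ℂ, E) 𝓘(ℂ, E) c.symm ξ y : E)) =ᶠ[𝓝 (c p)] f := by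
    intro ξ f hξ hf
    constructor
    · rw [c.left_inv hp]
      refine ContMDiffAt.mdifferentiableAt (n := ω) ?_ (by simp)
      rw [hc.holAt_iff hp]
      exact (hf.contMDiffAt.comp p (hc.contMDiffAt hp)).congr_of_eventuallyEq hξ
    · have h1 : ∀ᶠ y in 𝓝 (c p), mvfderiv 𝓘(ℂ, E) c (c.symm y) (ξ (c.symm y))
          = f (c (c.symm y)) := by
        have := c.symm.continuousAt (c.map_source hp)
        rw [ContinuousAt, c.left_inv hp] at this
        exact this.eventually hξ
      filter_upwards [h1, c.open_target.mem_nhds (c.map_source hp)] with y hy hy'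
      rw [hc.mpullback_symm_apply hy', hy, c.right_inv hy']
  obtain ⟨h1, h2⟩ := key hξ hf
  obtain ⟨h3, h4⟩ := key hη hg
  have h5 := VectorField.mpullback_mlieBracket (I := 𝓘(ℂ, E)) (I' := 𝓘(ℂ, E)) h1 h3
    (hc.contMDiffAt_symm (c.map_source hp)) (by simp)
  have h6 := hc.mpullback_symm_apply (c.map_source hp) (VectorField.mlieBracket 𝓘(ℂ, E) ξ η)
  have h7 : ∀ q', q' = p → mvfderiv 𝓘(ℂ, E) c p (VectorField.mlieBracket 𝓘(ℂ, E) ξ η p)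
      = mvfderiv 𝓘(ℂ, E) c q' (VectorField.mlieBracket 𝓘(ℂ, E) ξ η q') := by
    rintro _ rfl; rfl
  rw [h7 _ (c.left_inv hp), ← h6]
  refine Eq.trans h5 ?_
  have h8 := Filter.EventuallyEq.lieBracket_vectorField_eq (𝕜 := ℂ) h2 h4
  exact (mlieBracket_eq_lieBracket _ _ _).trans h8

end IsHolChart
end HolChart

/-! ### Two facts of complex analysis -/

/-- Local existence of holomorphic solutions of a holomorphic linear differential equation. -/
theorem exists_linear_ode_solution {E : Type*} [NormedAddCommGroup E] [NormedSpace ℂ E]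
    [CompleteSpace E] {L : ℂ → E →L[ℂ] E} {z₀ : ℂ} {R : ℝ} (hR : 0 < R)
    (hL : DifferentiableOn ℂ L (Metric.ball z₀ R)) (y₀ : E) :
    ∃ ρ > 0, ρ ≤ R ∧ ∃ y : ℂ → E, y z₀ = y₀ ∧
      ∀ z ∈ Metric.ball z₀ ρ, HasDerivAt y (L z (y z)) z := by
  have hcont : ContinuousAt L z₀ :=
    (hL.differentiableAt (Metric.isOpen_ball.mem_nhds (Metric.mem_ball_self hR))).continuousAt
  obtain ⟨δ, hδ, hLδ⟩ : ∃ δ > 0, ∀ z ∈ Metric.ball z₀ δ, ‖L z‖ ≤ ‖L z₀‖ + 1 := by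
    have := hcont.norm.eventually (gt_mem_nhds (lt_add_one ‖L z₀‖))
    obtain ⟨δ, hδ, h⟩ := Metric.eventually_nhds_iff_ball.1 this
    exact ⟨δ, hδ, fun z hz => (h z hz).le⟩
  set K := ‖L z₀‖ + 1 with hK
  have hKpos : 0 < K := by positivity
  -- With `K ρ ≤ 1 / 2` every Picard correction has at most half the bound of the preceding one.
  set ρ := min (min δ R) (1 / (2 * K)) with hρdef
  have hρ : 0 < ρ := by positivity
  have hρδ : ρ ≤ δ := (min_le_left _ _).trans (min_le_left _ _)
  have hρR : ρ ≤ R := (min_le_left _ _).trans (min_le_right _ _)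
  have hρK : K * ρ ≤ 1 / 2 := by
    calc K * ρ ≤ K * (1 / (2 * K)) := by gcongr; exact min_le_right _ _
      _ = 1 / 2 := by field_simp
  set U := Metric.ball z₀ ρ
  have hLU : DifferentiableOn ℂ L U := hL.mono (Metric.ball_subset_ball hρR)
  -- The primitive is chosen for every function so that the iteration is total; for a function that
  -- is not holomorphic the value is meaningless.
  have prim : ∀ f : ℂ → E, ∃ g : ℂ → E, DifferentiableOn ℂ f U →
      g z₀ = 0 ∧ ∀ z ∈ U, HasDerivAt g (f z) z := by
    intro f
    by_cases hf : DifferentiableOn ℂ f U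
    · obtain ⟨g, hg0, hg⟩ := hf.isExactOn_ball.with_val_at z₀ 0
      exact ⟨g, fun _ => ⟨hg0, hg⟩⟩
    · exact ⟨0, fun h => absurd h hf⟩
  choose P hP using prim
  -- `Y (n + 1)` is the primitive of `L · Y n` that vanishes at `z₀`. The sum of all `Y n` solves
  -- the equation, by termwise differentiation.
  let Y : ℕ → ℂ → E := fun n => Nat.rec (fun _ => y₀) (fun _ f => P fun z => L z (f z)) n
  have hYd : ∀ n, DifferentiableOn ℂ (Y n) U := by
    intro n
    induction n with
    | zero => exact differentiableOn_const _
    | succ n ih =>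
      exact fun z hz => ((hP _ (hLU.clm_apply ih)).2 z hz).differentiableAt.differentiableWithinAt
  have hY : ∀ n, Y (n + 1) z₀ = 0 ∧ ∀ z ∈ U, HasDerivAt (Y (n + 1)) (L z (Y n z)) z :=
    fun n => hP _ (hLU.clm_apply (hYd n))
  have hbound : ∀ n, ∀ z ∈ U, ‖Y n z‖ ≤ ‖y₀‖ * (1 / 2) ^ n := by
    intro n
    induction n with
    | zero => intro z _; simp [Y]
    | succ n ih =>
      intro z hz
      have h1 := (convex_ball z₀ ρ).norm_image_sub_le_of_norm_hasDerivWithin_le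
        (f := Y (n + 1)) (C := K * (‖y₀‖ * (1 / 2) ^ n))
        (fun w hw => ((hY n).2 w hw).hasDerivWithinAt)
        (fun w hw => (ContinuousLinearMap.le_opNorm _ _).trans
          (mul_le_mul (hLδ w (Metric.ball_subset_ball hρδ hw)) (ih w hw) (norm_nonneg _) hKpos.le))
        (Metric.mem_ball_self hρ) hz
      rw [(hY n).1, sub_zero] at h1
      have h2 : ‖z - z₀‖ ≤ ρ := (mem_ball_iff_norm.1 hz).le
      calc ‖Y (n + 1) z‖ ≤ K * (‖y₀‖ * (1 / 2) ^ n) * ρ :=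
            h1.trans (mul_le_mul_of_nonneg_left h2 (by positivity))
        _ = (K * ρ) * (‖y₀‖ * (1 / 2) ^ n) := by ring
        _ ≤ (1 / 2) * (‖y₀‖ * (1 / 2) ^ n) := by gcongr
        _ = ‖y₀‖ * (1 / 2) ^ (n + 1) := by ring
  have hsum : Summable fun n : ℕ => ‖y₀‖ * (1 / 2 : ℝ) ^ n :=
    (summable_geometric_of_lt_one (by norm_num) (by norm_num)).mul_left _
  refine ⟨ρ, hρ, hρR, fun z => ∑' n, Y n z, ?_, fun z hz => ?_⟩
  · change ∑' n, Y n z₀ = y₀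
    refine (tsum_eq_single 0 fun n hn => ?_).trans rfl
    obtain ⟨m, rfl⟩ := Nat.exists_eq_succ_of_ne_zero hn
    exact (hY m).1
  · have hd := ((Complex.differentiableOn_tsum_of_summable_norm hsum hYd Metric.isOpen_ball
      hbound).differentiableAt (Metric.isOpen_ball.mem_nhds hz)).hasDerivAt
    have hs := Complex.hasSum_deriv_of_summable_norm hsum hYd Metric.isOpen_ball hbound hz
    have hs' : Summable fun n => Y n z := Summable.of_norm_bounded hsum fun n => hbound n z hz
    have h3 : HasSum (fun n => deriv (Y (n + 1)) z) (L z (∑' n, Y n z)) := by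
      refine ((L z).hasSum hs'.hasSum).congr_fun fun n => ?_
      exact ((hY n).2 z hz).deriv
    have h4 : HasSum (fun n => deriv (Y n) z) (L z (∑' n, Y n z)) := by
      rw [← hasSum_nat_add_iff' 1]
      have h5 : deriv (Y 0) z = 0 := deriv_const z y₀
      simpa [h5] using h3
    rwa [hs.unique h4] at hd

/-- An entire function with quadratic growth that is controlled at infinity is a quadratic
polynomial. -/
theorem exists_eq_quad {h k : ℂ → ℂ} (hh : Differentiable ℂ h) (hk : ContinuousAt k 0)
    (hhk : ∀ z, z ≠ 0 → h z = k z⁻¹ * z ^ 2) : ∃ w, ∀ z, h z = quad w z := by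
  have hd : ∀ f : ℂ → ℂ, Differentiable ℂ f → Differentiable ℂ (dslope f 0) := fun f hf =>
    differentiableOn_univ.1 ((Complex.differentiableOn_dslope univ_mem).2 hf.differentiableOn)
  have hsl : ∀ (f : ℂ → ℂ) z, f z = f 0 + z * dslope f 0 z := fun f z => by
    have := sub_smul_dslope f 0 z
    simp only [sub_zero, smul_eq_mul] at this
    rw [this]; ring
  -- Write `h = h(0) + z h₁(0) + z² h₂` with `h₂` entire. The control at infinity says that `h₂`
  -- tends to `k 0`, so `h₂` is constant by Liouville.
  set h1 := dslope h 0
  set h2 := dslope h1 0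
  have key : ∀ z, h z = h 0 + z * (h1 0 + z * h2 z) := fun z =>
    (hsl h z).trans (by rw [show dslope h 0 z = h1 0 + z * h2 z from hsl h1 z])
  have hh2 : Differentiable ℂ h2 := hd _ (hd _ hh)
  have hlim : Tendsto h2 (cocompact ℂ) (𝓝 (k 0)) := by
    have hinv : Tendsto (fun z : ℂ => z⁻¹) (cocompact ℂ) (𝓝 0) := by
      rw [← Metric.cobounded_eq_cocompact]; exact tendsto_inv₀_cobounded
    have h3 : Tendsto (fun z : ℂ => k z⁻¹ - h 0 * z⁻¹ ^ 2 - h1 0 * z⁻¹) (cocompact ℂ)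
        (𝓝 (k 0 - h 0 * 0 ^ 2 - h1 0 * 0)) :=
      ((hk.tendsto.comp hinv).sub ((hinv.pow 2).const_mul _)).sub (hinv.const_mul _)
    have h4 : k 0 - h 0 * 0 ^ 2 - h1 0 * 0 = k 0 := by ring
    rw [h4] at h3
    refine h3.congr' ?_
    have : ({0}ᶜ : Set ℂ) ∈ cocompact ℂ := isCompact_singleton.compl_mem_cocompact
    filter_upwards [this] with z hz
    have hz : z ≠ 0 := hz
    have e := hhk z hz
    rw [key] at e
    generalize k z⁻¹ = c at e ⊢
    field_simp
    linear_combination -e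
  have hconst : ∀ z, h2 z = k 0 := fun z => hh2.apply_eq_of_tendsto_cocompact z hlim
  refine ⟨![h 0, h1 0, k 0], fun z => ?_⟩
  rw [key, hconst]
  simp [quad]; ring

/-! ### Fibre coordinates of projective bundles -/

section Derivatives

variable {E : Type*} [NormedAddCommGroup E] [NormedSpace ℂ E]
  {M : Type*} [TopologicalSpace M] [ChartedSpace E M]

lemma mvfderiv_clm_comp {F F' : Type*} [NormedAddCommGroup F] [NormedSpace ℂ F]
    [NormedAddCommGroup F'] [NormedSpace ℂ F'] (L : F →L[ℂ] F') {f : M → F} {p : M}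
    (hf : MDifferentiableAt 𝓘(ℂ, E) 𝓘(ℂ, F) f p) (v : TangentSpace 𝓘(ℂ, E) p) :
    mvfderiv 𝓘(ℂ, E) (fun q => L (f q)) p v = L (mvfderiv 𝓘(ℂ, E) f p v) := by
  have h := (L.hasMFDerivAt (x := f p)).comp p hf.hasMFDerivAt
  exact congrArg (fun T : E →L[ℂ] F' => T v) h.mfderiv

lemma mvfderiv_deriv_comp {f : M → ℂ} {p : M} (hf : MDifferentiableAt 𝓘(ℂ, E) 𝓘(ℂ) f p)
    {g : ℂ → ℂ} {g' : ℂ} (hg : HasDerivAt g g' (f p)) (v : TangentSpace 𝓘(ℂ, E) p) :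
    mvfderiv 𝓘(ℂ, E) (fun q => g (f q)) p v = g' * mvfderiv 𝓘(ℂ, E) f p v := by
  have h := (hg.hasFDerivAt.hasMFDerivAt).comp p hf.hasMFDerivAt
  have e := congrArg (fun T : E →L[ℂ] ℂ => T v) h.mfderiv
  refine Eq.trans e ?_
  rw [mul_comm]
  rfl

lemma mvfderiv_congr {F : Type*} [NormedAddCommGroup F] [NormedSpace ℂ F] {f g : M → F} {p : M}
    (h : f =ᶠ[𝓝 p] g) (v : TangentSpace 𝓘(ℂ, E) p) :
    mvfderiv 𝓘(ℂ, E) f p v = mvfderiv 𝓘(ℂ, E) g p v :=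
  congrArg (fun T : E →L[ℂ] F => T v) (h.mfderiv_eq (I := 𝓘(ℂ, E)) (I' := 𝓘(ℂ, F)))

lemma isHolChart_chartAt [IsManifold 𝓘(ℂ, E) ω M] (x : M) : IsHolChart (chartAt E x) :=
  ⟨contMDiffOn_chart, contMDiffOn_chart_symm⟩

end Derivatives

lemma mvfderiv_eq_deriv_mul {X : Type*} [TopologicalSpace X] [ChartedSpace ℂ X]
    {φ : OpenPartialHomeomorph X ℂ} (hφ : IsHolChart φ) {x : X} (hx : x ∈ φ.source) {f : X → ℂ}
    (hf : MDifferentiableAt 𝓘(ℂ) 𝓘(ℂ) f x) (v : TangentSpace 𝓘(ℂ) x) :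
    DifferentiableAt ℂ (f ∘ φ.symm) (φ x) ∧
    mvfderiv 𝓘(ℂ) f x v = deriv (f ∘ φ.symm) (φ x) * mvfderiv 𝓘(ℂ) φ x v := by
  have h1 : DifferentiableAt ℂ (f ∘ φ.symm) (φ x) := by
    rw [← φ.left_inv hx] at hf
    exact (hf.comp (φ x) ((hφ.contMDiffAt_symm (φ.map_source hx)).mdifferentiableAt
      (by simp))).differentiableAt
  refine ⟨h1, ?_⟩
  rw [← mvfderiv_deriv_comp ((hφ.contMDiffAt hx).mdifferentiableAt (by simp)) h1.hasDerivAt]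
  refine mvfderiv_congr ?_ v
  filter_upwards [φ.open_source.mem_nhds hx] with y hy
  simp [φ.left_inv hy]

section FibreCoord

variable {X : Type*} [TopologicalSpace X] [ChartedSpace ℂ X]
  {P : Type*} [TopologicalSpace P] [ChartedSpace (ℂ × ℂ) P]

/-- `ζ` is a fibre coordinate over `U`: together with `γ` it identifies `γ⁻¹(U)` biholomorphically
with `U × ℂℙ¹`. -/
structure IsFibreCoord (γ : P → X) (U : Set X) (ζ : P → CP1) : Prop where
  isOpen : IsOpen U
  proj : ContMDiff 𝓘(ℂ, ℂ × ℂ) 𝓘(ℂ) ω γ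
  hol : ContMDiffOn 𝓘(ℂ, ℂ × ℂ) 𝓘(ℂ) ω ζ (γ ⁻¹' U)
  exists_inv : ∃ σ : X × CP1 → P,
    ContMDiffOn (𝓘(ℂ).prod 𝓘(ℂ)) 𝓘(ℂ, ℂ × ℂ) ω σ (U ×ˢ univ) ∧
    (∀ x ∈ U, ∀ z, γ (σ (x, z)) = x ∧ ζ (σ (x, z)) = z) ∧ ∀ p, γ p ∈ U → σ (γ p, ζ p) = p

lemma IsSO.inv_entry {A : Matrix (Fin 3) (Fin 3) ℂ} (hA : IsSO A) (i j : Fin 3) :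
    A⁻¹ i j = A.adjugate i j := by
  rw [Matrix.inv_def, hA.2]; simp

/-- For determinant one the inverse is the adjugate, whose entries are polynomials. -/
lemma contMDiffAt_inv_entry {E H M : Type*} [NormedAddCommGroup E] [NormedSpace ℂ E]
    [TopologicalSpace H] {I : ModelWithCorners ℂ E H} [TopologicalSpace M] [ChartedSpace H M]
    {A : M → Matrix (Fin 3) (Fin 3) ℂ} {m : M}
    (hA : ∀ i j, ContMDiffAt I 𝓘(ℂ) ω (A · i j) m) (hSO : ∀ᶠ y in 𝓝 m, IsSO (A y)) (i j : Fin 3) :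
    ContMDiffAt I 𝓘(ℂ) ω (fun y => (A y)⁻¹ i j) m := by
  have h : ContMDiffAt I 𝓘(ℂ) ω (fun y => (A y).adjugate i j) m := by
    have h2 : ∀ i j k l, ContMDiffAt I 𝓘(ℂ) ω (fun y => A y i j * A y k l) m :=
      fun i j k l => (hA i j).mul (hA k l)
    have h3 : ∀ i j k l i' j' k' l', ContMDiffAt I 𝓘(ℂ) ω
        (fun y => A y i j * A y k l - A y i' j' * A y k' l') m :=
      fun i j k l i' j' k' l' => (h2 i j k l).sub (h2 i' j' k' l')
    have h4 : ∀ i j k l i' j' k' l', ContMDiffAt I 𝓘(ℂ) ω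
        (fun y => -(A y i j * A y k l) + A y i' j' * A y k' l') m :=
      fun i j k l i' j' k' l' => (h2 i j k l).neg.add (h2 i' j' k' l')
    simp only [Matrix.adjugate_fin_three]
    fin_cases i <;> fin_cases j <;> simp <;> first | exact h3 _ _ _ _ _ _ _ _ | exact h4 _ _ _ _ _ _ _ _
  refine h.congr_of_eventuallyEq ?_
  filter_upwards [hSO] with y hy
  exact hy.inv_entry i j

namespace IsFibreCoord

variable {γ : P → X} {U : Set X} {ζ : P → CP1}

lemma mono (h : IsFibreCoord γ U ζ) {V : Set X} (hV : IsOpen V) (hVU : V ⊆ U) :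
    IsFibreCoord γ V ζ := by
  obtain ⟨σ, h1, h2, h3⟩ := h.exists_inv
  exact ⟨hV, h.proj, h.hol.mono (preimage_mono hVU), σ, h1.mono (prod_mono_left hVU),
    fun x hx => h2 x (hVU hx), fun p hp => h3 p (hVU hp)⟩

lemma isOpen_preimage (h : IsFibreCoord γ U ζ) : IsOpen (γ ⁻¹' U) :=
  h.isOpen.preimage h.proj.continuous

lemma contMDiffAt (h : IsFibreCoord γ U ζ) {p : P} (hp : γ p ∈ U) :
    ContMDiffAt 𝓘(ℂ, ℂ × ℂ) 𝓘(ℂ) ω ζ p :=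
  h.hol.contMDiffAt (h.isOpen_preimage.mem_nhds hp)

/-- Changing a fibre coordinate by a holomorphic family of isometries. -/
lemma act (h : IsFibreCoord γ U ζ) {a : X → Matrix (Fin 3) (Fin 3) ℂ}
    (ha : ∀ i j, ContMDiffOn 𝓘(ℂ) 𝓘(ℂ) ω (a · i j) U) (hSO : ∀ x ∈ U, IsSO (a x)) :
    IsFibreCoord γ U (fun p => CP1.act (a (γ p)) (ζ p)) := by
  obtain ⟨σ, h1, h2, h3⟩ := h.exists_inv
  have hopen : IsOpen (U ×ˢ (univ : Set CP1)) := h.isOpen.prod isOpen_univ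
  refine ⟨h.isOpen, h.proj, fun p hp => ContMDiffAt.contMDiffWithinAt ?_,
    fun y => σ (y.1, CP1.act (a y.1)⁻¹ y.2), fun y hy => ContMDiffAt.contMDiffWithinAt ?_,
    fun x hx z => ?_, fun p hp => ?_⟩
  · refine CP1.contMDiffAt_act (fun i j => ?_) ?_ (h.contMDiffAt hp)
    · exact ((ha i j).contMDiffAt (h.isOpen.mem_nhds hp)).comp p (h.proj p)
    · filter_upwards [h.isOpen_preimage.mem_nhds hp] with q hq using hSO _ hq
  · have hy1 : y.1 ∈ U := hy.1
    have hev : ∀ᶠ y' in 𝓝 y, y' ∈ U ×ˢ (univ : Set CP1) := hopen.mem_nhds hy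
    have e : ContMDiffAt (𝓘(ℂ).prod 𝓘(ℂ)) (𝓘(ℂ).prod 𝓘(ℂ)) ω
        (fun y : X × CP1 => (y.1, CP1.act (a y.1)⁻¹ y.2)) y := by
      refine contMDiffAt_fst.prodMk (CP1.contMDiffAt_act (fun i j => ?_) ?_ contMDiffAt_snd)
      · refine contMDiffAt_inv_entry (fun i j => ?_) ?_ i j
        · exact ((ha i j).contMDiffAt (h.isOpen.mem_nhds hy1)).comp y contMDiffAt_fst
        · filter_upwards [hev] with y' hy' using hSO _ hy'.1
      · filter_upwards [hev] with y' hy' using (hSO _ hy'.1).inv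
    have h1' := h1.contMDiffAt (x := (y.1, CP1.act (a y.1)⁻¹ y.2)) (hopen.mem_nhds ⟨hy1, mem_univ _⟩)
    exact h1'.comp y e
  · obtain ⟨e1, e2⟩ := h2 x hx (CP1.act (a x)⁻¹ z)
    refine ⟨e1, ?_⟩
    dsimp only
    rw [e1, e2, CP1.act_act (hSO x hx).inv, (hSO x hx).mul_inv, CP1.act_one]
  · change σ (γ p, CP1.act (a (γ p))⁻¹ (CP1.act (a (γ p)) (ζ p))) = p
    rw [CP1.act_act (hSO _ hp), (hSO _ hp).inv_mul, CP1.act_one, h3 p hp]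

lemma actConst (h : IsFibreCoord γ U ζ) {A : Matrix (Fin 3) (Fin 3) ℂ} (hA : IsSO A) :
    IsFibreCoord γ U (fun p => CP1.act A (ζ p)) :=
  h.act (a := fun _ => A) (fun _ _ => contMDiffOn_const) fun _ _ => hA

open Classical in
/-- The chart of `P` given by a chart of `X` and the affine fibre coordinate. -/
def chart (h : IsFibreCoord γ U ζ) (φ : OpenPartialHomeomorph X ℂ) (hφ : IsHolChart φ) :
    OpenPartialHomeomorph P (ℂ × ℂ) where
  toFun p := (φ (γ p), CP1.toC (ζ p))
  invFun y := h.exists_inv.choose (φ.symm y.1, CP1.ofComplex y.2)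
  source := {p | (γ p ∈ U ∧ γ p ∈ φ.source) ∧ ζ p ≠ CP1.infinity}
  target := {y | y.1 ∈ φ.target ∧ φ.symm y.1 ∈ U}
  map_source' p hp := by
    refine ⟨φ.map_source hp.1.2, ?_⟩
    rw [φ.left_inv hp.1.2]; exact hp.1.1
  map_target' y hy := by
    obtain ⟨e1, e2⟩ := h.exists_inv.choose_spec.2.1 _ hy.2 (CP1.ofComplex y.2)
    refine ⟨⟨?_, ?_⟩, ?_⟩
    · rw [e1]; exact hy.2
    · rw [e1]; exact φ.map_target hy.1
    · rw [e2]; exact CP1.ofComplex_ne_infinity _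
  left_inv' p hp := by
    dsimp only
    rw [φ.left_inv hp.1.2, CP1.ofComplex_toC hp.2]
    exact h.exists_inv.choose_spec.2.2 p hp.1.1
  right_inv' y hy := by
    obtain ⟨e1, e2⟩ := h.exists_inv.choose_spec.2.1 _ hy.2 (CP1.ofComplex y.2)
    rw [e1, e2, φ.right_inv hy.1, CP1.toC_ofComplex]
  open_source := by
    have h1 : IsOpen ((γ ⁻¹' U) ∩ ζ ⁻¹' {p | p ≠ CP1.infinity}) :=
      h.hol.continuousOn.isOpen_inter_preimage h.isOpen_preimage CP1.isOpen_ne_infinity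
    have h2 := φ.open_source.preimage h.proj.continuous
    convert h1.inter h2 using 1
    ext p; simp only [mem_ofPred_eq, mem_inter_iff, mem_preimage]; tauto
  open_target := by
    have h1 : IsOpen (φ.target ∩ φ.symm ⁻¹' U) := φ.isOpen_inter_preimage_symm h.isOpen
    exact h1.preimage continuous_fst
  continuousOn_toFun := by
    intro p hp
    refine ContinuousAt.continuousWithinAt (ContinuousAt.prodMk ?_ ?_)
    · exact (φ.continuousAt hp.1.2).comp h.proj.continuous.continuousAt
    · exact (CP1.contMDiffAt_toC hp.2).continuousAt.comp (h.contMDiffAt hp.1.1).continuousAt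
  continuousOn_invFun := by
    intro y hy
    refine ContinuousAt.continuousWithinAt ?_
    have h1 := (h.exists_inv.choose_spec.1.contMDiffAt
      (x := (φ.symm y.1, CP1.ofComplex y.2))
      ((h.isOpen.prod isOpen_univ).mem_nhds ⟨hy.2, mem_univ _⟩)).continuousAt
    have h2 : ContinuousAt (fun y : ℂ × ℂ => (φ.symm y.1, CP1.ofComplex y.2)) y :=
      ContinuousAt.prodMk ((φ.symm.continuousAt hy.1).comp continuousAt_fst)
        (CP1.isOpenEmbedding_ofComplex.continuous.continuousAt.comp continuousAt_snd)
    exact ContinuousAt.comp (f := fun y : ℂ × ℂ => (φ.symm y.1, CP1.ofComplex y.2)) h1 h2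

variable {φ : OpenPartialHomeomorph X ℂ}

lemma chart_apply (h : IsFibreCoord γ U ζ) (hφ : IsHolChart φ) (p : P) :
    h.chart φ hφ p = (φ (γ p), CP1.toC (ζ p)) := rfl

lemma contMDiffAt_toC (h : IsFibreCoord γ U ζ) {p : P} (hp : γ p ∈ U) (hz : ζ p ≠ CP1.infinity) :
    ContMDiffAt 𝓘(ℂ, ℂ × ℂ) 𝓘(ℂ) ω (fun q => CP1.toC (ζ q)) p :=
  (CP1.contMDiffAt_toC hz).comp p (h.contMDiffAt hp)

lemma isHolChart_chart (h : IsFibreCoord γ U ζ) (hφ : IsHolChart φ) :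
    IsHolChart (h.chart φ hφ) where
  hol p hp := by
    refine ContMDiffAt.contMDiffWithinAt (ContMDiffAt.prodMk_space ?_ ?_)
    · exact (hφ.contMDiffAt hp.1.2).comp p (h.proj p)
    · exact h.contMDiffAt_toC hp.1.1 hp.2
  symm y hy := by
    refine ContMDiffAt.contMDiffWithinAt ?_
    have h1 := h.exists_inv.choose_spec.1.contMDiffAt
      (x := (φ.symm y.1, CP1.ofComplex y.2))
      ((h.isOpen.prod isOpen_univ).mem_nhds ⟨hy.2, mem_univ _⟩)
    have h2 : ContMDiffAt 𝓘(ℂ, ℂ × ℂ) (𝓘(ℂ).prod 𝓘(ℂ)) ω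
        (fun y : ℂ × ℂ => (φ.symm y.1, CP1.ofComplex y.2)) y := by
      refine ContMDiffAt.prodMk ?_ ?_
      · exact (hφ.contMDiffAt_symm hy.1).comp y contDiffAt_fst.contMDiffAt
      · exact (CP1.contMDiff_ofComplex _).comp y contDiffAt_snd.contMDiffAt
    exact ContMDiffAt.comp (f := fun y : ℂ × ℂ => (φ.symm y.1, CP1.ofComplex y.2)) y h1 h2

lemma mvfderiv_chart (h : IsFibreCoord γ U ζ) (hφ : IsHolChart φ) {p : P}
    (hp : p ∈ (h.chart φ hφ).source) (v : TangentSpace 𝓘(ℂ, ℂ × ℂ) p) :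
    mvfderiv 𝓘(ℂ, ℂ × ℂ) (h.chart φ hφ) p v =
      (mvfderiv 𝓘(ℂ) φ (γ p) (mfderiv 𝓘(ℂ, ℂ × ℂ) 𝓘(ℂ) γ p v),
        mvfderiv 𝓘(ℂ, ℂ × ℂ) (fun q => CP1.toC (ζ q)) p v) := by
  have h1 := ((hφ.contMDiffAt hp.1.2).mdifferentiableAt (by simp))
  have h2 := (h.proj p).mdifferentiableAt (by simp)
  have h3 := (h.contMDiffAt_toC hp.1.1 hp.2).mdifferentiableAt (by simp)
  have h4 : MDifferentiableAt 𝓘(ℂ, ℂ × ℂ) 𝓘(ℂ, ℂ × ℂ) (h.chart φ hφ) p :=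
    ((h.isHolChart_chart hφ).contMDiffAt hp).mdifferentiableAt (by simp)
  have e1 := mvfderiv_clm_comp (ContinuousLinearMap.fst ℂ ℂ ℂ) h4 v
  have e2 := mvfderiv_clm_comp (ContinuousLinearMap.snd ℂ ℂ ℂ) h4 v
  have e3 : mvfderiv 𝓘(ℂ, ℂ × ℂ) (φ ∘ γ) p v = _ := mvfderiv_comp_apply p h1 h2 v
  exact Prod.ext (e1.symm.trans e3) e2.symm

end IsFibreCoord

/-- The vertical tangent vector `ξ` at `p` is the value of the quadratic vector field `w` on the
fibre, with respect to the fibre coordinate `ζ`. -/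
def IsStdAt (γ : P → X) (ζ : P → CP1) (w : Fin 3 → ℂ) (p : P)
    (ξ : TangentSpace 𝓘(ℂ, ℂ × ℂ) p) : Prop :=
  mfderiv 𝓘(ℂ, ℂ × ℂ) 𝓘(ℂ) γ p ξ = 0 ∧
  -- Testing in all coordinates `act A ∘ ζ` that are finite at `p` treats `∞` like any other point
  -- and makes the notion equivariant. One such `A` suffices, by `IsFibreCoord.isStdAt_of`.
  ∀ A, IsSO A → CP1.act A (ζ p) ≠ CP1.infinity →
    mvfderiv 𝓘(ℂ, ℂ × ℂ) (fun q => CP1.toC (CP1.act A (ζ q))) p ξ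
      = quad (A.mulVec w) (CP1.toC (CP1.act A (ζ p)))

lemma CP1.exists_act_ne_infinity (z : CP1) : ∃ A, IsSO A ∧ CP1.act A z ≠ CP1.infinity := by
  by_cases h : z = CP1.infinity
  · exact ⟨CP1.flip, CP1.isSO_flip, by rw [h]; exact CP1.act_flip_infinity⟩
  · exact ⟨1, IsSO.one, by rwa [CP1.act_one]⟩

lemma IsStdAt.congr {γ : P → X} {ζ ζ' : P → CP1} {w : Fin 3 → ℂ} {p : P}
    {ξ : TangentSpace 𝓘(ℂ, ℂ × ℂ) p} (h : IsStdAt γ ζ w p ξ) (hζ : ζ =ᶠ[𝓝 p] ζ') :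
    IsStdAt γ ζ' w p ξ := by
  refine ⟨h.1, fun A hA hz => ?_⟩
  rw [← hζ.eq_of_nhds] at hz ⊢
  rw [← h.2 A hA hz]
  refine mvfderiv_congr ?_ ξ
  filter_upwards [hζ] with q hq
  rw [hq]

lemma IsStdAt.act {γ : P → X} {ζ : P → CP1} {w : Fin 3 → ℂ} {p : P}
    {ξ : TangentSpace 𝓘(ℂ, ℂ × ℂ) p} (h : IsStdAt γ ζ w p ξ) {A : Matrix (Fin 3) (Fin 3) ℂ}
    (hA : IsSO A) : IsStdAt γ (fun q => CP1.act A (ζ q)) (A.mulVec w) p ξ := by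
  refine ⟨h.1, fun B hB hz => ?_⟩
  simp only [CP1.act_act hA, Matrix.mulVec_mulVec] at hz ⊢
  exact h.2 _ (hB.mul hA) hz

lemma isStdAt_act_iff {γ : P → X} {ζ : P → CP1} {w : Fin 3 → ℂ} {p : P}
    {ξ : TangentSpace 𝓘(ℂ, ℂ × ℂ) p} {A : Matrix (Fin 3) (Fin 3) ℂ} (hA : IsSO A) :
    IsStdAt γ (fun q => CP1.act A (ζ q)) (A.mulVec w) p ξ ↔ IsStdAt γ ζ w p ξ := by
  refine ⟨fun h => ?_, fun h => h.act hA⟩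
  have := h.act hA.inv
  simpa only [CP1.act_act hA, hA.inv_mul, CP1.act_one, hA.inv_mulVec_mulVec] using this

namespace IsFibreCoord

variable {γ : P → X} {U : Set X} {ζ : P → CP1}

/-- How the derivative of the affine coordinate changes under an isometry. -/
lemma mvfderiv_act (h : IsFibreCoord γ U ζ) {p : P} (hp : γ p ∈ U)
    {A B : Matrix (Fin 3) (Fin 3) ℂ} (hA : IsSO A) (hB : IsSO B)
    (hzA : CP1.act A (ζ p) ≠ CP1.infinity) (hzB : CP1.act B (ζ p) ≠ CP1.infinity)
    (ξ : TangentSpace 𝓘(ℂ, ℂ × ℂ) p) :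
    ∃ c : ℂ, c ≠ 0 ∧ mvfderiv 𝓘(ℂ, ℂ × ℂ) (fun q => CP1.toC (CP1.act B (ζ q))) p ξ
      = c * mvfderiv 𝓘(ℂ, ℂ × ℂ) (fun q => CP1.toC (CP1.act A (ζ q))) p ξ ∧
      ∀ w, quad (B.mulVec w) (CP1.toC (CP1.act B (ζ p)))
        = c * quad (A.mulVec w) (CP1.toC (CP1.act A (ζ p))) := by
  -- The coordinate of `B` is the Möbius map of `B A⁻¹` applied to that of `A`; the constant `c` is
  -- the derivative of this map at the point in question.
  have hC : IsSO (B * A⁻¹) := hB.mul hA.inv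
  have key : ∀ z, CP1.act A z ≠ CP1.infinity →
      CP1.act (B * A⁻¹) (CP1.ofComplex (CP1.toC (CP1.act A z))) = CP1.act B z := fun z hz => by
    rw [CP1.ofComplex_toC hz, CP1.act_act hA, mul_assoc, hA.inv_mul, mul_one]
  have hz : CP1.act (B * A⁻¹) (CP1.ofComplex (CP1.toC (CP1.act A (ζ p)))) ≠ CP1.infinity := by
    rw [key _ hzA]; exact hzB
  have h2 := CP1.pt_ne_infinity_iff.1 hz
  have hAc := h.actConst hA
  rw [CP1.nul_ofComplex] at h2
  refine ⟨_, one_div_ne_zero h2, ?_, fun w => ?_⟩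
  · rw [← mvfderiv_deriv_comp ((hAc.contMDiffAt_toC hp hzA).mdifferentiableAt (by simp))
      (CP1.hasDerivAt_mob hC hz)]
    refine mvfderiv_congr ?_ ξ
    filter_upwards [(hAc.contMDiffAt hp).continuousAt.eventually_ne hzA] with q hq
    rw [CP1.mob, key _ hq]
  · have := CP1.quad_mob hC hz (A.mulVec w)
    rw [CP1.mob, key _ hzA, Matrix.mulVec_mulVec, mul_assoc, hA.inv_mul, mul_one] at this
    rw [this, one_div, div_eq_inv_mul]

/-- Under a change of isometry the derivative of the coordinate and the value of the quadratic field
are multiplied by the same factor. -/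
lemma isStdAt_of (h : IsFibreCoord γ U ζ) {p : P} (hp : γ p ∈ U)
    {A : Matrix (Fin 3) (Fin 3) ℂ} (hA : IsSO A) (hz : CP1.act A (ζ p) ≠ CP1.infinity)
    {w : Fin 3 → ℂ} {ξ : TangentSpace 𝓘(ℂ, ℂ × ℂ) p}
    (h0 : mfderiv 𝓘(ℂ, ℂ × ℂ) 𝓘(ℂ) γ p ξ = 0)
    (h1 : mvfderiv 𝓘(ℂ, ℂ × ℂ) (fun q => CP1.toC (CP1.act A (ζ q))) p ξ
      = quad (A.mulVec w) (CP1.toC (CP1.act A (ζ p)))) : IsStdAt γ ζ w p ξ := by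
  refine ⟨h0, fun B hB hzB => ?_⟩
  obtain ⟨c, -, e1, e2⟩ := h.mvfderiv_act hp hA hB hz hzB ξ
  rw [e1, e2, h1]

lemma isStdAt_iff (h : IsFibreCoord γ U ζ) {p : P} (hp : γ p ∈ U) (hz : ζ p ≠ CP1.infinity)
    {w : Fin 3 → ℂ} {ξ : TangentSpace 𝓘(ℂ, ℂ × ℂ) p} :
    IsStdAt γ ζ w p ξ ↔ mfderiv 𝓘(ℂ, ℂ × ℂ) 𝓘(ℂ) γ p ξ = 0 ∧
      mvfderiv 𝓘(ℂ, ℂ × ℂ) (fun q => CP1.toC (ζ q)) p ξ = quad w (CP1.toC (ζ p)) := by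
  constructor
  · intro hs
    have := hs.2 1 IsSO.one (by rwa [CP1.act_one])
    simp only [CP1.act_one, Matrix.one_mulVec] at this
    exact ⟨hs.1, this⟩
  · rintro ⟨h0, h1⟩
    refine h.isStdAt_of hp IsSO.one (by rwa [CP1.act_one]) h0 ?_
    simpa only [CP1.act_one, Matrix.one_mulVec] using h1

variable [IsManifold 𝓘(ℂ) ω X]

lemma eq_of_mfderiv_eq (h : IsFibreCoord γ U ζ) {p : P} (hp : γ p ∈ U)
    {A : Matrix (Fin 3) (Fin 3) ℂ} (hA : IsSO A) (hz : CP1.act A (ζ p) ≠ CP1.infinity)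
    {ξ η : TangentSpace 𝓘(ℂ, ℂ × ℂ) p}
    (h0 : mfderiv 𝓘(ℂ, ℂ × ℂ) 𝓘(ℂ) γ p ξ = mfderiv 𝓘(ℂ, ℂ × ℂ) 𝓘(ℂ) γ p η)
    (h1 : mvfderiv 𝓘(ℂ, ℂ × ℂ) (fun q => CP1.toC (CP1.act A (ζ q))) p ξ
      = mvfderiv 𝓘(ℂ, ℂ × ℂ) (fun q => CP1.toC (CP1.act A (ζ q))) p η) : ξ = η := by
  have hφ := isHolChart_chartAt (E := ℂ) (γ p)
  have hs : p ∈ ((h.actConst hA).chart (chartAt ℂ (γ p)) hφ).source :=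
    ⟨⟨hp, mem_chart_source ℂ (γ p)⟩, hz⟩
  refine ((h.actConst hA).isHolChart_chart hφ).mvfderiv_injective hs ?_
  rw [mvfderiv_chart _ _ hs, mvfderiv_chart _ _ hs, h0, h1]

lemma isStdAt_unique (h : IsFibreCoord γ U ζ) {p : P} (hp : γ p ∈ U) {w : Fin 3 → ℂ}
    {ξ η : TangentSpace 𝓘(ℂ, ℂ × ℂ) p} (hξ : IsStdAt γ ζ w p ξ) (hη : IsStdAt γ ζ w p η) :
    ξ = η := by
  obtain ⟨A, hA, hz⟩ := CP1.exists_act_ne_infinity (ζ p)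
  exact h.eq_of_mfderiv_eq hp hA hz (hξ.1.trans hη.1.symm)
    ((hξ.2 A hA hz).trans (hη.2 A hA hz).symm)

/-- The value at `p` of quadratic vector fields. -/
lemma exists_stdMap (h : IsFibreCoord γ U ζ) {p : P} (hp : γ p ∈ U) :
    ∃ ψ : (Fin 3 → ℂ) →ₗ[ℂ] TangentSpace 𝓘(ℂ, ℂ × ℂ) p, ∀ w, IsStdAt γ ζ w p (ψ w) := by
  obtain ⟨A, hA, hz⟩ := CP1.exists_act_ne_infinity (ζ p)
  have hφ := isHolChart_chartAt (E := ℂ) (γ p)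
  have hs : p ∈ ((h.actConst hA).chart (chartAt ℂ (γ p)) hφ).source :=
    ⟨⟨hp, mem_chart_source ℂ (γ p)⟩, hz⟩
  have hc := (h.actConst hA).isHolChart_chart hφ
  let L : (Fin 3 → ℂ) →ₗ[ℂ] ℂ × ℂ :=
    { toFun := fun w => (0, quad (A.mulVec w) (CP1.toC (CP1.act A (ζ p))))
      map_add' := fun a b => by
        rw [Matrix.mulVec_add]; ext <;> simp [quad]; ring
      map_smul' := fun c a => by
        rw [Matrix.mulVec_smul]; ext <;> simp [quad]; ring }
  refine ⟨(hc.tangentEquiv hs).symm.toLinearMap ∘ₗ L, fun w => ?_⟩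
  have e := hc.mvfderiv_symm_apply hs (L w)
  rw [mvfderiv_chart _ _ hs] at e
  refine h.isStdAt_of hp hA hz ?_ (congrArg Prod.snd e)
  have e1 := congrArg Prod.fst e
  refine hφ.mvfderiv_injective (mem_chart_source ℂ (γ p)) ?_
  rw [map_zero]; exact e1

end IsFibreCoord
end FibreCoord

/-! ### Vertical vector fields -/

section VerticalFields

lemma contMDiffAt_quad {E H M : Type*} [NormedAddCommGroup E] [NormedSpace ℂ E]
    [TopologicalSpace H] {I : ModelWithCorners ℂ E H} [TopologicalSpace M] [ChartedSpace H M]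
    {a : M → Fin 3 → ℂ} {z : M → ℂ} {m : M} (ha : ∀ i, ContMDiffAt I 𝓘(ℂ) ω (a · i) m)
    (hz : ContMDiffAt I 𝓘(ℂ) ω z m) : ContMDiffAt I 𝓘(ℂ) ω (fun y => quad (a y) (z y)) m :=
  ((ha 0).add ((ha 1).mul hz)).add ((ha 2).mul (hz.pow 2))

lemma contMDiffAt_mulVec {E H M : Type*} [NormedAddCommGroup E] [NormedSpace ℂ E]
    [TopologicalSpace H] {I : ModelWithCorners ℂ E H} [TopologicalSpace M] [ChartedSpace H M]
    {A : M → Matrix (Fin 3) (Fin 3) ℂ} {a : M → Fin 3 → ℂ} {m : M}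
    (hA : ∀ i j, ContMDiffAt I 𝓘(ℂ) ω (A · i j) m)
    (ha : ∀ i, ContMDiffAt I 𝓘(ℂ) ω (a · i) m) (i : Fin 3) :
    ContMDiffAt I 𝓘(ℂ) ω (fun y => (A y).mulVec (a y) i) m := by
  simp only [Matrix.mulVec, dotProduct, Fin.sum_univ_three]
  exact (((hA i 0).mul (ha 0)).add ((hA i 1).mul (ha 1))).add ((hA i 2).mul (ha 2))

lemma fderiv_quadField {α : ℂ → Fin 3 → ℂ} {α' : Fin 3 → ℂ} {y : ℂ × ℂ}
    (hα : ∀ i, HasDerivAt (α · i) (α' i) y.1) (u w : ℂ) :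
    fderiv ℂ (fun y : ℂ × ℂ => ((0 : ℂ), quad (α y.1) y.2)) y (u, w)
      = (0, u * quad α' y.2 + w * (α y.1 1 + 2 * α y.1 2 * y.2)) := by
  have h1 : ∀ i, HasFDerivAt (fun y : ℂ × ℂ => α y.1 i) _ y := fun i =>
    HasFDerivAt.comp (f := Prod.fst) (g := fun t => α t i) y (hα i).hasFDerivAt hasFDerivAt_fst
  have h2 : HasFDerivAt (fun y : ℂ × ℂ => y.2) (ContinuousLinearMap.snd ℂ ℂ ℂ) y := hasFDerivAt_snd
  have h3 := ((h1 0).add ((h1 1).mul h2)).add ((h1 2).mul (h2.pow 2))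
  have h4 := (hasFDerivAt_const (0 : ℂ) y).prodMk h3
  have h5 := h4.fderiv
  refine (congrArg (fun L : ℂ × ℂ →L[ℂ] ℂ × ℂ => L (u, w)) h5).trans ?_
  ext <;> simp [quad]
  ring

lemma fderiv_baseField {V : ℂ → ℂ} {V' : ℂ} {y : ℂ × ℂ} (hV : HasDerivAt V V' y.1) (u w : ℂ) :
    fderiv ℂ (fun y : ℂ × ℂ => (V y.1, (0 : ℂ))) y (u, w) = (u * V', 0) := by
  have h1 : HasFDerivAt (fun y : ℂ × ℂ => V y.1) _ y :=
    HasFDerivAt.comp (f := Prod.fst) (g := V) y hV.hasFDerivAt hasFDerivAt_fst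
  have h5 := (h1.prodMk (hasFDerivAt_const (0 : ℂ) y)).fderiv
  refine (congrArg (fun L : ℂ × ℂ →L[ℂ] ℂ × ℂ => L (u, w)) h5).trans ?_
  ext <;> simp

variable {X : Type*} [TopologicalSpace X] [ChartedSpace ℂ X] [IsManifold 𝓘(ℂ) ω X]
  {P : Type*} [TopologicalSpace P] [ChartedSpace (ℂ × ℂ) P]

lemma contDiffAt_comp_symm {φ : OpenPartialHomeomorph X ℂ} (hφ : IsHolChart φ) {x : X}
    (hx : x ∈ φ.source) {f : X → ℂ} (hf : ContMDiffAt 𝓘(ℂ) 𝓘(ℂ) ω f x) :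
    ContDiffAt ℂ ω (f ∘ φ.symm) (φ x) := by
  rw [← φ.left_inv hx] at hf
  exact (hf.comp (φ x) (hφ.contMDiffAt_symm (φ.map_source hx))).contDiffAt

namespace IsFibreCoord

variable {γ : P → X} {U : Set X} {ζ : P → CP1}

lemma chart_source_mem (h : IsFibreCoord γ U ζ) {p : P} (hp : γ p ∈ U)
    (hz : ζ p ≠ CP1.infinity) :
    p ∈ (h.chart (chartAt ℂ (γ p)) (isHolChart_chartAt (γ p))).source :=
  ⟨⟨hp, _root_.mem_chart_source ℂ (γ p)⟩, hz⟩

lemma mvfderiv_chart_of_isStdAt (h : IsFibreCoord γ U ζ) {φ : OpenPartialHomeomorph X ℂ}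
    (hφ : IsHolChart φ) {q : P} (hq : q ∈ (h.chart φ hφ).source) {w : Fin 3 → ℂ}
    {ξ : TangentSpace 𝓘(ℂ, ℂ × ℂ) q} (hξ : IsStdAt γ ζ w q ξ) :
    mvfderiv 𝓘(ℂ, ℂ × ℂ) (h.chart φ hφ) q ξ = (0, quad w (CP1.toC (ζ q))) := by
  rw [h.mvfderiv_chart hφ hq, hξ.1, map_zero, ((h.isStdAt_iff hq.1.1 hq.2).1 hξ).2]

lemma isStdAt_of_mvfderiv_chart (h : IsFibreCoord γ U ζ) {φ : OpenPartialHomeomorph X ℂ}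
    (hφ : IsHolChart φ) {q : P} (hq : q ∈ (h.chart φ hφ).source) {w : Fin 3 → ℂ}
    {ξ : TangentSpace 𝓘(ℂ, ℂ × ℂ) q}
    (hξ : mvfderiv 𝓘(ℂ, ℂ × ℂ) (h.chart φ hφ) q ξ = (0, quad w (CP1.toC (ζ q)))) :
    IsStdAt γ ζ w q ξ := by
  rw [h.mvfderiv_chart hφ hq] at hξ
  rw [h.isStdAt_iff hq.1.1 hq.2]
  refine ⟨hφ.mvfderiv_injective hq.1.2 ?_, congrArg Prod.snd hξ⟩
  rw [map_zero]
  exact congrArg Prod.fst hξ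

lemma contDiffAt_quadField (h : IsFibreCoord γ U ζ) {p : P} (hp : γ p ∈ U)
    {a : X → Fin 3 → ℂ} (ha : ∀ i, ContMDiffAt 𝓘(ℂ) 𝓘(ℂ) ω (a · i) (γ p)) :
    ContDiffAt ℂ ω (fun y : ℂ × ℂ => ((0 : ℂ), quad (a ((chartAt ℂ (γ p)).symm y.1)) y.2))
      (h.chart (chartAt ℂ (γ p)) (isHolChart_chartAt (γ p)) p) := by
  rw [← contMDiffAt_iff_contDiffAt]
  have hx := _root_.mem_chart_source ℂ (γ p)
  refine ContMDiffAt.prodMk_space contMDiffAt_const (contMDiffAt_quad (fun i => ?_) ?_)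
  · have := contDiffAt_comp_symm (isHolChart_chartAt (γ p)) hx (ha i)
    exact ContMDiffAt.comp (g := fun t => a ((chartAt ℂ (γ p)).symm t) i) (f := Prod.fst)
      (h.chart (chartAt ℂ (γ p)) (isHolChart_chartAt (γ p)) p)
      this.contMDiffAt contDiffAt_fst.contMDiffAt
  · exact contDiffAt_snd.contMDiffAt

lemma eventually_chart_eq (h : IsFibreCoord γ U ζ) {p : P} (hp : γ p ∈ U)
    (hz : ζ p ≠ CP1.infinity) {a : X → Fin 3 → ℂ} {ξ : ∀ q : P, TangentSpace 𝓘(ℂ, ℂ × ℂ) q}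
    (hξ : ∀ᶠ q in 𝓝 p, IsStdAt γ ζ (a (γ q)) q (ξ q)) :
    ∀ᶠ q in 𝓝 p, mvfderiv 𝓘(ℂ, ℂ × ℂ)
      (h.chart (chartAt ℂ (γ p)) (isHolChart_chartAt (γ p))) q (ξ q) =
      (fun y : ℂ × ℂ => ((0 : ℂ), quad (a ((chartAt ℂ (γ p)).symm y.1)) y.2))
        (h.chart (chartAt ℂ (γ p)) (isHolChart_chartAt (γ p)) q) := by
  filter_upwards [hξ, (h.chart _ (isHolChart_chartAt (γ p))).open_source.mem_nhds
    (h.chart_source_mem hp hz)] with q hq hq'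
  rw [h.mvfderiv_chart_of_isStdAt _ hq' hq, chart_apply]
  dsimp only
  rw [(chartAt ℂ (γ p)).left_inv hq'.1.2]

variable [IsManifold 𝓘(ℂ, ℂ × ℂ) ω P]

/-- A family of quadratic vector fields with holomorphic coefficients is holomorphic. -/
lemma contMDiffAt_of_isStdAt (h : IsFibreCoord γ U ζ) {p : P} (hp : γ p ∈ U)
    {a : X → Fin 3 → ℂ} (ha : ∀ i, ContMDiffAt 𝓘(ℂ) 𝓘(ℂ) ω (a · i) (γ p))
    {ξ : ∀ q : P, TangentSpace 𝓘(ℂ, ℂ × ℂ) q}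
    (hξ : ∀ᶠ q in 𝓝 p, IsStdAt γ ζ (a (γ q)) q (ξ q)) :
    ContMDiffAt 𝓘(ℂ, ℂ × ℂ) (𝓘(ℂ, ℂ × ℂ).prod 𝓘(ℂ, ℂ × ℂ)) ω
      (fun x => TotalSpace.mk' (ℂ × ℂ) (E := fun x : P => TangentSpace 𝓘(ℂ, ℂ × ℂ) x) x (ξ x)) p := by
  obtain ⟨A, hA, hz⟩ := CP1.exists_act_ne_infinity (ζ p)
  have h' := h.actConst hA
  have hs := h'.chart_source_mem hp hz
  rw [(h'.isHolChart_chart _).holAt_iff hs]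
  have ha' := h'.contDiffAt_quadField hp (a := fun x => A.mulVec (a x))
    (fun i => contMDiffAt_mulVec (A := fun _ => A) (fun _ _ => contMDiffAt_const) ha i)
  refine (ha'.contMDiffAt.comp p ((h'.isHolChart_chart _).contMDiffAt hs)).congr_of_eventuallyEq ?_
  exact h'.eventually_chart_eq hp hz (a := fun x => A.mulVec (a x))
    (hξ.mono fun q hq => hq.act hA)

/-- The Lie bracket of vertical vector fields that are quadratic on the fibres. -/
lemma isStdAt_mlieBracket (h : IsFibreCoord γ U ζ) {p : P} (hp : γ p ∈ U)
    {a b : X → Fin 3 → ℂ} (ha : ∀ i, ContMDiffAt 𝓘(ℂ) 𝓘(ℂ) ω (a · i) (γ p))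
    (hb : ∀ i, ContMDiffAt 𝓘(ℂ) 𝓘(ℂ) ω (b · i) (γ p))
    {ξ η : ∀ q : P, TangentSpace 𝓘(ℂ, ℂ × ℂ) q}
    (hξ : ∀ᶠ q in 𝓝 p, IsStdAt γ ζ (a (γ q)) q (ξ q))
    (hη : ∀ᶠ q in 𝓝 p, IsStdAt γ ζ (b (γ q)) q (η q)) :
    IsStdAt γ ζ (brk (a (γ p)) (b (γ p))) p (VectorField.mlieBracket 𝓘(ℂ, ℂ × ℂ) ξ η p) := by
  obtain ⟨A, hA, hz⟩ := CP1.exists_act_ne_infinity (ζ p)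
  have hA' : ∀ {a : X → Fin 3 → ℂ}, (∀ i, ContMDiffAt 𝓘(ℂ) 𝓘(ℂ) ω (a · i) (γ p)) →
      ∀ i, ContMDiffAt 𝓘(ℂ) 𝓘(ℂ) ω (fun x => A.mulVec (a x) i) (γ p) := fun ha i =>
    contMDiffAt_mulVec (A := fun _ => A) (fun _ _ => contMDiffAt_const) ha i
  -- An isometry moves the point away from `∞`; the bracket commutes with isometries.
  rw [← isStdAt_act_iff hA, ← hA.brk_mulVec]
  have h' := h.actConst hA
  have hs := h'.chart_source_mem hp hz
  have hx := _root_.mem_chart_source ℂ (γ p)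
  refine h'.isStdAt_of_mvfderiv_chart _ hs ?_
  rw [(h'.isHolChart_chart _).mlieBracket_eq hs
    (h'.eventually_chart_eq hp hz (a := fun x => A.mulVec (a x)) (hξ.mono fun q hq => hq.act hA))
    (h'.eventually_chart_eq hp hz (a := fun x => A.mulVec (b x)) (hη.mono fun q hq => hq.act hA))
    (h'.contDiffAt_quadField hp (hA' ha)) (h'.contDiffAt_quadField hp (hA' hb))]
  have hd : ∀ {a : X → Fin 3 → ℂ}, (∀ i, ContMDiffAt 𝓘(ℂ) 𝓘(ℂ) ω (a · i) (γ p)) → ∀ i,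
      HasDerivAt (fun t => a ((chartAt ℂ (γ p)).symm t) i)
        (deriv (fun t => a ((chartAt ℂ (γ p)).symm t) i) (chartAt ℂ (γ p) (γ p)))
        (chartAt ℂ (γ p) (γ p)) := fun ha i =>
    ((contDiffAt_comp_symm (isHolChart_chartAt (γ p)) hx (ha i)).differentiableAt
      (by simp)).hasDerivAt
  -- Both fields have base component `0`, so the derivatives of the coefficients along `X` drop out
  -- and only the bracket on the fibre remains.
  have e1 := fderiv_quadField (y := h'.chart _ (isHolChart_chartAt (γ p)) p) (hd (hA' ha))
    0 (quad (A.mulVec (b (γ p))) (CP1.toC (CP1.act A (ζ p))))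
  have e2 := fderiv_quadField (y := h'.chart _ (isHolChart_chartAt (γ p)) p) (hd (hA' hb))
    0 (quad (A.mulVec (a (γ p))) (CP1.toC (CP1.act A (ζ p))))
  simp only [chart_apply, (chartAt ℂ (γ p)).left_inv hx] at e1 e2 ⊢
  rw [e1, e2]
  ext
  · simp
  · simp only [quad, brk_apply]
    simp
    ring

/-- The Lie derivative of a vertical vector field that is quadratic on the fibres along
the horizontal lift of a vector field. -/
lemma isStdAt_mlieBracket_horizontal (h : IsFibreCoord γ U ζ) {p : P} (hp : γ p ∈ U)
    {a : X → Fin 3 → ℂ} (ha : ∀ i, ContMDiffAt 𝓘(ℂ) 𝓘(ℂ) ω (a · i) (γ p))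
    {v : ∀ x : X, TangentSpace 𝓘(ℂ) x} {V : Set X} (hV : IsOpen V) (hpV : γ p ∈ V)
    (hv : HolVectorField v V)
    {ξ η : ∀ q : P, TangentSpace 𝓘(ℂ, ℂ × ℂ) q}
    (hη : ∀ᶠ q in 𝓝 p, mfderiv 𝓘(ℂ, ℂ × ℂ) 𝓘(ℂ) γ q (η q) = v (γ q) ∧
      ∀ A, IsSO A → CP1.act A (ζ q) ≠ CP1.infinity →
        mvfderiv 𝓘(ℂ, ℂ × ℂ) (fun q => CP1.toC (CP1.act A (ζ q))) q (η q) = 0)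
    (hξ : ∀ᶠ q in 𝓝 p, IsStdAt γ ζ (a (γ q)) q (ξ q)) :
    IsStdAt γ ζ (fun i => mvfderiv 𝓘(ℂ) (a · i) (γ p) (v (γ p))) p
      (VectorField.mlieBracket 𝓘(ℂ, ℂ × ℂ) η ξ p) := by
  obtain ⟨A, hA, hz⟩ := CP1.exists_act_ne_infinity (ζ p)
  have hA' : ∀ i, ContMDiffAt 𝓘(ℂ) 𝓘(ℂ) ω (fun x => A.mulVec (a x) i) (γ p) := fun i =>
    contMDiffAt_mulVec (A := fun _ => A) (fun _ _ => contMDiffAt_const) ha i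
  rw [← isStdAt_act_iff hA]
  have h' := h.actConst hA
  have hs := h'.chart_source_mem hp hz
  have hφ := isHolChart_chartAt (E := ℂ) (γ p)
  have hx := _root_.mem_chart_source ℂ (γ p)
  set φ := chartAt ℂ (γ p) with hφdef
  have hx' : (chartAt ℂ (γ p)).symm (φ (γ p)) = γ p := φ.left_inv hx
  -- In the chart formed by `φ ∘ γ` and the flat fibre coordinate, `η` is `(W(t), 0)` and `ξ` is
  -- `(0, quad (A a(t)) z)`. Their bracket only differentiates the coefficients `a`, in the
  -- direction `W`.
  let W : ℂ → ℂ := fun t => mvfderiv 𝓘(ℂ) φ (φ.symm t) (v (φ.symm t))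
  have hW : ContDiffAt ℂ ω W (φ (γ p)) := by
    have := (hφ.holAt_iff hx v).1 (hv.contMDiffAt (hV.mem_nhds hpV))
    exact contDiffAt_comp_symm hφ hx this
  have hWc : ContDiffAt ℂ ω (fun y : ℂ × ℂ => (W y.1, (0 : ℂ))) (h'.chart φ hφ p) :=
    ContDiffAt.prodMk (ContDiffAt.comp (h'.chart φ hφ p) (g := W) (f := Prod.fst) hW
      contDiffAt_fst) contDiffAt_const
  refine h'.isStdAt_of_mvfderiv_chart hφ hs ?_
  rw [(h'.isHolChart_chart hφ).mlieBracket_eq hs (f := fun y : ℂ × ℂ => (W y.1, (0 : ℂ))) ?_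
    (h'.eventually_chart_eq hp hz (a := fun x => A.mulVec (a x)) (hξ.mono fun q hq => hq.act hA))
    hWc (h'.contDiffAt_quadField hp hA')]
  · have hd : ∀ {f : X → ℂ}, ContMDiffAt 𝓘(ℂ) 𝓘(ℂ) ω f (γ p) →
        HasDerivAt (fun t => f (φ.symm t)) (deriv (f ∘ φ.symm) (φ (γ p))) (φ (γ p)) := fun hf =>
      ((contDiffAt_comp_symm hφ hx hf).differentiableAt (by simp)).hasDerivAt
    have e1 := fderiv_quadField (y := h'.chart φ hφ p) (α := fun t => A.mulVec (a (φ.symm t)))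
      (fun i => hd (hA' i)) (W (φ (γ p))) 0
    have e2 := fderiv_baseField (y := h'.chart φ hφ p)
      (hW.differentiableAt (by simp)).hasDerivAt 0
      (quad (A.mulVec (a (γ p))) (CP1.toC (CP1.act A (ζ p))))
    simp only [chart_apply, φ.left_inv hx, hx'] at e1 e2 ⊢
    rw [e1, e2]
    have e3 : A.mulVec (fun i => mvfderiv 𝓘(ℂ) (a · i) (γ p) (v (γ p)))
        = fun i => deriv ((fun x => A.mulVec (a x) i) ∘ φ.symm) (φ (γ p)) * W (φ (γ p)) := by
      have hWp : W (φ (γ p)) = mvfderiv 𝓘(ℂ) φ (γ p) (v (γ p)) := by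
        simp only [W]; rw [φ.left_inv hx]
      funext i
      have e4 : ∀ i, mvfderiv 𝓘(ℂ) (a · i) (γ p) (v (γ p)) =
          deriv ((fun x => a x i) ∘ φ.symm) (φ (γ p)) * W (φ (γ p)) := fun i => by
        rw [hWp]
        exact (mvfderiv_eq_deriv_mul hφ hx ((ha i).mdifferentiableAt (by simp)) _).2
      simp only [Matrix.mulVec, dotProduct, Fin.sum_univ_three, e4]
      have e5 := ((((hd (ha 0)).const_mul (A i 0)).add ((hd (ha 1)).const_mul (A i 1))).add
        ((hd (ha 2)).const_mul (A i 2))).deriv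
      refine Eq.trans ?_ (congrArg (· * W (φ (γ p))) e5.symm)
      ring
    rw [e3]
    ext
    · simp
    · simp [quad]; ring
  · filter_upwards [hη, (h'.chart φ hφ).open_source.mem_nhds hs] with q hq hq'
    rw [h'.mvfderiv_chart hφ hq', hq.1, hq.2 A hA hq'.2, chart_apply]
    simp only [W]
    rw [φ.left_inv hq'.1.2]

end IsFibreCoord
end VerticalFields

/-! ### Holomorphic vector fields are quadratic on the fibres -/

section Liouville

variable {X : Type*} [TopologicalSpace X] [ChartedSpace ℂ X] [IsManifold 𝓘(ℂ) ω X]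
  {P : Type*} [TopologicalSpace P] [ChartedSpace (ℂ × ℂ) P] [IsManifold 𝓘(ℂ, ℂ × ℂ) ω P]

namespace IsFibreCoord

variable {γ : P → X} {U : Set X} {ζ : P → CP1}

lemma contMDiffAt_mvfderiv (h : IsFibreCoord γ U ζ) {p : P} (hp : γ p ∈ U)
    (hz : ζ p ≠ CP1.infinity) {ξ : ∀ p : P, TangentSpace 𝓘(ℂ, ℂ × ℂ) p}
    (hξ : ContMDiffAt 𝓘(ℂ, ℂ × ℂ) (𝓘(ℂ, ℂ × ℂ).prod 𝓘(ℂ, ℂ × ℂ)) ω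
      (fun x => TotalSpace.mk' (ℂ × ℂ) (E := fun x : P => TangentSpace 𝓘(ℂ, ℂ × ℂ) x) x (ξ x)) p) :
    ContMDiffAt 𝓘(ℂ, ℂ × ℂ) 𝓘(ℂ) ω
      (fun q => mvfderiv 𝓘(ℂ, ℂ × ℂ) (fun q => CP1.toC (ζ q)) q (ξ q)) p := by
  have hφ := isHolChart_chartAt (E := ℂ) (γ p)
  have hs := h.chart_source_mem hp hz
  rw [(h.isHolChart_chart hφ).holAt_iff hs] at hξ
  have h2 : ContMDiffAt 𝓘(ℂ, ℂ × ℂ) 𝓘(ℂ) ω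
      (fun q => (mvfderiv 𝓘(ℂ, ℂ × ℂ) (h.chart _ hφ) q (ξ q)).2) p :=
    (contDiff_snd (𝕜 := ℂ) (E := ℂ) (F := ℂ) (n := ω)).contMDiff.contMDiffAt.comp p hξ
  refine h2.congr_of_eventuallyEq ?_
  filter_upwards [(h.chart _ hφ).open_source.mem_nhds hs] with q hq
  rw [h.mvfderiv_chart hφ hq]

/-- The fibre component of a holomorphic vector field is a quadratic vector field on
every fibre. -/
theorem exists_quad (h : IsFibreCoord γ U ζ) {ξ : ∀ p : P, TangentSpace 𝓘(ℂ, ℂ × ℂ) p}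
    (hξ : HolVectorField ξ (γ ⁻¹' U)) :
    ∃ a : X → Fin 3 → ℂ, (∀ i, ContMDiffOn 𝓘(ℂ) 𝓘(ℂ) ω (a · i) U) ∧
      ∀ p, γ p ∈ U → ∀ A, IsSO A → CP1.act A (ζ p) ≠ CP1.infinity →
        mvfderiv 𝓘(ℂ, ℂ × ℂ) (fun q => CP1.toC (CP1.act A (ζ q))) p (ξ p)
          = quad (A.mulVec (a (γ p))) (CP1.toC (CP1.act A (ζ p))) := by
  obtain ⟨σ, hσ, hσ1, hσ2⟩ := h.exists_inv
  have hf := h.actConst CP1.isSO_flip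
  -- `G` and `G'` are the components of the field in the coordinates `z` and `1 / z`. On each fibre
  -- they satisfy `G = -G' z²`, which is the growth condition of `exists_eq_quad`.
  let G : P → ℂ := fun p => mvfderiv 𝓘(ℂ, ℂ × ℂ) (fun q => CP1.toC (ζ q)) p (ξ p)
  let G' : P → ℂ := fun p =>
    mvfderiv 𝓘(ℂ, ℂ × ℂ) (fun q => CP1.toC (CP1.act CP1.flip (ζ q))) p (ξ p)
  have hξat : ∀ {p}, γ p ∈ U → ContMDiffAt 𝓘(ℂ, ℂ × ℂ) (𝓘(ℂ, ℂ × ℂ).prod 𝓘(ℂ, ℂ × ℂ)) ω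
      (fun x => TotalSpace.mk' (ℂ × ℂ) (E := fun x : P => TangentSpace 𝓘(ℂ, ℂ × ℂ) x) x (ξ x)) p :=
    fun hp => hξ.contMDiffAt (h.isOpen_preimage.mem_nhds hp)
  have hG : ∀ {p}, γ p ∈ U → ζ p ≠ CP1.infinity → ContMDiffAt 𝓘(ℂ, ℂ × ℂ) 𝓘(ℂ) ω G p :=
    fun hp hz => h.contMDiffAt_mvfderiv hp hz (hξat hp)
  have hG' : ∀ {p}, γ p ∈ U → CP1.act CP1.flip (ζ p) ≠ CP1.infinity →
      ContMDiffAt 𝓘(ℂ, ℂ × ℂ) 𝓘(ℂ) ω G' p := fun hp hz =>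
    hf.contMDiffAt_mvfderiv hp hz (hξat hp)
  have hσat : ∀ {x}, x ∈ U → ∀ z, ContMDiffAt (𝓘(ℂ).prod 𝓘(ℂ)) 𝓘(ℂ, ℂ × ℂ) ω σ (x, z) :=
    fun hx z => hσ.contMDiffAt ((h.isOpen.prod isOpen_univ).mem_nhds ⟨hx, mem_univ _⟩)
  have hhol : ∀ z, ∀ x ∈ U, ContMDiffAt 𝓘(ℂ) 𝓘(ℂ) ω (fun x => G (σ (x, CP1.ofComplex z))) x := by
    intro z x hx
    obtain ⟨e1, e2⟩ := hσ1 x hx (CP1.ofComplex z)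
    have := hG (p := σ (x, CP1.ofComplex z)) (by rwa [e1])
      (by rw [e2]; exact CP1.ofComplex_ne_infinity z)
    exact ContMDiffAt.comp (f := fun x => σ (x, CP1.ofComplex z)) (g := G) x this
      (ContMDiffAt.comp (f := fun x => (x, CP1.ofComplex z)) x (hσat hx _)
        (contMDiffAt_id.prodMk contMDiffAt_const))
  have hlim : ∀ x ∈ U, ContinuousAt (fun u : ℂ => -G' (σ (x, CP1.inv (CP1.ofComplex u)))) 0 := by
    intro x hx
    have h0 : CP1.inv (CP1.ofComplex 0) = CP1.infinity := CP1.inv_zero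
    obtain ⟨e1, e2⟩ := hσ1 x hx (CP1.inv (CP1.ofComplex 0))
    have h1 := hG' (p := σ (x, CP1.inv (CP1.ofComplex 0))) (by rwa [e1])
      (by rw [e2, h0]; exact CP1.act_flip_infinity)
    have h2 : ContinuousAt (fun u : ℂ => σ (x, CP1.inv (CP1.ofComplex u))) 0 :=
      ContinuousAt.comp (f := fun u : ℂ => (x, CP1.inv (CP1.ofComplex u))) (hσat hx _).continuousAt
        (continuousAt_const.prodMk (CP1.continuous_inv.comp
          CP1.isOpenEmbedding_ofComplex.continuous).continuousAt)
    exact (ContinuousAt.comp (g := G') (f := fun u : ℂ => σ (x, CP1.inv (CP1.ofComplex u))) h1.continuousAt h2).neg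
  have hrel : ∀ x ∈ U, ∀ z : ℂ, z ≠ 0 → G (σ (x, CP1.ofComplex z))
      = -G' (σ (x, CP1.inv (CP1.ofComplex z⁻¹))) * z ^ 2 := by
    intro x hx z hz
    have e0 : CP1.inv (CP1.ofComplex z⁻¹) = CP1.ofComplex z := by
      rw [CP1.inv_ofComplex_of_ne (inv_ne_zero hz), _root_.inv_inv]
    rw [e0]
    obtain ⟨e1, e2⟩ := hσ1 x hx (CP1.ofComplex z)
    have e3 : CP1.act CP1.flip (CP1.ofComplex z) = CP1.ofComplex z⁻¹ := by
      rw [CP1.act_flip, CP1.inv_ofComplex_of_ne hz]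
    obtain ⟨c, -, hc1, hc2⟩ := h.mvfderiv_act (p := σ (x, CP1.ofComplex z)) (by rwa [e1])
      CP1.isSO_flip IsSO.one (by rw [e2, e3]; exact CP1.ofComplex_ne_infinity _)
      (by rw [e2, CP1.act_one]; exact CP1.ofComplex_ne_infinity _) (ξ (σ (x, CP1.ofComplex z)))
    simp only [CP1.act_one, Matrix.one_mulVec, e2, e3, CP1.toC_ofComplex, CP1.flip_mulVec] at hc1 hc2
    have h3 := hc2 ![0, 0, 1]
    simp [quad] at h3
    have hc3 : c = -z ^ 2 := by linear_combination h3
    refine hc1.trans ?_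
    rw [hc3]
    ring
  have hex : ∀ x, ∃ w : Fin 3 → ℂ, x ∈ U → ∀ z, G (σ (x, CP1.ofComplex z)) = quad w z := by
    intro x
    by_cases hx : x ∈ U
    swap
    · exact ⟨0, fun h => absurd h hx⟩
    have h1 : Differentiable ℂ (fun z : ℂ => G (σ (x, CP1.ofComplex z))) := by
      intro z
      obtain ⟨e1, e2⟩ := hσ1 x hx (CP1.ofComplex z)
      have := hG (p := σ (x, CP1.ofComplex z)) (by rwa [e1])
        (by rw [e2]; exact CP1.ofComplex_ne_infinity z)
      have h2 : ContMDiffAt 𝓘(ℂ) 𝓘(ℂ) ω (fun z : ℂ => G (σ (x, CP1.ofComplex z))) z :=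
        ContMDiffAt.comp (f := fun z : ℂ => σ (x, CP1.ofComplex z)) (g := G) z this
          (ContMDiffAt.comp (f := fun z : ℂ => (x, CP1.ofComplex z)) z (hσat hx _)
            (contMDiffAt_const.prodMk (CP1.contMDiff_ofComplex z)))
      exact h2.contDiffAt.differentiableAt (by simp)
    obtain ⟨w, hw⟩ := exists_eq_quad h1 (hlim x hx) (hrel x hx)
    exact ⟨w, fun _ => hw⟩
  choose a ha using hex
  refine ⟨a, fun i x hx => ContMDiffAt.contMDiffWithinAt ?_, fun p hp => ?_⟩
  · have hev : ∀ᶠ y in 𝓝 x, y ∈ U := h.isOpen.mem_nhds hx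
    have e0 := hhol 0 x hx
    have e1 := hhol 1 x hx
    have e2 := hhol (-1) x hx
    -- Interpolation at `0, 1, -1` expresses the coefficients through values of `G`, so they depend
    -- holomorphically on the base point.
    have k0 : ∀ y ∈ U, a y 0 = G (σ (y, CP1.ofComplex 0)) := fun y hy => by
      rw [ha y hy]; simp [quad]
    have k1 : ∀ y ∈ U, a y 1 =
        2⁻¹ * (G (σ (y, CP1.ofComplex 1)) - G (σ (y, CP1.ofComplex (-1)))) := fun y hy => by
      rw [ha y hy, ha y hy]; simp [quad]; ring
    have k2 : ∀ y ∈ U, a y 2 = 2⁻¹ * (G (σ (y, CP1.ofComplex 1)) + G (σ (y, CP1.ofComplex (-1))))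
        - G (σ (y, CP1.ofComplex 0)) := fun y hy => by
      rw [ha y hy, ha y hy, ha y hy]; simp [quad]; ring
    fin_cases i
    · exact e0.congr_of_eventuallyEq (hev.mono k0)
    · exact (contMDiffAt_const.mul (e1.sub e2)).congr_of_eventuallyEq (hev.mono k1)
    · exact ((contMDiffAt_const.mul (e1.add e2)).sub e0).congr_of_eventuallyEq (hev.mono k2)
  · suffices H : ∃ A, IsSO A ∧ CP1.act A (ζ p) ≠ CP1.infinity ∧
        mvfderiv 𝓘(ℂ, ℂ × ℂ) (fun q => CP1.toC (CP1.act A (ζ q))) p (ξ p)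
          = quad (A.mulVec (a (γ p))) (CP1.toC (CP1.act A (ζ p))) by
      obtain ⟨A, hA, hzA, hAe⟩ := H
      intro B hB hzB
      obtain ⟨c, -, e1, e2⟩ := h.mvfderiv_act hp hA hB hzA hzB (ξ p)
      rw [e1, e2, hAe]
    by_cases hz : ζ p = CP1.infinity
    -- At `∞` the formula in the coordinate `u = 1 / z` is known for `u ≠ 0` and extends to `u = 0`
    -- by continuity of `G'`.
    · refine ⟨CP1.flip, CP1.isSO_flip, by rw [hz]; exact CP1.act_flip_infinity, ?_⟩
      have e1 : σ (γ p, CP1.inv (CP1.ofComplex 0)) = p := by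
        rw [CP1.inv_zero, ← hz]; exact hσ2 p hp
      have h1 := (hlim _ hp).tendsto.mono_left (nhdsWithin_le_nhds (s := {0}ᶜ))
      rw [e1] at h1
      have h2 : Tendsto (fun u : ℂ => a (γ p) 0 * u ^ 2 + a (γ p) 1 * u + a (γ p) 2) (𝓝[≠] 0)
          (𝓝 (a (γ p) 2)) := by
        have : Continuous fun u : ℂ => a (γ p) 0 * u ^ 2 + a (γ p) 1 * u + a (γ p) 2 := by fun_prop
        have := this.tendsto 0
        simp only [ne_eq, OfNat.ofNat_ne_zero, not_false_eq_true, zero_pow, mul_zero, zero_add] at this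
        exact this.mono_left nhdsWithin_le_nhds
      have h3 : ∀ᶠ u : ℂ in 𝓝[≠] 0, -G' (σ (γ p, CP1.inv (CP1.ofComplex u)))
          = a (γ p) 0 * u ^ 2 + a (γ p) 1 * u + a (γ p) 2 := by
        filter_upwards [self_mem_nhdsWithin] with u hu
        have hu : u ≠ 0 := hu
        have := hrel _ hp u⁻¹ (inv_ne_zero hu)
        rw [ha _ hp, _root_.inv_inv] at this
        rw [quad] at this
        field_simp at this
        linear_combination -this
      have h4 := tendsto_nhds_unique (h1.congr' h3) h2
      have h5 : G' p = -a (γ p) 2 := by linear_combination -h4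
      refine h5.trans ?_
      rw [hz, CP1.act_flip, CP1.inv_infinity, CP1.toC_ofComplex, CP1.flip_mulVec]
      simp [quad]
    · refine ⟨1, IsSO.one, by rwa [CP1.act_one], ?_⟩
      simp only [CP1.act_one, Matrix.one_mulVec]
      rw [← ha _ hp, CP1.ofComplex_toC hz, hσ2 p hp]

/-- Holomorphic sections of the relative tangent bundle are quadratic on every fibre. -/
theorem exists_isStdAt (h : IsFibreCoord γ U ζ) {ξ : ∀ p : P, TangentSpace 𝓘(ℂ, ℂ × ℂ) p}
    (hξ : HolVectorField ξ (γ ⁻¹' U)) (hv : ∀ p ∈ γ ⁻¹' U, ξ p ∈ relTangent γ p) :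
    ∃ a : X → Fin 3 → ℂ, (∀ i, ContMDiffOn 𝓘(ℂ) 𝓘(ℂ) ω (a · i) U) ∧
      ∀ p, γ p ∈ U → IsStdAt γ ζ (a (γ p)) p (ξ p) := by
  obtain ⟨a, ha, hA⟩ := h.exists_quad hξ
  exact ⟨a, ha, fun p hp => ⟨hv p hp, hA p hp⟩⟩

end IsFibreCoord
end Liouville

/-! ### Flat fibre coordinates -/

section MatrixODE

/-- Local solutions of the matrix differential equation `M' = M N`. -/
lemma exists_matrix_ode {N : ℂ → Matrix (Fin 3) (Fin 3) ℂ} {t₀ : ℂ} {R : ℝ} (hR : 0 < R)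
    (hN : ∀ i j, DifferentiableOn ℂ (N · i j) (Metric.ball t₀ R)) :
    ∃ ρ > 0, ρ ≤ R ∧ ∃ M : ℂ → Matrix (Fin 3) (Fin 3) ℂ, M t₀ = 1 ∧
      ∀ t ∈ Metric.ball t₀ ρ, ∀ i j, HasDerivAt (M · i j) ((M t * N t) i j) t := by
  -- `T a b` is right multiplication by the elementary matrix `E_ab`, so `M ↦ M N` is `∑ N_ab T a
  -- b`.
  let T : Fin 3 → Fin 3 → (Fin 3 → Fin 3 → ℂ) →L[ℂ] (Fin 3 → Fin 3 → ℂ) := fun a b =>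
    LinearMap.toContinuousLinearMap
      { toFun := fun Y i j => if j = b then Y i a else 0
        map_add' := fun Y Z => by ext i j; by_cases h : j = b <;> simp [h]
        map_smul' := fun c Y => by ext i j; by_cases h : j = b <;> simp [h] }
  have hT : ∀ a b Y i j, T a b Y i j = if j = b then Y i a else 0 := fun _ _ _ _ _ => rfl
  let L : ℂ → (Fin 3 → Fin 3 → ℂ) →L[ℂ] (Fin 3 → Fin 3 → ℂ) := fun t =>
    ∑ a, ∑ b, N t a b • T a b
  have hL : DifferentiableOn ℂ L (Metric.ball t₀ R) :=
    DifferentiableOn.fun_sum fun a _ => DifferentiableOn.fun_sum fun b _ => (hN a b).smul_const _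
  obtain ⟨ρ, h0, h1, y, hy0, hy⟩ := exists_linear_ode_solution hR hL
    (fun i j => (1 : Matrix (Fin 3) (Fin 3) ℂ) i j)
  refine ⟨ρ, h0, h1, y, hy0, fun t ht i j => ?_⟩
  have h2 := hasDerivAt_pi.1 (hasDerivAt_pi.1 (hy t ht) i) j
  refine h2.congr_deriv ?_
  simp only [L, ContinuousLinearMap.sum_apply, ContinuousLinearMap.smul_apply, Finset.sum_apply,
    Pi.smul_apply, hT, smul_eq_mul]
  simp only [mul_ite, mul_zero, Finset.sum_ite_eq, Finset.mem_univ, if_true]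
  exact Finset.sum_congr rfl fun _ _ => mul_comm _ _

lemma hasDerivAt_mulVec {M : ℂ → Matrix (Fin 3) (Fin 3) ℂ} {M' : Matrix (Fin 3) (Fin 3) ℂ}
    {v : ℂ → Fin 3 → ℂ} {v' : Fin 3 → ℂ} {t : ℂ} (hM : ∀ i j, HasDerivAt (M · i j) (M' i j) t)
    (hv : ∀ i, HasDerivAt (v · i) (v' i) t) (i : Fin 3) :
    HasDerivAt (fun t => (M t).mulVec (v t) i) ((M'.mulVec (v t) + (M t).mulVec v') i) t := by
  simp only [Matrix.mulVec, dotProduct]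
  refine (HasDerivAt.fun_sum fun j _ => (hM i j).mul (hv j)).congr_deriv ?_
  simp [Finset.sum_add_distrib, Matrix.mulVec, dotProduct]

/-- The matrix of the Lie bracket with a quadratic vector field. -/
def adm (w : Fin 3 → ℂ) : Matrix (Fin 3) (Fin 3) ℂ :=
  !![-w 1, w 0, 0; -2 * w 2, 0, 2 * w 0; 0, -w 2, w 1]

lemma adm_mulVec (w v : Fin 3 → ℂ) : (adm w).mulVec v = brk w v := by
  ext i
  fin_cases i <;> simp [adm, Matrix.mulVec, dotProduct, Fin.sum_univ_three, brk_apply] <;> ring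

/-- The matrix of the Killing form, divided by `-4`, and its inverse up to a factor. -/
def killingMatrix : Matrix (Fin 3) (Fin 3) ℂ := !![0, 0, -4; 0, 2, 0; -4, 0, 0]

lemma killing_eq_dotProduct (a b : Fin 3 → ℂ) :
    killing a b = dotProduct a (killingMatrix.mulVec b) := by
  simp [killing_apply, killingMatrix, Matrix.mulVec, dotProduct, Fin.sum_univ_three]; ring

/-- The inverse of the matrix of the Killing form. -/
def killingMatrixInv : Matrix (Fin 3) (Fin 3) ℂ := !![0, 0, -4⁻¹; 0, 2⁻¹, 0; -4⁻¹, 0, 0]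

lemma killingMatrixInv_mul : killingMatrixInv * killingMatrix = 1 := by
  ext i j
  fin_cases i <;> fin_cases j <;>
    simp [killingMatrix, killingMatrixInv, Matrix.mul_apply, Fin.sum_univ_three]

/-- The condition is on the inverse form because `M K⁻¹ Mᵀ` is the quantity that an equation `M' = M
N` with `N` skew for `K` conserves. -/
lemma isSO_of_mul_transpose {M : Matrix (Fin 3) (Fin 3) ℂ}
    (h : M * killingMatrixInv * M.transpose = killingMatrixInv) (hdet : M.det = 1) : IsSO M := by
  refine ⟨fun a b => ?_, hdet⟩
  have h1 : M * (killingMatrixInv * M.transpose * killingMatrix) = 1 := by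
    rw [← mul_assoc, ← mul_assoc, h, killingMatrixInv_mul]
  have h2 := mul_eq_one_comm.1 h1
  have h3 : M.transpose * killingMatrix * M = killingMatrix := by
    have h4 : killingMatrix * killingMatrixInv = 1 := mul_eq_one_comm.1 killingMatrixInv_mul
    calc M.transpose * killingMatrix * M
        = killingMatrix * (killingMatrixInv * M.transpose * killingMatrix * M) := by
          simp only [← mul_assoc]; rw [h4, one_mul]
      _ = _ := by rw [h2, mul_one]
  rw [killing_eq_dotProduct, killing_eq_dotProduct, Matrix.mulVec_mulVec, Matrix.dotProduct_mulVec,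
    Matrix.vecMul_mulVec, ← Matrix.dotProduct_mulVec, ← mul_assoc, h3]

/-- Solutions of `M' = M ad_w` are isometries. -/
lemma exists_isSO_ode {w : ℂ → Fin 3 → ℂ} {t₀ : ℂ} {R : ℝ} (hR : 0 < R)
    (hw : ∀ i, DifferentiableOn ℂ (w · i) (Metric.ball t₀ R)) :
    ∃ ρ > 0, ρ ≤ R ∧ ∃ M : ℂ → Matrix (Fin 3) (Fin 3) ℂ, M t₀ = 1 ∧
      ∀ t ∈ Metric.ball t₀ ρ, IsSO (M t) ∧
        ∀ i j, HasDerivAt (M · i j) ((M t * adm (w t)) i j) t := by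
  obtain ⟨ρ, h0, h1, M, hM0, hM⟩ := exists_matrix_ode (N := fun t => adm (w t)) hR (by
    intro i j
    have h0 := hw 0
    have h1 := hw 1
    have h2 := hw 2
    have hc : DifferentiableOn ℂ (fun _ : ℂ => (0 : ℂ)) (Metric.ball t₀ R) :=
      differentiableOn_const _
    fin_cases i <;> fin_cases j
    · exact h1.neg
    · exact h0
    · exact hc
    · exact h2.const_mul (-2)
    · exact hc
    · exact h0.const_mul 2
    · exact hc
    · exact h2.neg
    · exact h1)
  refine ⟨ρ, h0, h1, M, hM0, fun t ht => ⟨?_, hM t ht⟩⟩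
  have const : ∀ {f : ℂ → ℂ}, (∀ t ∈ Metric.ball t₀ ρ, HasDerivAt f 0 t) → f t = f t₀ :=
    fun {f} hf => Metric.isOpen_ball.is_const_of_deriv_eq_zero
      (convex_ball t₀ ρ).isPreconnected
      (fun s hs => (hf s hs).differentiableAt.differentiableWithinAt)
      (fun s hs => (hf s hs).deriv) ht (Metric.mem_ball_self h0)
  refine isSO_of_mul_transpose ?_ ?_
  -- The derivative of `M K⁻¹ Mᵀ` is `M (ad K⁻¹ + K⁻¹ adᵀ) Mᵀ`, which is zero because `ad` is skew
  -- for the Killing form.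
  · ext i j
    have := const (f := fun t => (M t * killingMatrixInv * (M t).transpose) i j) fun s hs => by
      have e := hM s hs
      have e1 : ∀ i j, (M s * killingMatrixInv * (M s).transpose) i j = _ := fun i j => rfl
      simp only [Matrix.mul_apply, Fin.sum_univ_three, Matrix.transpose_apply, adm,
        killingMatrixInv] at e ⊢
      simp at e ⊢
      have d := (((((e i 2).const_mul (-4⁻¹)).mul (e j 0))).add
        (((e i 1).const_mul 2⁻¹).mul (e j 1))).add (((e i 0).const_mul (-4⁻¹)).mul (e j 2))
      refine (d.congr_deriv ?_).congr_of_eventuallyEq (Eventually.of_forall fun t => ?_)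
      · simp; ring
      · simp; ring
    rw [this, hM0]
    simp
  -- The derivative of the determinant is `tr(ad_w) det M`, and `ad_w` has trace zero.
  · have := const (f := fun t => (M t).det) fun s hs => by
      have e := hM s hs
      simp only [Matrix.mul_apply, Fin.sum_univ_three, adm] at e
      simp at e
      simp only [Matrix.det_fin_three]
      have d := (((((((e 0 0).mul (e 1 1)).mul (e 2 2)).sub (((e 0 0).mul (e 1 2)).mul (e 2 1))).sub
        (((e 0 1).mul (e 1 0)).mul (e 2 2))).add (((e 0 1).mul (e 1 2)).mul (e 2 0))).add
        (((e 0 2).mul (e 1 0)).mul (e 2 1))).sub (((e 0 2).mul (e 1 1)).mul (e 2 0))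
      refine (d.congr_deriv ?_).congr_of_eventuallyEq (Eventually.of_forall fun t => ?_)
      · simp; ring
      · simp
    rw [this, hM0, Matrix.det_one]

/-- When `z` moves with velocity `u(z)`, its isotropic vector moves by `-ad u`, up to a change of
length. -/
lemma brk_nulC (u : Fin 3 → ℂ) (z : ℂ) :
    quad u z • ![2 * z, -2, 0] = -brk u (CP1.nulC z) + (u 1 + 2 * u 2 * z) • CP1.nulC z := by
  ext i; fin_cases i <;> simp [quad, brk_apply, CP1.nulC] <;> ring

/-- A solution of `M' = M ad_w` straightens the vector field `∂_t + w`. -/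
lemma hasDerivAt_straighten {M : ℂ → Matrix (Fin 3) (Fin 3) ℂ} {t z : ℂ} {w : Fin 3 → ℂ}
    (hM : ∀ i j, HasDerivAt (M · i j) ((M t * adm w) i j) t)
    {B C : Matrix (Fin 3) (Fin 3) ℂ} (hC : IsSO C)
    (h2 : B.mulVec ((M t).mulVec (C⁻¹.mulVec (CP1.nulC z))) 2 ≠ 0) :
    HasDerivAt (fun s : ℂ =>
      -(B.mulVec ((M (t + s)).mulVec (C⁻¹.mulVec (CP1.nulC (z + s * quad (C.mulVec w) z)))) 1) /
      (2 * B.mulVec ((M (t + s)).mulVec (C⁻¹.mulVec (CP1.nulC (z + s * quad (C.mulVec w) z)))) 2))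
      0 0 := by
  set u := C.mulVec w with hu
  set κ := u 1 + 2 * u 2 * z with hκ
  have hconst : ∀ (A : Matrix (Fin 3) (Fin 3) ℂ) i j,
      HasDerivAt (fun _ : ℂ => A i j) ((0 : Matrix (Fin 3) (Fin 3) ℂ) i j) 0 :=
    fun A i j => hasDerivAt_const _ _
  have e1 : ∀ i, HasDerivAt (fun s : ℂ => CP1.nulC (z + s * quad u z) i)
      ((quad u z • ![2 * z, -2, 0]) i) 0 := by
    have l : HasDerivAt (fun s : ℂ => z + s * quad u z) (quad u z) 0 := by
      simpa using ((hasDerivAt_id (0 : ℂ)).mul_const (quad u z)).const_add z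
    intro i
    fin_cases i
    · refine (l.pow 2).congr_deriv ?_
      simp; ring
    · refine (l.const_mul (-2)).congr_deriv ?_
      simp; ring
    · refine (hasDerivAt_const (0 : ℂ) (1 : ℂ)).congr_deriv ?_
      simp
  have e2 := hasDerivAt_mulVec (M := fun _ => C⁻¹) (hconst _) e1
  have e3 : ∀ i j, HasDerivAt (fun s => M (t + s) i j) ((M t * adm w) i j) 0 := fun i j => by
    have h : HasDerivAt (M · i j) ((M t * adm w) i j) (t + 0) := by rw [add_zero]; exact hM i j
    exact h.comp_const_add t 0
  have e4 := hasDerivAt_mulVec (M := fun s => M (t + s)) e3 e2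
  have e5 := hasDerivAt_mulVec (M := fun _ => B) (hconst _) e4
  simp only [add_zero, zero_mul, Matrix.zero_mulVec, zero_add] at e5
  -- Along the direction `(1, u(z))` the isotropic vector `M C⁻¹ (nulC z)` moves inside its own
  -- line: the terms with `ad` cancel and a multiple by `κ` remains. So its point on the conic, seen
  -- through `B`, is stationary.
  have key : (M t * adm w).mulVec (C⁻¹.mulVec (CP1.nulC z))
      + (M t).mulVec (C⁻¹.mulVec (quad u z • ![2 * z, -2, 0]))
      = κ • (M t).mulVec (C⁻¹.mulVec (CP1.nulC z)) := by
    have h3 : brk w (C⁻¹.mulVec (CP1.nulC z)) = C⁻¹.mulVec (brk u (CP1.nulC z)) := by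
      rw [← hC.inv.brk_mulVec, hu, hC.inv_mulVec_mulVec]
    rw [brk_nulC, ← Matrix.mulVec_mulVec, adm_mulVec, h3, Matrix.mulVec_add, Matrix.mulVec_neg,
      Matrix.mulVec_add, Matrix.mulVec_neg, Matrix.mulVec_smul, Matrix.mulVec_smul]
    abel
  rw [key, Matrix.mulVec_smul] at e5
  have e6 := (e5 1).neg.div ((e5 2).const_mul 2) (by simpa using h2)
  refine e6.congr_deriv ?_
  simp
  left
  ring

end MatrixODE

section Apply

variable {E : Type*} [NormedAddCommGroup E] [NormedSpace ℂ E] [CompleteSpace E]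
  {M : Type*} [TopologicalSpace M] [ChartedSpace E M] [IsManifold 𝓘(ℂ, E) ω M]

/-- The derivative of a holomorphic function along a holomorphic vector field is
holomorphic. -/
lemma contMDiffAt_mvfderiv_apply {F : Type*} [NormedAddCommGroup F] [NormedSpace ℂ F] {f : M → F}
    {p : M} (hf : ContMDiffAt 𝓘(ℂ, E) 𝓘(ℂ, F) ω f p) {ξ : ∀ x : M, TangentSpace 𝓘(ℂ, E) x}
    (hξ : ContMDiffAt 𝓘(ℂ, E) (𝓘(ℂ, E).prod 𝓘(ℂ, E)) ω
      (fun x => TotalSpace.mk' E (E := fun x : M => TangentSpace 𝓘(ℂ, E) x) x (ξ x)) p) :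
    ContMDiffAt 𝓘(ℂ, E) 𝓘(ℂ, F) ω (fun q => mvfderiv 𝓘(ℂ, E) f q (ξ q)) p := by
  have hc := isHolChart_chartAt (E := E) p
  have hp := _root_.mem_chart_source E p
  set c := chartAt E p
  rw [hc.holAt_iff hp] at hξ
  have h1 : ContDiffAt ℂ ω (f ∘ c.symm) (c p) := by
    rw [← c.left_inv hp] at hf
    exact (hf.comp (c p) (hc.contMDiffAt_symm (c.map_source hp))).contDiffAt
  have h2 : ContDiffAt ℂ ω (fderiv ℂ (f ∘ c.symm)) (c p) := h1.fderiv_right (by simp)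
  have h3 : ContMDiffAt 𝓘(ℂ, E) 𝓘(ℂ, E →L[ℂ] F) ω (fun q => fderiv ℂ (f ∘ c.symm) (c q)) p :=
    h2.contMDiffAt.comp p (hc.contMDiffAt hp)
  refine (h3.clm_apply hξ).congr_of_eventuallyEq ?_
  have h4 : ∀ᶠ q in 𝓝 p, ContDiffAt ℂ ω (f ∘ c.symm) (c q) :=
    (c.continuousAt hp).eventually (h1.eventually (by simp))
  filter_upwards [h4, c.open_source.mem_nhds hp] with q hq hqc
  have e1 := ((hq.differentiableAt (by simp)).hasFDerivAt.hasMFDerivAt).comp q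
    ((hc.contMDiffAt hqc).mdifferentiableAt (by simp)).hasMFDerivAt
  refine (mvfderiv_congr (g := (f ∘ c.symm) ∘ c) ?_ (ξ q)).trans
    (congrArg (fun T : E →L[ℂ] F => T (ξ q)) e1.mfderiv)
  filter_upwards [c.open_source.mem_nhds hqc] with y hy
  simp [c.left_inv hy]

end Apply

lemma differentiableAt_mulVec {E : Type*} [NormedAddCommGroup E] [NormedSpace ℂ E]
    {M : E → Matrix (Fin 3) (Fin 3) ℂ} {v : E → Fin 3 → ℂ} {y : E}
    (hM : ∀ i j, DifferentiableAt ℂ (M · i j) y) (hv : ∀ i, DifferentiableAt ℂ (v · i) y)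
    (i : Fin 3) : DifferentiableAt ℂ (fun y => (M y).mulVec (v y) i) y := by
  simp only [Matrix.mulVec, dotProduct]
  exact DifferentiableAt.fun_sum fun j _ => (hM i j).mul (hv j)

section Flat

variable {X : Type*} [TopologicalSpace X] [ChartedSpace ℂ X]
  {P : Type*} [TopologicalSpace P] [ChartedSpace (ℂ × ℂ) P]

/-- A fibre coordinate that is constant along the leaves of the connection `H`. -/
structure IsFlatCoord (γ : P → X) (H : ∀ p : P, Submodule ℂ (TangentSpace 𝓘(ℂ, ℂ × ℂ) p))
    (U : Set X) (ζ : P → CP1) : Prop extends IsFibreCoord γ U ζ where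
  flat : ∀ p, γ p ∈ U → ∀ ξ ∈ H p, ∀ A, IsSO A → CP1.act A (ζ p) ≠ CP1.infinity →
    mvfderiv 𝓘(ℂ, ℂ × ℂ) (fun q => CP1.toC (CP1.act A (ζ q))) p ξ = 0

variable {γ : P → X} {H : ∀ p : P, Submodule ℂ (TangentSpace 𝓘(ℂ, ℂ × ℂ) p)}
  {U : Set X} {ζ : P → CP1}

namespace IsFlatCoord

lemma actConst (h : IsFlatCoord γ H U ζ) {A : Matrix (Fin 3) (Fin 3) ℂ} (hA : IsSO A) :
    IsFlatCoord γ H U (fun p => CP1.act A (ζ p)) where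
  toIsFibreCoord := h.toIsFibreCoord.actConst hA
  flat p hp ξ hξ B hB hz := by
    simp only [CP1.act_act hA] at hz ⊢
    exact h.flat p hp ξ hξ _ (hB.mul hA) hz

lemma mono (h : IsFlatCoord γ H U ζ) {V : Set X} (hV : IsOpen V) (hVU : V ⊆ U) :
    IsFlatCoord γ H V ζ where
  toIsFibreCoord := h.toIsFibreCoord.mono hV hVU
  flat p hp := h.flat p (hVU hp)

lemma flat_of_ne (h : IsFlatCoord γ H U ζ) {p : P} (hp : γ p ∈ U) (hz : ζ p ≠ CP1.infinity)
    {ξ : TangentSpace 𝓘(ℂ, ℂ × ℂ) p} (hξ : ξ ∈ H p) :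
    mvfderiv 𝓘(ℂ, ℂ × ℂ) (fun q => CP1.toC (ζ q)) p ξ = 0 := by
  have := h.flat p hp ξ hξ 1 IsSO.one (by rwa [CP1.act_one])
  simpa only [CP1.act_one] using this

end IsFlatCoord

lemma IsHolCP1Bundle.exists_isFibreCoord (hγ : IsHolCP1Bundle γ) (x : X) :
    ∃ U, x ∈ U ∧ ∃ ζ, IsFibreCoord γ U ζ := by
  obtain ⟨e, hx, h1, h2⟩ := hγ.2 x
  refine ⟨e.baseSet, hx, fun p => (e p).2, e.open_baseSet, hγ.1, ?_,
    e.toOpenPartialHomeomorph.symm, ?_, fun y hy z => ?_, fun p hp => ?_⟩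
  · rw [← e.source_eq]
    exact contMDiff_snd.comp_contMDiffOn h1
  · rw [← e.target_eq]; exact h2
  · have hy' : (y, z) ∈ e.target := e.mem_target.2 hy
    exact ⟨e.proj_symm_apply hy', by
      have := e.apply_symm_apply hy'
      rw [this]⟩
  · have hp' : p ∈ e.source := e.mem_source.2 hp
    have := e.symm_apply_mk_proj hp'
    exact this

variable [IsManifold 𝓘(ℂ) ω X] [IsManifold 𝓘(ℂ, ℂ × ℂ) ω P]

lemma IsHolConnection.eq_zero (hH : IsHolConnection γ H) {p : P}
    {ξ : TangentSpace 𝓘(ℂ, ℂ × ℂ) p} (hξ : ξ ∈ H p)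
    (h : mfderiv 𝓘(ℂ, ℂ × ℂ) 𝓘(ℂ) γ p ξ = 0) : ξ = 0 :=
  Submodule.disjoint_def.1 (hH.isCompl p).disjoint ξ h hξ

/-- The horizontal lift of the coordinate vector field. -/
lemma IsHolConnection.exists_horizontalLift (hH : IsHolConnection γ H)
    (hγ : ContMDiff 𝓘(ℂ, ℂ × ℂ) 𝓘(ℂ) ω γ) {φ : OpenPartialHomeomorph X ℂ} (hφ : IsHolChart φ) :
    ∃ η : ∀ p : P, TangentSpace 𝓘(ℂ, ℂ × ℂ) p, HolVectorField η (γ ⁻¹' φ.source) ∧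
      ∀ p, γ p ∈ φ.source → η p ∈ H p ∧
        mvfderiv 𝓘(ℂ) φ (γ p) (mfderiv 𝓘(ℂ, ℂ × ℂ) 𝓘(ℂ) γ p (η p)) = 1 := by
  have frame : ∀ p, γ p ∈ φ.source → ∀ e : TangentSpace 𝓘(ℂ, ℂ × ℂ) p, e ∈ H p → e ≠ 0 →
      mvfderiv 𝓘(ℂ) φ (γ p) (mfderiv 𝓘(ℂ, ℂ × ℂ) 𝓘(ℂ) γ p e) ≠ 0 := by
    intro p hp e he h0 h
    refine h0 (hH.eq_zero he (hφ.mvfderiv_injective hp ?_))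
    rw [h, map_zero]
  have hex : ∀ p, ∃ η : TangentSpace 𝓘(ℂ, ℂ × ℂ) p, γ p ∈ φ.source → η ∈ H p ∧
      mvfderiv 𝓘(ℂ) φ (γ p) (mfderiv 𝓘(ℂ, ℂ × ℂ) 𝓘(ℂ) γ p η) = 1 := by
    intro p
    by_cases hp : γ p ∈ φ.source
    swap
    · exact ⟨0, fun h => absurd h hp⟩
    obtain ⟨W, -, hpW, e, -, he⟩ := hH.holomorphic p
    obtain ⟨hli, hsp⟩ := he p hpW
    have h0 : e 0 p ≠ 0 := hli.ne_zero 0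
    have h1 : e 0 p ∈ H p := by rw [← hsp]; exact Submodule.subset_span ⟨0, rfl⟩
    refine ⟨(mvfderiv 𝓘(ℂ) φ (γ p) (mfderiv 𝓘(ℂ, ℂ × ℂ) 𝓘(ℂ) γ p (e 0 p)))⁻¹ • e 0 p, fun _ =>
      ⟨Submodule.smul_mem _ _ h1, ?_⟩⟩
    rw [map_smul, map_smul, smul_eq_mul, inv_mul_cancel₀ (frame p hp _ h1 h0)]
  choose η hη using hex
  refine ⟨η, fun p hp => ContMDiffAt.contMDiffWithinAt ?_, hη⟩
  have hp : γ p ∈ φ.source := hp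
  obtain ⟨W, hW, hpW, e, heh, he⟩ := hH.holomorphic p
  have he0 := (heh 0).contMDiffAt (hW.mem_nhds hpW)
  -- The pointwise choice of `η` is forced: `H` is a line complementary to `ker dγ`, so near `p` the
  -- lift is `e₀ / c`, where `c` is the base component of the local frame `e₀`.
  let c : P → ℂ := fun q => mvfderiv 𝓘(ℂ, ℂ × ℂ) (φ ∘ γ) q (e 0 q)
  have hc : ContMDiffAt 𝓘(ℂ, ℂ × ℂ) 𝓘(ℂ) ω c p :=
    contMDiffAt_mvfderiv_apply ((hφ.contMDiffAt hp).comp p (hγ p)) he0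
  have hcq : ∀ q, γ q ∈ φ.source →
      c q = mvfderiv 𝓘(ℂ) φ (γ q) (mfderiv 𝓘(ℂ, ℂ × ℂ) 𝓘(ℂ) γ q (e 0 q)) := fun q hq =>
    mvfderiv_comp_apply q ((hφ.contMDiffAt hq).mdifferentiableAt (by simp))
      ((hγ q).mdifferentiableAt (by simp)) _
  have hce : ∀ q ∈ W, γ q ∈ φ.source → c q ≠ 0 := fun q hqW hq => by
    rw [hcq q hq]
    exact frame q hq _ (by rw [← (he q hqW).2]; exact Submodule.subset_span ⟨0, rfl⟩)
      ((he q hqW).1.ne_zero 0)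
  have hinv : ContMDiffAt 𝓘(ℂ, ℂ × ℂ) 𝓘(ℂ) ω (fun q => (c q)⁻¹) p := hc.inv₀ (hce p hpW hp)
  refine (hinv.smul_section he0).congr_of_eventuallyEq ?_
  filter_upwards [hW.mem_nhds hpW, (φ.open_source.preimage hγ.continuous).mem_nhds hp]
    with q hqW hq
  have hq : γ q ∈ φ.source := hq
  obtain ⟨h1, h2⟩ := hη q hq
  have h3 := h1
  rw [← (he q hqW).2, Set.range_unique, Submodule.mem_span_singleton] at h3
  obtain ⟨k, hk⟩ := h3
  have hk : k • e 0 q = η q := hk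
  have h4 : k * c q = 1 := by
    rw [← hk, map_smul, map_smul, ← hcq q hq] at h2
    exact h2
  have h5 : k = (c q)⁻¹ := eq_inv_of_mul_eq_one_left h4
  change TotalSpace.mk' _ q (η q) = TotalSpace.mk' _ q ((c q)⁻¹ • e 0 q)
  rw [← h5, hk]

/-- Every holomorphic connection on a projective bundle over a Riemann surface has local flat
coordinates. -/
theorem IsHolConnection.exists_isFlatCoord (hH : IsHolConnection γ H) (hγ : IsHolCP1Bundle γ)
    (x : X) : ∃ U, x ∈ U ∧ ∃ ζ, IsFlatCoord γ H U ζ := by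
  obtain ⟨U, hxU, ζ, h⟩ := hγ.exists_isFibreCoord x
  have hφ := isHolChart_chartAt (E := ℂ) x
  have hx := _root_.mem_chart_source ℂ x
  set φ := chartAt ℂ x
  -- In the fibre coordinate `ζ` the lift of `∂_t` is `∂_t + w(t)` with `w` quadratic on the fibres.
  -- The flat coordinate is `M ζ`, where `M' = M ad_w`.
  obtain ⟨η, hη, hη'⟩ := hH.exists_horizontalLift hγ.1 hφ
  have h' := h.mono (V := U ∩ φ.source) (h.isOpen.inter φ.open_source) inter_subset_left
  obtain ⟨w, hw, hwq⟩ := h'.exists_quad (ξ := η) (hη.mono (preimage_mono inter_subset_right))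
  have hopen : IsOpen (φ.target ∩ φ.symm ⁻¹' U) := φ.isOpen_inter_preimage_symm h.isOpen
  obtain ⟨R, hR, hball⟩ := Metric.isOpen_iff.1 hopen (φ x)
    ⟨φ.map_source hx, by rw [mem_preimage, φ.left_inv hx]; exact hxU⟩
  obtain ⟨ρ, hρ, hρR, M, hM0, hM⟩ := exists_isSO_ode (w := fun t => w (φ.symm t)) (t₀ := φ x) hR
    (by
      intro i t ht
      have ht' := hball ht
      have h1 : ContMDiffAt 𝓘(ℂ) 𝓘(ℂ) ω (w · i) (φ.symm t) := (hw i).contMDiffAt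
        (h'.isOpen.mem_nhds ⟨ht'.2, φ.map_target ht'.1⟩)
      exact ((h1.comp t (hφ.contMDiffAt_symm ht'.1)).contDiffAt.differentiableAt
        (by simp)).differentiableWithinAt)
  set V : Set X := φ.source ∩ φ ⁻¹' Metric.ball (φ x) ρ with hV
  have hVo : IsOpen V := φ.isOpen_inter_preimage Metric.isOpen_ball
  have hVU : V ⊆ U ∩ φ.source := by
    rintro y ⟨hy1, hy2⟩
    have := (hball (Metric.ball_subset_ball hρR hy2)).2
    rw [mem_preimage, φ.left_inv hy1] at this
    exact ⟨this, hy1⟩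
  have hV' := h'.mono hVo hVU
  have hMan : ∀ i j, ContMDiffOn 𝓘(ℂ) 𝓘(ℂ) ω (fun y => M (φ y) i j) V := fun i j y hy => by
    have h1 : DifferentiableOn ℂ (M · i j) (Metric.ball (φ x) ρ) := fun t ht =>
      ((hM t ht).2 i j).differentiableAt.differentiableWithinAt
    have h2 : ContDiffAt ℂ ω (M · i j) (φ y) :=
      (h1.contDiffOn Metric.isOpen_ball).contDiffAt (Metric.isOpen_ball.mem_nhds hy.2)
    exact (ContMDiffAt.comp (g := (M · i j)) (f := φ) y h2.contMDiffAt
      (hφ.contMDiffAt hy.1)).contMDiffWithinAt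
  have hSO : ∀ y ∈ V, IsSO (M (φ y)) := fun y hy => (hM _ hy.2).1
  refine ⟨V, ⟨hx, Metric.mem_ball_self hρ⟩, fun p => CP1.act (M (φ (γ p))) (ζ p),
    { toIsFibreCoord := hV'.act hMan hSO, flat := ?_ }⟩
  intro p hp ξ hξ B hB hz
  have hpφ : γ p ∈ φ.source := hp.1
  obtain ⟨e1, e2⟩ := hη' p hpφ
  obtain ⟨k, rfl⟩ : ∃ k : ℂ, ξ = k • η p := by
    set k := mvfderiv 𝓘(ℂ) φ (γ p) (mfderiv 𝓘(ℂ, ℂ × ℂ) 𝓘(ℂ) γ p ξ) with hk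
    refine ⟨k, sub_eq_zero.1 (hH.eq_zero (sub_mem hξ (Submodule.smul_mem _ k e1)) ?_)⟩
    refine hφ.mvfderiv_injective hpφ ?_
    rw [map_sub, map_sub, map_smul, map_smul, e2, ← hk, map_zero, smul_eq_mul, mul_one, sub_self]
  rw [map_smul]
  suffices hs : mvfderiv 𝓘(ℂ, ℂ × ℂ)
      (fun q => CP1.toC (CP1.act B (CP1.act (M (φ (γ q))) (ζ q)))) p (η p) = 0 by
    rw [hs, smul_zero]
  obtain ⟨C, hC, hzC⟩ := CP1.exists_act_ne_infinity (ζ p)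
  have hc := hV'.actConst hC
  have hcs : p ∈ (hc.chart φ hφ).source := ⟨⟨hp, hpφ⟩, hzC⟩
  -- `C` makes the fibre coordinate finite at `p`, `B` is the isometry used to test flatness, and
  -- `m` is the isotropic vector of the new coordinate in the chart given by `C`.
  let m : ℂ × ℂ → Fin 3 → ℂ := fun y => B.mulVec ((M y.1).mulVec (C⁻¹.mulVec (CP1.nulC y.2)))
  let F : ℂ × ℂ → ℂ := fun y => -(m y 1) / (2 * m y 2)
  have hpt : ∀ q, γ q ∈ V → CP1.act C (ζ q) ≠ CP1.infinity →
      CP1.act B (CP1.act (M (φ (γ q))) (ζ q)) = CP1.pt (m (hc.chart φ hφ q)) := by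
    intro q hq hqz
    have e3 : ζ q = CP1.act C⁻¹ (CP1.act C (ζ q)) := by
      rw [CP1.act_act hC, hC.inv_mul, CP1.act_one]
    have e4 : CP1.pt (CP1.nulC (CP1.toC (CP1.act C (ζ q)))) = CP1.act C (ζ q) := by
      rw [← CP1.nul_ofComplex, CP1.pt_nul, CP1.ofComplex_toC hqz]
    have n1 := CP1.isNull_nul (CP1.act C (ζ q))
    have n2 := CP1.nul_ne_zero (CP1.act C (ζ q))
    rw [← CP1.ofComplex_toC hqz, CP1.nul_ofComplex] at n1 n2
    conv_lhs => rw [e3, ← e4, CP1.act_pt n1 n2, CP1.act_pt (hC.inv.isNull n1)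
      (hC.inv.mulVec_ne_zero n2), CP1.act_pt ((hSO _ hq).isNull (hC.inv.isNull n1))
      ((hSO _ hq).mulVec_ne_zero (hC.inv.mulVec_ne_zero n2))]
    rfl
  have hm2 : m (hc.chart φ hφ p) 2 ≠ 0 := by
    rw [hpt p hp hzC] at hz
    exact CP1.pt_ne_infinity_iff.1 hz
  have hFe : ∀ᶠ q in 𝓝 p, CP1.toC (CP1.act B (CP1.act (M (φ (γ q))) (ζ q)))
      = F (hc.chart φ hφ q) := by
    have hcont := ((hc.chart φ hφ).continuousAt hcs)
    have hzc : ∀ᶠ q in 𝓝 p, CP1.act B (CP1.act (M (φ (γ q))) (ζ q)) ≠ CP1.infinity :=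
      ((hV'.act hMan hSO).actConst hB |>.contMDiffAt hp).continuousAt.eventually_ne hz
    filter_upwards [(hc.chart φ hφ).open_source.mem_nhds hcs, hzc] with q hq hqz
    rw [hpt q hq.1.1 hq.2] at hqz ⊢
    have := CP1.pt_ne_infinity_iff.1 hqz
    rw [CP1.pt, if_neg this, CP1.toC_ofComplex]
  rw [mvfderiv_congr hFe]
  have hFd : DifferentiableAt ℂ F (hc.chart φ hφ p) := by
    have hMd : ∀ i j, DifferentiableAt ℂ (fun y : ℂ × ℂ => M y.1 i j) (hc.chart φ hφ p) :=
      fun i j => DifferentiableAt.comp (g := (M · i j)) (f := Prod.fst) _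
        ((hM _ hp.2).2 i j).differentiableAt differentiableAt_fst
    have hnul : ∀ i, DifferentiableAt ℂ (fun y : ℂ × ℂ => CP1.nulC y.2 i)
        (hc.chart φ hφ p) := by
      intro i
      fin_cases i
      · exact differentiableAt_snd.pow 2
      · exact differentiableAt_snd.const_mul (-2)
      · exact differentiableAt_const 1
    have hmd : ∀ i, DifferentiableAt ℂ (fun y => m y i) (hc.chart φ hφ p) :=
      differentiableAt_mulVec (M := fun _ => B) (fun _ _ => differentiableAt_const _)
        (differentiableAt_mulVec hMd
          (differentiableAt_mulVec (M := fun _ => C⁻¹) (fun _ _ => differentiableAt_const _) hnul))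
    simp only [F, div_eq_mul_inv]
    exact (hmd 1).neg.mul (((hmd 2).const_mul 2).fun_inv (mul_ne_zero two_ne_zero hm2))
  have e5 := (hFd.hasFDerivAt.hasMFDerivAt).comp p
    (((hc.isHolChart_chart hφ).contMDiffAt hcs).mdifferentiableAt (by simp)).hasMFDerivAt
  refine (congrArg (fun T : ℂ × ℂ →L[ℂ] ℂ => T (η p)) e5.mfderiv).trans ?_
  change fderiv ℂ F (hc.chart φ hφ p) (mvfderiv 𝓘(ℂ, ℂ × ℂ) (hc.chart φ hφ) p (η p)) = 0
  have e6 : mvfderiv 𝓘(ℂ, ℂ × ℂ) (hc.chart φ hφ) p (η p)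
      = (1, quad (C.mulVec (w (γ p))) (CP1.toC (CP1.act C (ζ p)))) := by
    rw [hc.mvfderiv_chart hφ hcs, e2, hwq p (hVU hp) C hC hzC]
  rw [e6]
  -- The derivative of `F` in the direction `(1, u(z))` is computed along the affine line in that
  -- direction, where `hasDerivAt_straighten` applies.
  have e7 := hasDerivAt_straighten (B := B) (z := CP1.toC (CP1.act C (ζ p))) (M := M)
    (w := w (γ p)) (t := φ (γ p)) (by
      intro i j
      have := (hM _ hp.2).2 i j
      rwa [φ.left_inv hpφ] at this) hC hm2
  have hl : HasDerivAt (fun s : ℂ => (φ (γ p) + s, CP1.toC (CP1.act C (ζ p)) +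
      s * quad (C.mulVec (w (γ p))) (CP1.toC (CP1.act C (ζ p)))))
      (1, quad (C.mulVec (w (γ p))) (CP1.toC (CP1.act C (ζ p)))) 0 := by
    refine HasDerivAt.prodMk ((hasDerivAt_id (0 : ℂ)).const_add _) ?_
    simpa using ((hasDerivAt_id (0 : ℂ)).mul_const
      (quad (C.mulVec (w (γ p))) (CP1.toC (CP1.act C (ζ p))))).const_add
        (CP1.toC (CP1.act C (ζ p)))
  have e8 := HasFDerivAt.comp_hasDerivAt_of_eq (0 : ℂ) hFd.hasFDerivAt hl (by simp [IsFibreCoord.chart_apply])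
  exact e8.unique e7

end Flat

/-! ### Vanishing along the section -/

lemma eq_smul_nulC {w : Fin 3 → ℂ} {z : ℂ} (h0 : quad w z = 0) (h1 : w 1 + 2 * w 2 * z = 0) :
    w = w 2 • CP1.nulC z := by
  ext i
  fin_cases i
  · simp [quad, CP1.nulC] at h0 ⊢; linear_combination h0 - z * h1
  · simp [CP1.nulC] at h1 ⊢; linear_combination h1
  · simp [CP1.nulC]

lemma quad_smul_nulC (c z t : ℂ) : quad (c • CP1.nulC z) t = c * (t - z) ^ 2 := by
  simp [quad, CP1.nulC]; ring

lemma IsSO.killing_nul_act {A : Matrix (Fin 3) (Fin 3) ℂ} (hA : IsSO A) (w : Fin 3 → ℂ) (z : CP1) :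
    killing (A.mulVec w) (CP1.nul (CP1.act A z)) = 0 ↔ killing w (CP1.nul z) = 0 := by
  obtain ⟨c, hc, h⟩ := CP1.exists_mulVec_nul hA z
  rw [← hA.1 w, h, map_smul, smul_eq_mul, mul_eq_zero, or_iff_right hc]

lemma IsSO.exists_smul_nul_act {A : Matrix (Fin 3) (Fin 3) ℂ} (hA : IsSO A) (w : Fin 3 → ℂ)
    (z : CP1) : (∃ c : ℂ, A.mulVec w = c • CP1.nul (CP1.act A z)) ↔ ∃ c : ℂ, w = c • CP1.nul z := by
  obtain ⟨c, hc, h⟩ := CP1.exists_mulVec_nul hA z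
  constructor
  · rintro ⟨k, hk⟩
    refine ⟨k / c, ?_⟩
    rw [← hA.inv_mulVec_mulVec w, hk, Matrix.mulVec_smul, div_eq_mul_inv, mul_smul]
    congr 1
    have := congrArg A⁻¹.mulVec h
    rw [hA.inv_mulVec_mulVec, Matrix.mulVec_smul] at this
    rw [this, smul_smul, inv_mul_cancel₀ hc, one_smul]
  · rintro ⟨k, rfl⟩
    exact ⟨k * c, by rw [Matrix.mulVec_smul, h, smul_smul]⟩

section Vanishing

variable {X : Type u} [TopologicalSpace X] [ChartedSpace ℂ X] [IsManifold 𝓘(ℂ) ω X] {S : Finset X}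
  {T : BranchedTriple X S} {U : Set X} {ζ : T.P → CP1}

namespace BranchedTriple

lemma killing_eq_zero_of_vanishesAlong {x : X} (hx : x ∈ U)
    {w : Fin 3 → ℂ} {ξ : ∀ p : T.P, TangentSpace 𝓘(ℂ, ℂ × ℂ) p}
    (hξ : ∀ p, T.γ p = x → IsStdAt T.γ ζ w p (ξ p)) (hv : T.VanishesAlong 1 ξ x) :
    killing w (CP1.nul (ζ (T.s x))) = 0 := by
  obtain ⟨V, -, hsV, f, η, -, hf0, -, hfη⟩ := hv
  obtain ⟨A, hA, hz⟩ := CP1.exists_act_ne_infinity (ζ (T.s x))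
  have h1 := (hξ _ (T.s_section x)).2 A hA hz
  rw [hfη _ hsV, hf0 _ hsV, pow_one, zero_smul, map_zero] at h1
  rw [← hA.killing_nul_act, ← CP1.ofComplex_toC hz, CP1.nul_ofComplex, CP1.killing_nulC, ← h1,
    mul_zero]

/-- On the fibre over `x` the quadratic polynomial of the field equals `f² g` with `f` zero at `s
x`. So it has a double zero there and is a multiple of the isotropic vector. -/
lemma exists_smul_nul_of_vanishesAlong (h : IsFibreCoord T.γ U ζ) {x : X} (hx : x ∈ U)
    {w : Fin 3 → ℂ} {ξ : ∀ p : T.P, TangentSpace 𝓘(ℂ, ℂ × ℂ) p}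
    (hξ : ∀ p, T.γ p = x → IsStdAt T.γ ζ w p (ξ p)) (hv : T.VanishesAlong 2 ξ x) :
    ∃ c : ℂ, w = c • CP1.nul (ζ (T.s x)) := by
  obtain ⟨V, hV, hsV, f, η, hf, hf0, hη, hfη⟩ := hv
  obtain ⟨A, hA, hz⟩ := CP1.exists_act_ne_infinity (ζ (T.s x))
  have h' := h.actConst hA
  obtain ⟨σ, hσ, hσ1, hσ2⟩ := h'.exists_inv
  set z₀ := CP1.toC (CP1.act A (ζ (T.s x))) with hz₀
  let q : ℂ → T.P := fun z => σ (x, CP1.ofComplex z)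
  have hq0 : q z₀ = T.s x := by
    have := hσ2 (T.s x) (by rwa [T.s_section])
    rwa [T.s_section, ← CP1.ofComplex_toC hz] at this
  have hqx : ∀ z, T.γ (q z) = x := fun z => (hσ1 x hx _).1
  have hqz : ∀ z, CP1.act A (ζ (q z)) = CP1.ofComplex z := fun z => (hσ1 x hx _).2
  have hq : ContMDiffAt 𝓘(ℂ) 𝓘(ℂ, ℂ × ℂ) ω q z₀ :=
    ContMDiffAt.comp (f := fun z : ℂ => (x, CP1.ofComplex z)) z₀
      (hσ.contMDiffAt ((h'.isOpen.prod isOpen_univ).mem_nhds ⟨hx, mem_univ _⟩))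
      (contMDiffAt_const.prodMk (CP1.contMDiff_ofComplex z₀))
  have hqV : ∀ᶠ z in 𝓝 z₀, q z ∈ V :=
    hq.continuousAt.eventually (hV.mem_nhds (by rw [hq0]; exact hsV))
  have hF : ContMDiffAt 𝓘(ℂ) 𝓘(ℂ) ω (fun z => f (q z)) z₀ :=
    ContMDiffAt.comp (g := f) z₀ (hf.contMDiffAt (hV.mem_nhds (by rw [hq0]; exact hsV))) hq
  let g : T.P → ℂ := fun p => mvfderiv 𝓘(ℂ, ℂ × ℂ) (fun q => CP1.toC (CP1.act A (ζ q))) p (η p)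
  have hg : ContMDiffAt 𝓘(ℂ) 𝓘(ℂ) ω (fun z => g (q z)) z₀ := by
    refine ContMDiffAt.comp (g := g) z₀ ?_ hq
    refine h'.contMDiffAt_mvfderiv ?_ ?_ (hη.1.contMDiffAt (hV.mem_nhds (by rw [hq0]; exact hsV)))
    · rw [hqx]; exact hx
    · rw [hqz]; exact CP1.ofComplex_ne_infinity _
  have heq : ∀ᶠ z in 𝓝 z₀, quad (A.mulVec w) z = f (q z) ^ 2 * g (q z) := by
    filter_upwards [hqV] with z hz
    have h1 := (hξ _ (hqx z)).2 A hA (by rw [hqz]; exact CP1.ofComplex_ne_infinity _)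
    rw [hfη _ hz, map_smul, hqz, CP1.toC_ofComplex, smul_eq_mul] at h1
    exact h1.symm
  have hf00 : f (q z₀) = 0 := by rw [hq0]; exact hf0 x hsV
  have h0 : quad (A.mulVec w) z₀ = 0 := by
    rw [heq.self_of_nhds, hf00]; simp
  have hd1 : HasDerivAt (quad (A.mulVec w))
      (A.mulVec w 1 + 2 * A.mulVec w 2 * z₀) z₀ := by
    have := (((hasDerivAt_id z₀).const_mul (A.mulVec w 1)).const_add (A.mulVec w 0)).add
      (((hasDerivAt_id z₀).pow 2).const_mul (A.mulVec w 2))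
    refine this.congr_deriv ?_
    simp; ring
  have hd2 := (((hF.contDiffAt.differentiableAt (by simp)).hasDerivAt.pow 2).mul
    (hg.contDiffAt.differentiableAt (by simp)).hasDerivAt)
  have h1 := (hd2.congr_of_eventuallyEq heq).unique hd1
  simp [hf00] at h1
  refine (hA.exists_smul_nul_act _ _).1 ⟨A.mulVec w 2, ?_⟩
  rw [← CP1.ofComplex_toC hz, CP1.nul_ofComplex]
  exact eq_smul_nulC h0 h1.symm

/-- The local equation of the divisor `s(X)` is `ζ - ζ ∘ s ∘ γ`, and the cofactor is the vertical
field with coefficients `b`. Assumptions on `b` are needed only where `ζ ∘ s` is finite, since `b`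
may involve its affine value. -/
lemma vanishesAlong_of_quad_eq (h : IsFibreCoord T.γ U ζ) {x : X} (hx : x ∈ U)
    (hz : ζ (T.s x) ≠ CP1.infinity) {k : ℕ} {a b : X → Fin 3 → ℂ}
    {ξ : ∀ p : T.P, TangentSpace 𝓘(ℂ, ℂ × ℂ) p}
    (hξ : ∀ p, T.γ p ∈ U → IsStdAt T.γ ζ (a (T.γ p)) p (ξ p))
    (hb : ∀ y ∈ U, ζ (T.s y) ≠ CP1.infinity → ∀ i, ContMDiffAt 𝓘(ℂ) 𝓘(ℂ) ω (b · i) y)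
    (hab : ∀ y ∈ U, ζ (T.s y) ≠ CP1.infinity → ∀ z,
      quad (a y) z = (z - CP1.toC (ζ (T.s y))) ^ k * quad (b y) z) :
    T.VanishesAlong k ξ x := by
  have hψ : ∀ p, ∃ η : TangentSpace 𝓘(ℂ, ℂ × ℂ) p,
      T.γ p ∈ U → IsStdAt T.γ ζ (b (T.γ p)) p η := fun p => by
    by_cases hp : T.γ p ∈ U
    · obtain ⟨ψ, hψ⟩ := h.exists_stdMap hp
      exact ⟨_, fun _ => hψ _⟩
    · exact ⟨0, fun h => absurd h hp⟩
  choose η hη using hψ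
  have hsU : ContMDiffOn 𝓘(ℂ) 𝓘(ℂ) ω (fun y => ζ (T.s y)) U := fun y hy =>
    ((h.contMDiffAt (p := T.s y) (by rwa [T.s_section])).comp y
      (T.s_holomorphic y)).contMDiffWithinAt
  have hU1 : IsOpen (U ∩ (fun y => ζ (T.s y)) ⁻¹' {p | p ≠ CP1.infinity}) :=
    hsU.continuousOn.isOpen_inter_preimage h.isOpen CP1.isOpen_ne_infinity
  set U1 := U ∩ (fun y => ζ (T.s y)) ⁻¹' {p | p ≠ CP1.infinity} with hU1def
  have h1 := h.mono hU1 inter_subset_left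
  have hV : IsOpen ((T.γ ⁻¹' U1) ∩ ζ ⁻¹' {p | p ≠ CP1.infinity}) :=
    h1.hol.continuousOn.isOpen_inter_preimage h1.isOpen_preimage CP1.isOpen_ne_infinity
  refine ⟨_, hV, ⟨by rw [mem_preimage, T.s_section]; exact ⟨hx, hz⟩, hz⟩,
    fun p => CP1.toC (ζ p) - CP1.toC (ζ (T.s (T.γ p))), η, fun p hp => ?_, fun y _ => ?_,
    ⟨fun p hp => ?_, fun p hp => (hη p hp.1.1).1⟩, fun p hp => ?_⟩
  · refine ContMDiffAt.contMDiffWithinAt (ContMDiffAt.sub (h.contMDiffAt_toC hp.1.1 hp.2) ?_)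
    exact ContMDiffAt.comp (g := CP1.toC) p (CP1.contMDiffAt_toC hp.1.2)
      (ContMDiffAt.comp (g := fun y => ζ (T.s y)) p
        (hsU.contMDiffAt (h.isOpen.mem_nhds hp.1.1)) (T.isBundle.1 p))
  · dsimp only
    rw [T.s_section, sub_self]
  · refine (h.contMDiffAt_of_isStdAt hp.1.1 (hb _ hp.1.1 hp.1.2) ?_).contMDiffWithinAt
    filter_upwards [h1.isOpen_preimage.mem_nhds hp.1] with q hq using hη q hq.1
  · have e1 := (h.isStdAt_iff hp.1.1 hp.2).1 (hξ p hp.1.1)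
    have e2 := (h.isStdAt_iff hp.1.1 hp.2).1 (hη p hp.1.1)
    refine h.eq_of_mfderiv_eq hp.1.1 IsSO.one (by rw [CP1.act_one]; exact hp.2) ?_ ?_
    · rw [e1.1, map_smul, e2.1, smul_zero]
    · simp only [CP1.act_one]
      rw [e1.2, map_smul, e2.2, hab _ hp.1.1 hp.1.2]
      rfl

/-- A polynomial with a double zero at `z₀` is its leading coefficient times `(z - z₀)²`, so the
cofactor is a constant on each fibre. -/
lemma vanishesAlong_two (h : IsFibreCoord T.γ U ζ) {x : X} (hx : x ∈ U) {a : X → Fin 3 → ℂ}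
    (ha : ∀ i, ContMDiffOn 𝓘(ℂ) 𝓘(ℂ) ω (a · i) U) {ξ : ∀ p : T.P, TangentSpace 𝓘(ℂ, ℂ × ℂ) p}
    (hξ : ∀ p, T.γ p ∈ U → IsStdAt T.γ ζ (a (T.γ p)) p (ξ p))
    (hv : ∀ y ∈ U, ∃ c : ℂ, a y = c • CP1.nul (ζ (T.s y))) : T.VanishesAlong 2 ξ x := by
  obtain ⟨A, hA, hz⟩ := CP1.exists_act_ne_infinity (ζ (T.s x))
  have haA : ∀ y ∈ U, ∀ i, ContMDiffAt 𝓘(ℂ) 𝓘(ℂ) ω (fun y => A.mulVec (a y) i) y := fun y hy =>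
    contMDiffAt_mulVec (A := fun _ => A) (fun _ _ => contMDiffAt_const)
      fun i => (ha i).contMDiffAt (h.isOpen.mem_nhds hy)
  refine vanishesAlong_of_quad_eq (h.actConst hA) hx hz (a := fun y => A.mulVec (a y))
    (b := fun y => ![A.mulVec (a y) 2, 0, 0]) (fun p hp => (hξ p hp).act hA)
    (fun y hy _ i => ?_) (fun y hy hzy z => ?_)
  · fin_cases i
    · exact haA y hy 2
    · exact contMDiffAt_const
    · exact contMDiffAt_const
  · obtain ⟨c, hc⟩ := (hA.exists_smul_nul_act _ _).2 (hv y hy)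
    rw [← CP1.ofComplex_toC hzy, CP1.nul_ofComplex] at hc
    rw [hc, quad_smul_nulC]
    simp [quad, CP1.nulC]
    ring

/-- Division of `a₀ + a₁ z + a₂ z²` by `z - z₀` has quotient `(a₁ + a₂ z₀) + a₂ z`, with
coefficients holomorphic in the base point. -/
lemma vanishesAlong_one (h : IsFibreCoord T.γ U ζ) {x : X} (hx : x ∈ U) {a : X → Fin 3 → ℂ}
    (ha : ∀ i, ContMDiffOn 𝓘(ℂ) 𝓘(ℂ) ω (a · i) U) {ξ : ∀ p : T.P, TangentSpace 𝓘(ℂ, ℂ × ℂ) p}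
    (hξ : ∀ p, T.γ p ∈ U → IsStdAt T.γ ζ (a (T.γ p)) p (ξ p))
    (hv : ∀ y ∈ U, killing (a y) (CP1.nul (ζ (T.s y))) = 0) : T.VanishesAlong 1 ξ x := by
  obtain ⟨A, hA, hz⟩ := CP1.exists_act_ne_infinity (ζ (T.s x))
  have haA : ∀ y ∈ U, ∀ i, ContMDiffAt 𝓘(ℂ) 𝓘(ℂ) ω (fun y => A.mulVec (a y) i) y := fun y hy =>
    contMDiffAt_mulVec (A := fun _ => A) (fun _ _ => contMDiffAt_const)
      fun i => (ha i).contMDiffAt (h.isOpen.mem_nhds hy)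
  refine vanishesAlong_of_quad_eq (h.actConst hA) hx hz (a := fun y => A.mulVec (a y))
    (b := fun y => ![A.mulVec (a y) 1 + A.mulVec (a y) 2 * CP1.toC (CP1.act A (ζ (T.s y))),
      A.mulVec (a y) 2, 0]) (fun p hp => (hξ p hp).act hA)
    (fun y hy hzy i => ?_) (fun y hy hzy z => ?_)
  · have hs : ContMDiffAt 𝓘(ℂ) 𝓘(ℂ) ω (fun y => CP1.toC (CP1.act A (ζ (T.s y)))) y :=
      ContMDiffAt.comp (g := fun q => CP1.toC (CP1.act A (ζ q))) y
        ((h.actConst hA).contMDiffAt_toC (p := T.s y) (by rwa [T.s_section]) hzy)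
        (T.s_holomorphic y)
    fin_cases i
    · exact (haA y hy 1).add ((haA y hy 2).mul hs)
    · exact haA y hy 2
    · exact contMDiffAt_const
  · have hk := (hA.killing_nul_act _ _).2 (hv y hy)
    rw [← CP1.ofComplex_toC hzy, CP1.nul_ofComplex, CP1.killing_nulC] at hk
    simp [quad] at hk ⊢
    linear_combination hk

end BranchedTriple
end Vanishing

/-! ### The divisor of the vertical differential -/

section Divisor

lemma contMDiffAt_mvfderiv_along {E : Type*} [NormedAddCommGroup E] [NormedSpace ℂ E]
    {M : Type*} [TopologicalSpace M] [ChartedSpace E M] [IsManifold 𝓘(ℂ, E) ω M]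
    {X : Type*} [TopologicalSpace X] [ChartedSpace ℂ X]
    {s : X → M} {w : ∀ y : X, TangentSpace 𝓘(ℂ, E) (s y)} {x : X}
    (hw : ContMDiffAt 𝓘(ℂ) (𝓘(ℂ, E).prod 𝓘(ℂ, E)) ω
      (fun y => (⟨s y, w y⟩ : TangentBundle 𝓘(ℂ, E) M)) x)
    {V : Set M} (hV : IsOpen V) (hx : s x ∈ V) {f : M → ℂ}
    (hf : ContMDiffOn 𝓘(ℂ, E) 𝓘(ℂ) ω f V) :
    ContMDiffAt 𝓘(ℂ) 𝓘(ℂ) ω (fun y => mvfderiv 𝓘(ℂ, E) f (s y) (w y)) x := by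
  have : IsManifold 𝓘(ℂ, E) (ω + 1) M := ‹IsManifold 𝓘(ℂ, E) ω M›
  have h1 := hf.contMDiffOn_tangentMapWithin (m := ω) (by simp) hV.uniqueMDiffOn
  have hopen : IsOpen (TotalSpace.proj ⁻¹' V : Set (TangentBundle 𝓘(ℂ, E) M)) :=
    hV.preimage (FiberBundle.continuous_proj E (fun x : M => TangentSpace 𝓘(ℂ, E) x))
  have h2 := h1.contMDiffAt (x := (⟨s x, w x⟩ : TangentBundle 𝓘(ℂ, E) M)) (hopen.mem_nhds hx)
  have h3 := h2.comp x hw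
  have h4 := (contMDiffAt_totalSpace (F := ℂ) (E := fun z : ℂ => TangentSpace 𝓘(ℂ) z)).1 h3
  refine h4.2.congr_of_eventuallyEq ?_
  filter_upwards [hw.continuousAt.eventually (hopen.mem_nhds hx)] with y hy
  have hy : s y ∈ V := hy
  simp only [Function.comp, tangentMapWithin]
  rw [mfderivWithin_of_isOpen hV hy]
  simp
  rfl

variable {X : Type*} [TopologicalSpace X] [ChartedSpace ℂ X] [IsManifold 𝓘(ℂ) ω X]

open Classical in
/-- The coordinate vector field of a chart. -/
lemma IsHolChart.exists_coordField {φ : OpenPartialHomeomorph X ℂ} (hφ : IsHolChart φ) :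
    ∃ v : ∀ y : X, TangentSpace 𝓘(ℂ) y, HolVectorField v φ.source ∧
      ∀ y ∈ φ.source, mvfderiv 𝓘(ℂ) φ y (v y) = 1 := by
  let v : ∀ y : X, TangentSpace 𝓘(ℂ) y := fun y =>
    if hy : y ∈ φ.source then (hφ.tangentEquiv hy).symm 1 else 0
  have hvφ : ∀ y ∈ φ.source, mvfderiv 𝓘(ℂ) φ y (v y) = 1 := fun y hy => by
    simp only [v, dif_pos hy]
    exact hφ.mvfderiv_symm_apply hy 1
  refine ⟨v, fun y hy => ContMDiffAt.contMDiffWithinAt ((hφ.holAt_iff hy v).2 ?_), hvφ⟩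
  refine (contMDiffAt_const (c := (1 : ℂ))).congr_of_eventuallyEq ?_
  filter_upwards [φ.open_source.mem_nhds hy] with q hq using hvφ q hq

variable
  {P : Type*} [TopologicalSpace P] [ChartedSpace (ℂ × ℂ) P] [IsManifold 𝓘(ℂ, ℂ × ℂ) ω P]
  {γ : P → X} {H : ∀ p : P, Submodule ℂ (TangentSpace 𝓘(ℂ, ℂ × ℂ) p)} {U : Set X} {ζ : P → CP1}
  {s : X → P}

/-- The projection along `H` alters `ds(v)` by a horizontal vector, on which the differential of a
flat coordinate is zero. -/
lemma IsFlatCoord.mvfderiv_verticalDifferential (h : IsFlatCoord γ H U ζ)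
    (hH : IsHolConnection γ H) {x : X} (hs : ContMDiffAt 𝓘(ℂ) 𝓘(ℂ, ℂ × ℂ) ω s x)
    (hsx : γ (s x) ∈ U) (hz : ζ (s x) ≠ CP1.infinity) (v : TangentSpace 𝓘(ℂ) x) :
    mvfderiv 𝓘(ℂ, ℂ × ℂ) (fun q => CP1.toC (ζ q)) (s x) (verticalDifferential hH s x v)
      = mvfderiv 𝓘(ℂ) (fun y => CP1.toC (ζ (s y))) x v := by
  have h1 := Submodule.sub_projection_mem (hH.isCompl (s x)) (mfderiv 𝓘(ℂ) 𝓘(ℂ, ℂ × ℂ) s x v)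
  have h2 := h.flat_of_ne hsx hz h1
  rw [map_sub, sub_eq_zero] at h2
  refine h2.symm.trans ?_
  exact (mvfderiv_comp_apply x ((h.contMDiffAt_toC hsx hz).mdifferentiableAt (by simp))
    (hs.mdifferentiableAt (by simp)) v).symm

/-- In a flat coordinate the order of vanishing of the vertical differential of a section is that of
the derivative of the section. -/
theorem IsFlatCoord.verticalDifferentialOrder_iff (h : IsFlatCoord γ H U ζ)
    (hH : IsHolConnection γ H) (hs : ContMDiff 𝓘(ℂ) 𝓘(ℂ, ℂ × ℂ) ω s) (hγs : ∀ x, γ (s x) = x)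
    {x : X} (hx : x ∈ U) (hz : ζ (s x) ≠ CP1.infinity) (n : ℕ∞) :
    VerticalDifferentialOrder hH s x n ↔
      analyticOrderAt (deriv ((fun y => CP1.toC (ζ (s y))) ∘ (chartAt ℂ x).symm))
        (chartAt ℂ x x) = n := by
  have hφ := isHolChart_chartAt (E := ℂ) x
  have hxφ := _root_.mem_chart_source ℂ x
  set φ := chartAt ℂ x with hφdef
  set g : X → ℂ := fun y => CP1.toC (ζ (s y)) with hg
  have hsU : ContMDiffOn 𝓘(ℂ) 𝓘(ℂ) ω (fun y => ζ (s y)) U := fun y hy =>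
    ((h.contMDiffAt (p := s y) (by rwa [hγs])).comp y (hs y)).contMDiffWithinAt
  have hU1 : IsOpen (U ∩ (fun y => ζ (s y)) ⁻¹' {p | p ≠ CP1.infinity}) :=
    hsU.continuousOn.isOpen_inter_preimage h.isOpen CP1.isOpen_ne_infinity
  set U1 := U ∩ (fun y => ζ (s y)) ⁻¹' {p | p ≠ CP1.infinity} with hU1def
  have hxU1 : x ∈ U1 := ⟨hx, hz⟩
  have hgh : ∀ y ∈ U1, ContMDiffAt 𝓘(ℂ) 𝓘(ℂ) ω g y := fun y hy =>
    ContMDiffAt.comp (g := CP1.toC) y (CP1.contMDiffAt_toC hy.2)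
      (hsU.contMDiffAt (h.isOpen.mem_nhds hy.1))
  have hV : IsOpen ((γ ⁻¹' U) ∩ ζ ⁻¹' {p | p ≠ CP1.infinity}) :=
    h.hol.continuousOn.isOpen_inter_preimage h.isOpen_preimage CP1.isOpen_ne_infinity
  have hVh : ContMDiffOn 𝓘(ℂ, ℂ × ℂ) 𝓘(ℂ) ω (fun q => CP1.toC (ζ q))
      ((γ ⁻¹' U) ∩ ζ ⁻¹' {p | p ≠ CP1.infinity}) := fun p hp =>
    (h.contMDiffAt_toC hp.1 hp.2).contMDiffWithinAt
  have hsV : ∀ y ∈ U1, s y ∈ (γ ⁻¹' U) ∩ ζ ⁻¹' {p | p ≠ CP1.infinity} := fun y hy =>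
    ⟨by rw [mem_preimage, hγs]; exact hy.1, hy.2⟩
  have hnear : ∀ {V : Set X}, IsOpen V → x ∈ V → ∀ᶠ t in 𝓝 (φ x), φ.symm t ∈ V ∧ t ∈ φ.target := by
    intro V hV hxV
    have h1 : ∀ᶠ t in 𝓝 (φ x), φ.symm t ∈ V := by
      have := (φ.symm.continuousAt (φ.map_source hxφ)).tendsto
      rw [φ.left_inv hxφ] at this
      exact this.eventually (hV.mem_nhds hxV)
    exact h1.and (φ.open_target.mem_nhds (φ.map_source hxφ))
  have hder : ∀ y ∈ U1, y ∈ φ.source → ∀ v : TangentSpace 𝓘(ℂ) y,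
      mvfderiv 𝓘(ℂ) g y v = deriv (g ∘ φ.symm) (φ y) * mvfderiv 𝓘(ℂ) φ y v := fun y hy hyφ v =>
    (mvfderiv_eq_deriv_mul hφ hyφ ((hgh y hy).mdifferentiableAt (by simp)) v).2
  have han : ∀ {f : X → ℂ}, ContMDiffAt 𝓘(ℂ) 𝓘(ℂ) ω f x → AnalyticAt ℂ (f ∘ φ.symm) (φ x) :=
    fun hf => (contDiffAt_comp_symm hφ hxφ hf).analyticAt
  have hgd : AnalyticAt ℂ (deriv (g ∘ φ.symm)) (φ x) := (han (hgh x hxU1)).deriv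
  constructor
  · rintro ⟨W, hW, hxW, v, w, f, hv, hv0, hw, hw0, hf, hvw, hord⟩
    -- `V'` and `W'` compare the given frames of `TX` and `s^* T_γ` with those of the coordinates.
    -- They are units at `x` and do not affect the order.
    set V' : X → ℂ := fun y => mvfderiv 𝓘(ℂ) φ y (v y) with hV'
    set W' : X → ℂ := fun y => mvfderiv 𝓘(ℂ, ℂ × ℂ) (fun q => CP1.toC (ζ q)) (s y) (w y) with hW'
    have aV : ContMDiffAt 𝓘(ℂ) 𝓘(ℂ) ω V' x :=
      (hφ.holAt_iff hxφ v).1 (hv.contMDiffAt (hW.mem_nhds hxW))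
    have aW : ContMDiffAt 𝓘(ℂ) 𝓘(ℂ) ω W' x :=
      contMDiffAt_mvfderiv_along (hw.contMDiffAt (hW.mem_nhds hxW)) hV (hsV x hxU1) hVh
    have hV0 : V' x ≠ 0 := fun h0 => hv0 x hxW (hφ.mvfderiv_injective hxφ (by rw [map_zero]; exact h0))
    have hW0 : W' x ≠ 0 := fun h0 => (hw0 x hxW).2 <| by
      refine h.eq_of_mfderiv_eq (A := 1) (by rw [hγs]; exact hx) IsSO.one
        (by rw [CP1.act_one]; exact hz) ?_ ?_
      · rw [map_zero]; exact (hw0 x hxW).1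
      · simp only [CP1.act_one]
        rw [map_zero]; exact h0
    have heq : (deriv (g ∘ φ.symm)) * (V' ∘ φ.symm) =ᶠ[𝓝 (φ x)] (f ∘ φ.symm) * (W' ∘ φ.symm) := by
      filter_upwards [hnear (hU1.inter hW) ⟨hxU1, hxW⟩] with t ht
      obtain ⟨⟨hy1, hy2⟩, ht⟩ := ht
      have e1 := h.mvfderiv_verticalDifferential hH (hs (φ.symm t))
        (by rw [hγs]; exact hy1.1) hy1.2 (v (φ.symm t))
      rw [hvw _ hy2, map_smul, smul_eq_mul] at e1
      have e2 := hder _ hy1 (φ.map_target ht) (v (φ.symm t))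
      rw [φ.right_inv ht] at e2
      exact (e1.trans e2).symm
    have h1 := analyticOrderAt_congr heq
    rw [analyticOrderAt_mul hgd (han aV),
      analyticOrderAt_mul (han (hf.contMDiffAt (hW.mem_nhds hxW))) (han aW),
      (han aV).analyticOrderAt_eq_zero.2 (by simpa [φ.left_inv hxφ] using hV0),
      (han aW).analyticOrderAt_eq_zero.2 (by simpa [φ.left_inv hxφ] using hW0), add_zero,
      add_zero] at h1
    rw [h1]; exact hord
  · intro hord
    -- For the converse the coordinate frames are used: `![1, 0, 0]` is `∂_z`, and relative to `∂_t`
    -- and `∂_z` the homomorphism is multiplication by the derivative itself.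
    have hψ : ∀ p, ∃ η : TangentSpace 𝓘(ℂ, ℂ × ℂ) p,
        γ p ∈ U → IsStdAt γ ζ ![1, 0, 0] p η := fun p => by
      by_cases hp : γ p ∈ U
      · obtain ⟨ψ, hψ⟩ := h.exists_stdMap hp
        exact ⟨_, fun _ => hψ _⟩
      · exact ⟨0, fun h => absurd h hp⟩
    choose η hη using hψ
    have hηd : ∀ y ∈ U1,
        mvfderiv 𝓘(ℂ, ℂ × ℂ) (fun q => CP1.toC (ζ q)) (s y) (η (s y)) = 1 := fun y hy => by
      rw [((h.isStdAt_iff (by rw [hγs]; exact hy.1) hy.2).1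
        (hη (s y) (by rw [hγs]; exact hy.1))).2]
      simp [quad]
    obtain ⟨v, hv, hvφ⟩ := hφ.exists_coordField
    refine ⟨U1 ∩ φ.source, hU1.inter φ.open_source, ⟨hxU1, hxφ⟩, v, fun y => η (s y),
      fun y => deriv (g ∘ φ.symm) (φ y), ?_, ?_, ?_, ?_, ?_, ?_, ?_⟩
    · exact hv.mono inter_subset_right
    · intro y hy h0
      have := hvφ y hy.2
      rw [h0, map_zero] at this
      exact zero_ne_one this
    · intro y hy
      have hyU : γ (s y) ∈ U := by rw [hγs]; exact hy.1.1
      have h1 := h.contMDiffAt_of_isStdAt hyU (a := fun _ => ![1, 0, 0])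
        (fun i => contMDiffAt_const) (ξ := η) (by
          filter_upwards [h.isOpen_preimage.mem_nhds hyU] with q hq using hη q hq)
      exact (h1.comp y (hs y)).contMDiffWithinAt
    · intro y hy
      refine ⟨(hη (s y) (by rw [hγs]; exact hy.1.1)).1, fun h0 => ?_⟩
      have := hηd y hy.1
      have h0 : η (s y) = 0 := h0
      rw [h0, map_zero] at this
      exact zero_ne_one this
    · intro y hy
      have h1 : ContDiffAt ℂ ω (g ∘ φ.symm) (φ y) := contDiffAt_comp_symm hφ hy.2 (hgh y hy.1)
      have h2 : ContDiffAt ℂ ω (deriv (g ∘ φ.symm)) (φ y) := h1.analyticAt.deriv.contDiffAt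
      exact (ContMDiffAt.comp (g := deriv (g ∘ φ.symm)) y h2.contMDiffAt
        (hφ.contMDiffAt hy.2)).contMDiffWithinAt
    · intro y hy
      have hyU : γ (s y) ∈ U := by rw [hγs]; exact hy.1.1
      refine h.eq_of_mfderiv_eq (A := 1) hyU IsSO.one (by rw [CP1.act_one]; exact hy.1.2) ?_ ?_
      · have h1 := Submodule.projection_apply_mem (hH.isCompl (s y))
          (mfderiv 𝓘(ℂ) 𝓘(ℂ, ℂ × ℂ) s y (v y))
        rw [map_smul, (hη (s y) hyU).1, smul_zero]
        exact h1
      · simp only [CP1.act_one]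
        rw [h.mvfderiv_verticalDifferential hH (hs y) hyU hy.1.2, map_smul, hηd y hy.1,
          hder y hy.1 hy.2, hvφ y hy.2, smul_eq_mul]
    · rw [← hord]
      refine analyticOrderAt_congr ?_
      filter_upwards [hnear isOpen_univ (mem_univ x)] with t ht
      change deriv (g ∘ φ.symm) (φ (φ.symm t)) = deriv (g ∘ φ.symm) t
      rw [φ.right_inv ht.2]

end Divisor

/-! ### Flat frames and local models -/

section Frames

variable {X : Type u} [TopologicalSpace X] [ChartedSpace ℂ X] [IsManifold 𝓘(ℂ) ω X] {S : Finset X}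

lemma SO3Bundle.finrank_eq (𝒲 : SO3Bundle X) (x : X) : Module.finrank ℂ (𝒲.W x) = 3 := by
  have e := (trivializationAt (Fin 3 → ℂ) 𝒲.W x).linearEquivAt ℂ x
    (FiberBundle.mem_baseSet_trivializationAt' x)
  rw [e.finrank_eq]
  simp

instance (𝒲 : SO3Bundle X) (x : X) : FiniteDimensional ℂ (𝒲.W x) :=
  FiniteDimensional.of_finrank_pos (by rw [𝒲.finrank_eq]; norm_num)

namespace SO3Bundle

variable {𝒲 : SO3Bundle X}

/-- The linear combinations of three sections at a point. -/
def comb (b : Fin 3 → ∀ x, 𝒲.W x) (x : X) : (Fin 3 → ℂ) →ₗ[ℂ] 𝒲.W x :=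
  Fintype.linearCombination ℂ (fun i => b i x)

lemma comb_apply (b : Fin 3 → ∀ x, 𝒲.W x) (x : X) (w : Fin 3 → ℂ) :
    comb b x w = ∑ i, w i • b i x := rfl

lemma comb_single (b : Fin 3 → ∀ x, 𝒲.W x) (x : X) (i : Fin 3) :
    comb b x (Pi.single i 1) = b i x := by
  simp [comb_apply, Pi.single_apply]

lemma Hol.mono {σ : ∀ x, 𝒲.W x} {U V : Set X} (h : 𝒲.Hol σ U) (hV : V ⊆ U) : 𝒲.Hol σ V :=
  ContMDiffOn.mono h hV

lemma hol_comb {b : Fin 3 → ∀ x, 𝒲.W x} {U : Set X} (hb : ∀ i, 𝒲.Hol (b i) U)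
    {a : X → Fin 3 → ℂ} (ha : ∀ i, ContMDiffOn 𝓘(ℂ) 𝓘(ℂ) ω (a · i) U) :
    𝒲.Hol (fun x => comb b x (a x)) U := by
  have h := ContMDiffOn.sum_section (s := Finset.univ) (fun i _ => (ha i).smul_section (hb i))
  refine h.congr fun x _ => ?_
  rfl

end SO3Bundle

open SO3Bundle

/-- A frame that identifies `B` with the Killing form. -/
structure IsKillingFrame (𝒲 : SO3Bundle X) (U : Set X) (b : Fin 3 → ∀ x, 𝒲.W x) : Prop where
  isOpen : IsOpen U
  hol : ∀ i, 𝒲.Hol (b i) U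
  killing_eq : ∀ x ∈ U, ∀ w w', 𝒲.B x (comb b x w) (comb b x w') = killing w w'

namespace IsKillingFrame

variable {𝒲 : SO3Bundle X} {U : Set X} {b : Fin 3 → ∀ x, 𝒲.W x}

lemma mono (h : IsKillingFrame 𝒲 U b) {V : Set X} (hV : IsOpen V) (hVU : V ⊆ U) :
    IsKillingFrame 𝒲 V b := ⟨hV, fun i => (h.hol i).mono hVU, fun x hx => h.killing_eq x (hVU hx)⟩

lemma comb_injective (h : IsKillingFrame 𝒲 U b) {x : X} (hx : x ∈ U) :
    Function.Injective (comb b x) := by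
  rw [injective_iff_map_eq_zero]
  intro w hw
  refine killing_nondegenerate fun w' => ?_
  rw [← h.killing_eq x hx, hw, map_zero, LinearMap.zero_apply]

/-- The coordinates of a vector in a frame. -/
def equiv (h : IsKillingFrame 𝒲 U b) {x : X} (hx : x ∈ U) : (Fin 3 → ℂ) ≃ₗ[ℂ] 𝒲.W x :=
  (comb b x).linearEquivOfInjective (h.comb_injective hx) (by rw [𝒲.finrank_eq]; simp)

lemma equiv_apply (h : IsKillingFrame 𝒲 U b) {x : X} (hx : x ∈ U) (w : Fin 3 → ℂ) :
    h.equiv hx w = comb b x w := rfl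

lemma comb_surjective (h : IsKillingFrame 𝒲 U b) {x : X} (hx : x ∈ U) (a : 𝒲.W x) :
    ∃ w, comb b x w = a := (h.equiv hx).surjective a

/-- Coordinates in a Killing frame are pairings with the dual basis. Their holomorphy and their
derivatives can therefore be read off from those of `B`. -/
lemma coef_eq (h : IsKillingFrame 𝒲 U b) {x : X} (hx : x ∈ U) {a : 𝒲.W x} {w : Fin 3 → ℂ}
    (hw : comb b x w = a) :
    w = ![-4⁻¹ * 𝒲.B x a (b 2 x), 2⁻¹ * 𝒲.B x a (b 1 x), -4⁻¹ * 𝒲.B x a (b 0 x)] := by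
  rw [← hw, ← comb_single b x 0, ← comb_single b x 1, ← comb_single b x 2, h.killing_eq x hx,
    h.killing_eq x hx, h.killing_eq x hx]
  ext i
  fin_cases i <;> simp [killing_apply]

/-- The coordinates of a section. -/
def coef (𝒲 : SO3Bundle X) (b : Fin 3 → ∀ x, 𝒲.W x) (σ : ∀ x, 𝒲.W x) (x : X) : Fin 3 → ℂ :=
  ![-4⁻¹ * 𝒲.B x (σ x) (b 2 x), 2⁻¹ * 𝒲.B x (σ x) (b 1 x), -4⁻¹ * 𝒲.B x (σ x) (b 0 x)]

lemma comb_coef (h : IsKillingFrame 𝒲 U b) {x : X} (hx : x ∈ U) (σ : ∀ x, 𝒲.W x) :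
    comb b x (coef 𝒲 b σ x) = σ x := by
  obtain ⟨w, hw⟩ := h.comb_surjective hx (σ x)
  rw [coef, ← h.coef_eq hx hw, hw]

lemma contMDiffOn_coef (h : IsKillingFrame 𝒲 U b) {σ : ∀ x, 𝒲.W x} (hσ : 𝒲.Hol σ U) (i : Fin 3) :
    ContMDiffOn 𝓘(ℂ) 𝓘(ℂ) ω (coef 𝒲 b σ · i) U := by
  have hB := fun j => 𝒲.B_holomorphic U h.isOpen σ (b j) hσ (h.hol j)
  fin_cases i
  · exact contMDiffOn_const.mul (hB 2)
  · exact contMDiffOn_const.mul (hB 1)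
  · exact contMDiffOn_const.mul (hB 0)

end IsKillingFrame

lemma finrank_ker_killing {n : Fin 3 → ℂ} (hn : n ≠ 0) :
    Module.finrank ℂ (LinearMap.ker (killing.flip n)) = 2 := by
  have h0 : killing.flip n ≠ 0 := fun h => hn <| killing_nondegenerate fun b => by
    rw [killing_comm]
    exact congrArg (fun L : (Fin 3 → ℂ) →ₗ[ℂ] ℂ => L b) h
  have h1 := Module.Dual.finrank_ker_add_one_of_ne_zero (K := ℂ) h0
  have h2 : Module.finrank ℂ (Fin 3 → ℂ) = 3 := by simp
  omega

lemma IsHolSubbundle.finrank_eq {𝒲 : SO3Bundle X} {k : ℕ} {L : ∀ x, Submodule ℂ (𝒲.W x)}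
    (h : IsHolSubbundle ℂ (Fin 3 → ℂ) k L) (x : X) : Module.finrank ℂ (L x) = k := by
  obtain ⟨U, -, hx, e, -, he⟩ := h x
  rw [← (he x hx).2, finrank_span_eq_card (he x hx).1]
  simp

/-- A flat frame that identifies `B` with the Killing form. -/
structure IsFlatFrame (O : BranchedOper X S) (U : Set X) (b : Fin 3 → ∀ x, O.bundle.W x) : Prop
    extends IsKillingFrame O.bundle U b where
  flat : ∀ i, ∀ x ∈ U, ∀ v, O.connection.D (b i) x v = 0

namespace IsFlatFrame

variable {O : BranchedOper X S} {U : Set X} {b : Fin 3 → ∀ x, O.bundle.W x}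

lemma mono (h : IsFlatFrame O U b) {V : Set X} (hV : IsOpen V) (hVU : V ⊆ U) :
    IsFlatFrame O V b := ⟨h.toIsKillingFrame.mono hV hVU, fun i x hx => h.flat i x (hVU hx)⟩

/-- In a flat frame the connection is the derivative of the coordinates. -/
lemma D_eq (h : IsFlatFrame O U b) {σ : ∀ x, O.bundle.W x} (hσ : O.bundle.Hol σ U) {x : X}
    (hx : x ∈ U) (v : TangentSpace 𝓘(ℂ) x) :
    O.connection.D σ x v = comb b x fun i =>
      mvfderiv 𝓘(ℂ) (IsKillingFrame.coef O.bundle b σ · i) x v := by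
  obtain ⟨w, hw⟩ := h.comb_surjective hx (O.connection.D σ x v)
  rw [← hw, h.coef_eq hx hw]
  congr 1
  -- Since `D` preserves `B` and the frame is flat, differentiating a pairing with a frame vector
  -- only differentiates `σ`.
  have hB : ∀ j, O.bundle.B x (O.connection.D σ x v) (b j x)
      = mvfderiv 𝓘(ℂ) (fun y => O.bundle.B y (σ y) (b j y)) x v := fun j => by
    rw [O.connection.D_B U h.isOpen σ (b j) hσ (h.hol j) x hx v, h.flat j x hx, map_zero, add_zero]
  have hd : ∀ j, MDifferentiableAt 𝓘(ℂ) 𝓘(ℂ) (fun y => O.bundle.B y (σ y) (b j y)) x := fun j =>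
    ((O.bundle.B_holomorphic U h.isOpen σ (b j) hσ (h.hol j)).contMDiffAt
      (h.isOpen.mem_nhds hx)).mdifferentiableAt (by simp)
  have hc : ∀ (c : ℂ) j, mvfderiv 𝓘(ℂ) (fun y => c * O.bundle.B y (σ y) (b j y)) x v
      = c * O.bundle.B x (O.connection.D σ x v) (b j x) := fun c j => by
    rw [hB]
    exact mvfderiv_clm_comp (c • ContinuousLinearMap.id ℂ ℂ) (hd j) v
  ext i
  fin_cases i
  · exact (hc _ 2).symm
  · exact (hc _ 1).symm
  · exact (hc _ 0).symm

/-- In a frame in which `F₁` is spanned by `n`, the subbundle `F₂` is the orthogonal of `n`. -/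
lemma comb_mem_F₂ (h : IsFlatFrame O U b) {x : X} (hx : x ∈ U) {n : Fin 3 → ℂ} (hn : n ≠ 0)
    (hF : comb b x n ∈ O.filtration.F₁ x) (w : Fin 3 → ℂ) :
    comb b x w ∈ O.filtration.F₂ x ↔ killing w n = 0 := by
  have hle : (O.filtration.F₂ x).comap (h.equiv hx).toLinearMap
      ≤ LinearMap.ker (killing.flip n) := fun w hw => by
    have h2 := O.filtration.orthogonal x _ hF _ hw
    change killing w n = 0
    rw [killing_comm, ← h.killing_eq x hx]
    exact h2
  have heq := Submodule.eq_of_le_of_finrank_eq hle (by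
    rw [finrank_ker_killing hn, ← O.filtration.F₂_subbundle.finrank_eq x]
    exact ((h.equiv hx).ofSubmodule' (O.filtration.F₂ x)).finrank_eq)
  exact SetLike.ext_iff.1 heq w

end IsFlatFrame

/-- Flat coordinates on the projective bundle and a flat frame of the oper in which the map `ψ` to
vertical vector fields, the filtration and the section have their normal forms. -/
structure LocalModel (T : BranchedTriple X S) (O : BranchedOper X S)
    (ψ : ∀ p : T.P, O.bundle.W (T.γ p) →ₗ[ℂ] TangentSpace 𝓘(ℂ, ℂ × ℂ) p) (U : Set X)
    (ζ : T.P → CP1) (b : Fin 3 → ∀ x, O.bundle.W x) : Prop where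
  coord : IsFlatCoord T.γ T.H U ζ
  frame : IsFlatFrame O U b
  std : ∀ p, T.γ p ∈ U → ∀ w, IsStdAt T.γ ζ w p (ψ p (comb b (T.γ p) w))
  filt : ∀ x ∈ U, ∀ w, comb b x w ∈ O.filtration.F₁ x ↔ ∃ c : ℂ, w = c • CP1.nul (ζ (T.s x))

lemma IsFibreCoord.eq_zero_of_isStdAt {P : Type*} [TopologicalSpace P] [ChartedSpace (ℂ × ℂ) P]
    {γ : P → X} {U : Set X} {ζ : P → CP1} (h : IsFibreCoord γ U ζ) {x : X} (hx : x ∈ U)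
    {w : Fin 3 → ℂ} (hw : ∀ p, γ p = x → IsStdAt γ ζ w p 0) : w = 0 := by
  obtain ⟨σ, -, hσ, -⟩ := h.exists_inv
  have hq : ∀ z : ℂ, quad w z = 0 := fun z => by
    obtain ⟨e1, e2⟩ := hσ x hx (CP1.ofComplex z)
    have h1 := (hw (σ (x, CP1.ofComplex z)) e1)
    have h2 := ((h.isStdAt_iff (by rw [e1]; exact hx)
      (by rw [e2]; exact CP1.ofComplex_ne_infinity z)).1 h1).2
    rw [map_zero, e2, CP1.toC_ofComplex] at h2
    exact h2.symm
  have h0 := hq 0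
  have h1 := hq 1
  have h2 := hq (-1)
  simp [quad] at h0 h1 h2
  ext i
  fin_cases i
  · exact h0
  · change w 1 = 0
    linear_combination (h1 - h2) / 2
  · change w 2 = 0
    linear_combination (h1 + h2) / 2 - h0

namespace LocalModel

variable {T : BranchedTriple X S} {O : BranchedOper X S}
  {ψ : ∀ p : T.P, O.bundle.W (T.γ p) →ₗ[ℂ] TangentSpace 𝓘(ℂ, ℂ × ℂ) p} {U : Set X}
  {ζ : T.P → CP1} {b : Fin 3 → ∀ x, O.bundle.W x}

lemma mono (h : LocalModel T O ψ U ζ b) {V : Set X} (hV : IsOpen V) (hVU : V ⊆ U) :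
    LocalModel T O ψ V ζ b :=
  ⟨h.coord.mono hV hVU, h.frame.mono hV hVU, fun p hp => h.std p (hVU hp),
    fun x hx => h.filt x (hVU hx)⟩

lemma comb_mem_F₂ (h : LocalModel T O ψ U ζ b) {x : X} (hx : x ∈ U) (w : Fin 3 → ℂ) :
    comb b x w ∈ O.filtration.F₂ x ↔ killing w (CP1.nul (ζ (T.s x))) = 0 :=
  h.frame.comb_mem_F₂ hx (CP1.nul_ne_zero _) ((h.filt x hx _).2 ⟨1, (one_smul _ _).symm⟩) w

lemma isStdAt_coef (h : LocalModel T O ψ U ζ b) (σ : ∀ x, O.bundle.W x) {p : T.P}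
    (hp : T.γ p ∈ U) :
    IsStdAt T.γ ζ (IsKillingFrame.coef O.bundle b σ (T.γ p)) p (ψ p (σ (T.γ p))) := by
  have := h.std p hp (IsKillingFrame.coef O.bundle b σ (T.γ p))
  rwa [h.frame.comb_coef hp] at this

/-- A vector of `W` over `x` is determined by the vector field it defines on the fibre over `x`.
This is what makes local constructions glue. -/
lemma eq_of_forall (h : LocalModel T O ψ U ζ b) {x : X} (hx : x ∈ U) {σ τ : ∀ x, O.bundle.W x}
    (hστ : ∀ p, T.γ p = x → ψ p (σ (T.γ p)) = ψ p (τ (T.γ p))) : σ x = τ x := by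
  have h0 : IsKillingFrame.coef O.bundle b (fun x => σ x - τ x) x = 0 := by
    refine h.coord.eq_zero_of_isStdAt hx fun p hp => ?_
    subst hp
    have h1 := h.isStdAt_coef (fun x => σ x - τ x) hx
    rwa [map_sub, hστ p rfl, sub_self] at h1
  have h1 := h.frame.comb_coef hx (fun x => σ x - τ x)
  rw [h0, map_zero] at h1
  exact (sub_eq_zero.1 h1.symm)

end LocalModel

end Frames

/-! ### Associated opers in terms of local models -/

section Associated

open SO3Bundle

variable {X : Type u} [TopologicalSpace X] [ChartedSpace ℂ X] [IsManifold 𝓘(ℂ) ω X] {S : Finset X}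
  {T : BranchedTriple X S} {O : BranchedOper X S}
  {ψ : ∀ p : T.P, O.bundle.W (T.γ p) →ₗ[ℂ] TangentSpace 𝓘(ℂ, ℂ × ℂ) p}

/-- The Lie bracket transported by a linear equivalence. -/
def brkOf {W : Type*} [AddCommGroup W] [Module ℂ W] (e : (Fin 3 → ℂ) ≃ₗ[ℂ] W) : W →ₗ[ℂ] W →ₗ[ℂ] W :=
  (brk.compl₁₂ e.symm.toLinearMap e.symm.toLinearMap).compr₂ e.toLinearMap

lemma brkOf_apply {W : Type*} [AddCommGroup W] [Module ℂ W] (e : (Fin 3 → ℂ) ≃ₗ[ℂ] W) (a b : W) :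
    brkOf e a b = e (brk (e.symm a) (e.symm b)) := rfl

lemma trace_of_bracket {W : Type*} [AddCommGroup W] [Module ℂ W] (e : (Fin 3 → ℂ) ≃ₗ[ℂ] W)
    {ad : W →ₗ[ℂ] W →ₗ[ℂ] W} (h : ∀ w w', ad (e w) (e w') = e (brk w w')) (w w' : Fin 3 → ℂ) :
    LinearMap.trace ℂ W (ad (e w) ∘ₗ ad (e w')) = killing w w' := by
  rw [killing_eq_trace, ← LinearMap.trace_conj' (brk w ∘ₗ brk w') e]
  congr 1
  refine LinearMap.ext fun a => ?_
  obtain ⟨a, rfl⟩ := e.surjective a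
  simp [LinearEquiv.conj_apply, h]

namespace LocalModel

variable {U : Set X} {ζ : T.P → CP1} {b : Fin 3 → ∀ x, O.bundle.W x}

lemma eventually_mem (h : LocalModel T O ψ U ζ b) {p : T.P} (hp : T.γ p ∈ U) :
    ∀ᶠ q in 𝓝 p, T.γ q ∈ U := h.coord.isOpen_preimage.mem_nhds hp

lemma holAt_field (h : LocalModel T O ψ U ζ b) {w : ∀ x, O.bundle.W x} (hw : O.bundle.Hol w U)
    {p : T.P} (hp : T.γ p ∈ U) :
    ContMDiffAt 𝓘(ℂ, ℂ × ℂ) (𝓘(ℂ, ℂ × ℂ).prod 𝓘(ℂ, ℂ × ℂ)) ω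
      (fun q => TotalSpace.mk' (ℂ × ℂ) (E := fun q : T.P => TangentSpace 𝓘(ℂ, ℂ × ℂ) q) q
        (ψ q (w (T.γ q)))) p :=
  h.coord.contMDiffAt_of_isStdAt hp
    (fun i => (h.frame.contMDiffOn_coef hw i).contMDiffAt (h.coord.isOpen.mem_nhds hp))
    ((h.eventually_mem hp).mono fun _ hq => h.isStdAt_coef w hq)

lemma isStdAt_field_mlieBracket (h : LocalModel T O ψ U ζ b) {α β : ∀ x, O.bundle.W x}
    (hα : O.bundle.Hol α U) (hβ : O.bundle.Hol β U) {p : T.P} (hp : T.γ p ∈ U) :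
    VectorField.mlieBracket 𝓘(ℂ, ℂ × ℂ) (fun q => ψ q (α (T.γ q))) (fun q => ψ q (β (T.γ q))) p
      = ψ p (brkOf (h.frame.equiv hp) (α (T.γ p)) (β (T.γ p))) := by
  have hc := fun {w : ∀ x, O.bundle.W x} (hw : O.bundle.Hol w U) i =>
    (h.frame.contMDiffOn_coef hw i).contMDiffAt (h.coord.isOpen.mem_nhds hp)
  have h1 := h.coord.isStdAt_mlieBracket hp (hc hα) (hc hβ)
    ((h.eventually_mem hp).mono fun _ hq => h.isStdAt_coef α hq)
    ((h.eventually_mem hp).mono fun _ hq => h.isStdAt_coef β hq)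
  refine h.coord.isStdAt_unique hp h1 ?_
  have hsymm : ∀ σ : ∀ y, O.bundle.W y, (h.frame.equiv hp).symm (σ (T.γ p))
      = IsKillingFrame.coef O.bundle b σ (T.γ p) := fun σ => by
    rw [LinearEquiv.symm_apply_eq]
    exact (h.frame.comb_coef hp σ).symm
  rw [brkOf_apply, hsymm, hsymm]
  exact h.std p hp _

lemma field_D (h : LocalModel T O ψ U ζ b) {w : ∀ x, O.bundle.W x} (hw : O.bundle.Hol w U)
    {v : ∀ x : X, TangentSpace 𝓘(ℂ) x} (hv : HolVectorField v U)
    {η : ∀ p : T.P, TangentSpace 𝓘(ℂ, ℂ × ℂ) p} (hη : T.IsHorizontalLift v η U) {p : T.P}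
    (hp : T.γ p ∈ U) :
    ψ p (O.connection.D w (T.γ p) (v (T.γ p)))
      = VectorField.mlieBracket 𝓘(ℂ, ℂ × ℂ) η (fun q => ψ q (w (T.γ q))) p := by
  have h1 := h.coord.toIsFibreCoord.isStdAt_mlieBracket_horizontal hp
    (fun i => (h.frame.contMDiffOn_coef hw i).contMDiffAt (h.coord.isOpen.mem_nhds hp))
    h.coord.isOpen hp hv (η := η) (by
      filter_upwards [h.eventually_mem hp] with q hq
      exact ⟨(hη q hq).2, fun A hA hz => h.coord.flat q hq _ (hη q hq).1 A hA hz⟩)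
    ((h.eventually_mem hp).mono fun _ hq => h.isStdAt_coef w hq)
  refine h.coord.isStdAt_unique hp ?_ h1
  rw [h.frame.D_eq hw hp]
  exact h.std p hp _

lemma mem_F₁_of_vanishesAlong (h : LocalModel T O ψ U ζ b) {w : ∀ x, O.bundle.W x} {x : X}
    (hx : x ∈ U) (hv : T.VanishesAlong 2 (fun q => ψ q (w (T.γ q))) x) :
    w x ∈ O.filtration.F₁ x := by
  rw [← h.frame.comb_coef hx w, h.filt x hx]
  refine BranchedTriple.exists_smul_nul_of_vanishesAlong h.coord.toIsFibreCoord hx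
    (fun p hp => ?_) hv
  subst hp
  exact h.isStdAt_coef w hx

lemma mem_F₂_of_vanishesAlong (h : LocalModel T O ψ U ζ b) {w : ∀ x, O.bundle.W x} {x : X}
    (hx : x ∈ U) (hv : T.VanishesAlong 1 (fun q => ψ q (w (T.γ q))) x) :
    w x ∈ O.filtration.F₂ x := by
  rw [← h.frame.comb_coef hx w, h.comb_mem_F₂ hx]
  refine BranchedTriple.killing_eq_zero_of_vanishesAlong hx (fun p hp => ?_) hv
  subst hp
  exact h.isStdAt_coef w hx

lemma vanishesAlong_of_mem_F₁ (h : LocalModel T O ψ U ζ b) {w : ∀ x, O.bundle.W x}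
    (hw : O.bundle.Hol w U) {x : X} (hx : x ∈ U) (hF : ∀ y ∈ U, w y ∈ O.filtration.F₁ y) :
    T.VanishesAlong 2 (fun q => ψ q (w (T.γ q))) x := by
  refine BranchedTriple.vanishesAlong_two h.coord.toIsFibreCoord hx (h.frame.contMDiffOn_coef hw)
    (fun p hp => h.isStdAt_coef w hp) fun y hy => ?_
  rw [← h.filt y hy, h.frame.comb_coef hy]
  exact hF y hy

lemma vanishesAlong_of_mem_F₂ (h : LocalModel T O ψ U ζ b) {w : ∀ x, O.bundle.W x}
    (hw : O.bundle.Hol w U) {x : X} (hx : x ∈ U) (hF : ∀ y ∈ U, w y ∈ O.filtration.F₂ y) :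
    T.VanishesAlong 1 (fun q => ψ q (w (T.γ q))) x := by
  refine BranchedTriple.vanishesAlong_one h.coord.toIsFibreCoord hx (h.frame.contMDiffOn_coef hw)
    (fun p hp => h.isStdAt_coef w hp) fun y hy => ?_
  rw [← h.comb_mem_F₂ hy, h.frame.comb_coef hy]
  exact hF y hy

lemma exists_section (h : LocalModel T O ψ U ζ b) {ξ : ∀ p : T.P, TangentSpace 𝓘(ℂ, ℂ × ℂ) p}
    (hξ : T.HolRelField ξ (T.γ ⁻¹' U)) :
    ∃ w, O.bundle.Hol w U ∧ ∀ p, T.γ p ∈ U → ψ p (w (T.γ p)) = ξ p := by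
  obtain ⟨a, ha, has⟩ := h.coord.exists_isStdAt hξ.1 hξ.2
  exact ⟨fun y => comb b y (a y), hol_comb h.frame.hol ha, fun p hp =>
    h.coord.isStdAt_unique hp (h.std p hp _) (has p hp)⟩

end LocalModel

/-- An oper with local models is associated with the projective structure. -/
theorem isAssociatedOper_of_localModels
    (h : ∀ x, ∃ U ζ b, x ∈ U ∧ LocalModel T O ψ U ζ b) : T.IsAssociatedOper O := by
  choose U ζ b hxU hm using h
  have hmo : ∀ {U' : Set X}, IsOpen U' → ∀ x, LocalModel T O ψ (U x ∩ U') (ζ x) (b x) :=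
    fun hU' x => (hm x).mono ((hm x).coord.isOpen.inter hU') inter_subset_left
  -- The bracket on the fibre over `x` is transported by the frame chosen at `x`. No agreement
  -- between different frames is needed, because each identity at `p` is checked in the model at `γ
  -- p`.
  refine ⟨ψ, fun x => brkOf ((hm x).frame.equiv (hxU x)), fun U' hU' => ⟨fun w hw => ?_,
    fun w hw h0 x hx => ?_, fun ξ hξ => ?_⟩, fun U' hU' α β hα hβ p hp => ?_, fun x α β => ?_,
    fun U' hU' w hw => ⟨⟨fun h x hx => ?_, fun h x hx => ?_⟩, ⟨fun h x hx => ?_, fun h x hx => ?_⟩⟩,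
    fun U' hU' v w η hv hw hη p hp => ?_⟩
  · refine ⟨fun p hp => ContMDiffAt.contMDiffWithinAt ?_, fun p hp => ?_⟩
    · exact (hmo hU' (T.γ p)).holAt_field (hw.mono inter_subset_right) ⟨hxU _, hp⟩
    · exact ((hm (T.γ p)).isStdAt_coef w (hxU _)).1
  · exact (hm x).eq_of_forall (hxU x) (σ := w) (τ := fun _ => 0) fun p hp =>
      (h0 p (by rw [hp]; exact hx)).trans (map_zero _).symm
  -- The sections found in the local models induce the same vector field, hence agree on overlaps,
  -- and the diagonal choice `w x x` is holomorphic.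
  · have hex := fun x => (hmo hU' x).exists_section (ξ := ξ)
      ⟨hξ.1.mono (preimage_mono inter_subset_right), fun p hp => hξ.2 p hp.2⟩
    choose w hw using hex
    refine ⟨fun x => w x x, fun x hx => ContMDiffAt.contMDiffWithinAt ?_, fun p hp =>
      (hw _).2 p ⟨hxU _, hp⟩⟩
    have ho := (hmo hU' x).coord.isOpen
    refine ((hw x).1.contMDiffAt (ho.mem_nhds ⟨hxU x, hx⟩)).congr_of_eventuallyEq ?_
    filter_upwards [ho.mem_nhds ⟨hxU x, hx⟩] with y hy
    refine congrArg (TotalSpace.mk' _ y) ?_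
    refine (hm y).eq_of_forall (hxU y) (σ := w y) (τ := w x) fun p hp => ?_
    subst hp
    rw [(hw _).2 p ⟨hxU _, hy.2⟩, (hw x).2 p hy]
  · exact ((hmo hU' (T.γ p)).isStdAt_field_mlieBracket (hα.mono inter_subset_right)
      (hβ.mono inter_subset_right) ⟨hxU _, hp⟩).symm
  · obtain ⟨w, rfl⟩ := ((hm x).frame.equiv (hxU x)).surjective α
    obtain ⟨w', rfl⟩ := ((hm x).frame.equiv (hxU x)).surjective β
    rw [trace_of_bracket _ (fun w w' => by simp [brkOf_apply])]
    exact (hm x).frame.killing_eq x (hxU x) w w'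
  · exact (hmo hU' x).vanishesAlong_of_mem_F₁ (hw.mono inter_subset_right) ⟨hxU x, hx⟩
      fun y hy => h y hy.2
  · exact (hm x).mem_F₁_of_vanishesAlong (hxU x) (h x hx)
  · exact (hmo hU' x).vanishesAlong_of_mem_F₂ (hw.mono inter_subset_right) ⟨hxU x, hx⟩
      fun y hy => h y hy.2
  · exact (hm x).mem_F₂_of_vanishesAlong (hxU x) (h x hx)
  · exact (hmo hU' (T.γ p)).field_D (hw.mono inter_subset_right) (hv.mono inter_subset_right)
      (fun q hq => hη q hq.2) ⟨hxU _, hp⟩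

/-- An associated oper has a local model for every flat coordinate. -/
theorem BranchedTriple.IsAssociatedOper.exists_localModel (h : T.IsAssociatedOper O) :
    ∃ ψ : ∀ p : T.P, O.bundle.W (T.γ p) →ₗ[ℂ] TangentSpace 𝓘(ℂ, ℂ × ℂ) p,
      ∀ U ζ, IsFlatCoord T.γ T.H U ζ → ∃ b, LocalModel T O ψ U ζ b := by
  obtain ⟨ψ, ad, hsec, hbr, htr, hfil, hcon⟩ := h
  refine ⟨ψ, fun U ζ hζ => ?_⟩
  have hU := hζ.isOpen
  have hΨ : ∀ p, ∃ Ψ : (Fin 3 → ℂ) →ₗ[ℂ] TangentSpace 𝓘(ℂ, ℂ × ℂ) p,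
      T.γ p ∈ U → ∀ w, IsStdAt T.γ ζ w p (Ψ w) := fun p => by
    by_cases hp : T.γ p ∈ U
    · obtain ⟨Ψ, hΨ⟩ := hζ.exists_stdMap hp
      exact ⟨Ψ, fun _ => hΨ⟩
    · exact ⟨0, fun h => absurd h hp⟩
  choose Ψ hΨ using hΨ
  have hev : ∀ {p : T.P}, T.γ p ∈ U → ∀ᶠ q in 𝓝 p, T.γ q ∈ U :=
    fun hp => (hU.preimage T.isBundle.1.continuous).mem_nhds hp
  -- The frame is the preimage of the fields `∂_z, z ∂_z, z² ∂_z` of the flat coordinate.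
  have hrel : ∀ i : Fin 3, T.HolRelField (fun p => Ψ p (Pi.single i 1)) (T.γ ⁻¹' U) := fun i =>
    ⟨fun p hp => (hζ.contMDiffAt_of_isStdAt (a := fun _ => Pi.single i 1) hp
      (fun j => contMDiffAt_const) ((hev hp).mono fun q hq => hΨ q hq _)).contMDiffWithinAt,
      fun p hp => (hΨ p hp _).1⟩
  choose b hb hbΨ using fun i => (hsec U hU).2.2 _ (hrel i)
  have hstd : ∀ p, T.γ p ∈ U → ∀ w, IsStdAt T.γ ζ w p (ψ p (comb b (T.γ p) w)) := fun p hp w => by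
    have : ψ p (comb b (T.γ p) w) = Ψ p w := by
      rw [comb_apply, map_sum, LinearMap.pi_apply_eq_sum_univ]
      refine Finset.sum_congr rfl fun i _ => ?_
      rw [map_smul]
      congr 1
      refine (hbΨ i p hp).trans ?_
      congr 1
      ext j
      simp [Pi.single_apply, eq_comm]
    rw [this]
    exact hΨ p hp w
  have hzero : ∀ x ∈ U, ∀ w, (∀ p, T.γ p = x → ψ p (comb b (T.γ p) w) = 0) → w = 0 :=
    fun x hx w h => hζ.eq_zero_of_isStdAt hx fun p hp => by
      rw [← h p hp]; exact hstd p (by rw [hp]; exact hx) w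
  have hinj : ∀ x ∈ U, Function.Injective (comb b x) := fun x hx => by
    rw [injective_iff_map_eq_zero]
    intro w hw
    refine hzero x hx w fun p hp => ?_
    subst hp
    rw [hw, map_zero]
  have e : ∀ x ∈ U, ∃ e : (Fin 3 → ℂ) ≃ₗ[ℂ] O.bundle.W x, ∀ w, e w = comb b x w := fun x hx =>
    ⟨(comb b x).linearEquivOfInjective (hinj x hx) (by rw [O.bundle.finrank_eq]; simp),
      fun _ => rfl⟩
  have heq : ∀ x ∈ U, ∀ (σ : ∀ y, O.bundle.W y) (w : Fin 3 → ℂ),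
      (∀ p, T.γ p = x → IsStdAt T.γ ζ w p (ψ p (σ (T.γ p)))) → σ x = comb b x w := by
    intro x hx σ w h
    obtain ⟨e, he⟩ := e x hx
    obtain ⟨w', hw'⟩ := e.surjective (σ x)
    rw [he] at hw'
    rw [← hw', sub_eq_zero.1 (hzero x hx (w' - w) fun p hp => ?_)]
    subst hp
    rw [map_sub, map_sub, hw', sub_eq_zero]
    exact hζ.isStdAt_unique hx (h p rfl) (hstd p hx w)
  have hcomb : ∀ w : Fin 3 → ℂ, O.bundle.Hol (fun x => comb b x w) U := fun w =>
    hol_comb hb (a := fun _ => w) fun i => contMDiffOn_const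
  -- `ad` and `brk` induce the same Lie bracket of vector fields, so they correspond under the
  -- frame, and their trace forms agree.
  have hkill : IsKillingFrame O.bundle U b := by
    refine ⟨hU, hb, fun x hx w w' => ?_⟩
    obtain ⟨e, he⟩ := e x hx
    rw [htr, ← he, ← he, trace_of_bracket]
    intro w w'
    rw [he, he, he]
    refine heq x hx (fun y => ad y (comb b y w) (comb b y w')) _ fun p hp => ?_
    subst hp
    have h1 := hbr U hU _ _ (hcomb w) (hcomb w') p hx
    dsimp only at h1 ⊢
    rw [h1]
    exact hζ.isStdAt_mlieBracket hx (a := fun _ => w) (b := fun _ => w')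
      (fun i => contMDiffAt_const) (fun i => contMDiffAt_const)
      ((hev hx).mono fun q hq => hstd q hq w) ((hev hx).mono fun q hq => hstd q hq w')
  refine ⟨b, hζ, ⟨hkill, fun i x hx v => ?_⟩, hstd, fun x hx w => ?_⟩
  -- Each frame vector has constant coefficients in the flat coordinate, so its Lie derivative along
  -- a horizontal lift is zero. Testing on a coordinate field is enough, because `TX` has rank one.
  · have hφ := isHolChart_chartAt (E := ℂ) x
    have hxφ := _root_.mem_chart_source ℂ x
    set φ := chartAt ℂ x
    obtain ⟨v₀, hv₀, hvφ⟩ := hφ.exists_coordField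
    obtain ⟨η, -, hη⟩ := T.isConnection.exists_horizontalLift T.isBundle.1 hφ
    have hUφ := hU.inter φ.open_source
    have hlift : T.IsHorizontalLift v₀ η (U ∩ φ.source) := fun p hp =>
      ⟨(hη p hp.2).1, hφ.mvfderiv_injective hp.2 ((hη p hp.2).2.trans (hvφ _ hp.2).symm)⟩
    have h1 := hcon (U ∩ φ.source) hUφ v₀ (b i) η (hv₀.mono inter_subset_right)
      ((hb i).mono inter_subset_left) hlift
    have h2 : O.connection.D (b i) x (v₀ x) = 0 := by
      refine (heq x hx (fun y => O.connection.D (b i) y (v₀ y)) 0 fun p hp => ?_).trans (map_zero _)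
      subst hp
      have h3 := h1 p ⟨hx, hxφ⟩
      dsimp only at h3 ⊢
      rw [h3]
      have h4 := hζ.toIsFibreCoord.isStdAt_mlieBracket_horizontal hx (a := fun _ => Pi.single i 1)
        (fun j => contMDiffAt_const) hUφ ⟨hx, hxφ⟩ (hv₀.mono inter_subset_right) (η := η)
        (ξ := fun q => ψ q (b i (T.γ q))) (by
          filter_upwards [(hUφ.preimage T.isBundle.1.continuous).mem_nhds ⟨hx, hxφ⟩] with q hq
          exact ⟨(hlift q hq).2, fun A hA hz => hζ.flat q hq.1 _ (hlift q hq).1 A hA hz⟩)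
        ((hev hx).mono fun q hq => by
          have := hstd q hq (Pi.single i 1)
          rwa [comb_single] at this)
      convert h4 using 1
      funext j
      exact (congrArg (fun L : ℂ →L[ℂ] ℂ => L (v₀ (T.γ p)))
        (mfderiv_const (I := 𝓘(ℂ)) (I' := 𝓘(ℂ)) (x := T.γ p)
          (c := (Pi.single i 1 : Fin 3 → ℂ) j))).symm
    have h5 : v = mvfderiv 𝓘(ℂ) φ x v • v₀ x := hφ.mvfderiv_injective hxφ (by
      rw [map_smul, hvφ x hxφ, smul_eq_mul, mul_one])
    rw [h5, map_smul, h2, smul_zero]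
  -- A local generator of `F₁` has a double zero along `s`, hence is a multiple of the isotropic
  -- vector. It is nonzero, so the two lines coincide.
  · obtain ⟨V, hV, hxV, ε, hε, hεF⟩ := O.filtration.F₁_subbundle x
    obtain ⟨hli, hsp⟩ := hεF x hxV
    rw [Set.range_unique] at hsp
    have hUV := hU.inter hV
    have h1 := ((hfil (U ∩ V) hUV (ε default) ((hε default).mono inter_subset_right)).1.1
      (fun y hy => by rw [← (hεF y hy.2).2]; exact Submodule.subset_span ⟨_, rfl⟩)) x ⟨hx, hxV⟩
    set w₀ := IsKillingFrame.coef O.bundle b (ε default) x with hw₀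
    have h2 : comb b x w₀ = ε default x := hkill.comb_coef hx _
    obtain ⟨c, hc⟩ := BranchedTriple.exists_smul_nul_of_vanishesAlong
      (hζ.toIsFibreCoord.mono hUV inter_subset_left) ⟨hx, hxV⟩ (w := w₀) (fun p hp => by
        subst hp
        have := hstd p hx w₀
        rwa [h2] at this) h1
    have hc0 : c ≠ 0 := by
      rintro rfl
      rw [hc, zero_smul, map_zero] at h2
      exact hli.ne_zero default h2.symm
    rw [← hsp, Submodule.mem_span_singleton]
    constructor
    · rintro ⟨k, hk⟩
      rw [← h2, ← map_smul] at hk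
      exact ⟨k * c, by rw [← hinj x hx hk, hc, smul_smul]⟩
    · rintro ⟨k, rfl⟩
      exact ⟨k / c, by rw [← h2, ← map_smul, hc, smul_smul, div_mul_cancel₀ _ hc0]⟩

end Associated

/-! ### Functoriality of the associated oper -/

section Transport

open SO3Bundle

variable {X : Type u} [TopologicalSpace X] [ChartedSpace ℂ X] [IsManifold 𝓘(ℂ) ω X] {S : Finset X}

/-! ### Transport of flat coordinates by a biholomorphism over `X` -/

section Diffeo

variable {T₁ T₂ : BranchedTriple X S} {Φ : T₁.P ≃ₘ^ω⟮𝓘(ℂ, ℂ × ℂ), 𝓘(ℂ, ℂ × ℂ)⟯ T₂.P}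
  {U : Set X} {ζ : T₁.P → CP1}

lemma IsFibreCoord.comp_symm (h : IsFibreCoord T₁.γ U ζ) (hΦ : ∀ p, T₂.γ (Φ p) = T₁.γ p) :
    IsFibreCoord T₂.γ U (fun p => ζ (Φ.symm p)) := by
  have hΦ' : ∀ p, T₁.γ (Φ.symm p) = T₂.γ p := fun p => by rw [← hΦ, Φ.apply_symm_apply]
  obtain ⟨σ, h1, h2, h3⟩ := h.exists_inv
  refine ⟨h.isOpen, T₂.isBundle.1, fun p hp => ?_, fun y => Φ (σ y), fun y hy => ?_,
    fun x hx z => ?_, fun p hp => ?_⟩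
  · exact ((h.contMDiffAt (p := Φ.symm p) (by rw [hΦ']; exact hp)).comp p
      (Φ.symm.contMDiff p)).contMDiffWithinAt
  · exact (Φ.contMDiff _).comp_contMDiffWithinAt y (h1 y hy)
  · rw [hΦ, Φ.symm_apply_apply]; exact h2 x hx z
  · change Φ (σ (T₂.γ p, ζ (Φ.symm p))) = p
    rw [← hΦ', h3 _ (by rw [hΦ']; exact hp), Φ.apply_symm_apply]

lemma mvfderiv_comp_symm {f : T₁.P → ℂ} {q : T₁.P}
    (hf : MDifferentiableAt 𝓘(ℂ, ℂ × ℂ) 𝓘(ℂ) f q) (ξ : TangentSpace 𝓘(ℂ, ℂ × ℂ) q) :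
    mvfderiv 𝓘(ℂ, ℂ × ℂ) (fun p => f (Φ.symm p)) (Φ q)
      (mfderiv 𝓘(ℂ, ℂ × ℂ) 𝓘(ℂ, ℂ × ℂ) Φ q ξ) = mvfderiv 𝓘(ℂ, ℂ × ℂ) f q ξ := by
  have h1 : MDifferentiableAt 𝓘(ℂ, ℂ × ℂ) 𝓘(ℂ) (fun p => f (Φ.symm p)) (Φ q) := by
    rw [← Φ.symm_apply_apply q] at hf
    exact hf.comp (Φ q) ((Φ.symm.contMDiff (Φ q)).mdifferentiableAt (by simp))
  have h2 := mvfderiv_comp_apply q h1 ((Φ.contMDiff q).mdifferentiableAt (by simp)) ξ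
  refine h2.symm.trans ?_
  refine mvfderiv_congr (Eventually.of_forall fun p => ?_) ξ
  simp

lemma mfderiv_eq_zero_iff_of_comp (hΦ : ∀ p, T₂.γ (Φ p) = T₁.γ p) {q : T₁.P}
    (ξ : TangentSpace 𝓘(ℂ, ℂ × ℂ) q) :
    mfderiv 𝓘(ℂ, ℂ × ℂ) 𝓘(ℂ) T₂.γ (Φ q) (mfderiv 𝓘(ℂ, ℂ × ℂ) 𝓘(ℂ, ℂ × ℂ) Φ q ξ) = 0 ↔
      mfderiv 𝓘(ℂ, ℂ × ℂ) 𝓘(ℂ) T₁.γ q ξ = 0 := by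
  have h := mfderiv_comp q ((T₂.isBundle.1 (Φ q)).mdifferentiableAt (by simp))
    ((Φ.contMDiff q).mdifferentiableAt (by simp))
  have e : T₂.γ ∘ Φ = T₁.γ := funext hΦ
  rw [e] at h
  have h' := congrArg (fun L : ℂ × ℂ →L[ℂ] ℂ => L ξ) h
  exact ⟨fun h0 => h'.trans h0, fun h0 => h'.symm.trans h0⟩

lemma IsStdAt.comp_symm (h : IsFibreCoord T₁.γ U ζ) (hΦ : ∀ p, T₂.γ (Φ p) = T₁.γ p) {q : T₁.P}
    (hq : T₁.γ q ∈ U) {w : Fin 3 → ℂ} {ξ : TangentSpace 𝓘(ℂ, ℂ × ℂ) q} (hξ : IsStdAt T₁.γ ζ w q ξ) :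
    IsStdAt T₂.γ (fun p => ζ (Φ.symm p)) w (Φ q) (mfderiv 𝓘(ℂ, ℂ × ℂ) 𝓘(ℂ, ℂ × ℂ) Φ q ξ) := by
  refine ⟨(mfderiv_eq_zero_iff_of_comp hΦ ξ).2 hξ.1, fun A hA hz => ?_⟩
  dsimp only at hz ⊢
  rw [Φ.symm_apply_apply] at hz ⊢
  rw [← hξ.2 A hA hz]
  exact mvfderiv_comp_symm (f := fun p => CP1.toC (CP1.act A (ζ p)))
    (((h.actConst hA).contMDiffAt_toC hq hz).mdifferentiableAt (by simp)) ξ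

lemma IsFlatCoord.comp_symm (h : IsFlatCoord T₁.γ T₁.H U ζ) (hΦ : ∀ p, T₂.γ (Φ p) = T₁.γ p)
    (hH : ∀ p, (T₁.H p).map (mfderiv 𝓘(ℂ, ℂ × ℂ) 𝓘(ℂ, ℂ × ℂ) Φ p).toLinearMap = T₂.H (Φ p)) :
    IsFlatCoord T₂.γ T₂.H U (fun p => ζ (Φ.symm p)) where
  toIsFibreCoord := h.toIsFibreCoord.comp_symm hΦ
  flat p hp ξ hξ A hA hz := by
    obtain ⟨q, rfl⟩ := Φ.surjective p
    change T₂.γ (Φ q) ∈ U at hp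
    change CP1.act A (ζ (Φ.symm (Φ q))) ≠ CP1.infinity at hz
    rw [Φ.symm_apply_apply] at hz
    rw [hΦ] at hp
    have hξ' : ξ ∈ T₂.H (Φ q) := hξ
    rw [← hH q] at hξ'
    obtain ⟨ξ, hξ₁, rfl⟩ := hξ'
    exact (mvfderiv_comp_symm (f := fun p => CP1.toC (CP1.act A (ζ p)))
      (((h.toIsFibreCoord.actConst hA).contMDiffAt_toC hp hz).mdifferentiableAt (by simp)) ξ).trans
      (h.flat q hp ξ hξ₁ A hA hz)

end Diffeo

/-- Local models move with the biholomorphism: flat coordinates are composed with its inverse,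
evaluation maps with its differential, and the frames stay as they are. -/
lemma BranchedTriple.Equivalent.isAssociatedOper {T₁ T₂ : BranchedTriple X S}
    (h : T₁.Equivalent T₂) {O : BranchedOper X S} (hO : T₁.IsAssociatedOper O) :
    T₂.IsAssociatedOper O := by
  obtain ⟨Φ, hΦ, hH, hs⟩ := h
  obtain ⟨ψ, hψ⟩ := hO.exists_localModel
  have hL : ∀ p : T₂.P, ∃ L : O.bundle.W (T₂.γ p) →ₗ[ℂ] TangentSpace 𝓘(ℂ, ℂ × ℂ) p,
      ∀ U ζ b, LocalModel T₁ O ψ U ζ b → T₂.γ p ∈ U → ∀ w,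
        IsStdAt T₂.γ (fun p => ζ (Φ.symm p)) w p (L (comb b (T₂.γ p) w)) := by
    intro p
    obtain ⟨q, rfl⟩ := Φ.surjective p
    -- The fibres of `W` over `T₂.γ (Φ q)` and over `T₁.γ q` agree only through an equality of base
    -- points; `C` is the transport between them.
    have hcast : ∀ x, x = T₁.γ q → ∃ C : O.bundle.W x →ₗ[ℂ] O.bundle.W (T₁.γ q),
        ∀ σ : ∀ x, O.bundle.W x, C (σ x) = σ (T₁.γ q) := by
      rintro _ rfl; exact ⟨LinearMap.id, fun _ => rfl⟩
    obtain ⟨C, hC⟩ := hcast _ (hΦ q)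
    refine ⟨(mfderiv 𝓘(ℂ, ℂ × ℂ) 𝓘(ℂ, ℂ × ℂ) Φ q).toLinearMap ∘ₗ ψ q ∘ₗ C, fun U ζ b hm hp w => ?_⟩
    have hq : T₁.γ q ∈ U := by rw [← hΦ]; exact hp
    have := (hm.std q hq w).comp_symm hm.coord.toIsFibreCoord hΦ hq
    rw [← hC (fun x => comb b x w)] at this
    exact this
  choose L hL using hL
  refine isAssociatedOper_of_localModels (ψ := L) fun x => ?_
  obtain ⟨U, hxU, ζ, hζ⟩ := T₁.isConnection.exists_isFlatCoord T₁.isBundle x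
  obtain ⟨b, hm⟩ := hψ U ζ hζ
  refine ⟨U, fun p => ζ (Φ.symm p), b, hxU, hζ.comp_symm hΦ hH, hm.frame,
    fun p hp w => hL p U ζ b hm hp w, fun y hy w => ?_⟩
  rw [← hs, Φ.symm_apply_apply]
  exact hm.filt y hy w

/-- Evaluation is composed with `φ⁻¹` and the frames are moved by `φ`. The volume form plays no part
in association, and `F₂` is determined as the orthogonal of `F₁`. -/
lemma BranchedOper.Isomorphic.isAssociatedOper {T : BranchedTriple X S} {O₁ O₂ : BranchedOper X S}
    (h : O₁.Isomorphic O₂) (hO : T.IsAssociatedOper O₁) : T.IsAssociatedOper O₂ := by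
  obtain ⟨φ, hol, hB, -, hF₁, -, hD⟩ := h
  obtain ⟨ψ, hψ⟩ := hO.exists_localModel
  refine isAssociatedOper_of_localModels (ψ := fun p => ψ p ∘ₗ (φ (T.γ p)).symm.toLinearMap)
    fun x => ?_
  obtain ⟨U, hxU, ζ, hζ⟩ := T.isConnection.exists_isFlatCoord T.isBundle x
  obtain ⟨b, hm⟩ := hψ U ζ hζ
  have hcomb : ∀ y w, comb (fun i y => φ y (b i y)) y w = φ y (comb b y w) := fun y w => by
    simp [comb_apply]
  refine ⟨U, ζ, fun i y => φ y (b i y), hxU, hζ, ⟨⟨hζ.isOpen, fun i =>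
    (hol U hζ.isOpen _).1 (hm.frame.hol i), fun y hy w w' => ?_⟩, fun i y hy v => ?_⟩,
    fun p hp w => ?_, fun y hy w => ?_⟩
  · rw [hcomb, hcomb, hB]; exact hm.frame.killing_eq y hy w w'
  · rw [hD U hζ.isOpen _ (hm.frame.hol i) y hy, hm.frame.flat i y hy, map_zero]
  · have := hm.std p hp w
    rw [hcomb]
    simpa using this
  · rw [hcomb, hF₁]; exact hm.filt y hy w

end Transport

/-! ### Uniqueness of the associated oper -/

section Uniqueness

open SO3Bundle

variable {X : Type u} [TopologicalSpace X] [ChartedSpace ℂ X] [IsManifold 𝓘(ℂ) ω X] {S : Finset X}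

/-- The determinant of the Gram matrix of the Killing form. -/
lemma vol_comb_sq {𝒲 : SO3Bundle X} {U : Set X} {b : Fin 3 → ∀ x, 𝒲.W x}
    (h : IsKillingFrame 𝒲 U b) {x : X} (hx : x ∈ U) : 𝒲.vol x (fun i => b i x) ^ 2 = -32 := by
  rw [sq, ← 𝒲.vol_normalized]
  have : (Matrix.of fun i j => 𝒲.B x (b i x) (b j x))
      = Matrix.of fun i j => killing (Pi.single i 1) (Pi.single j 1) := by
    ext i j
    simp only [Matrix.of_apply]
    rw [← comb_single b x i, ← comb_single b x j, h.killing_eq x hx]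
  rw [this, Matrix.det_fin_three]
  simp [killing_apply, Pi.single_apply]
  norm_num

lemma vol_comb {𝒲 : SO3Bundle X} {U : Set X} {b : Fin 3 → ∀ x, 𝒲.W x}
    (h : IsKillingFrame 𝒲 U b) {x : X} (hx : x ∈ U) (v : Fin 3 → Fin 3 → ℂ) :
    𝒲.vol x (fun i => comb b x (v i)) = 𝒲.vol x (fun i => b i x) * (Matrix.of v).det := by
  let e : Module.Basis (Fin 3) ℂ (𝒲.W x) := Module.Basis.ofEquivFun (h.equiv hx).symm
  have he : ∀ i, e i = b i x := fun i => by
    rw [← comb_single b x i, Module.Basis.coe_ofEquivFun]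
    rfl
  have h1 := (𝒲.vol x).eq_smul_basis_det e
  have h2 := congrArg (fun f : 𝒲.W x [⋀^Fin 3]→ₗ[ℂ] ℂ => f (fun i => comb b x (v i))) h1
  refine h2.trans ?_
  simp only [AlternatingMap.smul_apply, smul_eq_mul]
  congr 1
  · congr 1
    funext i
    exact he i
  · rw [Module.Basis.det_apply, ← Matrix.det_transpose]
    congr 1
    ext i j
    change (h.equiv hx).symm (comb b x (v i)) j = v i j
    rw [← h.equiv_apply hx, LinearEquiv.symm_apply_apply]

lemma IsFlatFrame.smul {O : BranchedOper X S} {U : Set X} {b : Fin 3 → ∀ x, O.bundle.W x}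
    (h : IsFlatFrame O U b) {c : ℂ} (hc : c ^ 2 = 1) :
    IsFlatFrame O U (fun i x => c • b i x) := by
  have hcomb : ∀ x w, comb (fun i x => c • b i x) x w = c • comb b x w := fun x w => by
    simp only [comb_apply, Finset.smul_sum]
    exact Finset.sum_congr rfl fun i _ => smul_comm _ _ _
  have hol : ∀ i, O.bundle.Hol (fun x => c • b i x) U := fun i =>
    ContMDiffOn.smul_section (contMDiffOn_const (c := c)) (h.hol i)
  refine ⟨⟨h.isOpen, hol, fun x hx w w' => ?_⟩, fun i x hx v => ?_⟩
  · rw [hcomb, hcomb, map_smul, map_smul, LinearMap.smul_apply, smul_smul, ← sq, hc, one_smul,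
      h.killing_eq x hx]
  · rw [h.D_eq (hol i) hx]
    refine Eq.trans (congrArg (comb b x) (funext fun j => ?_)) (map_zero _)
    have : (fun y => IsKillingFrame.coef O.bundle b (fun x => c • b i x) y j)
        =ᶠ[𝓝 x] fun _ => (c • (Pi.single i 1 : Fin 3 → ℂ)) j := by
      filter_upwards [h.isOpen.mem_nhds hx] with y hy
      refine congrFun (h.comb_injective hy ?_) j
      rw [h.comb_coef hy, map_smul, comb_single]
    rw [mvfderiv_congr this]
    exact congrArg (fun L : ℂ →L[ℂ] ℂ => L v)
      (mfderiv_const (I := 𝓘(ℂ)) (I' := 𝓘(ℂ)) (x := x)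
        (c := (c • (Pi.single i 1 : Fin 3 → ℂ)) j))

/-- An isomorphism of bundles that respects flat frames is an isomorphism of opers. -/
lemma BranchedOper.isomorphic_of_frames {O₁ O₂ : BranchedOper X S}
    (φ : ∀ x, O₁.bundle.W x ≃ₗ[ℂ] O₂.bundle.W x)
    (h : ∀ x, ∃ U b₁ b₂, x ∈ U ∧ IsFlatFrame O₁ U b₁ ∧ IsFlatFrame O₂ U b₂ ∧
      ∀ y ∈ U, ∀ w, φ y (comb b₁ y w) = comb b₂ y w)
    (hvol : ∀ x (a : Fin 3 → O₁.bundle.W x),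
      O₂.bundle.vol x (fun i => φ x (a i)) = O₁.bundle.vol x a)
    (h₁ : ∀ x a, φ x a ∈ O₂.filtration.F₁ x ↔ a ∈ O₁.filtration.F₁ x)
    (h₂ : ∀ x a, φ x a ∈ O₂.filtration.F₂ x ↔ a ∈ O₁.filtration.F₂ x) : O₁.Isomorphic O₂ := by
  choose U b₁ b₂ hxU hb₁ hb₂ hφ using h
  have hcoef : ∀ x, ∀ (σ : ∀ y, O₁.bundle.W y), ∀ y ∈ U x,
      IsKillingFrame.coef O₂.bundle (b₂ x) (fun y => φ y (σ y)) y
        = IsKillingFrame.coef O₁.bundle (b₁ x) σ y := fun x σ y hy => by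
    refine (hb₂ x).comb_injective hy ?_
    rw [(hb₂ x).comb_coef hy, ← hφ x y hy, (hb₁ x).comb_coef hy]
  refine ⟨φ, fun V hV σ => ⟨fun hσ x hx => ContMDiffAt.contMDiffWithinAt ?_,
    fun hσ x hx => ContMDiffAt.contMDiffWithinAt ?_⟩, fun x a b => ?_, hvol, h₁, h₂,
    fun V hV σ hσ x hx v => ?_⟩
  · have ho := (hb₁ x).isOpen.inter hV
    have h1 := ((hb₁ x).mono ho inter_subset_left).contMDiffOn_coef (hσ.mono inter_subset_right)
    have h2 := hol_comb (fun i => ((hb₂ x).hol i).mono (inter_subset_left (t := V))) h1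
    refine (ContMDiffOn.contMDiffAt h2 (ho.mem_nhds ⟨hxU x, hx⟩)).congr_of_eventuallyEq ?_
    filter_upwards [ho.mem_nhds ⟨hxU x, hx⟩] with y hy
    rw [← hφ x y hy.1, (hb₁ x).comb_coef hy.1]
  · have ho := (hb₁ x).isOpen.inter hV
    have hσ : O₂.bundle.Hol (fun y => φ y (σ y)) V := hσ
    have h1 := ((hb₂ x).mono ho inter_subset_left).contMDiffOn_coef (hσ.mono inter_subset_right)
    have h2 := hol_comb (fun i => ((hb₁ x).hol i).mono (inter_subset_left (t := V))) h1
    refine (ContMDiffOn.contMDiffAt h2 (ho.mem_nhds ⟨hxU x, hx⟩)).congr_of_eventuallyEq ?_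
    filter_upwards [ho.mem_nhds ⟨hxU x, hx⟩] with y hy
    rw [hcoef x σ y hy.1, (hb₁ x).comb_coef hy.1]
  · obtain ⟨w, rfl⟩ := (hb₁ x).comb_surjective (hxU x) a
    obtain ⟨w', rfl⟩ := (hb₁ x).comb_surjective (hxU x) b
    rw [hφ x x (hxU x), hφ x x (hxU x), (hb₁ x).killing_eq x (hxU x), (hb₂ x).killing_eq x (hxU x)]
  · have ho := (hb₁ x).isOpen.inter hV
    have hσ' : O₂.bundle.Hol (fun y => φ y (σ y)) (U x ∩ V) := by
      have h1 := ((hb₁ x).mono ho inter_subset_left).contMDiffOn_coef (hσ.mono inter_subset_right)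
      refine ContMDiffOn.congr
        (hol_comb (fun i => ((hb₂ x).hol i).mono (inter_subset_left (t := V))) h1) fun y hy => ?_
      dsimp only
      rw [← hφ x y hy.1, (hb₁ x).comb_coef hy.1]
    rw [((hb₁ x).mono ho inter_subset_left).D_eq (hσ.mono inter_subset_right) ⟨hxU x, hx⟩,
      ((hb₂ x).mono ho inter_subset_left).D_eq hσ' ⟨hxU x, hx⟩, hφ x x (hxU x)]
    refine congrArg (comb (b₂ x) x) (funext fun i => mvfderiv_congr ?_ v)
    filter_upwards [(hb₁ x).isOpen.mem_nhds (hxU x)] with y hy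
    rw [hcoef x σ y hy]

/-- Both bundles are `γ_* T_γ`, so there is an isomorphism `φ` compatible with evaluation; it
matches flat frames and filtrations. On volume forms it is multiplication by some `r` with `r² = 1`.
By connectedness `r` is a constant `c`, and `c φ` has volume factor `c³ c = 1` while still
respecting `B`, the filtrations and the connections. -/
theorem BranchedTriple.IsAssociatedOper.isomorphic [ConnectedSpace X] {T : BranchedTriple X S}
    {O₁ O₂ : BranchedOper X S} (h₁ : T.IsAssociatedOper O₁) (h₂ : T.IsAssociatedOper O₂) :
    O₁.Isomorphic O₂ := by
  obtain ⟨ψ₁, hψ₁⟩ := h₁.exists_localModel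
  obtain ⟨ψ₂, hψ₂⟩ := h₂.exists_localModel
  choose U hxU ζ hζ using T.isConnection.exists_isFlatCoord T.isBundle
  choose b₁ hm₁ using fun x => hψ₁ (U x) (ζ x) (hζ x)
  choose b₂ hm₂ using fun x => hψ₂ (U x) (ζ x) (hζ x)
  let φ : ∀ x, O₁.bundle.W x ≃ₗ[ℂ] O₂.bundle.W x := fun x =>
    ((hm₁ x).frame.equiv (hxU x)).symm.trans ((hm₂ x).frame.equiv (hxU x))
  have hφ0 : ∀ x w, φ x (comb (b₁ x) x w) = comb (b₂ x) x w := fun x w => by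
    simp only [φ, LinearEquiv.trans_apply]
    rw [← (hm₁ x).frame.equiv_apply (hxU x), LinearEquiv.symm_apply_apply]
    rfl
  have hφψ : ∀ p a, ψ₂ p (φ (T.γ p) a) = ψ₁ p a := fun p a => by
    obtain ⟨w, rfl⟩ := (hm₁ (T.γ p)).frame.comb_surjective (hxU _) a
    rw [hφ0]
    exact (hζ (T.γ p)).isStdAt_unique (hxU _) ((hm₂ _).std p (hxU _) w) ((hm₁ _).std p (hxU _) w)
  -- `φ` is defined at each point through the frame chosen there; compatibility with evaluation
  -- shows that every other pair of frames gives the same map.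
  have hφ : ∀ x, ∀ y ∈ U x, ∀ w, φ y (comb (b₁ x) y w) = comb (b₂ x) y w := fun x y hy w => by
    refine (hm₂ x).eq_of_forall hy (σ := fun y => φ y (comb (b₁ x) y w))
      (τ := fun y => comb (b₂ x) y w) fun p hp => ?_
    subst hp
    rw [hφψ]
    exact (hζ x).isStdAt_unique hy ((hm₁ x).std p hy w) ((hm₂ x).std p hy w)
  let r : X → ℂ := fun x =>
    O₂.bundle.vol x (fun i => b₂ x i x) / O₁.bundle.vol x (fun i => b₁ x i x)
  have hv0 : ∀ x, ∀ y ∈ U x, O₁.bundle.vol y (fun i => b₁ x i y) ≠ 0 := fun x y hy h0 => by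
    have := vol_comb_sq (hm₁ x).frame.toIsKillingFrame hy
    rw [h0] at this; norm_num at this
  have hvol : ∀ x (a : Fin 3 → O₁.bundle.W x),
      O₂.bundle.vol x (fun i => φ x (a i)) = r x * O₁.bundle.vol x a := fun x a => by
    choose w hw using fun i => (hm₁ x).frame.comb_surjective (hxU x) (a i)
    have e1 : a = fun i => comb (b₁ x) x (w i) := funext fun i => (hw i).symm
    have e2 : (fun i => φ x (a i)) = fun i => comb (b₂ x) x (w i) := funext fun i => by
      rw [e1, hφ0]
    rw [e2, e1, vol_comb (hm₁ x).frame.toIsKillingFrame (hxU x),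
      vol_comb (hm₂ x).frame.toIsKillingFrame (hxU x)]
    simp only [r]
    have := hv0 x x (hxU x)
    field_simp
  have hr2 : ∀ x, r x ^ 2 = 1 := fun x => by
    simp only [r, div_pow]
    rw [vol_comb_sq (hm₁ x).frame.toIsKillingFrame (hxU x),
      vol_comb_sq (hm₂ x).frame.toIsKillingFrame (hxU x)]
    norm_num
  have hpm : ∀ y, r y = 1 ∨ r y = -1 := fun y => by
    have h0 : (r y - 1) * (r y + 1) = 0 := by linear_combination hr2 y
    rcases mul_eq_zero.1 h0 with h | h
    · exact Or.inl (sub_eq_zero.1 h)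
    · exact Or.inr (eq_neg_of_add_eq_zero_left h)
  have hrc : Continuous r := continuous_iff_continuousAt.2 fun x => by
    have hr : ∀ᶠ y in 𝓝 x, r y =
        O₂.bundle.vol y (fun i => b₂ x i y) / O₁.bundle.vol y (fun i => b₁ x i y) := by
      filter_upwards [(hζ x).isOpen.mem_nhds (hxU x)] with y hy
      rw [eq_div_iff (hv0 x y hy), ← hvol]
      congr 1
      funext i
      rw [← comb_single (b₁ x) y i, hφ x y hy, comb_single]
    have c₁ := ((O₁.bundle.vol_holomorphic (U x) (hζ x).isOpen (b₁ x)
      (hm₁ x).frame.hol).contMDiffAt ((hζ x).isOpen.mem_nhds (hxU x))).continuousAt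
    have c₂ := ((O₂.bundle.vol_holomorphic (U x) (hζ x).isOpen (b₂ x)
      (hm₂ x).frame.hol).contMDiffAt ((hζ x).isOpen.mem_nhds (hxU x))).continuousAt
    exact (c₂.div c₁ (hv0 x x (hxU x))).congr_of_eventuallyEq hr
  obtain ⟨c, hc⟩ : ∃ c, ∀ x, r x = c := by
    obtain ⟨x₀⟩ := (inferInstance : Nonempty X)
    refine ⟨r x₀, fun x => ?_⟩
    -- The values are `1` and `-1` only, so the set where `r = 1` is open and closed.
    have hclopen : IsClopen (r ⁻¹' {1}) := by
      refine ⟨isClosed_singleton.preimage hrc, ?_⟩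
      have : r ⁻¹' {1} = (r ⁻¹' {-1})ᶜ := by
        ext y
        simp only [mem_preimage, mem_singleton_iff, mem_compl_iff]
        rcases hpm y with h | h <;> rw [h] <;> norm_num
      rw [this]
      exact (isClosed_singleton.preimage hrc).isOpen_compl
    rcases isClopen_iff.1 hclopen with h | h
    · have h' : ∀ y, r y = -1 := fun y => by
        have h1 : y ∉ r ⁻¹' {1} := by rw [h]; exact notMem_empty y
        exact (hpm y).resolve_left h1
      rw [h', h']
    · have h' : ∀ y, r y = 1 := fun y => by
        have h1 : y ∈ r ⁻¹' {1} := by rw [h]; exact mem_univ y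
        exact h1
      rw [h', h']
  have hc2 : c ^ 2 = 1 := by
    obtain ⟨x₀⟩ := (inferInstance : Nonempty X)
    rw [← hc x₀]; exact hr2 x₀
  have hc0 : c ≠ 0 := by rintro rfl; norm_num at hc2
  have hmem : ∀ x (a : O₁.bundle.W x) (F : Submodule ℂ (O₂.bundle.W x)), c • φ x a ∈ F ↔ φ x a ∈ F :=
    fun x a F => F.smul_mem_iff hc0
  refine BranchedOper.isomorphic_of_frames
    (fun x => (φ x).trans (LinearEquiv.smulOfNeZero ℂ _ c hc0)) (fun x => ⟨U x, b₁ x,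
      fun i y => c • b₂ x i y, hxU x, (hm₁ x).frame, (hm₂ x).frame.smul hc2, fun y hy w => ?_⟩)
    (fun x a => ?_) (fun x a => ?_) (fun x a => ?_)
  · change c • φ y (comb (b₁ x) y w) = _
    rw [hφ x y hy]
    simp only [comb_apply, Finset.smul_sum]
    exact Finset.sum_congr rfl fun i _ => smul_comm _ _ _
  · change O₂.bundle.vol x (fun i => c • φ x (a i)) = _
    have := (O₂.bundle.vol x).map_smul_univ (fun _ => c) (fun i => φ x (a i))
    refine this.trans ?_
    rw [hvol, hc]
    simp only [Finset.prod_const, Finset.card_univ, Fintype.card_fin, smul_eq_mul]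
    linear_combination (c ^ 2 + 1) * O₁.bundle.vol x a * hc2
  · obtain ⟨w, rfl⟩ := (hm₁ x).frame.comb_surjective (hxU x) a
    refine (hmem x _ _).trans ?_
    rw [hφ0, (hm₁ x).filt x (hxU x), (hm₂ x).filt x (hxU x)]
  · obtain ⟨w, rfl⟩ := (hm₁ x).frame.comb_surjective (hxU x) a
    refine (hmem x _ _).trans ?_
    rw [hφ0, (hm₁ x).comb_mem_F₂ (hxU x), (hm₂ x).comb_mem_F₂ (hxU x)]

end Uniqueness

/-! ### The projective structure is determined by the associated oper -/

/-- Comparing Gram determinants gives `det A² = 1`, and in odd dimension a change of sign of `A`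
changes the sign of the determinant. -/
lemma killing_preserving_isSO_or {A : Matrix (Fin 3) (Fin 3) ℂ}
    (hA : ∀ a b, killing (A.mulVec a) (A.mulVec b) = killing a b) : IsSO A ∨ IsSO (-A) := by
  have h1 : A.transpose * killingMatrix * A = killingMatrix := by
    ext i j
    have h2 := hA (Pi.single i 1) (Pi.single j 1)
    rw [killing_eq_dotProduct, killing_eq_dotProduct, Matrix.mulVec_mulVec,
      Matrix.dotProduct_mulVec, Matrix.vecMul_mulVec, ← Matrix.dotProduct_mulVec, ← mul_assoc] at h2
    simpa using h2
  have h2 := congrArg Matrix.det h1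
  rw [Matrix.det_mul, Matrix.det_mul, Matrix.det_transpose] at h2
  have h3 : killingMatrix.det ≠ 0 := by
    have := congrArg Matrix.det killingMatrixInv_mul
    rw [Matrix.det_mul, Matrix.det_one] at this
    exact right_ne_zero_of_mul_eq_one this
  have h4 : (A.det - 1) * (A.det + 1) = 0 := by
    refine mul_right_cancel₀ h3 ?_
    linear_combination h2
  rcases mul_eq_zero.1 h4 with h | h
  · exact Or.inl ⟨hA, sub_eq_zero.1 h⟩
  · refine Or.inr ⟨fun a b => ?_, ?_⟩
    · simp only [Matrix.neg_mulVec, map_neg, LinearMap.neg_apply, neg_neg, hA]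
    · rw [Matrix.det_neg, eq_neg_of_add_eq_zero_left h]
      norm_num

/-- The pairing of the isotropic vectors of two affine points is `-4 (z - z')²`. Geometrically, the
conic contains no line. -/
lemma CP1.eq_of_killing_nul {a b : CP1} (h : killing (CP1.nul a) (CP1.nul b) = 0) : a = b := by
  rcases CP1.eq_infinity_or a with rfl | ⟨z, rfl⟩ <;>
    rcases CP1.eq_infinity_or b with rfl | ⟨z', rfl⟩
  · rfl
  · simp [killing_apply, CP1.nulC] at h
  · simp [killing_apply, CP1.nulC] at h
  · have h1 : (z - z') ^ 2 = 0 := by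
      simp [killing_apply, CP1.nulC] at h
      linear_combination -h / 4
    rw [sub_eq_zero.1 (pow_eq_zero_iff two_ne_zero |>.1 h1)]

section Reconstruction

open SO3Bundle

variable {X : Type u} [TopologicalSpace X] [ChartedSpace ℂ X] [IsManifold 𝓘(ℂ) ω X] {S : Finset X}

/-- A function with vanishing derivative is locally constant. -/
lemma eventually_eq_of_mvfderiv_eq_zero {f : X → ℂ} {U : Set X} (hU : IsOpen U)
    (hf : ContMDiffOn 𝓘(ℂ) 𝓘(ℂ) ω f U) (h0 : ∀ y ∈ U, ∀ v, mvfderiv 𝓘(ℂ) f y v = 0) {x : X}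
    (hx : x ∈ U) : ∀ᶠ y in 𝓝 x, f y = f x := by
  have hφ := isHolChart_chartAt (E := ℂ) x
  have hxs := _root_.mem_chart_source ℂ x
  set φ := chartAt ℂ x
  have hW : IsOpen (φ.target ∩ φ.symm ⁻¹' U) := φ.symm.isOpen_inter_preimage hU
  have hxW : φ x ∈ φ.target ∩ φ.symm ⁻¹' U :=
    ⟨φ.map_source hxs, by rw [mem_preimage, φ.left_inv hxs]; exact hx⟩
  obtain ⟨r, hr, hball⟩ := Metric.isOpen_iff.1 hW _ hxW
  have hd : ∀ t ∈ Metric.ball (φ x) r, DifferentiableAt ℂ (f ∘ φ.symm) t ∧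
      deriv (f ∘ φ.symm) t = 0 := fun t ht => by
    obtain ⟨ht1, ht2⟩ := hball ht
    have hs := φ.map_target ht1
    obtain ⟨d1, d2⟩ := mvfderiv_eq_deriv_mul hφ hs
      ((hf.contMDiffAt (hU.mem_nhds ht2)).mdifferentiableAt (by simp))
      ((hφ.tangentEquiv hs).symm 1)
    rw [h0 _ ht2, hφ.mvfderiv_symm_apply hs, mul_one, φ.right_inv ht1] at d2
    rw [φ.right_inv ht1] at d1
    exact ⟨d1, d2.symm⟩
  have hc : ∀ t ∈ Metric.ball (φ x) r, (f ∘ φ.symm) t = (f ∘ φ.symm) (φ x) := fun t ht =>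
    Metric.isOpen_ball.is_const_of_deriv_eq_zero (convex_ball _ r).isPreconnected
      (fun s hs => (hd s hs).1.differentiableWithinAt) (fun s hs => (hd s hs).2) ht
      (Metric.mem_ball_self hr)
  filter_upwards [φ.open_source.mem_nhds hxs,
    (φ.continuousAt hxs).eventually (Metric.ball_mem_nhds _ hr)] with y hy hyb
  have := hc _ hyb
  simpa [φ.left_inv hy, φ.left_inv hxs] using this

/-- Two flat frames differ by a constant matrix. -/
lemma IsFlatFrame.exists_const_matrix {O : BranchedOper X S} {U U' : Set X}
    {b b' : Fin 3 → ∀ x, O.bundle.W x} (h : IsFlatFrame O U b) (h' : IsFlatFrame O U' b') {x : X}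
    (hx : x ∈ U) (hx' : x ∈ U') : ∃ A : Matrix (Fin 3) (Fin 3) ℂ,
      (∀ a c, killing (A.mulVec a) (A.mulVec c) = killing a c) ∧
      ∀ᶠ y in 𝓝 x, ∀ w, comb b' y w = comb b y (A.mulVec w) := by
  have ho := h.isOpen.inter h'.isOpen
  have hb := h.mono ho inter_subset_left
  have hb' := h'.mono ho inter_subset_right
  have hconst : ∀ i j, ∀ᶠ y in 𝓝 x, IsKillingFrame.coef O.bundle b (b' j) y i
      = IsKillingFrame.coef O.bundle b (b' j) x i := fun i j => by
    refine eventually_eq_of_mvfderiv_eq_zero ho (hb.contMDiffOn_coef (hb'.hol j) i)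
      (fun y hy v => ?_) ⟨hx, hx'⟩
    have h1 := hb.D_eq (hb'.hol j) hy v
    rw [hb'.flat j y hy v] at h1
    exact congrFun (hb.comb_injective hy (h1.symm.trans (map_zero _).symm)) i
  let A : Matrix (Fin 3) (Fin 3) ℂ := Matrix.of fun i j => IsKillingFrame.coef O.bundle b (b' j) x i
  have hev : ∀ᶠ y in 𝓝 x, ∀ w, comb b' y w = comb b y (A.mulVec w) := by
    filter_upwards [eventually_all.2 fun i => eventually_all.2 (hconst i), ho.mem_nhds ⟨hx, hx'⟩]
      with y hy hyU w
    have hj : ∀ j, comb b y (A.col j) = b' j y := fun j => by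
      rw [← hb.comb_coef hyU (b' j)]
      exact congrArg _ (funext fun i => (hy i j).symm)
    rw [comb_apply, Matrix.mulVec_eq_sum, map_sum]
    refine Finset.sum_congr rfl fun j _ => ?_
    rw [← hj j]
    simp only [op_smul_eq_smul, map_smul]
    rfl
  refine ⟨A, fun a c => ?_, hev⟩
  have hA := hev.self_of_nhds
  rw [← h.killing_eq x hx, ← hA, ← hA, h'.killing_eq x hx']

section Flat

variable {P : Type*} [TopologicalSpace P] [ChartedSpace (ℂ × ℂ) P] [IsManifold 𝓘(ℂ, ℂ × ℂ) ω P]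
  {γ : P → X} {H : ∀ p : P, Submodule ℂ (TangentSpace 𝓘(ℂ, ℂ × ℂ) p)} {U : Set X} {ζ : P → CP1}

/-- The connection is the kernel of the derivative of a flat coordinate. -/
lemma IsFlatCoord.mem_iff (h : IsFlatCoord γ H U ζ) (hH : IsHolConnection γ H) {p : P}
    (hp : γ p ∈ U) {A : Matrix (Fin 3) (Fin 3) ℂ} (hA : IsSO A)
    (hz : CP1.act A (ζ p) ≠ CP1.infinity) (ξ : TangentSpace 𝓘(ℂ, ℂ × ℂ) p) :
    ξ ∈ H p ↔ mvfderiv 𝓘(ℂ, ℂ × ℂ) (fun q => CP1.toC (CP1.act A (ζ q))) p ξ = 0 := by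
  refine ⟨fun hξ => h.flat p hp ξ hξ A hA hz, fun h0 => ?_⟩
  obtain ⟨a, ha, c, hc, rfl⟩ := Submodule.mem_sup.1
    ((hH.isCompl p).sup_eq_top ▸ Submodule.mem_top (x := ξ))
  have h1 : a = 0 := by
    refine h.toIsFibreCoord.eq_of_mfderiv_eq hp hA hz ?_ ?_
    · rw [map_zero]; exact ha
    · rw [map_zero, ← h0, map_add, h.flat p hp c hc A hA hz, add_zero]
  rw [h1, zero_add]
  exact hc

end Flat

/-- A correspondence between the total spaces of two projective bundles which is locally given by
equality of flat coordinates is the graph of a holomorphic map. -/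
lemma exists_map_of_flatCoords {T₁ T₂ : BranchedTriple X S} {R : T₁.P → T₂.P → Prop}
    (hRγ : ∀ p q, R p q → T₂.γ q = T₁.γ p)
    (hR : ∀ x, ∃ U ζ₁ ζ₂, x ∈ U ∧ IsFlatCoord T₁.γ T₁.H U ζ₁ ∧ IsFlatCoord T₂.γ T₂.H U ζ₂ ∧
      ∀ p q, T₁.γ p ∈ U → T₂.γ q = T₁.γ p → (R p q ↔ ζ₂ q = ζ₁ p)) :
    ∃ f : T₁.P → T₂.P, ContMDiff 𝓘(ℂ, ℂ × ℂ) 𝓘(ℂ, ℂ × ℂ) ω f ∧ (∀ p q, R p q ↔ q = f p) ∧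
      ∀ p ξ, ξ ∈ T₁.H p ↔ mfderiv 𝓘(ℂ, ℂ × ℂ) 𝓘(ℂ, ℂ × ℂ) f p ξ ∈ T₂.H (f p) := by
  choose U ζ₁ ζ₂ hxU h₁ h₂ hR using hR
  choose σ hσ hσ1 hσ2 using fun x => (h₂ x).exists_inv
  have key : ∀ x p, T₁.γ p ∈ U x → ∀ q, R p q ↔ q = σ x (T₁.γ p, ζ₁ x p) := fun x p hp q => by
    obtain ⟨e1, e2⟩ := hσ1 x _ hp (ζ₁ x p)
    constructor
    · intro h
      have hq := hRγ p q h
      rw [← (hR x p q hp hq).1 h, ← hq]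
      exact (hσ2 x q (by rw [hq]; exact hp)).symm
    · rintro rfl
      exact (hR x p _ hp e1).2 e2
  -- The partner of `p` is the point over `γ p` with equal flat coordinate. The relation `R` makes
  -- it independent of the index used, so near any point one index computes `f`.
  let f : T₁.P → T₂.P := fun p => σ (T₁.γ p) (T₁.γ p, ζ₁ (T₁.γ p) p)
  have hf : ∀ p q, R p q ↔ q = f p := fun p q => key _ p (hxU _) q
  have hfx : ∀ x p, T₁.γ p ∈ U x → f p = σ x (T₁.γ p, ζ₁ x p) := fun x p hp =>
    (key x p hp _).1 ((hf p _).2 rfl)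
  have hhol : ContMDiff 𝓘(ℂ, ℂ × ℂ) 𝓘(ℂ, ℂ × ℂ) ω f := fun p => by
    have hp := hxU (T₁.γ p)
    set x := T₁.γ p with hx
    have ho : IsOpen (U x ×ˢ (univ : Set CP1)) := (h₂ x).isOpen.prod isOpen_univ
    have h1 := ((hσ x).contMDiffAt (x := (T₁.γ p, ζ₁ x p)) (ho.mem_nhds ⟨hp, mem_univ _⟩)).comp p
      ((T₁.isBundle.1 p).prodMk ((h₁ x).contMDiffAt hp))
    refine h1.congr_of_eventuallyEq ?_
    filter_upwards [(h₁ x).isOpen_preimage.mem_nhds hp] with q hq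
    exact hfx x q hq
  refine ⟨f, hhol, hf, fun p ξ => ?_⟩
  have hγ : ∀ q, T₂.γ (f q) = T₁.γ q := fun q => hRγ q _ ((hf q _).2 rfl)
  obtain ⟨x, hp⟩ : ∃ x, T₁.γ p ∈ U x := ⟨_, hxU _⟩
  have hζ : ∀ q, T₁.γ q ∈ U x → ζ₂ x (f q) = ζ₁ x q := fun q hq =>
    (hR _ q _ hq (hγ q)).1 ((hf q _).2 rfl)
  have hp' : T₂.γ (f p) ∈ U x := by rw [hγ]; exact hp
  obtain ⟨A, hA, hz⟩ := CP1.exists_act_ne_infinity (ζ₁ x p)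
  have hz' : CP1.act A (ζ₂ x (f p)) ≠ CP1.infinity := by rw [hζ p hp]; exact hz
  rw [(h₁ x).mem_iff T₁.isConnection hp hA hz, (h₂ x).mem_iff T₂.isConnection hp' hA hz',
    ← mvfderiv_comp_apply p
      ((((h₂ x).toIsFibreCoord.actConst hA).contMDiffAt_toC hp' hz').mdifferentiableAt (by simp))
      ((hhol p).mdifferentiableAt (by simp)) ξ]
  refine Eq.congr (mvfderiv_congr ?_ ξ) rfl
  filter_upwards [(h₁ x).isOpen_preimage.mem_nhds hp] with q hq
  simp only [Function.comp]
  rw [hζ q hq]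

/-- The hypotheses are symmetric in the two triples, so the reversed relation is the graph of the
inverse map. -/
lemma equivalent_of_flatCoords {T₁ T₂ : BranchedTriple X S} {R : T₁.P → T₂.P → Prop}
    (hRγ : ∀ p q, R p q → T₂.γ q = T₁.γ p)
    (hR : ∀ x, ∃ U ζ₁ ζ₂, x ∈ U ∧ IsFlatCoord T₁.γ T₁.H U ζ₁ ∧ IsFlatCoord T₂.γ T₂.H U ζ₂ ∧
      ∀ p q, T₁.γ p ∈ U → T₂.γ q = T₁.γ p → (R p q ↔ ζ₂ q = ζ₁ p))
    (hs : ∀ x, R (T₁.s x) (T₂.s x)) : T₁.Equivalent T₂ := by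
  obtain ⟨f, hf, hRf, hH⟩ := exists_map_of_flatCoords hRγ hR
  obtain ⟨g, hg, hRg, -⟩ := exists_map_of_flatCoords (T₁ := T₂) (T₂ := T₁) (R := fun q p => R p q)
    (fun q p h => (hRγ p q h).symm) fun x => by
      obtain ⟨U, ζ₁, ζ₂, hx, h₁, h₂, h⟩ := hR x
      exact ⟨U, ζ₂, ζ₁, hx, h₂, h₁, fun q p hq hpq =>
        (h p q (by rw [hpq]; exact hq) hpq.symm).trans eq_comm⟩
  have hgf : ∀ p, g (f p) = p := fun p => ((hRg _ _).1 ((hRf p _).2 rfl)).symm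
  have hfg : ∀ q, f (g q) = q := fun q => ((hRf _ _).1 ((hRg q _).2 rfl)).symm
  let Φ : T₁.P ≃ₘ^ω⟮𝓘(ℂ, ℂ × ℂ), 𝓘(ℂ, ℂ × ℂ)⟯ T₂.P := ⟨⟨f, g, hgf, hfg⟩, hf, hg⟩
  refine ⟨Φ, fun p => hRγ p _ ((hRf p _).2 rfl), fun p => ?_, fun x => ((hRf _ _).1 (hs x)).symm⟩
  ext η
  constructor
  · rintro ⟨ξ, hξ, rfl⟩
    exact (hH p ξ).1 hξ
  · intro hη
    obtain ⟨ξ, rfl⟩ := (Φ.mfderivToContinuousLinearEquiv (by simp) p).surjective η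
    exact ⟨ξ, (hH p ξ).2 hη, rfl⟩

/-- A quadratic field vanishes at a point exactly when it is orthogonal to the isotropic vector of
that point. -/
lemma IsFibreCoord.isStdAt_zero_iff {P : Type*} [TopologicalSpace P] [ChartedSpace (ℂ × ℂ) P]
    {γ : P → X} {U : Set X} {ζ : P → CP1} (h : IsFibreCoord γ U ζ) {p : P} (hp : γ p ∈ U)
    {w : Fin 3 → ℂ} : IsStdAt γ ζ w p 0 ↔ killing w (CP1.nul (ζ p)) = 0 := by
  obtain ⟨A, hA, hz⟩ := CP1.exists_act_ne_infinity (ζ p)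
  rw [← hA.killing_nul_act, ← CP1.ofComplex_toC hz, CP1.nul_ofComplex, CP1.killing_nulC]
  constructor
  · intro h1
    rw [← h1.2 A hA hz, map_zero, mul_zero]
  · intro h0
    refine h.isStdAt_of hp hA hz (map_zero _) ?_
    rw [map_zero]
    exact ((mul_eq_zero.1 h0).resolve_left (by norm_num)).symm

lemma LocalModel.eq_zero_iff {T : BranchedTriple X S} {O : BranchedOper X S}
    {ψ : ∀ p : T.P, O.bundle.W (T.γ p) →ₗ[ℂ] TangentSpace 𝓘(ℂ, ℂ × ℂ) p} {U : Set X}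
    {ζ : T.P → CP1} {b : Fin 3 → ∀ x, O.bundle.W x} (h : LocalModel T O ψ U ζ b) {p : T.P}
    (hp : T.γ p ∈ U) (w : Fin 3 → ℂ) :
    ψ p (comb b (T.γ p) w) = 0 ↔ killing w (CP1.nul (ζ p)) = 0 := by
  rw [← h.coord.isStdAt_zero_iff hp]
  have h1 := h.std p hp w
  exact ⟨fun h0 => by rwa [h0] at h1, fun h0 => h.coord.isStdAt_unique hp h1 h0⟩

/-- A point `p` is recovered from `W`: the kernel of `ψ p` is the plane of fields that vanish at
`p`, the orthogonal of one isotropic line. The relation `R` pairs points over the same base point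
with equal kernels, and the sections correspond because both are given by `F₁`. -/
theorem BranchedTriple.IsAssociatedOper.equivalent {T₁ T₂ : BranchedTriple X S}
    {O : BranchedOper X S} (h₁ : T₁.IsAssociatedOper O) (h₂ : T₂.IsAssociatedOper O) :
    T₁.Equivalent T₂ := by
  obtain ⟨ψ₁, hψ₁⟩ := h₁.exists_localModel
  obtain ⟨ψ₂, hψ₂⟩ := h₂.exists_localModel
  let R : T₁.P → T₂.P → Prop := fun p q => T₂.γ q = T₁.γ p ∧
    ∀ σ : ∀ x, O.bundle.W x, ψ₁ p (σ (T₁.γ p)) = 0 ↔ ψ₂ q (σ (T₂.γ q)) = 0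
  have local_model : ∀ x, ∃ U ζ₁ ζ₂, x ∈ U ∧ IsFlatCoord T₁.γ T₁.H U ζ₁ ∧
      IsFlatCoord T₂.γ T₂.H U ζ₂ ∧ (∀ p q, T₁.γ p ∈ U → T₂.γ q = T₁.γ p → (R p q ↔ ζ₂ q = ζ₁ p)) ∧
      ∀ y ∈ U, ζ₂ (T₂.s y) = ζ₁ (T₁.s y) := by
    intro x
    obtain ⟨U₁, hx₁, ζ₁, hζ₁⟩ := T₁.isConnection.exists_isFlatCoord T₁.isBundle x
    obtain ⟨U₂, hx₂, ζ₂, hζ₂⟩ := T₂.isConnection.exists_isFlatCoord T₂.isBundle x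
    obtain ⟨b₁, hm₁⟩ := hψ₁ U₁ ζ₁ hζ₁
    obtain ⟨b₂, hm₂⟩ := hψ₂ U₂ ζ₂ hζ₂
    obtain ⟨A, hA, hev⟩ := hm₂.frame.exists_const_matrix hm₁.frame hx₂ hx₁
    obtain ⟨V, hV, hVo, hxV⟩ := eventually_nhds_iff.1 hev
    -- The frames come without control of orientation, so the transition matrix may have determinant
    -- `-1`. Its negative induces the same map on isotropic lines.
    obtain ⟨B, ε, hB, hε, hAB⟩ : ∃ (B : Matrix (Fin 3) (Fin 3) ℂ) (ε : ℂ), IsSO B ∧ ε ≠ 0 ∧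
        ∀ w, A.mulVec w = ε • B.mulVec w := by
      rcases killing_preserving_isSO_or hA with h | h
      · exact ⟨A, 1, h, one_ne_zero, fun w => (one_smul _ _).symm⟩
      · exact ⟨-A, -1, h, by norm_num, fun w => by simp [Matrix.neg_mulVec]⟩
    have ho := (hζ₁.isOpen.inter hζ₂.isOpen).inter hVo
    refine ⟨(U₁ ∩ U₂) ∩ V, fun p => CP1.act B (ζ₁ p), ζ₂, ⟨⟨hx₁, hx₂⟩, hxV⟩,
      (hζ₁.actConst hB).mono ho fun y hy => hy.1.1, hζ₂.mono ho fun y hy => hy.1.2,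
      fun p q hp hpq => ?_, fun y hy => ?_⟩
    · have hq : T₂.γ q ∈ (U₁ ∩ U₂) ∩ V := by rw [hpq]; exact hp
      have e1 : ∀ w, ψ₁ p (comb b₁ (T₁.γ p) w) = 0 ↔
          killing (B.mulVec w) (CP1.nul (CP1.act B (ζ₁ p))) = 0 := fun w => by
        rw [hm₁.eq_zero_iff hp.1.1, hB.killing_nul_act]
      have e2 : ∀ w, ψ₂ q (comb b₁ (T₂.γ q) w) = 0 ↔
          killing (B.mulVec w) (CP1.nul (ζ₂ q)) = 0 := fun w => by
        rw [hV _ hq.2, hm₂.eq_zero_iff hq.1.2, hAB, map_smul, LinearMap.smul_apply, smul_eq_mul,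
          mul_eq_zero, or_iff_right hε]
      constructor
      · rintro ⟨-, h⟩
        have h1 := (e1 (B⁻¹.mulVec (CP1.nul (CP1.act B (ζ₁ p))))).symm.trans
          ((h fun y => comb b₁ y (B⁻¹.mulVec (CP1.nul (CP1.act B (ζ₁ p))))).trans (e2 _))
        rw [hB.mulVec_inv_mulVec, ← isNull_iff] at h1
        exact (CP1.eq_of_killing_nul (h1.1 (CP1.isNull_nul _))).symm
      · intro h
        refine ⟨hpq, fun σ => ?_⟩
        have h1 := hm₁.frame.comb_coef hp.1.1 σ
        have h2 := hm₁.frame.comb_coef hq.1.1 σ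
        rw [← h1, ← h2, e1, e2, h, hpq]
    · obtain ⟨c, hc, hn⟩ := CP1.exists_mulVec_nul hB (ζ₁ (T₁.s y))
      obtain ⟨k, hk⟩ := (hm₂.filt y hy.1.2 _).1 (by
        rw [← hV y hy.2 (CP1.nul (ζ₁ (T₁.s y)))]
        exact (hm₁.filt y hy.1.1 _).2 ⟨1, (one_smul _ _).symm⟩)
      rw [hAB, hn, smul_smul] at hk
      refine CP1.eq_of_killing_nul ?_
      have h0 : k * killing (CP1.nul (ζ₂ (T₂.s y))) (CP1.nul (CP1.act B (ζ₁ (T₁.s y)))) = 0 := by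
        rw [← smul_eq_mul, ← LinearMap.smul_apply, ← map_smul, ← hk, map_smul, LinearMap.smul_apply,
          isNull_iff.1 (CP1.isNull_nul _), smul_zero]
      refine (mul_eq_zero.1 h0).resolve_left ?_
      rintro rfl
      rw [zero_smul, smul_eq_zero] at hk
      exact hk.elim (mul_ne_zero hε hc) (CP1.nul_ne_zero _)
  refine equivalent_of_flatCoords (R := R) (fun p q h => h.1) (fun x => ?_) fun x => ?_
  · obtain ⟨U, ζ₁, ζ₂, hx, h1, h2, h, -⟩ := local_model x
    exact ⟨U, ζ₁, ζ₂, hx, h1, h2, h⟩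
  · obtain ⟨U, ζ₁, ζ₂, hx, h1, h2, h, hs⟩ := local_model x
    exact (h _ _ (by rw [T₁.s_section]; exact hx) (by rw [T₁.s_section, T₂.s_section])).2 (hs x hx)

end Reconstruction

/-! ### The flat bundle of a locally constant cocycle -/

/-- A locally constant cocycle of isometries. -/
structure SOCocycle (X : Type u) [TopologicalSpace X] where
  U : X → Set X
  isOpen : ∀ i, IsOpen (U i)
  mem : ∀ x, x ∈ U x
  g : X → X → X → Matrix (Fin 3) (Fin 3) ℂ
  isSO : ∀ {i j x}, x ∈ U i → x ∈ U j → IsSO (g i j x)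
  self : ∀ {i x}, x ∈ U i → g i i x = 1
  comp : ∀ {i j k x}, x ∈ U i → x ∈ U j → x ∈ U k → g i j x * g j k x = g i k x
  const : ∀ {i j x}, x ∈ U i → x ∈ U j → ∀ᶠ y in 𝓝 x, g i j y = g i j x

/-- A square root of the determinant of the Killing form. -/
def volConst : ℂ := (IsAlgClosed.exists_pow_nat_eq (-32 : ℂ) two_pos).choose

lemma volConst_sq : volConst ^ 2 = -32 :=
  (IsAlgClosed.exists_pow_nat_eq (-32 : ℂ) two_pos).choose_spec

lemma det_killing (a b : Fin 3 → Fin 3 → ℂ) :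
    (Matrix.of fun i j => killing (a i) (b j)).det
      = -32 * ((Matrix.of a).det * (Matrix.of b).det) := by
  have h : (Matrix.of fun i j => killing (a i) (b j))
      = Matrix.of a * killingMatrix * (Matrix.of b).transpose := by
    ext i j
    simp only [Matrix.of_apply, killing_apply]
    simp [Matrix.mul_apply, killingMatrix, Fin.sum_univ_three]
    ring
  rw [h, Matrix.det_mul, Matrix.det_mul, Matrix.det_transpose]
  have : killingMatrix.det = -32 := by
    simp [killingMatrix, Matrix.det_fin_three]
    norm_num
  rw [this]
  ring

namespace SOCocycle

variable {X : Type u} [TopologicalSpace X] (C : SOCocycle X)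

lemma comp_mulVec {i j k x : X} (hi : x ∈ C.U i) (hj : x ∈ C.U j) (hk : x ∈ C.U k)
    (w : Fin 3 → ℂ) : (C.g i j x).mulVec ((C.g j k x).mulVec w) = (C.g i k x).mulVec w := by
  rw [Matrix.mulVec_mulVec, C.comp hi hj hk]

lemma self_mulVec {i x : X} (hi : x ∈ C.U i) (w : Fin 3 → ℂ) : (C.g i i x).mulVec w = w := by
  rw [C.self hi, Matrix.one_mulVec]

/-- The fibres of the flat vector bundle. -/
def Fibre (_ : SOCocycle X) (_ : X) : Type u := ULift.{u} (Fin 3 → ℂ)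

instance (x : X) : AddCommGroup (C.Fibre x) := inferInstanceAs (AddCommGroup (ULift (Fin 3 → ℂ)))
instance (x : X) : Module ℂ (C.Fibre x) := inferInstanceAs (Module ℂ (ULift (Fin 3 → ℂ)))
instance (x : X) : TopologicalSpace (C.Fibre x) :=
  inferInstanceAs (TopologicalSpace (ULift (Fin 3 → ℂ)))
instance (x : X) : IsTopologicalAddGroup (C.Fibre x) :=
  inferInstanceAs (IsTopologicalAddGroup (ULift (Fin 3 → ℂ)))

/-- The identification of a fibre with the model. -/
def down (x : X) : C.Fibre x ≃L[ℂ] (Fin 3 → ℂ) := ContinuousLinearEquiv.ulift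

instance (x : X) : ContinuousSMul ℂ (C.Fibre x) := ⟨by
  have h : Continuous fun p : ℂ × C.Fibre x => (C.down x).symm (p.1 • C.down x p.2) :=
    (C.down x).symm.continuous.comp
      (continuous_fst.smul ((C.down x).continuous.comp continuous_snd))
  refine h.congr fun p => ?_
  simp⟩

/-- The coordinates of a vector with respect to the index `i`. -/
def coord (i x : X) : C.Fibre x →ₗ[ℂ] (Fin 3 → ℂ) :=
  (C.g i x x).mulVecLin ∘ₗ (C.down x).toLinearMap

/-- The vector with given coordinates with respect to the index `i`. -/
def vec (i x : X) : (Fin 3 → ℂ) →ₗ[ℂ] C.Fibre x :=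
  (C.down x).symm.toLinearMap ∘ₗ (C.g x i x).mulVecLin

lemma coord_apply (i x : X) (a : C.Fibre x) : C.coord i x a = (C.g i x x).mulVec (C.down x a) := rfl

lemma coord_vec {i j x : X} (hi : x ∈ C.U i) (hj : x ∈ C.U j) (w : Fin 3 → ℂ) :
    C.coord i x (C.vec j x w) = (C.g i j x).mulVec w := by
  change (C.g i x x).mulVec (C.down x ((C.down x).symm ((C.g x j x).mulVec w))) = _
  rw [ContinuousLinearEquiv.apply_symm_apply, C.comp_mulVec hi (C.mem x) hj]

lemma coord_vec_self {i x : X} (hi : x ∈ C.U i) (w : Fin 3 → ℂ) : C.coord i x (C.vec i x w) = w := by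
  rw [C.coord_vec hi hi, C.self_mulVec hi]

lemma vec_coord {i x : X} (hi : x ∈ C.U i) (a : C.Fibre x) : C.vec i x (C.coord i x a) = a := by
  change (C.down x).symm ((C.g x i x).mulVec ((C.g i x x).mulVec (C.down x a))) = a
  rw [C.comp_mulVec (C.mem x) hi (C.mem x), C.self_mulVec (C.mem x),
    ContinuousLinearEquiv.symm_apply_apply]

lemma coord_change {i j x : X} (hi : x ∈ C.U i) (hj : x ∈ C.U j) (a : C.Fibre x) :
    C.coord i x a = (C.g i j x).mulVec (C.coord j x a) := by
  conv_lhs => rw [← C.vec_coord hj a]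
  exact C.coord_vec hi hj _

/-- The local trivialization of the flat bundle. -/
def pretriv (i : X) : Pretrivialization (Fin 3 → ℂ) (π (Fin 3 → ℂ) C.Fibre) where
  toFun p := (p.1, C.coord i p.1 p.2)
  invFun y := ⟨y.1, C.vec i y.1 y.2⟩
  source := TotalSpace.proj ⁻¹' C.U i
  target := C.U i ×ˢ univ
  map_source' _ hp := ⟨hp, mem_univ _⟩
  map_target' _ hy := hy.1
  left_inv' p hp := by
    obtain ⟨x, a⟩ := p
    dsimp only
    rw [C.vec_coord hp]
  right_inv' y hy := by
    dsimp only
    rw [C.coord_vec_self hy.1]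
  open_target := (C.isOpen i).prod isOpen_univ
  baseSet := C.U i
  open_baseSet := C.isOpen i
  source_eq := rfl
  target_eq := rfl
  proj_toFun _ _ := rfl

lemma pretriv_symm {i x : X} (hx : x ∈ C.U i) (w : Fin 3 → ℂ) :
    (C.pretriv i).symm x w = C.vec i x w := by
  have := (C.pretriv i).mk_symm (b := x) hx w
  have h2 : (⟨x, (C.pretriv i).symm x w⟩ : TotalSpace (Fin 3 → ℂ) C.Fibre) = ⟨x, C.vec i x w⟩ := this
  simpa using h2

lemma continuousOn_change (i j : X) :
    ContinuousOn (fun x => (C.g i j x).mulVecLin.toContinuousLinearMap) (C.U i ∩ C.U j) :=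
  fun x hx => ContinuousAt.continuousWithinAt <|
    (continuousAt_const (y := (C.g i j x).mulVecLin.toContinuousLinearMap)).congr <| by
      filter_upwards [C.const hx.1 hx.2] with y hy
      rw [hy]

/-- The flat vector bundle of a cocycle. -/
def prebundle : VectorPrebundle ℂ (Fin 3 → ℂ) C.Fibre where
  pretrivializationAtlas := range C.pretriv
  pretrivialization_linear' := by
    rintro _ ⟨i, rfl⟩
    exact ⟨fun b _ => ⟨fun a a' => map_add (C.coord i b) a a',
      fun c a => map_smul (C.coord i b) c a⟩⟩
  pretrivializationAt := C.pretriv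
  mem_base_pretrivializationAt := C.mem
  pretrivialization_mem_atlas x := ⟨x, rfl⟩
  exists_coordChange := by
    rintro _ ⟨i, rfl⟩ _ ⟨j, rfl⟩
    refine ⟨fun x => (C.g j i x).mulVecLin.toContinuousLinearMap, ?_, fun x hx v => ?_⟩
    · exact (C.continuousOn_change j i).mono fun x hx => ⟨hx.2, hx.1⟩
    · rw [C.pretriv_symm hx.1]
      exact (C.coord_vec hx.2 hx.1 v).symm
  totalSpaceMk_isInducing b := by
    refine isInducing_const_prod.2 ?_
    have : (fun a : C.Fibre b => C.coord b b a) = C.down b := by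
      funext a
      rw [coord_apply, C.self_mulVec (C.mem b)]
    rw [this]
    exact (C.down b).toHomeomorph.isInducing

instance : TopologicalSpace (TotalSpace (Fin 3 → ℂ) C.Fibre) := C.prebundle.totalSpaceTopology
instance : FiberBundle (Fin 3 → ℂ) C.Fibre := C.prebundle.toFiberBundle
instance : VectorBundle ℂ (Fin 3 → ℂ) C.Fibre := C.prebundle.toVectorBundle

variable [ChartedSpace ℂ X]

/-- The transition functions are locally constant, hence holomorphic. -/
instance : C.prebundle.IsContMDiff 𝓘(ℂ) ω where
  exists_contMDiffCoordChange := by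
    rintro _ ⟨i, rfl⟩ _ ⟨j, rfl⟩
    refine ⟨fun x => (C.g j i x).mulVecLin.toContinuousLinearMap, fun x hx =>
      ContMDiffAt.contMDiffWithinAt ?_, fun x hx v => ?_⟩
    · refine (contMDiffAt_const
        (c := (C.g j i x).mulVecLin.toContinuousLinearMap)).congr_of_eventuallyEq ?_
      filter_upwards [C.const hx.2 hx.1] with y hy
      rw [hy]
    · rw [C.pretriv_symm hx.1]
      exact (C.coord_vec hx.2 hx.1 v).symm

instance : ContMDiffVectorBundle ω (Fin 3 → ℂ) C.Fibre 𝓘(ℂ) := C.prebundle.contMDiffVectorBundle 𝓘(ℂ)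

/-- A trivialization of the flat bundle. -/
def triv (i : X) : Trivialization (Fin 3 → ℂ) (π (Fin 3 → ℂ) C.Fibre) :=
  C.prebundle.trivializationOfMemPretrivializationAtlas ⟨i, rfl⟩

instance (i : X) : MemTrivializationAtlas (C.triv i) where
  out := ⟨C.pretriv i, ⟨i, rfl⟩, rfl⟩

variable [IsManifold 𝓘(ℂ) ω X]

lemma mdifferentiableAt_section_iff {i x : X} (hx : x ∈ C.U i) {σ : ∀ y, C.Fibre y} :
    MDifferentiableAt 𝓘(ℂ) (𝓘(ℂ).prod 𝓘(ℂ, Fin 3 → ℂ)) (fun y => TotalSpace.mk' (Fin 3 → ℂ) y (σ y)) x ↔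
      MDifferentiableAt 𝓘(ℂ) 𝓘(ℂ, Fin 3 → ℂ) (fun y => C.coord i y (σ y)) x :=
  (C.triv i).mdifferentiableAt_section_iff 𝓘(ℂ) σ (show x ∈ (C.triv i).baseSet from hx)

lemma contMDiffAt_section_iff {i x : X} (hx : x ∈ C.U i) {σ : ∀ y, C.Fibre y} :
    ContMDiffAt 𝓘(ℂ) (𝓘(ℂ).prod 𝓘(ℂ, Fin 3 → ℂ)) ω (fun y => TotalSpace.mk' (Fin 3 → ℂ) y (σ y)) x ↔
      ∀ k, ContMDiffAt 𝓘(ℂ) 𝓘(ℂ) ω (fun y => C.coord i y (σ y) k) x := by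
  rw [(C.triv i).contMDiffAt_section_iff (show x ∈ (C.triv i).baseSet from hx)]
  exact contMDiffAt_pi_space

lemma contMDiffOn_section_iff {σ : ∀ y, C.Fibre y} {V : Set X} (hV : IsOpen V) :
    HolSection ℂ (Fin 3 → ℂ) σ V ↔
      ∀ i, ∀ x ∈ V, x ∈ C.U i → ∀ k, ContMDiffAt 𝓘(ℂ) 𝓘(ℂ) ω (fun y => C.coord i y (σ y) k) x := by
  constructor
  · intro h i x hx hxi
    exact (C.contMDiffAt_section_iff hxi).1 (h.contMDiffAt (hV.mem_nhds hx))
  · intro h x hx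
    exact ((C.contMDiffAt_section_iff (C.mem x)).2 (h x x hx (C.mem x))).contMDiffWithinAt

lemma killing_coord {i x : X} (hi : x ∈ C.U i) (a b : C.Fibre x) :
    killing (C.coord i x a) (C.coord i x b) = killing (C.down x a) (C.down x b) :=
  (C.isSO hi (C.mem x)).1 _ _

lemma det_coord {i x : X} (hi : x ∈ C.U i) (a : Fin 3 → C.Fibre x) :
    (Matrix.of fun k => C.coord i x (a k)).det = (Matrix.of fun k => C.down x (a k)).det := by
  have h := det_of_mulVec (C.g i x x) (C.down x (a 0)) (C.down x (a 1)) (C.down x (a 2))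
  rw [(C.isSO hi (C.mem x)).2, one_mul] at h
  convert h using 2
  · ext k l
    fin_cases k <;> rfl
  · ext k l
    fin_cases k <;> rfl

/-- The flat `SO(3, ℂ)`-bundle of a cocycle. -/
def so3Bundle : SO3Bundle X where
  W := C.Fibre
  B x := killing.compl₁₂ (C.down x).toLinearMap (C.down x).toLinearMap
  B_symm x a b := killing_comm _ _
  B_nondegenerate x a h := by
    have h0 : C.down x a = 0 := killing_nondegenerate fun w => by
      have := h ((C.down x).symm w)
      simpa using this
    simpa using h0
  B_holomorphic V hV a b ha hb := fun x hx => ContMDiffAt.contMDiffWithinAt <| by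
    have h1 := (C.contMDiffOn_section_iff hV).1 ha x x hx (C.mem x)
    have h2 := (C.contMDiffOn_section_iff hV).1 hb x x hx (C.mem x)
    have h3 : ContMDiffAt 𝓘(ℂ) 𝓘(ℂ) ω
        (fun y => killing (C.coord x y (a y)) (C.coord x y (b y))) x := by
      simp only [killing_apply]
      exact ((contMDiffAt_const.mul (h1 1)).mul (h2 1)).sub
        (contMDiffAt_const.mul (((h1 0).mul (h2 2)).add ((h1 2).mul (h2 0))))
    refine h3.congr_of_eventuallyEq ?_
    filter_upwards [(C.isOpen x).mem_nhds (C.mem x)] with y hy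
    exact (C.killing_coord hy _ _).symm
  -- The Gram determinant of the Killing form in the standard basis is `-32`, so the normalized
  -- volume form is the determinant times a square root of `-32`.
  vol x := volConst • Matrix.detRowAlternating.compLinearMap (C.down x).toLinearMap
  vol_ne_zero x h := by
    have h1 := congrArg (fun f => f fun k => (C.down x).symm (Pi.single k 1)) h
    have h2 : volConst * (Matrix.of fun k => C.down x ((C.down x).symm (Pi.single k (1 : ℂ)))).det = 0 := h1
    simp only [ContinuousLinearEquiv.apply_symm_apply] at h2
    have h3 : (Matrix.of fun k => (Pi.single k (1 : ℂ) : Fin 3 → ℂ)) = 1 := by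
      ext i j
      simp [Matrix.one_apply, Pi.single_apply, eq_comm]
    rw [h3, Matrix.det_one, mul_one] at h2
    have := volConst_sq
    rw [h2] at this
    norm_num at this
  vol_holomorphic V hV a ha := fun x hx => ContMDiffAt.contMDiffWithinAt <| by
    have h1 := fun l => (C.contMDiffOn_section_iff hV).1 (ha l) x x hx (C.mem x)
    have h3 : ContMDiffAt 𝓘(ℂ) 𝓘(ℂ) ω
        (fun y => volConst * (Matrix.of fun k => C.coord x y (a k y)).det) x := by
      simp only [Matrix.det_fin_three, Matrix.of_apply]
      refine contMDiffAt_const.mul ?_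
      have t : ∀ i j k, ContMDiffAt 𝓘(ℂ) 𝓘(ℂ) ω (fun y => C.coord x y (a 0 y) i *
          C.coord x y (a 1 y) j * C.coord x y (a 2 y) k) x :=
        fun i j k => ((h1 0 i).mul (h1 1 j)).mul (h1 2 k)
      exact (((((t 0 1 2).sub (t 0 2 1)).sub (t 1 0 2)).add (t 1 2 0)).add (t 2 0 1)).sub (t 2 1 0)
    refine h3.congr_of_eventuallyEq ?_
    filter_upwards [(C.isOpen x).mem_nhds (C.mem x)] with y hy
    exact congrArg (volConst * ·) (C.det_coord hy _).symm
  vol_normalized x a b := by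
    change (Matrix.of fun i j => killing (C.down x (a i)) (C.down x (b j))).det
      = (volConst * (Matrix.of fun k => C.down x (a k)).det)
        * (volConst * (Matrix.of fun k => C.down x (b k)).det)
    rw [det_killing]
    linear_combination -(Matrix.of fun k => C.down x (a k)).det
      * (Matrix.of fun k => C.down x (b k)).det * volConst_sq

end SOCocycle

/-! ### The cocycle of a projective structure -/

/-- Isometries are determined by their action on the conic. -/
lemma IsSO.eq_one_of_act {A : Matrix (Fin 3) (Fin 3) ℂ} (hA : IsSO A)
    (h : ∀ z, CP1.act A z = z) : A = 1 := by
  have key : ∀ z, ∃ c : ℂ, A.mulVec (CP1.nul z) = c • CP1.nul z := fun z => by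
    obtain ⟨c, -, hc⟩ := CP1.exists_mulVec_nul hA z
    exact ⟨c, by rw [hc, h]⟩
  -- The isotropic lines at `∞, 0, 1, -1` are eigenlines. Any three of them span `ℂ³` and the fourth
  -- is in general position, so `A` is a scalar `c`; then `c² = c³ = 1` forces `c = 1`.
  obtain ⟨a, ha⟩ := key CP1.infinity
  obtain ⟨b, hb⟩ := key (CP1.ofComplex 0)
  obtain ⟨c, hc⟩ := key (CP1.ofComplex 1)
  obtain ⟨d, hd⟩ := key (CP1.ofComplex (-1))
  have ea := congrFun ha
  have eb := congrFun hb
  have ec := congrFun hc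
  have ed := congrFun hd
  simp [CP1.nulC, Matrix.mulVec, dotProduct, Fin.sum_univ_three, Fin.forall_fin_succ] at ea eb ec ed
  obtain ⟨a0, a1, a2⟩ := ea
  obtain ⟨b0, b1, b2⟩ := eb
  obtain ⟨c0, c1, c2⟩ := ec
  obtain ⟨d0, d1, d2⟩ := ed
  have hc' : A 1 1 = c := by linear_combination (-c1 + a1 + b1) / 2
  have hd' : A 1 1 = d := by linear_combination (d1 - a1 - b1) / 2
  have h01 : A 0 1 = 0 := by linear_combination (d0 - c0 - hd' + hc') / 4
  have h21 : A 2 1 = 0 := by linear_combination (d2 - c2 - hd' + hc') / 4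
  have h00 : A 0 0 = c := by linear_combination c0 - b0 + 2 * h01
  have h22 : A 2 2 = c := by linear_combination c2 - a2 + 2 * h21
  have hA' : A = c • 1 := by
    ext i j
    fin_cases i <;> fin_cases j <;> simp [a1, a2, b0, b1, h00, h01, h21, h22, hc']
  have hk := hA.1 (Pi.single 1 1) (Pi.single 1 1)
  have hdet := hA.2
  simp [hA', killing_apply] at hk
  simp [hA'] at hdet
  have : c = 1 := by linear_combination hdet - c * hk / 2
  rw [hA', this, one_smul]

lemma IsSO.eq_of_act {A B : Matrix (Fin 3) (Fin 3) ℂ} (hA : IsSO A) (hB : IsSO B)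
    (h : ∀ z, CP1.act A z = CP1.act B z) : A = B := by
  have h1 : B⁻¹ * A = 1 := (hB.inv.mul hA).eq_one_of_act fun z => by
    rw [← CP1.act_act hA, h, CP1.act_act hB, hB.inv_mul, CP1.act_one]
  rw [← one_mul A, ← hB.mul_inv, mul_assoc, h1, mul_one]

/-! ### Flat coordinates of one connection differ by a constant isometry -/

section Transition

variable {X : Type u} [TopologicalSpace X] [ChartedSpace ℂ X] [IsManifold 𝓘(ℂ) ω X]
  {P : Type*} [TopologicalSpace P] [ChartedSpace (ℂ × ℂ) P] [IsManifold 𝓘(ℂ, ℂ × ℂ) ω P]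
  {γ : P → X} {H : ∀ p : P, Submodule ℂ (TangentSpace 𝓘(ℂ, ℂ × ℂ) p)} {U U' : Set X} {ζ ζ' : P → CP1}

/-- Flat coordinates differ by a constant isometry. -/
theorem IsFlatCoord.exists_change (h : IsFlatCoord γ H U ζ) (h' : IsFlatCoord γ H U' ζ')
    (hH : IsHolConnection γ H) {x : X} (hx : x ∈ U) (hx' : x ∈ U') :
    ∃ A, IsSO A ∧ ∀ᶠ y in 𝓝 x, ∀ p, γ p = y → ζ p = CP1.act A (ζ' p) := by
  have hφ := isHolChart_chartAt (E := ℂ) x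
  have hxφ := _root_.mem_chart_source ℂ x
  set φ := chartAt ℂ x
  have hVo : IsOpen ((U ∩ U') ∩ φ.source) := (h.isOpen.inter h'.isOpen).inter φ.open_source
  have hxV : x ∈ (U ∩ U') ∩ φ.source := ⟨⟨hx, hx'⟩, hxφ⟩
  set V := (U ∩ U') ∩ φ.source with hV
  replace h := h.mono hVo fun y hy => hy.1.1
  replace h' := h'.mono hVo fun y hy => hy.1.2
  have hstd : ∀ ζ : P → CP1, IsFibreCoord γ V ζ → ∀ p, ∃ ψ : (Fin 3 → ℂ) →ₗ[ℂ] TangentSpace 𝓘(ℂ, ℂ × ℂ) p,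
      γ p ∈ V → ∀ w, IsStdAt γ ζ w p (ψ w) := fun ζ h p => by
    by_cases hp : γ p ∈ V
    · obtain ⟨ψ, hψ⟩ := h.exists_stdMap hp
      exact ⟨ψ, fun _ => hψ⟩
    · exact ⟨0, fun hp' => absurd hp' hp⟩
  choose ψ hψ using hstd ζ h.toIsFibreCoord
  choose ψ' hψ' using hstd ζ' h'.toIsFibreCoord
  have inj : ∀ {y}, y ∈ V → ∀ {w}, (∀ p, γ p = y → IsStdAt γ ζ w p 0) → w = 0 := fun hy w hw =>
    h.toIsFibreCoord.eq_zero_of_isStdAt hy hw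
  have inj' : ∀ {y}, y ∈ V → ∀ {u w}, (∀ p, γ p = y → ψ p u = ψ p w) → u = w := fun {y} hy {u w} he => by
    refine sub_eq_zero.1 (inj hy fun p hp => ?_)
    have := hψ p (by rw [hp]; exact hy) (u - w)
    rwa [map_sub, he p hp, sub_self] at this
  have hnear : ∀ {p}, γ p ∈ V → ∀ᶠ q in 𝓝 p, γ q ∈ V := fun hp => h.isOpen_preimage.mem_nhds hp
  have hhol : ∀ w, HolVectorField (fun p => ψ' p w) (γ ⁻¹' V) := fun w p hp =>
    (h'.toIsFibreCoord.contMDiffAt_of_isStdAt hp (a := fun _ => w) (fun _ => contMDiffAt_const)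
      ((hnear hp).mono fun q hq => hψ' q hq w)).contMDiffWithinAt
  -- `a w` denotes the coefficients, in the coordinate `ζ`, of the field that has constant
  -- coefficients `w` in the coordinate `ζ'`.
  have hex := fun w => h.toIsFibreCoord.exists_isStdAt (hhol w) fun p hp => (hψ' p hp w).1
  choose a ha hastd using hex
  have ha' : ∀ w {y}, y ∈ V → ∀ i, ContMDiffAt 𝓘(ℂ) 𝓘(ℂ) ω (a w · i) y := fun w y hy i =>
    (ha w i).contMDiffAt (hVo.mem_nhds hy)
  have haψ : ∀ w p, γ p ∈ V → ψ p (a w (γ p)) = ψ' p w := fun w p hp =>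
    h.toIsFibreCoord.isStdAt_unique hp (hψ p hp _) (hastd w p hp)
  -- linearity
  let A : X → Matrix (Fin 3) (Fin 3) ℂ := fun y => Matrix.of fun i j => a (Pi.single j 1) y i
  have hA : ∀ y ∈ V, ∀ w, a w y = (A y).mulVec w := fun y hy w => by
    refine inj' hy fun p hp => ?_
    subst hp
    rw [haψ w p hy, Matrix.mulVec_eq_sum, map_sum]
    conv_lhs => rw [pi_eq_sum_univ' w, map_sum]
    refine Finset.sum_congr rfl fun j _ => ?_
    rw [map_smul, op_smul_eq_smul, map_smul, ← haψ _ p hy]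
    rfl
  -- the coefficients are constant
  obtain ⟨v, hv, hv1⟩ := hφ.exists_coordField
  obtain ⟨η, -, hη⟩ := hH.exists_horizontalLift h.proj hφ
  have hηv : ∀ q, γ q ∈ V → mfderiv 𝓘(ℂ, ℂ × ℂ) 𝓘(ℂ) γ q (η q) = v (γ q) := fun q hq =>
    hφ.mvfderiv_injective hq.2 (((hη q hq.2).2).trans (hv1 _ hq.2).symm)
  -- The Lie derivative of such a field along the horizontal lift is zero when computed in `ζ'`, and
  -- differentiates `a w` when computed in `ζ`.
  have hder : ∀ w i, ∀ y ∈ V, ∀ u, mvfderiv 𝓘(ℂ) (a w · i) y u = 0 := fun w i y hy u => by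
    have h0 : (fun i => mvfderiv 𝓘(ℂ) (a w · i) y (v y)) = 0 := inj hy fun p hp => by
      subst hp
      have hvV : HolVectorField v V := ContMDiffOn.mono hv fun y hy => hy.2
      have e1 := h.toIsFibreCoord.isStdAt_mlieBracket_horizontal hy (ha' w hy) hVo hy hvV (η := η)
        ((hnear hy).mono fun q hq => ⟨hηv q hq, fun A hA hz => h.flat q hq _ (hη q hq.2).1 A hA hz⟩)
        ((hnear hy).mono fun q hq => hastd w q hq)
      have e2 := h'.toIsFibreCoord.isStdAt_mlieBracket_horizontal hy (a := fun _ => w)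
        (fun _ => contMDiffAt_const) hVo hy hvV (η := η)
        ((hnear hy).mono fun q hq => ⟨hηv q hq, fun A hA hz => h'.flat q hq _ (hη q hq.2).1 A hA hz⟩)
        ((hnear hy).mono fun q hq => hψ' q hq w)
      have e3 : (fun i => mvfderiv 𝓘(ℂ) (fun _ : X => w i) (γ p) (v (γ p))) = 0 := funext fun i =>
        congrArg (fun L : ℂ →L[ℂ] ℂ => L (v (γ p)))
          (mfderiv_const (I := 𝓘(ℂ)) (I' := 𝓘(ℂ)) (x := γ p) (c := w i))
      rw [e3] at e2
      have e4 := h'.toIsFibreCoord.isStdAt_unique hy e2 (hψ' p hy 0)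
      rw [e4, map_zero] at e1
      exact e1
    obtain ⟨-, h1⟩ := mvfderiv_eq_deriv_mul hφ hy.2 ((ha' w hy i).mdifferentiableAt (by simp)) (v y)
    rw [congrFun h0 i, hv1 y hy.2, mul_one] at h1
    rw [(mvfderiv_eq_deriv_mul hφ hy.2 ((ha' w hy i).mdifferentiableAt (by simp)) u).2, ← h1]
    exact zero_mul _
  have hconst : ∀ᶠ y in 𝓝 x, A y = A x := by
    have := fun i j => eventually_eq_of_mvfderiv_eq_zero hVo (ha (Pi.single j 1) i)
      (hder (Pi.single j 1) i) hxV
    filter_upwards [eventually_all.2 fun i => eventually_all.2 fun j => this i j] with y hy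
    ext i j
    exact hy i j
  -- The change of coefficients respects the Lie bracket of vector fields, so it is an isometry of
  -- determinant one.
  have hSO : IsSO (A x) := by
    refine IsSO.of_brk (fun hdet => ?_) fun w w' => ?_
    · obtain ⟨w, hw0, hw⟩ := Matrix.exists_mulVec_eq_zero_iff.2 hdet
      refine hw0 (h'.toIsFibreCoord.eq_zero_of_isStdAt hxV fun p hp => ?_)
      subst hp
      have := hψ' p hxV w
      rwa [← haψ w p hxV, hA _ hxV, hw, map_zero] at this
    · refine inj' hxV fun p hp => ?_
      subst hp
      have e1 := h.toIsFibreCoord.isStdAt_mlieBracket hxV (ha' w hxV) (ha' w' hxV)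
        ((hnear hxV).mono fun q hq => hastd w q hq) ((hnear hxV).mono fun q hq => hastd w' q hq)
      have e2 := h'.toIsFibreCoord.isStdAt_mlieBracket hxV (a := fun _ => w) (b := fun _ => w')
        (fun _ => contMDiffAt_const) (fun _ => contMDiffAt_const)
        ((hnear hxV).mono fun q hq => hψ' q hq w) ((hnear hxV).mono fun q hq => hψ' q hq w')
      rw [← hA _ hxV, ← hA _ hxV, ← hA _ hxV, haψ _ p hxV,
        h.toIsFibreCoord.isStdAt_unique hxV (hψ p hxV _) e1,
        h'.toIsFibreCoord.isStdAt_unique hxV (hψ' p hxV _) e2]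
  refine ⟨A x, hSO, ?_⟩
  filter_upwards [hconst, hVo.mem_nhds hxV] with y hy hyV p hp
  subst hp
  -- The field with a double zero at `ζ' p` vanishes at `p`. Read in `ζ` this says that `A (nul (ζ'
  -- p))` is orthogonal to `nul (ζ p)`, so the two isotropic lines coincide.
  have h0 := h'.toIsFibreCoord.isStdAt_zero_iff hyV (w := CP1.nul (ζ' p))
  rw [isNull_iff.1 (CP1.isNull_nul _), eq_self_iff_true, iff_true] at h0
  have h1 := hastd (CP1.nul (ζ' p)) p hyV
  rw [h'.toIsFibreCoord.isStdAt_unique hyV (hψ' p hyV _) h0,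
    h.toIsFibreCoord.isStdAt_zero_iff hyV, hA _ hyV, hy] at h1
  obtain ⟨c, hc, he⟩ := CP1.exists_mulVec_nul hSO (ζ' p)
  rw [he, map_smul, LinearMap.smul_apply, smul_eq_mul, mul_eq_zero, or_iff_right hc] at h1
  exact (CP1.eq_of_killing_nul h1).symm

end Transition

section Cocycle

variable {X : Type u} [TopologicalSpace X] [ChartedSpace ℂ X] [IsManifold 𝓘(ℂ) ω X] {S : Finset X}
  (T : BranchedTriple X S)

/-- After a constant isometry and shrinking, the section avoids `∞`, so the developing map may be
taken with values in `ℂ`. -/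
lemma BranchedTriple.exists_flatCoord_ne_infinity (x : X) :
    ∃ U, x ∈ U ∧ ∃ ζ, IsFlatCoord T.γ T.H U ζ ∧ ∀ y ∈ U, ζ (T.s y) ≠ CP1.infinity := by
  obtain ⟨U, hx, ζ, hζ⟩ := T.isConnection.exists_isFlatCoord T.isBundle x
  obtain ⟨A, hA, hz⟩ := CP1.exists_act_ne_infinity (ζ (T.s x))
  have h' := hζ.actConst hA
  have hev : ∀ᶠ y in 𝓝 x, y ∈ U ∧ CP1.act A (ζ (T.s y)) ≠ CP1.infinity :=
    (hζ.isOpen.eventually_mem hx).and <|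
      ((h'.contMDiffAt (p := T.s x) (by rw [T.s_section]; exact hx)).continuousAt.comp
        (T.s_holomorphic x).continuousAt).eventually_ne hz
  obtain ⟨V, hV, hVo, hxV⟩ := eventually_nhds_iff.1 hev
  exact ⟨V, hxV, _, h'.mono hVo fun y hy => (hV y hy).1, fun y hy => (hV y hy).2⟩

open Classical in
/-- The cocycle of flat coordinates of a projective structure. -/
theorem BranchedTriple.exists_cocycle : ∃ (C : SOCocycle X) (ζ : X → T.P → CP1),
    (∀ i, IsFlatCoord T.γ T.H (C.U i) (ζ i)) ∧
    (∀ i, ∀ y ∈ C.U i, ζ i (T.s y) ≠ CP1.infinity) ∧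
    ∀ i j p, T.γ p ∈ C.U i → T.γ p ∈ C.U j → ζ i p = CP1.act (C.g i j (T.γ p)) (ζ j p) := by
  choose U hxU ζ hζ hs using T.exists_flatCoord_ne_infinity
  have hex : ∀ i j x, ∃ A, x ∈ U i → x ∈ U j → IsSO A ∧
      ∀ᶠ y in 𝓝 x, ∀ p, T.γ p = y → ζ i p = CP1.act A (ζ j p) := fun i j x => by
    by_cases h : x ∈ U i ∧ x ∈ U j
    · obtain ⟨A, hA⟩ := (hζ i).exists_change (hζ j) T.isConnection h.1 h.2
      exact ⟨A, fun _ _ => hA⟩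
    · exact ⟨1, fun hi hj => absurd ⟨hi, hj⟩ h⟩
  choose g hg using hex
  -- An isometry is determined by its action on one whole fibre. The cocycle identities and the
  -- local constancy all follow from this uniqueness.
  have huniq : ∀ j x, x ∈ U j → ∀ A B, IsSO A → IsSO B →
      (∀ p, T.γ p = x → CP1.act A (ζ j p) = CP1.act B (ζ j p)) → A = B := fun j x hj A B hA hB h => by
    refine hA.eq_of_act hB fun z => ?_
    obtain ⟨σ, -, hσ, -⟩ := (hζ j).exists_inv
    obtain ⟨e1, e2⟩ := hσ x hj z
    rw [← e2]
    exact h _ e1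
  have hact : ∀ i j x, x ∈ U i → x ∈ U j → ∀ p, T.γ p = x → ζ i p = CP1.act (g i j x) (ζ j p) :=
    fun i j x hi hj => (hg i j x hi hj).2.self_of_nhds
  let C : SOCocycle X :=
    { U := U
      isOpen := fun i => (hζ i).isOpen
      mem := hxU
      g := g
      isSO := fun hi hj => (hg _ _ _ hi hj).1
      self := fun {i x} hi => huniq i x hi _ _ (hg _ _ _ hi hi).1 IsSO.one fun p hp => by
        rw [← hact i i x hi hi p hp, CP1.act_one]
      comp := fun {i j k x} hi hj hk => huniq k x hk _ _
        ((hg _ _ _ hi hj).1.mul (hg _ _ _ hj hk).1) (hg _ _ _ hi hk).1 fun p hp => by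
          rw [← CP1.act_act (hg _ _ _ hj hk).1, ← hact j k x hj hk p hp, ← hact i j x hi hj p hp,
            ← hact i k x hi hk p hp]
      const := fun {i j x} hi hj => by
        filter_upwards [(hg i j x hi hj).2, (hζ i).isOpen.mem_nhds hi, (hζ j).isOpen.mem_nhds hj]
          with y hy hyi hyj
        refine huniq j y hyj _ _ (hg _ _ _ hyi hyj).1 (hg _ _ _ hi hj).1 fun p hp => ?_
        rw [← hact i j y hyi hyj p hp, hy p hp] }
  exact ⟨C, ζ, hζ, hs, fun i j p hi hj => hact i j _ hi hj p rfl⟩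

end Cocycle

/-! ### The oper of a developing map -/

section Calculus

variable {E : Type*} [NormedAddCommGroup E] [NormedSpace ℂ E]
  {M : Type*} [TopologicalSpace M] [ChartedSpace E M]

lemma mvfderiv_apply_comp {f : M → Fin 3 → ℂ} {x : M} (hf : MDifferentiableAt 𝓘(ℂ, E) 𝓘(ℂ, Fin 3 → ℂ) f x)
    (v : TangentSpace 𝓘(ℂ, E) x) (k : Fin 3) :
    mvfderiv 𝓘(ℂ, E) (fun y => f y k) x v = mvfderiv 𝓘(ℂ, E) f x v k :=
  mvfderiv_clm_comp (ContinuousLinearMap.proj (R := ℂ) (φ := fun _ : Fin 3 => ℂ) k) hf v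

lemma mdifferentiableAt_pi_comp {f : M → Fin 3 → ℂ} {x : M} :
    MDifferentiableAt 𝓘(ℂ, E) 𝓘(ℂ, Fin 3 → ℂ) f x ↔
      ∀ k, MDifferentiableAt 𝓘(ℂ, E) 𝓘(ℂ) (fun y => f y k) x := by
  simp only [mdifferentiableAt_iff, continuousAt_pi, forall_and]
  exact and_congr_right fun _ => differentiableWithinAt_pi

lemma mvfderiv_mul_apply {f g : M → ℂ} {x : M} (hf : MDifferentiableAt 𝓘(ℂ, E) 𝓘(ℂ) f x)
    (hg : MDifferentiableAt 𝓘(ℂ, E) 𝓘(ℂ) g x) (v : TangentSpace 𝓘(ℂ, E) x) :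
    mvfderiv 𝓘(ℂ, E) (fun y => f y * g y) x v
      = mvfderiv 𝓘(ℂ, E) f x v * g x + f x * mvfderiv 𝓘(ℂ, E) g x v := by
  have := congrArg (fun L => L v) (mvfderiv_mul hf hg)
  refine Eq.trans this ?_
  simp
  ring

lemma mvfderiv_add_apply {F : Type*} [NormedAddCommGroup F] [NormedSpace ℂ F] {f g : M → F} {x : M}
    (hf : MDifferentiableAt 𝓘(ℂ, E) 𝓘(ℂ, F) f x)
    (hg : MDifferentiableAt 𝓘(ℂ, E) 𝓘(ℂ, F) g x) (v : TangentSpace 𝓘(ℂ, E) x) :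
    mvfderiv 𝓘(ℂ, E) (fun y => f y + g y) x v
      = mvfderiv 𝓘(ℂ, E) f x v + mvfderiv 𝓘(ℂ, E) g x v :=
  congrArg (fun L => L v) (mvfderiv_add hf hg)

lemma mvfderiv_sub_apply {F : Type*} [NormedAddCommGroup F] [NormedSpace ℂ F] {f g : M → F} {x : M}
    (hf : MDifferentiableAt 𝓘(ℂ, E) 𝓘(ℂ, F) f x)
    (hg : MDifferentiableAt 𝓘(ℂ, E) 𝓘(ℂ, F) g x) (v : TangentSpace 𝓘(ℂ, E) x) :
    mvfderiv 𝓘(ℂ, E) (fun y => f y - g y) x v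
      = mvfderiv 𝓘(ℂ, E) f x v - mvfderiv 𝓘(ℂ, E) g x v :=
  congrArg (fun L => L v) (mvfderiv_sub hf hg)

lemma mvfderiv_const_mul {f : M → ℂ} {x : M} (c : ℂ)
    (hf : MDifferentiableAt 𝓘(ℂ, E) 𝓘(ℂ) f x) (v : TangentSpace 𝓘(ℂ, E) x) :
    mvfderiv 𝓘(ℂ, E) (fun y => c * f y) x v = c * mvfderiv 𝓘(ℂ, E) f x v :=
  mvfderiv_clm_comp (c • ContinuousLinearMap.id ℂ ℂ) hf v

lemma mvfderiv_killing {f g : M → Fin 3 → ℂ} {x : M}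
    (hf : MDifferentiableAt 𝓘(ℂ, E) 𝓘(ℂ, Fin 3 → ℂ) f x)
    (hg : MDifferentiableAt 𝓘(ℂ, E) 𝓘(ℂ, Fin 3 → ℂ) g x) (v : TangentSpace 𝓘(ℂ, E) x) :
    mvfderiv 𝓘(ℂ, E) (fun y => killing (f y) (g y)) x v
      = killing (mvfderiv 𝓘(ℂ, E) f x v) (g x) + killing (f x) (mvfderiv 𝓘(ℂ, E) g x v) := by
  have hf' := mdifferentiableAt_pi_comp.1 hf
  have hg' := mdifferentiableAt_pi_comp.1 hg
  have hm : ∀ i j, MDifferentiableAt 𝓘(ℂ, E) 𝓘(ℂ) (fun y => f y i * g y j) x :=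
    fun i j => (hf' i).mul (hg' j)
  have e : (fun y => killing (f y) (g y))
      = fun y => 2 * (f y 1 * g y 1) - 4 * (f y 0 * g y 2 + f y 2 * g y 0) := by
    funext y
    rw [killing_apply]
    ring
  have s1 : MDifferentiableAt 𝓘(ℂ, E) 𝓘(ℂ) (fun y => f y 0 * g y 2 + f y 2 * g y 0) x :=
    (hm 0 2).add (hm 2 0)
  have s2 : MDifferentiableAt 𝓘(ℂ, E) 𝓘(ℂ) (fun y => 2 * (f y 1 * g y 1)) x :=
    mdifferentiableAt_const.mul (hm 1 1)
  have s3 : MDifferentiableAt 𝓘(ℂ, E) 𝓘(ℂ) (fun y => 4 * (f y 0 * g y 2 + f y 2 * g y 0)) x :=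
    mdifferentiableAt_const.mul s1
  rw [e, mvfderiv_sub_apply s2 s3, mvfderiv_const_mul _ (hm 1 1),
    mvfderiv_const_mul _ s1, mvfderiv_add_apply (hm 0 2) (hm 2 0),
    mvfderiv_mul_apply (hf' 1) (hg' 1), mvfderiv_mul_apply (hf' 0) (hg' 2),
    mvfderiv_mul_apply (hf' 2) (hg' 0)]
  simp only [mvfderiv_apply_comp hf, mvfderiv_apply_comp hg, killing_apply]
  ring

lemma mvfderiv_det {f : Fin 3 → M → Fin 3 → ℂ} {x : M}
    (hf : ∀ i, MDifferentiableAt 𝓘(ℂ, E) 𝓘(ℂ, Fin 3 → ℂ) (f i) x) (v : TangentSpace 𝓘(ℂ, E) x) :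
    mvfderiv 𝓘(ℂ, E) (fun y => (Matrix.of fun i => f i y).det) x v
      = ∑ i, (Matrix.of (Function.update (fun j => f j x) i (mvfderiv 𝓘(ℂ, E) (f i) x v))).det := by
  have hf' := fun i => mdifferentiableAt_pi_comp.1 (hf i)
  have h2 : ∀ j k, MDifferentiableAt 𝓘(ℂ, E) 𝓘(ℂ) (fun y => f 1 y j * f 2 y k) x :=
    fun j k => (hf' 1 j).mul (hf' 2 k)
  have h3 : ∀ i j k, MDifferentiableAt 𝓘(ℂ, E) 𝓘(ℂ) (fun y => f 0 y i * (f 1 y j * f 2 y k)) x :=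
    fun i j k => (hf' 0 i).mul (h2 j k)
  have e : (fun y => (Matrix.of fun i => f i y).det) = fun y =>
      ((f 0 y 0 * (f 1 y 1 * f 2 y 2) - f 0 y 0 * (f 1 y 2 * f 2 y 1)) +
      (f 0 y 1 * (f 1 y 2 * f 2 y 0) - f 0 y 1 * (f 1 y 0 * f 2 y 2))) +
      (f 0 y 2 * (f 1 y 0 * f 2 y 1) - f 0 y 2 * (f 1 y 1 * f 2 y 0)) := by
    funext y
    rw [Matrix.det_fin_three]
    simp only [Matrix.of_apply]
    ring
  have d2 : ∀ j k, mvfderiv 𝓘(ℂ, E) (fun y => f 1 y j * f 2 y k) x v = _ :=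
    fun j k => mvfderiv_mul_apply (hf' 1 j) (hf' 2 k) v
  have d3 : ∀ i j k, mvfderiv 𝓘(ℂ, E) (fun y => f 0 y i * (f 1 y j * f 2 y k)) x v = _ :=
    fun i j k => mvfderiv_mul_apply (hf' 0 i) (h2 j k) v
  have h4 : ∀ i j k i' j' k', MDifferentiableAt 𝓘(ℂ, E) 𝓘(ℂ) (fun y =>
      f 0 y i * (f 1 y j * f 2 y k) - f 0 y i' * (f 1 y j' * f 2 y k')) x :=
    fun i j k i' j' k' => (h3 i j k).sub (h3 i' j' k')
  have h5 : MDifferentiableAt 𝓘(ℂ, E) 𝓘(ℂ) (fun y =>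
      (f 0 y 0 * (f 1 y 1 * f 2 y 2) - f 0 y 0 * (f 1 y 2 * f 2 y 1)) +
      (f 0 y 1 * (f 1 y 2 * f 2 y 0) - f 0 y 1 * (f 1 y 0 * f 2 y 2))) x :=
    (h4 0 1 2 0 2 1).add (h4 1 2 0 1 0 2)
  rw [e, mvfderiv_add_apply h5 (h4 _ _ _ _ _ _),
    mvfderiv_add_apply (h4 _ _ _ _ _ _) (h4 _ _ _ _ _ _),
    mvfderiv_sub_apply (h3 _ _ _) (h3 _ _ _), mvfderiv_sub_apply (h3 _ _ _) (h3 _ _ _),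
    mvfderiv_sub_apply (h3 _ _ _) (h3 _ _ _)]
  simp only [d3, d2, mvfderiv_apply_comp (hf _), Fin.sum_univ_three, Matrix.det_fin_three,
    Matrix.of_apply]
  simp [Function.update_apply]
  ring

end Calculus

/-! ### The flat connection on the bundle of a cocycle -/

namespace SOCocycle

variable {X : Type u} [TopologicalSpace X] [ChartedSpace ℂ X] [IsManifold 𝓘(ℂ) ω X]
  (C : SOCocycle X)

lemma hol_iff {σ : ∀ y, C.so3Bundle.W y} {V : Set X} (hV : IsOpen V) :
    C.so3Bundle.Hol σ V ↔
      ∀ i, ∀ x ∈ V, x ∈ C.U i → ∀ k, ContMDiffAt 𝓘(ℂ) 𝓘(ℂ) ω (fun y => C.coord i y (σ y) k) x :=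
  C.contMDiffOn_section_iff hV

lemma coord_eventuallyEq {i j x : X} (hi : x ∈ C.U i) (hj : x ∈ C.U j) (σ : ∀ y, C.Fibre y) :
    (fun y => C.coord i y (σ y)) =ᶠ[𝓝 x] fun y => (C.g i j x).mulVec (C.coord j y (σ y)) := by
  filter_upwards [C.const hi hj, (C.isOpen i).mem_nhds hi, (C.isOpen j).mem_nhds hj] with y hy hyi hyj
  rw [C.coord_change hyi hyj, hy]

/-- The flat connection on the bundle of a cocycle. -/
def D (σ : ∀ x, C.so3Bundle.W x) (x : X) : TangentSpace 𝓘(ℂ) x →L[ℂ] C.so3Bundle.W x :=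
  ((C.down x).symm : (Fin 3 → ℂ) →L[ℂ] C.Fibre x).comp
    (mvfderiv 𝓘(ℂ) (fun y => C.coord x y (σ y)) x)

/-- The connection at `x` is defined with the index `x`; any other index computes it too, since the
transition matrices are locally constant. -/
lemma coord_D {i x : X} (hi : x ∈ C.U i) {σ : ∀ x, C.Fibre x}
    (hσ : MDifferentiableAt 𝓘(ℂ) 𝓘(ℂ, Fin 3 → ℂ) (fun y => C.coord x y (σ y)) x)
    (v : TangentSpace 𝓘(ℂ) x) :
    C.coord i x (C.D σ x v) = mvfderiv 𝓘(ℂ) (fun y => C.coord i y (σ y)) x v := by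
  rw [mvfderiv_congr (C.coord_eventuallyEq hi (C.mem x) σ)]
  refine Eq.trans ?_ (mvfderiv_clm_comp (C.g i x x).mulVecLin.toContinuousLinearMap hσ v).symm
  change (C.g i x x).mulVec (C.down x ((C.down x).symm _)) = _
  rw [ContinuousLinearEquiv.apply_symm_apply]
  rfl

variable {C}

lemma mdifferentiableAt_coord {i x : X} (hi : x ∈ C.U i) {σ : ∀ x, C.so3Bundle.W x} {V : Set X}
    (hV : IsOpen V) (hσ : C.so3Bundle.Hol σ V) (hx : x ∈ V) :
    MDifferentiableAt 𝓘(ℂ) 𝓘(ℂ, Fin 3 → ℂ) (fun y => C.coord i y (σ y)) x :=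
  mdifferentiableAt_pi_comp.2 fun k =>
    ((C.hol_iff hV).1 hσ i x hx hi k).mdifferentiableAt (by simp)

lemma coord_D_apply {i x : X} (hi : x ∈ C.U i) {σ : ∀ x, C.so3Bundle.W x} {V : Set X}
    (hV : IsOpen V) (hσ : C.so3Bundle.Hol σ V) (hx : x ∈ V) (v : TangentSpace 𝓘(ℂ) x) (k : Fin 3) :
    C.coord i x (C.D σ x v) k = mvfderiv 𝓘(ℂ) (fun y => C.coord i y (σ y) k) x v := by
  rw [C.coord_D hi (mdifferentiableAt_coord (C.mem x) hV hσ hx),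
    mvfderiv_apply_comp (mdifferentiableAt_coord hi hV hσ hx)]

lemma down_D (σ : ∀ x, C.Fibre x) (x : X) (v : TangentSpace 𝓘(ℂ) x) :
    C.down x (C.D σ x v) = mvfderiv 𝓘(ℂ) (fun y => C.coord x y (σ y)) x v :=
  (C.down x).apply_symm_apply _

lemma down_eq (x : X) (a : C.Fibre x) : C.down x a = C.coord x x a := by
  rw [coord_apply, C.self_mulVec (C.mem x)]

variable (C)

lemma D_isCovariantDerivative : IsCovariantDerivativeOn (Fin 3 → ℂ) C.D where
  add {σ σ' x} hσ hσ' _ := by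
    have h1 := (C.mdifferentiableAt_section_iff (C.mem x)).1 hσ
    have h2 := (C.mdifferentiableAt_section_iff (C.mem x)).1 hσ'
    refine ContinuousLinearMap.ext fun v => ?_
    refine (C.down x).injective ?_
    change C.down x (C.D (σ + σ') x v) = C.down x (C.D σ x v + C.D σ' x v)
    have := mvfderiv_add_apply h1 h2 v
    refine ((down_D (C := C) (σ + σ') x v).trans ?_).trans (map_add (C.down x) _ _).symm
    refine Eq.trans ?_ (this.trans (congrArg₂ (· + ·) (down_D σ x v).symm (down_D σ' x v).symm))
    refine mvfderiv_congr (Eventually.of_forall fun y => ?_) v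
    exact map_add (C.coord x y) _ _
  leibniz {σ g x} hσ hg _ := by
    have h1 := (C.mdifferentiableAt_section_iff (C.mem x)).1 hσ
    refine ContinuousLinearMap.ext fun v => ?_
    refine (C.down x).injective ?_
    change C.down x (C.D (g • σ) x v) = C.down x (g x • C.D σ x v + mvfderiv 𝓘(ℂ) g x v • σ x)
    have := congrArg (fun L => L v) (mvfderiv_smul hg h1)
    refine ((down_D (C := C) (g • σ) x v).trans ?_).trans
      ((map_add (C.down x) _ _).trans (congrArg₂ (· + ·) (map_smul (C.down x) _ _)
        (map_smul (C.down x) _ _))).symm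
    refine (Eq.trans ?_ this).trans ?_
    · refine mvfderiv_congr (Eventually.of_forall fun y => ?_) v
      exact map_smul (C.coord x y) _ _
    · have e1 := down_D (C := C) σ x v
      have e2 := down_eq (C := C) x (σ x)
      rw [show (C.down x) (C.D σ x v) = _ from e1, show (C.down x) (σ x) = _ from e2]
      rfl

lemma D_holomorphic {V : Set X} (hV : IsOpen V) {σ : ∀ x, C.so3Bundle.W x}
    {v : ∀ x : X, TangentSpace 𝓘(ℂ) x} (hσ : C.so3Bundle.Hol σ V) (hv : HolVectorField v V) :
    C.so3Bundle.Hol (fun x => C.D σ x (v x)) V := by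
  refine (C.hol_iff hV).2 fun i x hx hi k => ?_
  have h1 := contMDiffAt_mvfderiv_apply ((C.hol_iff hV).1 hσ i x hx hi k)
    (hv.contMDiffAt (hV.mem_nhds hx))
  refine h1.congr_of_eventuallyEq ?_
  filter_upwards [hV.mem_nhds hx, (C.isOpen i).mem_nhds hi] with y hy hyi
  exact coord_D_apply hyi hV hσ hy _ k

lemma D_B {V : Set X} (hV : IsOpen V) {a b : ∀ x, C.so3Bundle.W x} (ha : C.so3Bundle.Hol a V)
    (hb : C.so3Bundle.Hol b V) {x : X} (hx : x ∈ V) (v : TangentSpace 𝓘(ℂ) x) :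
    mvfderiv 𝓘(ℂ) (fun y => C.so3Bundle.B y (a y) (b y)) x v
      = C.so3Bundle.B x (C.D a x v) (b x) + C.so3Bundle.B x (a x) (C.D b x v) := by
  have h1 := mvfderiv_killing (mdifferentiableAt_coord (C.mem x) hV ha hx)
    (mdifferentiableAt_coord (C.mem x) hV hb hx) v
  refine Eq.trans (mvfderiv_congr ?_ v) (h1.trans ?_)
  swap
  · have e1 := down_D (C := C) a x v
    have e2 := down_D (C := C) b x v
    have e3 := down_eq (C := C) x (a x)
    have e4 := down_eq (C := C) x (b x)
    rw [← e1, ← e2, ← e3, ← e4]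
    rfl
  filter_upwards [(C.isOpen x).mem_nhds (C.mem x)] with y hy
  exact (C.killing_coord hy _ _).symm

lemma D_vol {V : Set X} (hV : IsOpen V) {a : Fin 3 → ∀ x, C.so3Bundle.W x}
    (ha : ∀ i, C.so3Bundle.Hol (a i) V) {x : X} (hx : x ∈ V) (v : TangentSpace 𝓘(ℂ) x) :
    mvfderiv 𝓘(ℂ) (fun y => C.so3Bundle.vol y fun i => a i y) x v
      = ∑ i, C.so3Bundle.vol x (Function.update (fun j => a j x) i (C.D (a i) x v)) := by
  have hd := fun i => mdifferentiableAt_coord (C.mem x) hV (ha i) hx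
  have h1 := mvfderiv_det hd v
  have hdet : MDifferentiableAt 𝓘(ℂ) 𝓘(ℂ) (fun y => (Matrix.of fun i => C.coord x y (a i y)).det) x := by
    have hd' := fun i => mdifferentiableAt_pi_comp.1 (hd i)
    simp only [Matrix.det_fin_three, Matrix.of_apply]
    have t : ∀ i j k, MDifferentiableAt 𝓘(ℂ) 𝓘(ℂ) (fun y => C.coord x y (a 0 y) i *
        C.coord x y (a 1 y) j * C.coord x y (a 2 y) k) x :=
      fun i j k => ((hd' 0 i).mul (hd' 1 j)).mul (hd' 2 k)
    exact (((((t 0 1 2).sub (t 0 2 1)).sub (t 1 0 2)).add (t 1 2 0)).add (t 2 0 1)).sub (t 2 1 0)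
  have h2 := mvfderiv_const_mul volConst hdet v
  rw [h1, Finset.mul_sum] at h2
  refine Eq.trans (mvfderiv_congr ?_ v) (h2.trans (Finset.sum_congr rfl fun i _ => ?_))
  · filter_upwards [(C.isOpen x).mem_nhds (C.mem x)] with y hy
    exact congrArg (volConst * ·) (C.det_coord hy _).symm
  · change _ = volConst * (Matrix.of fun k => C.down x (Function.update (fun j => a j x) i (C.D (a i) x v) k)).det
    congr 3
    funext k
    by_cases hk : k = i
    · subst hk
      simp only [Function.update_self]
      exact (down_D (C := C) (a k) x v).symm
    · simp only [Function.update_of_ne hk]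
      exact (down_eq (C := C) x (a k x)).symm

end SOCocycle

/-! ### The filtration of a developing map -/

/-- The derivative of a quadratic polynomial. -/
def quadDeriv (w : Fin 3 → ℂ) (z : ℂ) : ℂ := w 1 + 2 * w 2 * z

/-- At a zero of `w` the derivative of `w` is the eigenvalue of `ad w` on the isotropic line, hence
invariant under isometries. This makes `β` independent of the coordinate. -/
lemma brk_nulC_of_quad_eq_zero {w : Fin 3 → ℂ} {z : ℂ} (h : quad w z = 0) :
    brk w (CP1.nulC z) = quadDeriv w z • CP1.nulC z := by
  rw [quad] at h
  ext i
  fin_cases i <;> simp [brk_apply, CP1.nulC, quadDeriv]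
  · linear_combination -2 * z * h
  · linear_combination 2 * h
  · ring

lemma IsSO.quad_eq_zero_iff {A : Matrix (Fin 3) (Fin 3) ℂ} (hA : IsSO A) {z z' κ : ℂ} (hκ : κ ≠ 0)
    (h : A.mulVec (CP1.nulC z) = κ • CP1.nulC z') (w : Fin 3 → ℂ) :
    quad (A.mulVec w) z' = 0 ↔ quad w z = 0 := by
  have h1 := hA.1 w (CP1.nulC z)
  rw [h, map_smul, CP1.killing_nulC, CP1.killing_nulC, smul_eq_mul] at h1
  constructor
  · intro h0
    rw [h0] at h1
    linear_combination h1 / 4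
  · intro h0
    have h2 : κ * quad (A.mulVec w) z' = 0 := by rw [h0] at h1; linear_combination -h1 / 4
    exact (mul_eq_zero.1 h2).resolve_left hκ

lemma IsSO.quadDeriv_eq {A : Matrix (Fin 3) (Fin 3) ℂ} (hA : IsSO A) {z z' κ : ℂ} (hκ : κ ≠ 0)
    (h : A.mulVec (CP1.nulC z) = κ • CP1.nulC z') {w : Fin 3 → ℂ} (hw : quad w z = 0) :
    quadDeriv (A.mulVec w) z' = quadDeriv w z := by
  have h1 := hA.brk_mulVec w (CP1.nulC z)
  rw [brk_nulC_of_quad_eq_zero hw, h, map_smul, Matrix.mulVec_smul, h,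
    brk_nulC_of_quad_eq_zero ((hA.quad_eq_zero_iff hκ h w).2 hw)] at h1
  have h2 := congrFun h1 2
  simp [CP1.nulC] at h2
  exact mul_left_cancel₀ hκ (by linear_combination h2)

/-- Division of analytic functions. -/
lemma exists_analyticAt_quotient {h k : ℂ → ℂ} {t₀ : ℂ} (hh : AnalyticAt ℂ h t₀)
    (hk : AnalyticAt ℂ k t₀) {n : ℕ} (hkn : analyticOrderAt k t₀ = n)
    (hhn : n ≤ analyticOrderAt h t₀) :
    ∃ f, AnalyticAt ℂ f t₀ ∧ ∀ᶠ t in 𝓝 t₀, h t = f t * k t := by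
  obtain ⟨u, hu, hu0, hku⟩ := hk.analyticOrderAt_eq_natCast.1 hkn
  obtain ⟨h₁, hh₁, hhu⟩ := (natCast_le_analyticOrderAt hh).1 hhn
  refine ⟨fun t => h₁ t / u t, hh₁.div hu hu0, ?_⟩
  filter_upwards [hku, hhu, hu.continuousAt.eventually_ne hu0] with t h1 h2 h3
  rw [h1, h2]
  simp only [smul_eq_mul]
  field_simp

namespace SOCocycle

variable {X : Type u} [TopologicalSpace X] [ChartedSpace ℂ X] [IsManifold 𝓘(ℂ) ω X]

open Classical in
/-- A developing map for a cocycle, with values in the affine line and branching divisor `S`. -/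
structure Developing (C : SOCocycle X) (S : Finset X) where
  z : X → X → ℂ
  hol : ∀ i, ContMDiffOn 𝓘(ℂ) 𝓘(ℂ) ω (z i) (C.U i)
  change : ∀ {i j x}, x ∈ C.U i → x ∈ C.U j →
    CP1.act (C.g i j x) (CP1.ofComplex (z j x)) = CP1.ofComplex (z i x)
  order : ∀ {i x}, x ∈ C.U i →
    analyticOrderAt (deriv (z i ∘ (chartAt ℂ x).symm)) (chartAt ℂ x x) = if x ∈ S then 1 else 0

variable {C : SOCocycle X}

lemma coord_injective {i x : X} (hi : x ∈ C.U i) : Function.Injective (C.coord i x) := fun a b h => by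
  rw [← C.vec_coord hi a, h, C.vec_coord hi]

lemma hol_vec {i : X} {f : X → Fin 3 → ℂ} {V : Set X} (hV : IsOpen V) (hVU : V ⊆ C.U i)
    (hf : ∀ k, ContMDiffOn 𝓘(ℂ) 𝓘(ℂ) ω (f · k) V) : C.so3Bundle.Hol (fun y => C.vec i y (f y)) V := by
  refine (C.hol_iff hV).2 fun j x hx hj k => ?_
  refine (contMDiffAt_mulVec (A := fun _ => C.g j i x) (fun _ _ => contMDiffAt_const)
    (fun k => (hf k).contMDiffAt (hV.mem_nhds hx)) k).congr_of_eventuallyEq ?_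
  filter_upwards [C.coord_eventuallyEq hj (hVU hx) (fun y => C.vec i y (f y)), hV.mem_nhds hx]
    with y hy hyV
  rw [hy, C.coord_vec_self (hVU hyV)]

namespace Developing

variable {S : Finset X} (Z : C.Developing S)

lemma contMDiffAt {i x : X} (hi : x ∈ C.U i) : ContMDiffAt 𝓘(ℂ) 𝓘(ℂ) ω (Z.z i) x :=
  (Z.hol i).contMDiffAt ((C.isOpen i).mem_nhds hi)

lemma mdifferentiableAt {i x : X} (hi : x ∈ C.U i) : MDifferentiableAt 𝓘(ℂ) 𝓘(ℂ) (Z.z i) x :=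
  (Z.contMDiffAt hi).mdifferentiableAt (by simp)

/-- `κ` is the last coordinate of `g (nulC z_j)`. Its inverse is the derivative of the Möbius map
that takes `z_j` to `z_i`, whence `dz_j = κ dz_i`. -/
lemma exists_change {i j x : X} (hi : x ∈ C.U i) (hj : x ∈ C.U j) :
    ∃ κ : ℂ, κ ≠ 0 ∧ (C.g i j x).mulVec (CP1.nulC (Z.z j x)) = κ • CP1.nulC (Z.z i x) ∧
      ∀ v, mvfderiv 𝓘(ℂ) (Z.z j) x v = κ * mvfderiv 𝓘(ℂ) (Z.z i) x v := by
  have hA := C.isSO hi hj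
  have hz : CP1.act (C.g i j x) (CP1.ofComplex (Z.z j x)) ≠ CP1.infinity := by
    rw [Z.change hi hj]
    exact CP1.ofComplex_ne_infinity _
  have hmob : CP1.mob (C.g i j x) (Z.z j x) = Z.z i x := by
    rw [CP1.mob, Z.change hi hj, CP1.toC_ofComplex]
  have h2 := CP1.pt_ne_infinity_iff.1 hz
  rw [CP1.nul_ofComplex] at h2
  refine ⟨_, h2, ?_, fun v => ?_⟩
  · rw [← hmob]
    exact CP1.mulVec_nulC hA hz
  · have h3 : mvfderiv 𝓘(ℂ) (Z.z i) x v
        = mvfderiv 𝓘(ℂ) (fun y => CP1.mob (C.g i j x) (Z.z j y)) x v := by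
      refine mvfderiv_congr ?_ v
      filter_upwards [C.const hi hj, (C.isOpen i).mem_nhds hi, (C.isOpen j).mem_nhds hj]
        with y hy hyi hyj
      rw [CP1.mob, ← hy, Z.change hyi hyj, CP1.toC_ofComplex]
    rw [h3, mvfderiv_deriv_comp (Z.mdifferentiableAt hj) (CP1.hasDerivAt_mob hA hz)]
    field_simp

/-- The line of quadratic vector fields with a double zero at the developing map. -/
def F₁ (x : X) : Submodule ℂ (C.Fibre x) :=
  (Submodule.span ℂ {CP1.nulC (Z.z x x)}).comap (C.coord x x)

/-- The plane of quadratic vector fields with a zero at the developing map. -/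
def F₂ (x : X) : Submodule ℂ (C.Fibre x) :=
  (LinearMap.ker (killing.flip (CP1.nulC (Z.z x x)))).comap (C.coord x x)

lemma mem_F₁ {i x : X} (hi : x ∈ C.U i) {a : C.Fibre x} :
    a ∈ Z.F₁ x ↔ ∃ c : ℂ, C.coord i x a = c • CP1.nulC (Z.z i x) := by
  have h0 : a ∈ Z.F₁ x ↔ ∃ c : ℂ, C.coord x x a = c • CP1.nulC (Z.z x x) := by
    exact Submodule.mem_span_singleton.trans ⟨fun ⟨c, h⟩ => ⟨c, h.symm⟩, fun ⟨c, h⟩ => ⟨c, h.symm⟩⟩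
  have key : ∀ {i j : X}, x ∈ C.U i → x ∈ C.U j → (∃ c : ℂ, C.coord j x a = c • CP1.nulC (Z.z j x)) →
      ∃ c : ℂ, C.coord i x a = c • CP1.nulC (Z.z i x) := by
    rintro i j hi hj ⟨c, hc⟩
    obtain ⟨κ, -, h, -⟩ := Z.exists_change hi hj
    exact ⟨c * κ, by rw [C.coord_change hi hj, hc, Matrix.mulVec_smul, h, smul_smul]⟩
  rw [h0]
  exact ⟨key hi (C.mem x), key (C.mem x) hi⟩

lemma mem_F₂ {i x : X} (hi : x ∈ C.U i) {a : C.Fibre x} :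
    a ∈ Z.F₂ x ↔ quad (C.coord i x a) (Z.z i x) = 0 := by
  have h0 : a ∈ Z.F₂ x ↔ quad (C.coord x x a) (Z.z x x) = 0 := by
    change killing (C.coord x x a) (CP1.nulC (Z.z x x)) = 0 ↔ _
    rw [CP1.killing_nulC, mul_eq_zero, or_iff_right (by norm_num)]
  obtain ⟨κ, hκ, h, -⟩ := Z.exists_change hi (C.mem x)
  rw [h0, C.coord_change hi (C.mem x), (C.isSO hi (C.mem x)).quad_eq_zero_iff hκ h]

/-- The identification of `F₁` with a subsheaf of the canonical bundle. -/
def α (x : X) : Z.F₁ x →ₗ[ℂ] TangentSpace 𝓘(ℂ) x →ₗ[ℂ] ℂ where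
  -- The factor `-2` is imposed by the second fundamental form: the derivative of `(Z - z)²` is `-2
  -- (Z - z) dz`, and `β` takes the value `1` on `Z - z`.
  toFun a := (-2 * C.coord x x a 2) • (mvfderiv 𝓘(ℂ) (Z.z x) x).toLinearMap
  map_add' a b := by
    rw [← add_smul]
    congr 1
    rw [Submodule.coe_add]
    have : C.coord x x ((a : C.Fibre x) + (b : C.Fibre x)) = _ := map_add (C.coord x x) _ _
    rw [this, Pi.add_apply]
    ring
  map_smul' c a := by
    rw [RingHom.id_apply, smul_smul]
    congr 1
    rw [Submodule.coe_smul]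
    have : C.coord x x (c • (a : C.Fibre x)) = _ := map_smul (C.coord x x) _ _
    rw [this, Pi.smul_apply, smul_eq_mul]
    ring

/-- In passing to the index `i` the coordinate of the vector is multiplied by `κ` and `dz` is
divided by `κ`. -/
lemma α_apply {i x : X} (hi : x ∈ C.U i) (a : Z.F₁ x) (v : TangentSpace 𝓘(ℂ) x) :
    Z.α x a v = -2 * C.coord i x a 2 * mvfderiv 𝓘(ℂ) (Z.z i) x v := by
  change (-2 * C.coord x x a 2) * mvfderiv 𝓘(ℂ) (Z.z x) x v = _
  obtain ⟨c, hc⟩ := (Z.mem_F₁ (C.mem x)).1 a.2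
  obtain ⟨κ, -, h, hd⟩ := Z.exists_change hi (C.mem x)
  rw [C.coord_change hi (C.mem x), hc, Matrix.mulVec_smul, h, hd]
  simp [CP1.nulC]
  ring

/-- The identification of `F₂ / F₁` with the trivial bundle. -/
def β (x : X) : Z.F₂ x →ₗ[ℂ] ℂ where
  toFun a := quadDeriv (C.coord x x a) (Z.z x x)
  map_add' a b := by
    rw [Submodule.coe_add]
    have : C.coord x x ((a : C.Fibre x) + (b : C.Fibre x)) = _ := map_add (C.coord x x) _ _
    rw [this]
    simp only [quadDeriv, Pi.add_apply]
    ring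
  map_smul' c a := by
    rw [Submodule.coe_smul]
    have : C.coord x x (c • (a : C.Fibre x)) = _ := map_smul (C.coord x x) _ _
    rw [this]
    simp only [quadDeriv, Pi.smul_apply, smul_eq_mul, RingHom.id_apply]
    ring

lemma β_apply {i x : X} (hi : x ∈ C.U i) (a : Z.F₂ x) :
    Z.β x a = quadDeriv (C.coord i x a) (Z.z i x) := by
  obtain ⟨κ, hκ, h, -⟩ := Z.exists_change hi (C.mem x)
  rw [C.coord_change hi (C.mem x),
    (C.isSO hi (C.mem x)).quadDeriv_eq hκ h ((Z.mem_F₂ (C.mem x)).1 a.2)]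
  rfl

lemma F₁_subbundle : IsHolSubbundle ℂ (Fin 3 → ℂ) (V := C.Fibre) 1 Z.F₁ := by
  intro x
  refine ⟨C.U x, C.isOpen x, C.mem x, fun _ y => C.vec x y (CP1.nulC (Z.z x y)), fun _ => ?_,
    fun y hy => ⟨?_, ?_⟩⟩
  · refine hol_vec (C.isOpen x) subset_rfl fun k => ?_
    fin_cases k
    · exact (Z.hol x).pow 2
    · exact contMDiffOn_const.mul (Z.hol x)
    · exact contMDiffOn_const
  · refine Fintype.linearIndependent_iff.2 fun c hc k => ?_
    have h1 := congrArg (C.coord x y) hc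
    have h2 : C.coord x y (c 0 • C.vec x y (CP1.nulC (Z.z x y))) = 0 := by
      rw [Fin.sum_univ_one] at h1
      exact h1.trans (map_zero _)
    rw [map_smul, C.coord_vec_self hy] at h2
    have h3 := congrFun h2 2
    simp [CP1.nulC] at h3
    rwa [Subsingleton.elim k 0]
  · ext a
    rw [Submodule.mem_span_range_iff_exists_fun, Z.mem_F₁ hy]
    constructor
    · rintro ⟨c, rfl⟩
      refine ⟨c 0, ?_⟩
      rw [Fin.sum_univ_one]
      change C.coord x y (c 0 • C.vec x y _) = _
      rw [map_smul, C.coord_vec_self hy]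
    · rintro ⟨c, hc⟩
      refine ⟨fun _ => c, coord_injective hy ?_⟩
      rw [Fin.sum_univ_one]
      change C.coord x y (c • C.vec x y _) = _
      rw [map_smul, C.coord_vec_self hy, hc]

lemma F₂_subbundle : IsHolSubbundle ℂ (Fin 3 → ℂ) (V := C.Fibre) 2 Z.F₂ := by
  intro x
  -- The frame of `F₂` consists of the polynomials `(Z - z)²` and `Z - z`.
  let e : Fin 2 → ∀ y, C.Fibre y := fun k y =>
    C.vec x y (![CP1.nulC (Z.z x y), ![-Z.z x y, 1, 0]] k)
  have he : ∀ y ∈ C.U x, ∀ c : Fin 2 → ℂ, C.coord x y (∑ k, c k • e k y)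
      = c 0 • CP1.nulC (Z.z x y) + c 1 • ![-Z.z x y, 1, 0] := fun y hy c => by
    rw [Fin.sum_univ_two, map_add, map_smul, map_smul, C.coord_vec_self hy, C.coord_vec_self hy]
    rfl
  refine ⟨C.U x, C.isOpen x, C.mem x, e, fun l => ?_, fun y hy => ⟨?_, ?_⟩⟩
  · refine hol_vec (C.isOpen x) subset_rfl fun k => ?_
    fin_cases l <;> fin_cases k
    · exact (Z.hol x).pow 2
    · exact contMDiffOn_const.mul (Z.hol x)
    · exact contMDiffOn_const
    · exact (Z.hol x).neg
    · exact contMDiffOn_const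
    · exact contMDiffOn_const
  · refine Fintype.linearIndependent_iff.2 fun c hc k => ?_
    have h2 := he y hy c
    have h1 : C.coord x y (∑ k, c k • e k y) = 0 := (congrArg (C.coord x y) hc).trans (map_zero _)
    rw [h1] at h2
    have h3 := congrFun h2 2
    have h4 := congrFun h2 1
    simp [CP1.nulC] at h3 h4
    rw [← h3] at h4
    fin_cases k
    · exact h3.symm
    · simpa using h4.symm
  · ext a
    rw [Submodule.mem_span_range_iff_exists_fun, Z.mem_F₂ hy]
    constructor
    · rintro ⟨c, rfl⟩
      have h2 := he y hy c
      refine (congrArg (fun w => quad w (Z.z x y)) h2).trans ?_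
      simp [quad, CP1.nulC]
      ring
    · intro h0
      refine ⟨![C.coord x y a 2, quadDeriv (C.coord x y a) (Z.z x y)], coord_injective hy ?_⟩
      refine (he y hy _).trans ?_
      rw [quad] at h0
      ext k
      fin_cases k <;> simp [CP1.nulC, quadDeriv]
      · linear_combination -h0
      · ring

end Developing

end SOCocycle

/-! ### The identifications `α`, `β` and the oper of a developing map -/

namespace SOCocycle

variable {X : Type u} [TopologicalSpace X] [ChartedSpace ℂ X] [IsManifold 𝓘(ℂ) ω X]
  {C : SOCocycle X}

namespace Developing

variable {S : Finset X} (Z : C.Developing S)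

lemma mvfderiv_z {i x y : X} (hy : y ∈ C.U i) (hyx : y ∈ (chartAt ℂ x).source)
    (v : TangentSpace 𝓘(ℂ) y) :
    mvfderiv 𝓘(ℂ) (Z.z i) y v = deriv (Z.z i ∘ (chartAt ℂ x).symm) (chartAt ℂ x y)
      * mvfderiv 𝓘(ℂ) (chartAt ℂ x) y v :=
  (mvfderiv_eq_deriv_mul (isHolChart_chartAt x) hyx (Z.mdifferentiableAt hy) v).2

lemma analyticAt_deriv {i x : X} (hi : x ∈ C.U i) :
    AnalyticAt ℂ (deriv (Z.z i ∘ (chartAt ℂ x).symm)) (chartAt ℂ x x) :=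
  (contDiffAt_comp_symm (isHolChart_chartAt x) (mem_chart_source ℂ x)
    (Z.contMDiffAt hi)).analyticAt.deriv

lemma eventually_deriv_ne_zero {i x : X} (hi : x ∈ C.U i) :
    ∀ᶠ t in 𝓝[≠] chartAt ℂ x x, deriv (Z.z i ∘ (chartAt ℂ x).symm) t ≠ 0 := by
  refine (Z.analyticAt_deriv hi).eventually_eq_zero_or_eventually_ne_zero.resolve_left fun h => ?_
  have h1 := Z.order hi
  rw [analyticOrderAt_eq_top.2 h] at h1
  split_ifs at h1 <;> simp at h1

lemma α_holomorphic {U : Set X} (hU : IsOpen U) {σ : ∀ x, Z.F₁ x}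
    (hσ : C.so3Bundle.Hol (fun x => (σ x : C.Fibre x)) U) : HolOneForm (fun x => Z.α x (σ x)) U := by
  intro V hVU hV v hv x hx
  have h1 := contMDiffAt_mvfderiv_apply (Z.contMDiffAt (C.mem x)) (hv.contMDiffAt (hV.mem_nhds hx))
  have h2 := (C.hol_iff hU).1 hσ x x (hVU hx) (C.mem x) 2
  refine ContMDiffAt.contMDiffWithinAt ((((contMDiffAt_const (c := (-2 : ℂ))).mul h2).mul h1).congr_of_eventuallyEq ?_)
  filter_upwards [(C.isOpen x).mem_nhds (C.mem x)] with y hy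
  exact Z.α_apply hy _ _

lemma α_vanishes {x : X} (hx : x ∈ S) : Z.α x = 0 := by
  have h1 := Z.order (C.mem x)
  rw [if_pos hx] at h1
  have h2 : deriv (Z.z x ∘ (chartAt ℂ x).symm) (chartAt ℂ x x) = 0 := by
    by_contra h
    rw [(Z.analyticAt_deriv (C.mem x)).analyticOrderAt_eq_zero.2 h] at h1
    exact zero_ne_one h1
  refine LinearMap.ext fun a => LinearMap.ext fun v => ?_
  rw [Z.α_apply (C.mem x), Z.mvfderiv_z (C.mem x) (mem_chart_source ℂ x), h2]
  simp

/-- `α` is multiplication by `dz`, which has isolated zeros. A section killed by `α` is zero off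
these points, and at them by continuity. -/
lemma α_injective {U : Set X} (hU : IsOpen U) {σ : ∀ x, Z.F₁ x}
    (hσ : C.so3Bundle.Hol (fun x => (σ x : C.Fibre x)) U) (h0 : ∀ x ∈ U, Z.α x (σ x) = 0) {x : X}
    (hx : x ∈ U) : σ x = 0 := by
  have hφ := isHolChart_chartAt (E := ℂ) x
  have hxφ := mem_chart_source ℂ x
  set φ := chartAt ℂ x with hφd
  obtain ⟨v, -, hvφ⟩ := hφ.exists_coordField
  let f : X → ℂ := fun y => C.coord x y (σ y) 2
  have hf : ContMDiffAt 𝓘(ℂ) 𝓘(ℂ) ω f x := (C.hol_iff hU).1 hσ x x hx (C.mem x) 2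
  have hfc : ContinuousAt (f ∘ φ.symm) (φ x) :=
    (contDiffAt_comp_symm hφ hxφ hf).continuousAt
  have hsymm : Tendsto φ.symm (𝓝 (φ x)) (𝓝 x) := by
    have := (φ.continuousAt_symm (φ.map_source hxφ)).tendsto
    rwa [φ.left_inv hxφ] at this
  have h1 : (f ∘ φ.symm) =ᶠ[𝓝[≠] φ x] fun _ => 0 := by
    filter_upwards [Z.eventually_deriv_ne_zero (C.mem x),
      nhdsWithin_le_nhds (hsymm.eventually (hU.mem_nhds hx)),
      nhdsWithin_le_nhds (hsymm.eventually ((C.isOpen x).mem_nhds (C.mem x))),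
      nhdsWithin_le_nhds (φ.open_target.mem_nhds (φ.map_source hxφ))] with t ht htU htx htφ
    have hs := φ.map_target htφ
    have h2 := congrArg (fun L => L (v (φ.symm t))) (h0 _ htU)
    rw [Z.α_apply htx, Z.mvfderiv_z htx hs, hvφ _ hs, ← hφd, φ.right_inv htφ] at h2
    have h3 : -2 * f (φ.symm t) * (deriv (Z.z x ∘ φ.symm) t * 1) = 0 := h2
    simpa [hφd ▸ ht] using h3
  have h2 := ((hfc.eventuallyEq_nhds_iff_eventuallyEq_nhdsNE continuousAt_const).1 h1).eq_of_nhds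
  have h3 : C.coord x x (σ x) 2 = 0 := by
    have : f (φ.symm (φ x)) = 0 := h2
    rwa [φ.left_inv hxφ] at this
  obtain ⟨c, hc⟩ := (Z.mem_F₁ (C.mem x)).1 (σ x).2
  rw [hc] at h3
  have hc0 : c = 0 := by simpa [CP1.nulC] using h3
  refine Subtype.ext (coord_injective (C.mem x) ?_)
  rw [hc, hc0, zero_smul]
  exact (map_zero _).symm

/-- With `θ = h dt` and `dz = k dt` the equation asks for the quotient `h / k`. It is holomorphic,
since `k` has at most a simple zero, and only at points of `S`, where `h` vanishes too. -/
lemma exists_local_section {U : Set X} (hU : IsOpen U) {θ : ∀ x : X, TangentSpace 𝓘(ℂ) x →ₗ[ℂ] ℂ}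
    (hθ : HolOneForm θ U) (hS : ∀ x ∈ S, x ∈ U → θ x = 0) {x : X} (hx : x ∈ U) :
    ∃ V, IsOpen V ∧ x ∈ V ∧ ∃ σ : ∀ y, Z.F₁ y,
      C.so3Bundle.Hol (fun y => (σ y : C.Fibre y)) V ∧ ∀ y ∈ V, Z.α y (σ y) = θ y := by
  classical
  have hφ := isHolChart_chartAt (E := ℂ) x
  have hxφ := mem_chart_source ℂ x
  set φ := chartAt ℂ x with hφd
  obtain ⟨v, hv, hvφ⟩ := hφ.exists_coordField
  have hh : AnalyticAt ℂ ((fun y => θ y (v y)) ∘ φ.symm) (φ x) := by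
    have hW := hU.inter φ.open_source
    exact (contDiffAt_comp_symm hφ hxφ ((hθ _ inter_subset_left hW v
      (hv.mono inter_subset_right)).contMDiffAt (hW.mem_nhds ⟨hx, hxφ⟩))).analyticAt
  obtain ⟨F, hF, hFe⟩ := exists_analyticAt_quotient hh (Z.analyticAt_deriv (C.mem x))
    (n := if x ∈ S then 1 else 0) (by rw [Z.order (C.mem x)]; split_ifs <;> rfl) (by
      split_ifs with hxS
      · refine Order.one_le_iff_pos.2 (pos_iff_ne_zero.2 (hh.analyticOrderAt_ne_zero.2 ?_))
        have e : ∀ y, y = x → θ y (v y) = 0 := by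
          rintro _ rfl
          rw [hS _ hxS hx]
          rfl
        exact e _ (φ.left_inv hxφ)
      · exact zero_le)
  have hcont : Tendsto φ (𝓝 x) (𝓝 (φ x)) := φ.continuousAt hxφ
  obtain ⟨V, hVp, hV, hxV⟩ := _root_.eventually_nhds_iff.1 ((((hcont.eventually hF.eventually_analyticAt).and
    (hcont.eventually hFe)).and (φ.open_source.mem_nhds hxφ)).and ((C.isOpen x).mem_nhds (C.mem x)))
  let a : X → Fin 3 → ℂ := fun y => (-(1 / 2) * F (φ y)) • CP1.nulC (Z.z x y)
  let σ : ∀ y, Z.F₁ y := fun y => if hy : y ∈ C.U x then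
    ⟨C.vec x y (a y), (Z.mem_F₁ hy).2 ⟨_, C.coord_vec_self hy _⟩⟩ else 0
  have hσ : ∀ y ∈ C.U x, (σ y : C.Fibre y) = C.vec x y (a y) := fun y hy => by
    simp only [σ, dif_pos hy]
  have hVU : V ⊆ C.U x := fun y hy => (hVp y hy).2
  refine ⟨V, hV, hxV, σ, ?_, fun y hy => ?_⟩
  · refine (hol_vec hV hVU (f := a) fun k => ?_).congr fun y hy =>
      congrArg (TotalSpace.mk' (Fin 3 → ℂ) (E := C.Fibre) y) (hσ y (hVU hy))
    have hFφ : ContMDiffOn 𝓘(ℂ) 𝓘(ℂ) ω (fun y => -(1 / 2) * F (φ y)) V := fun y hy =>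
      (contMDiffAt_const.mul ((hVp y hy).1.1.1.contDiffAt.contMDiffAt.comp y
        (hφ.contMDiffAt (hVp y hy).1.2))).contMDiffWithinAt
    have hz := (Z.hol x).mono hVU
    refine hFφ.mul ?_
    fin_cases k
    · exact hz.pow 2
    · exact contMDiffOn_const.mul hz
    · exact contMDiffOn_const
  · have hyφ := (hVp y hy).1.2
    refine LinearMap.ext fun w => ?_
    have hw : w = mvfderiv 𝓘(ℂ) φ y w • v y := by
      refine hφ.mvfderiv_injective hyφ ?_
      rw [map_smul, hvφ y hyφ, smul_eq_mul, mul_one]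
    have h1 : θ y (v y) = F (φ y) * deriv (Z.z x ∘ φ.symm) (φ y) := by
      have := (hVp y hy).1.1.2
      simp only [Function.comp_apply] at this
      rwa [φ.left_inv hyφ] at this
    have h2 : C.coord x y (σ y) 2 = -(1 / 2) * F (φ y) := by
      rw [hσ y (hVU hy), C.coord_vec_self (hVU hy)]
      simp [a, CP1.nulC]
    rw [Z.α_apply (hVU hy), h2, Z.mvfderiv_z (hVU hy) hyφ, ← hφd]
    conv_rhs => rw [hw, map_smul, h1, smul_eq_mul]
    ring

/-- Local solutions are unique by `α_injective`, so they glue. -/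
lemma α_surjective {U : Set X} (hU : IsOpen U) {θ : ∀ x : X, TangentSpace 𝓘(ℂ) x →ₗ[ℂ] ℂ}
    (hθ : HolOneForm θ U) (hS : ∀ x ∈ S, x ∈ U → θ x = 0) :
    ∃ σ : ∀ x, Z.F₁ x, C.so3Bundle.Hol (fun y => (σ y : C.Fibre y)) U ∧
      ∀ x ∈ U, Z.α x (σ x) = θ x := by
  classical
  choose! V hV hxV τ hτ hτθ using fun x (hx : x ∈ U) => Z.exists_local_section hU hθ hS hx
  refine ⟨fun x => τ x x, fun x hx => ?_, fun x hx => hτθ x hx x (hxV x hx)⟩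
  have h1 : C.so3Bundle.Hol (fun y => (τ y y : C.Fibre y)) (V x ∩ U) := by
    refine ((hτ x hx).mono inter_subset_left).congr fun y hy => ?_
    have hW := (hV x hx).inter (hV y hy.2)
    have h3 := Z.α_injective hW (σ := fun p => τ y p - τ x p) ?_ (fun p hp => by
      rw [map_sub, hτθ x hx p hp.1, hτθ y hy.2 p hp.2, sub_self]) ⟨hy.1, hxV y hy.2⟩
    · exact congrArg (fun a : Z.F₁ y => TotalSpace.mk' (Fin 3 → ℂ) (E := C.Fibre) y a) (sub_eq_zero.1 h3)
    · refine (C.hol_iff hW).2 fun i p hp hi k => ?_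
      have e1 := (C.hol_iff (hV y hy.2)).1 (hτ y hy.2) i p hp.2 hi k
      have e2 := (C.hol_iff (hV x hx)).1 (hτ x hx) i p hp.1 hi k
      refine (e1.sub e2).congr_of_eventuallyEq (Eventually.of_forall fun q => ?_)
      exact congrFun (map_sub (C.coord i q) _ _) k
  exact (h1.contMDiffAt (((hV x hx).inter hU).mem_nhds ⟨hxV x hx, hx⟩)).contMDiffWithinAt

lemma β_holomorphic {U : Set X} (hU : IsOpen U) {σ : ∀ x, Z.F₂ x}
    (hσ : C.so3Bundle.Hol (fun x => (σ x : C.Fibre x)) U) :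
    HolFun ℂ (fun x => Z.β x (σ x)) U := by
  intro x hx
  have h2 := (C.hol_iff hU).1 hσ x x hx (C.mem x)
  refine ContMDiffAt.contMDiffWithinAt (((h2 1).add (((contMDiffAt_const (c := (2 : ℂ))).mul (h2 2)).mul
    (Z.contMDiffAt (C.mem x)))).congr_of_eventuallyEq ?_)
  filter_upwards [(C.isOpen x).mem_nhds (C.mem x)] with y hy
  exact Z.β_apply hy _

/-- The branched filtration of a developing map. -/
def filtration : BranchedFiltration S C.so3Bundle where
  F₁ := Z.F₁
  F₂ := Z.F₂
  F₁_le_F₂ x a ha := by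
    obtain ⟨c, hc⟩ := (Z.mem_F₁ (C.mem x)).1 ha
    refine (Z.mem_F₂ (C.mem x)).2 ?_
    rw [hc]
    simp [quad, CP1.nulC]
    ring
  F₁_subbundle := Z.F₁_subbundle
  F₂_subbundle := Z.F₂_subbundle
  isotropic x a ha b hb := by
    obtain ⟨c, hc⟩ := (Z.mem_F₁ (C.mem x)).1 ha
    obtain ⟨d, hd⟩ := (Z.mem_F₁ (C.mem x)).1 hb
    refine (C.killing_coord (C.mem x) a b).symm.trans ?_
    rw [hc, hd, map_smul, CP1.killing_nulC]
    simp [quad, CP1.nulC]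
    ring_nf
    simp
  orthogonal x a ha b hb := by
    obtain ⟨c, hc⟩ := (Z.mem_F₁ (C.mem x)).1 ha
    refine (C.killing_coord (C.mem x) a b).symm.trans ?_
    rw [hc, killing_comm, map_smul, CP1.killing_nulC, (Z.mem_F₂ (C.mem x)).1 hb]
    simp
  α := Z.α
  α_holomorphic _ hU _ hσ := Z.α_holomorphic hU hσ
  α_vanishes _ hx := Z.α_vanishes hx
  α_injective _ hU _ hσ h0 _ hx := Z.α_injective hU hσ h0 hx
  α_surjective _ hU _ hθ hS := Z.α_surjective hU hθ hS
  β := Z.β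
  β_holomorphic _ hU _ hσ := Z.β_holomorphic hU hσ
  β_ker x a := by
    refine Iff.trans ?_ (Z.mem_F₁ (C.mem x)).symm
    refine (Eq.congr_left (Z.β_apply (C.mem x) ⟨a.1, a.2⟩)).trans ?_
    constructor
    · intro h
      exact ⟨_, eq_smul_nulC ((Z.mem_F₂ (C.mem x)).1 a.2) h⟩
    · rintro ⟨c, hc⟩
      rw [show C.coord x x a.1 = _ from hc]
      simp [quadDeriv, CP1.nulC]
      ring
  β_surjective x c := by
    refine ⟨⟨C.vec x x (c • ![-Z.z x x, 1, 0]), (Z.mem_F₂ (C.mem x)).2 ?_⟩, ?_⟩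
    · rw [C.coord_vec_self (C.mem x)]
      simp [quad]
    · refine (Z.β_apply (C.mem x) _).trans ?_
      change quadDeriv (C.coord x x (C.vec x x _)) _ = _
      rw [C.coord_vec_self (C.mem x)]
      simp [quadDeriv]

/-- For `σ = f (Z - z)²` the product rule gives `df (Z - z)² - 2 f (Z - z) dz`. Both terms vanish at
`z`, and only the second contributes to the derivative there. -/
lemma coord_D_F₁ {U : Set X} (hU : IsOpen U) {σ : ∀ x, Z.F₁ x}
    (hσ : C.so3Bundle.Hol (fun x => (σ x : C.Fibre x)) U) {x : X} (hx : x ∈ U)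
    (v : TangentSpace 𝓘(ℂ) x) :
    quad (C.coord x x (C.D (fun y => (σ y : C.Fibre y)) x v)) (Z.z x x) = 0 ∧
      quadDeriv (C.coord x x (C.D (fun y => (σ y : C.Fibre y)) x v)) (Z.z x x)
        = -2 * C.coord x x (σ x) 2 * mvfderiv 𝓘(ℂ) (Z.z x) x v := by
  let f : X → ℂ := fun y => C.coord x y (σ y) 2
  have hf : MDifferentiableAt 𝓘(ℂ) 𝓘(ℂ) f x :=
    ((C.hol_iff hU).1 hσ x x hx (C.mem x) 2).mdifferentiableAt (by simp)
  have hz := Z.mdifferentiableAt (C.mem x)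
  have hcoord : ∀ y ∈ C.U x, C.coord x y (σ y) = f y • CP1.nulC (Z.z x y) := fun y hy => by
    obtain ⟨c, hc⟩ := (Z.mem_F₁ hy).1 (σ y).2
    have : f y = c := by simp only [f]; rw [hc]; simp [CP1.nulC]
    rw [this, hc]
  have hev : ∀ᶠ y in 𝓝 x, y ∈ C.U x := (C.isOpen x).mem_nhds (C.mem x)
  have e2 := coord_D_apply (C.mem x) hU hσ hx v 2
  have e1 := coord_D_apply (C.mem x) hU hσ hx v 1
  have e0 := coord_D_apply (C.mem x) hU hσ hx v 0
  have h1 : mvfderiv 𝓘(ℂ) (fun y => C.coord x y (σ y) 1) x v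
      = -2 * (f x * mvfderiv 𝓘(ℂ) (Z.z x) x v + mvfderiv 𝓘(ℂ) f x v * Z.z x x) := by
    have : (fun y => C.coord x y (σ y) 1) =ᶠ[𝓝 x] fun y => -2 * (f y * Z.z x y) := by
      filter_upwards [hev] with y hy
      rw [hcoord y hy]
      simp [CP1.nulC]
      ring
    rw [mvfderiv_congr this v, show mvfderiv 𝓘(ℂ) (fun y => -2 * (f y * Z.z x y)) x v = _ from
      mvfderiv_const_mul _ (hf.mul hz) v,
      show mvfderiv 𝓘(ℂ) (f * Z.z x) x v = _ from mvfderiv_mul_apply hf hz v]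
    ring
  have h0 : mvfderiv 𝓘(ℂ) (fun y => C.coord x y (σ y) 0) x v
      = 2 * f x * Z.z x x * mvfderiv 𝓘(ℂ) (Z.z x) x v + mvfderiv 𝓘(ℂ) f x v * Z.z x x ^ 2 := by
    have : (fun y => C.coord x y (σ y) 0) =ᶠ[𝓝 x] fun y => f y * (Z.z x y * Z.z x y) := by
      filter_upwards [hev] with y hy
      rw [hcoord y hy]
      simp [CP1.nulC]
      left; ring
    rw [mvfderiv_congr this v, show mvfderiv 𝓘(ℂ) (fun y => f y * (Z.z x y * Z.z x y)) x v = _ from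
      mvfderiv_mul_apply hf (hz.mul hz) v,
      show mvfderiv 𝓘(ℂ) (Z.z x * Z.z x) x v = _ from mvfderiv_mul_apply hz hz v]
    simp only [Pi.mul_apply]
    ring
  rw [h1] at e1
  rw [h0] at e0
  have e2' : C.coord x x (C.D (fun y => (σ y : C.Fibre y)) x v) 2 = mvfderiv 𝓘(ℂ) f x v := e2
  constructor
  · rw [quad, e0, e1, e2']
    ring
  · rw [quadDeriv, e1, e2']
    change _ = -2 * f x * _
    ring

/-- The branched oper of a developing map. -/
def oper : BranchedOper X S where
  bundle := C.so3Bundle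
  filtration := Z.filtration
  connection :=
    { D := C.D
      isCovariantDerivative := C.D_isCovariantDerivative
      D_holomorphic := fun _ hU _ _ hσ hv => C.D_holomorphic hU hσ hv
      D_B := fun _ hU _ _ ha hb _ hx v => C.D_B hU ha hb hx v
      D_vol := fun _ hU _ ha _ hx v => C.D_vol hU ha hx v
      D_F₁ := fun _ hU σ hσ x hx v => (Z.mem_F₂ (C.mem x)).2 (Z.coord_D_F₁ hU (σ := σ) hσ hx v).1
      secondFundamentalForm_eq_one := fun _ hU σ hσ x hx v => by
        refine (Z.β_apply (C.mem x) _).trans ?_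
        refine (Z.coord_D_F₁ hU (σ := σ) hσ hx v).2.trans ?_
        exact (Z.α_apply (C.mem x) (σ x) v).symm }

end Developing

end SOCocycle

/-! ### Opers and projective structures with a common cocycle -/

section CommonCocycle

variable {X : Type u} [TopologicalSpace X] [ChartedSpace ℂ X] [IsManifold 𝓘(ℂ) ω X] {S : Finset X}

/-- Flat coordinates and flat frames with the same transition functions give an association. -/
theorem isAssociatedOper_of_cocycle {T : BranchedTriple X S} {O : BranchedOper X S} {C : SOCocycle X}
    {ζ : X → T.P → CP1} {b : X → Fin 3 → ∀ x, O.bundle.W x}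
    (hζ : ∀ i, IsFlatCoord T.γ T.H (C.U i) (ζ i)) (hb : ∀ i, IsFlatFrame O (C.U i) (b i))
    (hζg : ∀ i j p, T.γ p ∈ C.U i → T.γ p ∈ C.U j → ζ i p = CP1.act (C.g i j (T.γ p)) (ζ j p))
    (hbg : ∀ i j x, x ∈ C.U i → x ∈ C.U j → ∀ w,
      SO3Bundle.comb (b j) x w = SO3Bundle.comb (b i) x ((C.g i j x).mulVec w))
    (hfilt : ∀ i, ∀ x ∈ C.U i, ∀ w, SO3Bundle.comb (b i) x w ∈ O.filtration.F₁ x ↔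
      ∃ c : ℂ, w = c • CP1.nul (ζ i (T.s x))) : T.IsAssociatedOper O := by
  choose st hst using fun p : T.P => (hζ (T.γ p)).toIsFibreCoord.exists_stdMap (C.mem (T.γ p))
  -- Evaluation at `p` is defined with the index `γ p`. The coordinates and the frames have the same
  -- transition matrices, so every index gives the same map.
  let ψ : ∀ p : T.P, O.bundle.W (T.γ p) →ₗ[ℂ] TangentSpace 𝓘(ℂ, ℂ × ℂ) p := fun p =>
    st p ∘ₗ ((hb (T.γ p)).equiv (C.mem (T.γ p))).symm.toLinearMap
  refine isAssociatedOper_of_localModels (ψ := ψ) fun i =>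
    ⟨C.U i, ζ i, b i, C.mem i, hζ i, hb i, fun p hp w => ?_, hfilt i⟩
  set x := T.γ p with hx
  have h1 : ψ p (SO3Bundle.comb (b i) x w) = st p ((C.g x i x).mulVec w) := by
    change st p (((hb x).equiv (C.mem x)).symm _) = _
    congr 1
    rw [LinearEquiv.symm_apply_eq]
    exact hbg x i x (C.mem x) hp w
  rw [h1]
  refine (isStdAt_act_iff (C.isSO (C.mem x) hp)).1 ((hst p _).congr ?_)
  have hc : ContinuousAt T.γ p := (T.isBundle.1 p).continuousAt
  filter_upwards [hc.eventually (C.const (C.mem x) hp),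
    hc.eventually ((C.isOpen x).mem_nhds (C.mem x)), hc.eventually ((C.isOpen i).mem_nhds hp)]
    with q hq hqx hqi
  rw [hζg _ _ q hqx hqi, hq]

namespace SOCocycle.Developing

variable {C : SOCocycle X} (Z : C.Developing S)

/-- The flat frame of the oper of a developing map. -/
def frame (i : X) (k : Fin 3) (x : X) : Z.oper.bundle.W x := C.vec i x (Pi.single k 1)

lemma comb_frame (i x : X) (w : Fin 3 → ℂ) : SO3Bundle.comb (Z.frame i) x w = C.vec i x w := by
  rw [SO3Bundle.comb_apply]
  have h : w = ∑ k, w k • (Pi.single k 1 : Fin 3 → ℂ) := by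
    ext k
    simp [Pi.single_apply, Finset.sum_apply]
  conv_rhs => rw [h, map_sum]
  refine Finset.sum_congr rfl fun k _ => ?_
  rw [map_smul]
  rfl

lemma isFlatFrame_frame (i : X) : IsFlatFrame Z.oper (C.U i) (Z.frame i) where
  isOpen := C.isOpen i
  hol k := hol_vec (f := fun _ => Pi.single k 1) (C.isOpen i) subset_rfl fun _ => contMDiffOn_const
  killing_eq x hx w w' := by
    rw [comb_frame, comb_frame]
    refine (C.killing_coord hx _ _).symm.trans ?_
    rw [C.coord_vec_self hx, C.coord_vec_self hx]
  flat k x hx v := by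
    refine coord_injective hx ?_
    ext l
    have h : C.so3Bundle.Hol (Z.frame i k) (C.U i) :=
      hol_vec (f := fun _ => Pi.single k 1) (C.isOpen i) subset_rfl fun _ => contMDiffOn_const
    refine (coord_D_apply hx (C.isOpen i) h hx v l).trans ?_
    have h2 : (fun y => C.coord i y (Z.frame i k y) l) =ᶠ[𝓝 x]
        fun _ => (Pi.single k 1 : Fin 3 → ℂ) l := by
      filter_upwards [(C.isOpen i).mem_nhds hx] with y hy
      exact congrFun (C.coord_vec_self hy _) l
    refine (mvfderiv_congr h2 v).trans ?_
    refine Eq.trans ?_ (congrFun (map_zero (C.coord i x)) l).symm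
    rw [mvfderiv_const]
    rfl

end SOCocycle.Developing

/-- A branched projective structure has an associated oper. -/
theorem BranchedTriple.exists_isAssociatedOper (T : BranchedTriple X S) :
    ∃ O, T.IsAssociatedOper O := by
  classical
  obtain ⟨C, ζ, hζ, hs, hg⟩ := T.exists_cocycle
  have hz : ∀ {i x}, x ∈ C.U i → CP1.ofComplex (CP1.toC (ζ i (T.s x))) = ζ i (T.s x) :=
    fun hx => CP1.ofComplex_toC (hs _ _ hx)
  let Z : C.Developing S :=
    { z := fun i x => CP1.toC (ζ i (T.s x))
      hol := fun i x hx => by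
        have hsx : T.γ (T.s x) ∈ C.U i := by rw [T.s_section]; exact hx
        exact (((hζ i).contMDiffAt_toC hsx (hs i x hx)).comp x
          (T.s_holomorphic x)).contMDiffWithinAt
      change := fun {i j x} hi hj => by
        rw [hz hi, hz hj, hg i j (T.s x) (by rwa [T.s_section]) (by rwa [T.s_section]), T.s_section]
      order := fun {i x} hx => by
        have := ((hζ i).verticalDifferentialOrder_iff T.isConnection T.s_holomorphic T.s_section hx
          (hs i x hx) _).1 (T.divisor_eq x)
        convert this using 1 }
  refine ⟨Z.oper, isAssociatedOper_of_cocycle hζ Z.isFlatFrame_frame hg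
    (fun i j x hi hj w => ?_) fun i x hx w => ?_⟩
  · rw [Z.comb_frame, Z.comb_frame]
    refine SOCocycle.coord_injective hi ?_
    rw [C.coord_vec_self hi, C.coord_vec hi hj]
  · rw [Z.comb_frame]
    refine (Z.mem_F₁ hx).trans ?_
    rw [C.coord_vec_self hx, ← hz hx, CP1.nul_ofComplex]

end CommonCocycle

/-! ### The projective bundle of a cocycle -/

lemma CP1.contMDiff_act {A : Matrix (Fin 3) (Fin 3) ℂ} (hA : IsSO A) :
    ContMDiff 𝓘(ℂ) 𝓘(ℂ) ω (CP1.act A) := fun _ =>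
  CP1.contMDiffAt_act (fun _ _ => contMDiffAt_const) (Eventually.of_forall fun _ => hA) contMDiffAt_id

namespace SOCocycle

section Bundle

variable {X : Type u} [TopologicalSpace X] (C : SOCocycle X)

/-- The gluing data of the projective bundle. -/
def projCore : FiberBundleCore X X CP1 where
  baseSet := C.U
  isOpen_baseSet := C.isOpen
  indexAt := id
  mem_baseSet_at := C.mem
  coordChange i j x z := CP1.act (C.g j i x) z
  coordChange_self i x hx v := by rw [C.self hx, CP1.act_one]
  continuousOn_coordChange i j p hp := by
    refine ContinuousAt.continuousWithinAt ?_
    have h1 : ContinuousAt (fun q : X × CP1 => CP1.act (C.g j i p.1) q.2) p :=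
      (CP1.contMDiff_act (C.isSO hp.1.2 hp.1.1)).continuous.continuousAt.comp continuousAt_snd
    refine h1.congr ?_
    filter_upwards [continuousAt_fst.eventually (C.const hp.1.2 hp.1.1)] with q hq
    rw [hq]
  coordChange_comp i j k x hx v := by
    rw [CP1.act_act (C.isSO hx.1.2 hx.1.1), C.comp hx.2 hx.1.2 hx.1.1]

/-- The total space of the projective bundle. -/
def Proj : Type u := C.projCore.TotalSpace

instance : TopologicalSpace C.Proj := inferInstanceAs (TopologicalSpace C.projCore.TotalSpace)

/-- The projection of the projective bundle. -/
def projMap : C.Proj → X := C.projCore.proj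

/-- The local trivializations of the projective bundle. -/
def projTriv (i : X) : Trivialization CP1 C.projMap := C.projCore.localTriv i

/-- The fibre coordinates of the projective bundle. -/
def projCoord (i : X) (p : C.Proj) : CP1 := (C.projTriv i p).2

lemma continuous_projMap : Continuous C.projMap := C.projCore.continuous_proj

variable {C}

lemma projCoord_change {i j : X} {p : C.Proj} (hi : C.projMap p ∈ C.U i) (hj : C.projMap p ∈ C.U j) :
    C.projCoord i p = CP1.act (C.g i j (C.projMap p)) (C.projCoord j p) :=
  (C.projCore.coordChange_comp (C.projMap p) j i (C.projMap p) ⟨⟨C.mem _, hj⟩, hi⟩ _).symm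

lemma projMap_symm {i x : X} (hx : x ∈ C.U i) (z : CP1) :
    C.projMap ((C.projTriv i).toOpenPartialHomeomorph.symm (x, z)) = x :=
  (C.projTriv i).proj_symm_apply ((C.projTriv i).mem_target.2 (show (x, z).1 ∈ (C.projTriv i).baseSet from hx))

lemma projCoord_symm {i x : X} (hx : x ∈ C.U i) (z : CP1) :
    C.projCoord i ((C.projTriv i).toOpenPartialHomeomorph.symm (x, z)) = z :=
  congrArg Prod.snd ((C.projTriv i).apply_symm_apply ((C.projTriv i).mem_target.2 (show (x, z).1 ∈ (C.projTriv i).baseSet from hx)))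

lemma projTriv_symm {i : X} {p : C.Proj} (hp : C.projMap p ∈ C.U i) :
    (C.projTriv i).toOpenPartialHomeomorph.symm (C.projMap p, C.projCoord i p) = p :=
  (C.projTriv i).symm_apply_mk_proj hp

lemma projCoord_eventuallyEq {i j : X} {p : C.Proj} (hi : C.projMap p ∈ C.U i)
    (hj : C.projMap p ∈ C.U j) : C.projCoord i =ᶠ[𝓝 p]
      fun q => CP1.act (C.g i j (C.projMap p)) (C.projCoord j q) := by
  have hc := C.continuous_projMap.continuousAt (x := p)
  filter_upwards [hc.eventually (C.const hi hj), hc.eventually ((C.isOpen i).mem_nhds hi),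
    hc.eventually ((C.isOpen j).mem_nhds hj)] with q hq hqi hqj
  rw [projCoord_change hqi hqj, hq]

end Bundle

variable {X : Type u} [TopologicalSpace X] [ChartedSpace ℂ X] (C : SOCocycle X)

/-- Charts of the projective bundle. -/
def projChart (i x : X) (z : CP1) : OpenPartialHomeomorph C.Proj (ℂ × ℂ) :=
  (C.projTriv i).toOpenPartialHomeomorph ≫ₕ ((chartAt ℂ x).prod (chartAt ℂ z))

variable {C}

lemma projChart_apply (i x : X) (z : CP1) (p : C.Proj) :
    C.projChart i x z p = (chartAt ℂ x (C.projMap p), chartAt ℂ z (C.projCoord i p)) := rfl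

lemma projChart_symm_apply (i x : X) (z : CP1) (y : ℂ × ℂ) :
    (C.projChart i x z).symm y = (C.projTriv i).toOpenPartialHomeomorph.symm
      ((chartAt ℂ x).symm y.1, (chartAt ℂ z).symm y.2) := rfl

lemma mem_projChart_source {i x : X} {z : CP1} {p : C.Proj} :
    p ∈ (C.projChart i x z).source ↔ C.projMap p ∈ C.U i ∧
      C.projMap p ∈ (chartAt ℂ x).source ∧ C.projCoord i p ∈ (chartAt ℂ z).source := Iff.rfl

lemma mem_projChart_target {i x : X} {z : CP1} {y : ℂ × ℂ} :
    y ∈ (C.projChart i x z).target ↔ (y.1 ∈ (chartAt ℂ x).target ∧ y.2 ∈ (chartAt ℂ z).target) ∧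
      (chartAt ℂ x).symm y.1 ∈ C.U i := by
  refine and_congr_right fun _ => ?_
  exact (C.projTriv i).mem_target

instance : ChartedSpace (ℂ × ℂ) C.Proj where
  atlas := {e | ∃ i x z, e = C.projChart i x z}
  chartAt p := C.projChart (C.projMap p) (C.projMap p) (C.projCoord (C.projMap p) p)
  mem_chart_source _ := ⟨C.mem _, mem_chart_source ℂ _, mem_chart_source ℂ _⟩
  chart_mem_atlas _ := ⟨_, _, _, rfl⟩

variable [IsManifold 𝓘(ℂ) ω X]

/-- Near a point the transition matrix is constant, so a change of charts is a product of a change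
of charts on `X` and a fixed Möbius map in charts of `ℂℙ¹`. -/
instance : IsManifold 𝓘(ℂ, ℂ × ℂ) ω C.Proj := by
  refine isManifold_of_contDiffOn 𝓘(ℂ, ℂ × ℂ) ω C.Proj ?_
  rintro _ _ ⟨i, x, z, rfl⟩ ⟨j, x', z', rfl⟩
  simp only [modelWithCornersSelf_coe, modelWithCornersSelf_coe_symm, Function.comp_id,
    Function.id_comp, preimage_id, range_id, inter_univ]
  rintro y ⟨hy, hy'⟩
  refine ContDiffAt.contDiffWithinAt ?_
  obtain ⟨⟨h1, h2⟩, hi⟩ := mem_projChart_target.1 hy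
  obtain ⟨hj, h3, h4⟩ := mem_projChart_source.1 hy'
  have hφ := isHolChart_chartAt (E := ℂ) x
  have hφ' := isHolChart_chartAt (E := ℂ) x'
  have hc := isHolChart_chartAt (E := ℂ) z
  have hc' := isHolChart_chartAt (E := ℂ) z'
  set φ := chartAt ℂ x
  set φ' := chartAt ℂ x'
  set c := chartAt ℂ z
  set c' := chartAt ℂ z'
  have key : ∀ y : ℂ × ℂ, φ.symm y.1 ∈ C.U i → φ.symm y.1 ∈ C.U j →
      ((C.projChart i x z).symm ≫ₕ C.projChart j x' z') y
        = (φ' (φ.symm y.1), c' (CP1.act (C.g j i (φ.symm y.1)) (c.symm y.2))) := fun y hi hj => by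
    rw [OpenPartialHomeomorph.coe_trans, Function.comp_apply, projChart_symm_apply,
      projChart_apply, projCoord_change (i := j) (j := i), projMap_symm hi, projCoord_symm hi]
    · rwa [projMap_symm hi]
    · rwa [projMap_symm hi]
  change C.projMap ((C.projTriv i).toOpenPartialHomeomorph.symm (φ.symm y.1, c.symm y.2)) ∈ _ at hj h3
  rw [projMap_symm hi] at hj h3
  have h4' : CP1.act (C.g j i (φ.symm y.1)) (c.symm y.2) ∈ c'.source := by
    change C.projCoord j ((C.projTriv i).toOpenPartialHomeomorph.symm (φ.symm y.1, c.symm y.2)) ∈ _ at h4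
    rw [projCoord_change (i := j) (j := i), projMap_symm hi, projCoord_symm hi] at h4
    · exact h4
    · rwa [projMap_symm hi]
    · rwa [projMap_symm hi]
  have hcont : ContinuousAt (fun y : ℂ × ℂ => φ.symm y.1) y :=
    (φ.continuousAt_symm h1).comp continuousAt_fst
  have e1 : ContDiffAt ℂ ω (fun t => φ' (φ.symm t)) y.1 :=
    ((hφ'.contMDiffAt h3).comp y.1 (hφ.contMDiffAt_symm h1)).contDiffAt
  have e2 : ContDiffAt ℂ ω (fun t => c' (CP1.act (C.g j i (φ.symm y.1)) (c.symm t))) y.2 :=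
    ((hc'.contMDiffAt h4').comp y.2 ((CP1.contMDiff_act (C.isSO hj hi) _).comp y.2
      (hc.contMDiffAt_symm h2))).contDiffAt
  refine ((e1.comp y contDiffAt_fst).prodMk (e2.comp y contDiffAt_snd)).congr_of_eventuallyEq ?_
  filter_upwards [hcont.eventually (C.const hj hi), hcont.eventually ((C.isOpen i).mem_nhds hi),
    hcont.eventually ((C.isOpen j).mem_nhds hj)] with q hq hqi hqj
  rw [key q hqi hqj, hq]
  rfl

lemma contMDiff_projMap : ContMDiff 𝓘(ℂ, ℂ × ℂ) 𝓘(ℂ) ω C.projMap := by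
  intro p
  have hc := (isHolChart_chartAt (E := ℂ × ℂ) p).contMDiffAt (mem_chart_source _ p)
  have hφ := isHolChart_chartAt (E := ℂ) (C.projMap p)
  have hp := mem_chart_source ℂ (C.projMap p)
  have h1 : ContMDiffAt 𝓘(ℂ, ℂ × ℂ) 𝓘(ℂ) ω (fun q => (chartAt (ℂ × ℂ) p q).1) p :=
    contDiffAt_fst.contMDiffAt.comp p hc
  refine ((hφ.contMDiffAt_symm ((chartAt ℂ (C.projMap p)).map_source hp)).comp p
    (f := fun q => (chartAt (ℂ × ℂ) p q).1) h1).congr_of_eventuallyEq ?_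
  filter_upwards [(chartAt (ℂ × ℂ) p).open_source.mem_nhds (mem_chart_source _ p)] with q hq
  exact ((chartAt ℂ (C.projMap p)).left_inv (mem_projChart_source.1 hq).2.1).symm

lemma contMDiffAt_projCoord {i : X} {p : C.Proj} (hi : C.projMap p ∈ C.U i) :
    ContMDiffAt 𝓘(ℂ, ℂ × ℂ) 𝓘(ℂ) ω (C.projCoord i) p := by
  have hc := (isHolChart_chartAt (E := ℂ × ℂ) p).contMDiffAt (mem_chart_source _ p)
  set j := C.projMap p with hj
  have hφ := isHolChart_chartAt (E := ℂ) (C.projCoord j p)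
  have hp := mem_chart_source ℂ (C.projCoord j p)
  have h1 : ContMDiffAt 𝓘(ℂ, ℂ × ℂ) 𝓘(ℂ) ω (fun q => (chartAt (ℂ × ℂ) p q).2) p :=
    contDiffAt_snd.contMDiffAt.comp p hc
  have h2 : ContMDiffAt 𝓘(ℂ, ℂ × ℂ) 𝓘(ℂ) ω (C.projCoord j) p := by
    refine ((hφ.contMDiffAt_symm ((chartAt ℂ (C.projCoord j p)).map_source hp)).comp p
      (f := fun q => (chartAt (ℂ × ℂ) p q).2) h1).congr_of_eventuallyEq ?_
    filter_upwards [(chartAt (ℂ × ℂ) p).open_source.mem_nhds (mem_chart_source _ p)] with q hq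
    exact ((chartAt ℂ (C.projCoord j p)).left_inv (mem_projChart_source.1 hq).2.2).symm
  exact ((CP1.contMDiff_act (C.isSO hi (C.mem j)) _).comp p h2).congr_of_eventuallyEq
    (projCoord_eventuallyEq hi (C.mem j))

lemma contMDiffAt_projTriv_symm {i x : X} (hx : x ∈ C.U i) (z : CP1) :
    ContMDiffAt (𝓘(ℂ).prod 𝓘(ℂ)) 𝓘(ℂ, ℂ × ℂ) ω (C.projTriv i).toOpenPartialHomeomorph.symm (x, z) := by
  have hx0 := mem_chart_source ℂ x
  have hz0 := mem_chart_source ℂ z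
  have h1 : ContMDiffAt (𝓘(ℂ).prod 𝓘(ℂ)) 𝓘(ℂ, ℂ × ℂ) ω
      (fun y : X × CP1 => (chartAt ℂ x y.1, chartAt ℂ z y.2)) (x, z) :=
    (((isHolChart_chartAt (E := ℂ) x).contMDiffAt hx0).comp (x, z) contMDiffAt_fst).prodMk_space
      (((isHolChart_chartAt (E := ℂ) z).contMDiffAt hz0).comp (x, z) contMDiffAt_snd)
  have hmem : C.projChart i x z ∈ IsManifold.maximalAtlas 𝓘(ℂ, ℂ × ℂ) ω C.Proj :=
    IsManifold.subset_maximalAtlas ⟨i, x, z, rfl⟩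
  have h2 : ContMDiffAt 𝓘(ℂ, ℂ × ℂ) 𝓘(ℂ, ℂ × ℂ) ω (C.projChart i x z).symm
      (chartAt ℂ x x, chartAt ℂ z z) := by
    refine contMDiffAt_symm_of_mem_maximalAtlas hmem (mem_projChart_target.2 ⟨⟨?_, ?_⟩, ?_⟩)
    · exact (chartAt ℂ x).map_source hx0
    · exact (chartAt ℂ z).map_source hz0
    · rwa [(chartAt ℂ x).left_inv hx0]
  refine (h2.comp (x, z) (f := fun y : X × CP1 => (chartAt ℂ x y.1, chartAt ℂ z y.2))
    h1).congr_of_eventuallyEq ?_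
  filter_upwards [((chartAt ℂ x).open_source.prod (chartAt ℂ z).open_source).mem_nhds
    ⟨hx0, hz0⟩] with y hy
  rw [Function.comp_apply, projChart_symm_apply, (chartAt ℂ x).left_inv hy.1,
    (chartAt ℂ z).left_inv hy.2]

lemma isHolCP1Bundle_projMap : IsHolCP1Bundle C.projMap := by
  refine ⟨contMDiff_projMap, fun x => ⟨C.projTriv x, C.mem x, fun p hp =>
    ContMDiffAt.contMDiffWithinAt ?_, fun y hy => ContMDiffAt.contMDiffWithinAt ?_⟩⟩
  · exact (contMDiff_projMap p).prodMk (contMDiffAt_projCoord hp)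
  · exact contMDiffAt_projTriv_symm ((C.projTriv x).mem_target.1 hy) y.2

lemma isFibreCoord_projCoord (i : X) : IsFibreCoord C.projMap (C.U i) (C.projCoord i) where
  isOpen := C.isOpen i
  proj := contMDiff_projMap
  hol _ hp := (contMDiffAt_projCoord hp).contMDiffWithinAt
  exists_inv := ⟨(C.projTriv i).toOpenPartialHomeomorph.symm,
    fun y hy => (contMDiffAt_projTriv_symm hy.1 y.2).contMDiffWithinAt,
    fun _ hx z => ⟨projMap_symm hx z, projCoord_symm hx z⟩, fun _ hp => projTriv_symm hp⟩

end SOCocycle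

/-! ### The flat connection on the projective bundle of a cocycle -/

namespace SOCocycle

variable {X : Type u} [TopologicalSpace X] [ChartedSpace ℂ X] [IsManifold 𝓘(ℂ) ω X]
  (C : SOCocycle X)

/-- The flat connection of the projective bundle: the tangent vectors along which the fibre
coordinates are constant. -/
def projConn (p : C.Proj) : Submodule ℂ (TangentSpace 𝓘(ℂ, ℂ × ℂ) p) where
  carrier := {ξ | ∀ A, IsSO A → CP1.act A (C.projCoord (C.projMap p) p) ≠ CP1.infinity →
    mvfderiv 𝓘(ℂ, ℂ × ℂ) (fun q => CP1.toC (CP1.act A (C.projCoord (C.projMap p) q))) p ξ = 0}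
  add_mem' hξ hη A hA hz := by rw [map_add, hξ A hA hz, hη A hA hz, add_zero]
  zero_mem' A _ _ := map_zero _
  smul_mem' c ξ hξ A hA hz := by rw [map_smul, hξ A hA hz, smul_zero]

variable {C}

/-- Fibre coordinates of different indices differ near `p` by a fixed isometry, and isometries
multiply the derivative by a nonzero factor, so a single test decides membership. -/
lemma mem_projConn {i : X} {p : C.Proj} (hi : C.projMap p ∈ C.U i)
    {A : Matrix (Fin 3) (Fin 3) ℂ} (hA : IsSO A) (hz : CP1.act A (C.projCoord i p) ≠ CP1.infinity)
    {ξ : TangentSpace 𝓘(ℂ, ℂ × ℂ) p} : ξ ∈ C.projConn p ↔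
      mvfderiv 𝓘(ℂ, ℂ × ℂ) (fun q => CP1.toC (CP1.act A (C.projCoord i q))) p ξ = 0 := by
  set j := C.projMap p with hj
  have hg := C.isSO hi (C.mem j)
  have hev := projCoord_eventuallyEq hi (C.mem j)
  rw [hev.eq_of_nhds, CP1.act_act hg] at hz
  have h1 : mvfderiv 𝓘(ℂ, ℂ × ℂ) (fun q => CP1.toC (CP1.act A (C.projCoord i q))) p ξ
      = mvfderiv 𝓘(ℂ, ℂ × ℂ) (fun q => CP1.toC (CP1.act (A * C.g i j j) (C.projCoord j q))) p ξ := by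
    refine mvfderiv_congr ?_ ξ
    filter_upwards [hev] with q hq
    rw [hq, CP1.act_act hg]
  rw [h1]
  refine ⟨fun h => h _ (hA.mul hg) hz, fun h B hB hzB => ?_⟩
  obtain ⟨c, -, hc, -⟩ := (C.isFibreCoord_projCoord j).mvfderiv_act (C.mem j) (hA.mul hg) hB hz hzB ξ
  rw [hc, h, mul_zero]

lemma isFlatCoord_projCoord (i : X) :
    IsFlatCoord C.projMap C.projConn (C.U i) (C.projCoord i) where
  toIsFibreCoord := C.isFibreCoord_projCoord i
  flat _ hp _ hξ _ hA hz := (mem_projConn hp hA hz).1 hξ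

/-- In a chart made from the base coordinate and a finite fibre coordinate, `T_γ` is the locus where
the first component is zero and `H` the locus where the second is, so the splitting is that of a
product. -/
lemma isHolConnection_projConn : IsHolConnection C.projMap C.projConn := by
  have key : ∀ p : C.Proj, ∃ c : OpenPartialHomeomorph C.Proj (ℂ × ℂ), IsHolChart c ∧ p ∈ c.source ∧
      ∀ q ∈ c.source, ∀ ξ, (ξ ∈ C.projConn q ↔ (mvfderiv 𝓘(ℂ, ℂ × ℂ) c q ξ).2 = 0) ∧
        (ξ ∈ relTangent C.projMap q ↔ (mvfderiv 𝓘(ℂ, ℂ × ℂ) c q ξ).1 = 0) := by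
    intro p
    obtain ⟨A, hA, hz⟩ := CP1.exists_act_ne_infinity (C.projCoord (C.projMap p) p)
    have hφ := isHolChart_chartAt (E := ℂ) (C.projMap p)
    have hζ := (C.isFibreCoord_projCoord (C.projMap p)).actConst hA
    refine ⟨hζ.chart _ hφ, hζ.isHolChart_chart hφ, ⟨⟨C.mem _, mem_chart_source ℂ _⟩, hz⟩,
      fun q hq ξ => ?_⟩
    rw [hζ.mvfderiv_chart hφ hq]
    refine ⟨mem_projConn hq.1.1 hA hq.2, fun h => ?_, fun h => ?_⟩
    · have h : mfderiv 𝓘(ℂ, ℂ × ℂ) 𝓘(ℂ) C.projMap q ξ = 0 := h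
      dsimp only
      rw [h, map_zero]
    · exact hφ.mvfderiv_injective hq.1.2 (h.trans (map_zero _).symm)
  constructor
  · intro p
    obtain ⟨c, hc, hp, h⟩ := key p
    refine ⟨Submodule.disjoint_def.2 fun ξ h1 h2 => ?_, codisjoint_iff.2 (eq_top_iff.2 fun ξ _ => ?_)⟩
    · refine hc.mvfderiv_injective hp (Eq.trans ?_ (map_zero _).symm)
      exact Prod.ext ((h p hp ξ).2.1 h1) ((h p hp ξ).1.1 h2)
    · have e := hc.mvfderiv_symm_apply hp
      set v := mvfderiv 𝓘(ℂ, ℂ × ℂ) c p ξ with hv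
      refine Submodule.mem_sup.2 ⟨(hc.tangentEquiv hp).symm (0, v.2), ?_,
        (hc.tangentEquiv hp).symm (v.1, 0), ?_, ?_⟩
      · rw [(h p hp _).2, e]
      · rw [(h p hp _).1, e]
      · refine hc.mvfderiv_injective hp ?_
        rw [map_add, e, e]
        exact Prod.ext (zero_add v.1) (add_zero v.2)
  · intro p
    obtain ⟨c, hc, hp, h⟩ := key p
    classical
    let η : ∀ q : C.Proj, TangentSpace 𝓘(ℂ, ℂ × ℂ) q := fun q =>
      if hq : q ∈ c.source then (hc.tangentEquiv hq).symm (1, 0) else 0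
    have hη : ∀ q ∈ c.source, mvfderiv 𝓘(ℂ, ℂ × ℂ) c q (η q) = (1, 0) := fun q hq => by
      simp only [η, dif_pos hq]
      exact hc.mvfderiv_symm_apply hq _
    refine ⟨c.source, c.open_source, hp, fun _ => η, fun _ q hq =>
      ContMDiffAt.contMDiffWithinAt ((hc.holAt_iff hq η).2 ?_), fun q hq => ⟨?_, ?_⟩⟩
    · refine (contMDiffAt_const (c := ((1, 0) : ℂ × ℂ))).congr_of_eventuallyEq ?_
      filter_upwards [c.open_source.mem_nhds hq] with q' hq' using hη q' hq'
    · refine LinearIndependent.of_subsingleton 0 fun h0 => ?_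
      have := hη q hq
      rw [show η q = 0 from h0, map_zero] at this
      exact zero_ne_one (congrArg Prod.fst this)
    · refine le_antisymm (Submodule.span_le.2 ?_) fun ξ hξ => ?_
      · rintro _ ⟨_, rfl⟩
        refine (h q hq _).1.2 ?_
        rw [hη q hq]
      · have h2 := (h q hq ξ).1.1 hξ
        have h3 : ξ = (mvfderiv 𝓘(ℂ, ℂ × ℂ) c q ξ).1 • η q := by
          refine hc.mvfderiv_injective hq ?_
          rw [map_smul, hη q hq]
          exact Prod.ext (by simp) (by simp [h2])
        rw [h3]
        exact Submodule.smul_mem _ _ (Submodule.subset_span ⟨0, rfl⟩)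

namespace Developing

variable {S : Finset X} (Z : C.Developing S)

/-- The section of the projective bundle given by a developing map. -/
def projSection (x : X) : C.Proj :=
  (C.projTriv x).toOpenPartialHomeomorph.symm (x, CP1.ofComplex (Z.z x x))

lemma projMap_projSection (x : X) : C.projMap (Z.projSection x) = x := projMap_symm (C.mem x) _

lemma projCoord_projSection {i x : X} (hi : x ∈ C.U i) :
    C.projCoord i (Z.projSection x) = CP1.ofComplex (Z.z i x) := by
  have h := Z.projMap_projSection x
  rw [projCoord_change (i := i) (j := x) (by rwa [h]) (by rw [h]; exact C.mem x), h,
    projSection, projCoord_symm (C.mem x), Z.change hi (C.mem x)]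

lemma contMDiff_projSection : ContMDiff 𝓘(ℂ) 𝓘(ℂ, ℂ × ℂ) ω Z.projSection := by
  intro x
  have h1 : ContMDiffAt 𝓘(ℂ) (𝓘(ℂ).prod 𝓘(ℂ)) ω (fun y => (y, CP1.ofComplex (Z.z x y))) x :=
    contMDiffAt_id.prodMk ((CP1.contMDiff_ofComplex _).comp x (Z.contMDiffAt (C.mem x)))
  refine ((contMDiffAt_projTriv_symm (C.mem x) _).comp x (f := fun y => (y, CP1.ofComplex (Z.z x y)))
    h1).congr_of_eventuallyEq ?_
  filter_upwards [(C.isOpen x).mem_nhds (C.mem x)] with y hy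
  rw [Function.comp_apply, ← Z.projCoord_projSection hy]
  have := projTriv_symm (C := C) (i := x) (p := Z.projSection y) (by rwa [Z.projMap_projSection])
  rw [Z.projMap_projSection] at this
  exact this.symm

/-- The branched projective structure of a developing map. -/
def triple : BranchedTriple X S where
  P := C.Proj
  γ := C.projMap
  isBundle := isHolCP1Bundle_projMap
  H := C.projConn
  isConnection := isHolConnection_projConn
  s := Z.projSection
  s_holomorphic := Z.contMDiff_projSection
  s_section := Z.projMap_projSection
  divisor_eq x := by
    have hz : C.projCoord x (Z.projSection x) ≠ CP1.infinity := by
      rw [Z.projCoord_projSection (C.mem x)]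
      exact CP1.ofComplex_ne_infinity _
    refine ((isFlatCoord_projCoord x).verticalDifferentialOrder_iff isHolConnection_projConn
      Z.contMDiff_projSection Z.projMap_projSection (C.mem x) hz _).2 ?_
    refine Eq.trans (analyticOrderAt_congr (EventuallyEq.deriv ?_)) (Z.order (C.mem x))
    have hx := mem_chart_source ℂ x
    have hc : Tendsto (chartAt ℂ x).symm (𝓝 (chartAt ℂ x x)) (𝓝 x) := by
      have := ((chartAt ℂ x).continuousAt_symm ((chartAt ℂ x).map_source hx)).tendsto
      rwa [(chartAt ℂ x).left_inv hx] at this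
    filter_upwards [hc.eventually ((C.isOpen x).mem_nhds (C.mem x))] with t ht
    rw [Function.comp_apply, Z.projCoord_projSection ht, CP1.toC_ofComplex, Function.comp_apply]

end Developing

end SOCocycle

/-! ### Flat frames of branched opers -/

section AdaptedFrames

open SO3Bundle

variable {X : Type u} [TopologicalSpace X] [ChartedSpace ℂ X] [IsManifold 𝓘(ℂ) ω X] {S : Finset X}

/-- Local holomorphic frames of the bundle. -/
lemma SO3Bundle.exists_frame (𝒲 : SO3Bundle X) (x₀ : X) :
    ∃ (U : Set X) (e : Fin 3 → ∀ x, 𝒲.W x), IsOpen U ∧ x₀ ∈ U ∧ (∀ i, 𝒲.Hol (e i) U) ∧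
      (∀ V ⊆ U, IsOpen V → ∀ σ, 𝒲.Hol σ V → ∃ a : X → Fin 3 → ℂ,
        (∀ i, ContMDiffOn 𝓘(ℂ) 𝓘(ℂ) ω (a · i) V) ∧ ∀ y ∈ V, comb e y (a y) = σ y) ∧
      ∀ y ∈ U, ∀ w, ∃ a, comb e y a = w := by
  let t := trivializationAt (Fin 3 → ℂ) 𝒲.W x₀
  let e : Fin 3 → ∀ x, 𝒲.W x := fun i x => t.symmₗ ℂ x (Pi.single i 1)
  have he : ∀ y a, comb e y a = t.symmₗ ℂ y a := fun y a => by
    have h : a = ∑ k, a k • (Pi.single k 1 : Fin 3 → ℂ) := by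
      ext k
      simp [Pi.single_apply, Finset.sum_apply]
    rw [comb_apply]
    conv_rhs => rw [h, map_sum]
    exact Finset.sum_congr rfl fun k _ => (map_smul _ _ _).symm
  have hl : ∀ y ∈ t.baseSet, ∀ w : 𝒲.W y, t.linearMapAt ℂ y w = (t ⟨y, w⟩).2 := fun y hy w => by
    rw [t.coe_linearMapAt_of_mem hy]
  refine ⟨t.baseSet, e, t.open_baseSet, FiberBundle.mem_baseSet_trivializationAt' x₀, fun i x hx =>
    ContMDiffAt.contMDiffWithinAt ((t.contMDiffAt_section_iff hx).2 ?_), fun V hV hVo σ hσ =>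
    ⟨fun y => t.linearMapAt ℂ y (σ y), fun i y hy => ContMDiffAt.contMDiffWithinAt ?_, fun y hy => ?_⟩,
    fun y hy w => ⟨t.linearMapAt ℂ y w, ?_⟩⟩
  · refine (contMDiffAt_const (c := (Pi.single i 1 : Fin 3 → ℂ))).congr_of_eventuallyEq ?_
    filter_upwards [t.open_baseSet.mem_nhds hx] with y hy
    rw [← hl y hy]
    exact t.linearMapAt_symmₗ hy _
  · have h1 := contMDiffAt_pi_space.1
      ((t.contMDiffAt_section_iff (hV hy)).1 (hσ.contMDiffAt (hVo.mem_nhds hy))) i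
    refine h1.congr_of_eventuallyEq ?_
    filter_upwards [hVo.mem_nhds hy] with z hz
    rw [hl z (hV hz)]
  · rw [he]
    exact t.symmₗ_linearMapAt (hV hy) _
  · rw [he]
    exact t.symmₗ_linearMapAt hy _

/-- Parallel transport. -/
lemma BranchedOper.exists_flat_section (O : BranchedOper X S) (x₀ : X) (w₀ : O.bundle.W x₀) :
    ∃ (V : Set X) (σ : ∀ x, O.bundle.W x), IsOpen V ∧ x₀ ∈ V ∧ O.bundle.Hol σ V ∧ σ x₀ = w₀ ∧
      ∀ x ∈ V, ∀ v, O.connection.D σ x v = 0 := by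
  obtain ⟨U, e, hU, hxU, hol, hcoef, hsurj⟩ := O.bundle.exists_frame x₀
  have hφ := isHolChart_chartAt (E := ℂ) x₀
  have hxφ := mem_chart_source ℂ x₀
  set φ := chartAt ℂ x₀
  obtain ⟨v, hv, hvφ⟩ := hφ.exists_coordField
  have hVo := hU.inter φ.open_source
  choose a ha hae using fun j => hcoef (U ∩ φ.source) inter_subset_left hVo
    (fun y => O.connection.D (e j) y (v y))
    (O.connection.D_holomorphic _ hVo _ v ((hol j).mono inter_subset_left) (hv.mono inter_subset_right))
  have hW : IsOpen (φ.target ∩ φ.symm ⁻¹' U) := φ.isOpen_inter_preimage_symm hU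
  have hxW : φ x₀ ∈ φ.target ∩ φ.symm ⁻¹' U :=
    ⟨φ.map_source hxφ, by rw [mem_preimage, φ.left_inv hxφ]; exact hxU⟩
  obtain ⟨R, hR, hball⟩ := Metric.isOpen_iff.1 hW _ hxW
  -- `a j` holds the coefficients of `D e_j` along `∂_t`. The section `∑ f_j e_j` is parallel when
  -- `f' = -∑ f_j a_j`.
  let L : ℂ → (Fin 3 → ℂ) →L[ℂ] (Fin 3 → ℂ) := fun t => -∑ j,
    (ContinuousLinearMap.proj (R := ℂ) (φ := fun _ : Fin 3 => ℂ) j).smulRight (a j (φ.symm t))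
  have hL : DifferentiableOn ℂ L (Metric.ball (φ x₀) R) := fun t ht => by
    obtain ⟨ht1, ht2⟩ := hball ht
    refine DifferentiableAt.differentiableWithinAt (DifferentiableAt.neg
      (DifferentiableAt.fun_sum fun j _ => ?_))
    have h1 : DifferentiableAt ℂ (fun t => a j (φ.symm t)) t := differentiableAt_pi.2 fun i => by
      have h2 := contDiffAt_comp_symm hφ (φ.map_target ht1)
        ((ha j i).contMDiffAt (hVo.mem_nhds ⟨ht2, φ.map_target ht1⟩))
      rw [φ.right_inv ht1] at h2
      exact h2.differentiableAt (by simp)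
    exact (ContinuousLinearMap.smulRightL ℂ (Fin 3 → ℂ) (Fin 3 → ℂ)
      (ContinuousLinearMap.proj (R := ℂ) (φ := fun _ : Fin 3 => ℂ) j)).differentiableAt.comp t h1
  obtain ⟨f₀, hf₀⟩ := hsurj x₀ hxU w₀
  obtain ⟨ρ, hρ, hρR, f, hf0, hf⟩ := exists_linear_ode_solution hR hL f₀
  let V := φ.source ∩ φ ⁻¹' Metric.ball (φ x₀) ρ
  have hV : IsOpen V := φ.isOpen_inter_preimage Metric.isOpen_ball
  have hVU : V ⊆ U ∩ φ.source := fun y hy => by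
    have := (hball (Metric.ball_subset_ball hρR hy.2)).2
    rw [mem_preimage, φ.left_inv hy.1] at this
    exact ⟨this, hy.1⟩
  let g : Fin 3 → X → ℂ := fun i y => f (φ y) i
  have hfd : ∀ i, ∀ t ∈ Metric.ball (φ x₀) ρ, HasDerivAt (f · i) (L t (f t) i) t :=
    fun i t ht => hasDerivAt_pi.1 (hf t ht) i
  have hg : ∀ i, ∀ y ∈ V, ContMDiffAt 𝓘(ℂ) 𝓘(ℂ) ω (g i) y := fun i y hy => by
    have h1 : DifferentiableOn ℂ (f · i) (Metric.ball (φ x₀) ρ) := fun t ht =>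
      (hfd i t ht).differentiableAt.differentiableWithinAt
    exact (h1.analyticAt (Metric.isOpen_ball.mem_nhds hy.2)).contDiffAt.contMDiffAt.comp y
      (hφ.contMDiffAt hy.1)
  have hgd : ∀ i, ∀ y ∈ V, mvfderiv 𝓘(ℂ) (g i) y (v y) = L (φ y) (f (φ y)) i := fun i y hy => by
    have h1 := mvfderiv_deriv_comp ((hφ.contMDiffAt hy.1).mdifferentiableAt (by simp))
      (hfd i (φ y) hy.2) (v := v y)
    refine h1.trans ?_
    rw [hvφ y hy.1, mul_one]
  refine ⟨V, g 0 • e 0 + g 1 • e 1 + g 2 • e 2, hV, ⟨hxφ, Metric.mem_ball_self hρ⟩, ?_, ?_,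
    fun x hx w => ?_⟩
  · refine (hol_comb (fun i => (hol i).mono fun y hy => (hVU hy).1) (a := fun y => f (φ y))
      fun i y hy => (hg i y hy).contMDiffWithinAt).congr fun y _ => ?_
    refine congrArg (TotalSpace.mk' (Fin 3 → ℂ) y) (Eq.trans ?_ (comb_apply e y (f (φ y))).symm)
    rw [Fin.sum_univ_three]
    rfl
  · rw [← hf₀, ← hf0, comb_apply, Fin.sum_univ_three]
    rfl
  · have hm : ∀ i, MDifferentiableAt 𝓘(ℂ) (𝓘(ℂ).prod 𝓘(ℂ, Fin 3 → ℂ))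
        (fun y => TotalSpace.mk' (Fin 3 → ℂ) y (e i y)) x := fun i =>
      ((hol i).contMDiffAt (hU.mem_nhds (hVU hx).1)).mdifferentiableAt (by simp)
    have hgm : ∀ i, MDifferentiableAt 𝓘(ℂ) 𝓘(ℂ) (g i) x := fun i =>
      (hg i x hx).mdifferentiableAt (by simp)
    have hgs : ∀ i, MDifferentiableAt 𝓘(ℂ) (𝓘(ℂ).prod 𝓘(ℂ, Fin 3 → ℂ))
        (fun y => TotalSpace.mk' (Fin 3 → ℂ) y ((g i • e i) y)) x := fun i =>
      (hgm i).smul_section (hm i)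
    have hD := O.connection.isCovariantDerivative
    have h1 : O.connection.D (g 0 • e 0 + g 1 • e 1 + g 2 • e 2) x (v x) = 0 := by
      rw [hD.add (mdifferentiableAt_add_section (hgs 0) (hgs 1)) (hgs 2), hD.add (hgs 0) (hgs 1),
        hD.leibniz (hm 0) (hgm 0), hD.leibniz (hm 1) (hgm 1), hD.leibniz (hm 2) (hgm 2)]
      simp only [ContinuousLinearMap.add_apply, ContinuousLinearMap.smul_apply,
        ContinuousLinearMap.smulRight_apply]
      have e1 := fun j => hae j x (hVU hx)
      rw [hgd 0 x hx, hgd 1 x hx, hgd 2 x hx, ← e1 0, ← e1 1, ← e1 2]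
      have e2 : ∀ i, e i x = comb e x (Pi.single i 1) := fun i => (comb_single e x i).symm
      rw [e2 0, e2 1, e2 2]
      simp only [← map_smul, ← map_add]
      refine (congrArg (comb e x) ?_).trans (map_zero _)
      ext i
      simp only [L, ContinuousLinearMap.neg_apply, ContinuousLinearMap.sum_apply,
        ContinuousLinearMap.smulRight_apply, ContinuousLinearMap.proj_apply, Fin.sum_univ_three,
        φ.left_inv hx.1]
      fin_cases i <;> simp [g] <;> ring
    have hw : w = mvfderiv 𝓘(ℂ) φ x w • v x := by
      refine hφ.mvfderiv_injective hx.1 ?_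
      rw [map_smul, hvφ x hx.1, smul_eq_mul, mul_one]
    rw [hw, map_smul, h1, smul_zero]

/-! ### Flat Killing frames adapted to the filtration -/

/-- A nondegenerate form in dimension three is the Killing form in a basis that contains a given
isotropic vector. -/
lemma exists_killing_basis {W : Type*} [AddCommGroup W] [Module ℂ W] (hW : Module.finrank ℂ W = 3)
    {B : W →ₗ[ℂ] W →ₗ[ℂ] ℂ} (hs : ∀ a b, B a b = B b a) (hn : ∀ a, (∀ b, B a b = 0) → a = 0)
    {n : W} (h0 : n ≠ 0) (hnn : B n n = 0) :
    ∃ a c : W, B a a = 0 ∧ B a n = -4 ∧ B c c = 2 ∧ B c n = 0 ∧ B c a = 0 := by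
  obtain ⟨a', ha'⟩ : ∃ a', B n a' ≠ 0 := by
    by_contra! h
    exact h0 (hn n h)
  let a₁ := (-4 / B n a') • a'
  have h1 : B a₁ n = -4 := by
    simp only [a₁, map_smul, LinearMap.smul_apply, smul_eq_mul, hs a' n]
    field_simp
  -- Adding `r n` changes `B(a₁, a₁)` by `2 r B(a₁, n) = -8 r`, so this multiple makes the vector
  -- isotropic.
  let a := a₁ + (B a₁ a₁ / 8) • n
  have han : B a n = -4 := by simp [a, h1, hnn]
  have haa : B a a = 0 := by
    simp only [a, map_add, map_smul, LinearMap.add_apply, LinearMap.smul_apply, smul_eq_mul, h1, hnn,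
      hs n a₁]
    ring
  have hfin : FiniteDimensional ℂ W := FiniteDimensional.of_finrank_pos (by omega)
  -- The orthogonal of `n` and `a` is nonzero by dimension, and its vectors are not isotropic by
  -- nondegeneracy; a square root normalizes the length to that of `z ∂_z`.
  obtain ⟨c, hc, hc0⟩ : ∃ c ∈ LinearMap.ker ((B n).prod (B a)), c ≠ 0 := by
    refine (Submodule.ne_bot_iff _).1 fun h => ?_
    have := LinearMap.finrank_range_add_finrank_ker ((B n).prod (B a))
    rw [h, finrank_bot, hW] at this
    have h2 := Submodule.finrank_le (LinearMap.range ((B n).prod (B a)))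
    rw [Module.finrank_prod, Module.finrank_self] at h2
    omega
  obtain ⟨hcn, hca⟩ : B n c = 0 ∧ B a c = 0 := Prod.ext_iff.1 (LinearMap.mem_ker.1 hc)
  have hcc : B c c ≠ 0 := fun hcc => by
    have hli : LinearIndependent ℂ ![n, a, c] := by
      refine Fintype.linearIndependent_iff.2 fun x hx => ?_
      rw [Fin.sum_univ_three] at hx
      change x 0 • n + x 1 • a + x 2 • c = 0 at hx
      have e1 := congrArg (B n) hx
      have e0 := congrArg (B a) hx
      simp [hnn, hcn, hs n a, han] at e1
      simp [haa, hca, han] at e0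
      rw [e0, e1] at hx
      have e2 : x 2 = 0 := by simpa [hc0] using hx
      intro i
      fin_cases i
      exacts [e0, e1, e2]
    have hsp := hli.span_eq_top_of_card_eq_finrank (by simp [hW])
    refine hc0 (hn c fun b => ?_)
    have hle : Submodule.span ℂ (range ![n, a, c]) ≤ LinearMap.ker (B c) := by
      refine Submodule.span_le.2 ?_
      rintro _ ⟨i, rfl⟩
      fin_cases i
      · exact (hs _ _).trans hcn
      · exact (hs _ _).trans hca
      · exact hcc
    exact hle (hsp ▸ Submodule.mem_top)
  obtain ⟨r, hr⟩ := IsAlgClosed.exists_pow_nat_eq (2 / B c c) two_pos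
  refine ⟨a, r • c, haa, han, ?_, ?_, ?_⟩
  · simp only [map_smul, LinearMap.smul_apply, smul_eq_mul, ← mul_assoc, ← sq, hr]
    field_simp
  · simp [hs c n, hcn]
  · simp [hs c a, hca]

/-- The sign of the middle vector is free and is used to fix the volume. The generator of `F₁` is
placed last, as `z² ∂_z` with its double zero at `0`, so that the developing map is finite at the
point. -/
lemma BranchedOper.exists_adapted_basis (O : BranchedOper X S) (x : X) :
    ∃ a : Fin 3 → O.bundle.W x, (∀ i j, O.bundle.B x (a i) (a j)
      = killing (Pi.single i 1) (Pi.single j 1)) ∧ O.bundle.vol x a = volConst ∧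
      a 2 ∈ O.filtration.F₁ x := by
  have hF := O.filtration.F₁_subbundle.finrank_eq x
  obtain ⟨n, hn0, -⟩ := finrank_eq_one_iff'.1 hF
  have hn0' : (n : O.bundle.W x) ≠ 0 := fun h => hn0 (Subtype.ext h)
  have hnn := O.filtration.isotropic x n n.2 n n.2
  obtain ⟨a, c, haa, han, hcc, hcn, hca⟩ := exists_killing_basis (O.bundle.finrank_eq x)
    (O.bundle.B_symm x) (O.bundle.B_nondegenerate x) hn0' hnn
  have hB : ∀ c : O.bundle.W x, O.bundle.B x c c = 2 → O.bundle.B x c n = 0 → O.bundle.B x c a = 0 →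
      ∀ i j, O.bundle.B x (![a, c, (n : O.bundle.W x)] i) (![a, c, (n : O.bundle.W x)] j)
        = killing (Pi.single i 1) (Pi.single j 1) := fun c hcc hcn hca i j => by
    have h1 := (O.bundle.B_symm x n a).trans han
    have h2 := (O.bundle.B_symm x n c).trans hcn
    have h3 := (O.bundle.B_symm x a c).trans hca
    fin_cases i <;> fin_cases j <;> simp [killing_apply, haa, han, hcc, hcn, hca, hnn, h1, h2, h3]
  have hsq : O.bundle.vol x ![a, c, n] ^ 2 = volConst ^ 2 := by
    have h := hB c hcc hcn hca
    rw [sq, ← O.bundle.vol_normalized, volConst_sq, Matrix.det_fin_three]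
    simp only [Matrix.of_apply, h]
    simp [killing_apply]
    norm_num
  rcases sq_eq_sq_iff_eq_or_eq_neg.1 hsq with h | h
  · exact ⟨_, hB c hcc hcn hca, h, n.2⟩
  · refine ⟨_, hB (-c) (by simp [hcc]) (by simp [hcn]) (by simp [hca]), ?_, n.2⟩
    have h1 := (O.bundle.vol x).map_update_neg ![a, c, (n : O.bundle.W x)] 1 c
    have h2 : ∀ c' : O.bundle.W x, Function.update ![a, c, (n : O.bundle.W x)] 1 c' = ![a, c', n] :=
      fun c' => by
        ext i
        fin_cases i <;> simp [Function.update]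
    rw [h2, h2, h, neg_neg] at h1
    exact h1

/-- Flat Killing frames in which the filtration is given by an affine developing map. -/
lemma BranchedOper.exists_adapted_frame (O : BranchedOper X S) (x₀ : X) :
    ∃ (U : Set X) (b : Fin 3 → ∀ x, O.bundle.W x) (z : X → ℂ), x₀ ∈ U ∧ IsFlatFrame O U b ∧
      (∀ y ∈ U, O.bundle.vol y (fun i => b i y) = volConst) ∧ ContMDiffOn 𝓘(ℂ) 𝓘(ℂ) ω z U ∧
      ∀ y ∈ U, ∀ w, comb b y w ∈ O.filtration.F₁ y ↔ ∃ c : ℂ, w = c • CP1.nulC (z y) := by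
  obtain ⟨a, haB, hav, haF⟩ := O.exists_adapted_basis x₀
  choose V b hV hxV hol hb0 hflat using fun i => O.exists_flat_section x₀ (a i)
  have hVo : IsOpen (⋂ i, V i) := isOpen_iInter_of_finite hV
  have hxVi : x₀ ∈ ⋂ i, V i := mem_iInter.2 hxV
  have hol' : ∀ i, O.bundle.Hol (b i) (⋂ i, V i) := fun i => (hol i).mono (iInter_subset _ i)
  have hflat' : ∀ i, ∀ x ∈ ⋂ i, V i, ∀ v, O.connection.D (b i) x v = 0 := fun i x hx =>
    hflat i x (mem_iInter.1 hx i)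
  -- The sections are parallel, so their products under `B` and their volume have derivative zero
  -- and keep their values at `x₀`.
  have hBc : ∀ i j, ∀ᶠ y in 𝓝 x₀, O.bundle.B y (b i y) (b j y)
      = killing (Pi.single i 1) (Pi.single j 1) := fun i j => by
    have := eventually_eq_of_mvfderiv_eq_zero hVo
      (O.bundle.B_holomorphic _ hVo (b i) (b j) (hol' i) (hol' j)) (fun y hy v => by
        rw [O.connection.D_B _ hVo (b i) (b j) (hol' i) (hol' j) y hy v, hflat' i y hy,
          hflat' j y hy, map_zero, map_zero, LinearMap.zero_apply, add_zero]) hxVi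
    filter_upwards [this] with y hy
    rw [hy, hb0, hb0, haB]
  have hvc : ∀ᶠ y in 𝓝 x₀, O.bundle.vol y (fun i => b i y) = volConst := by
    have := eventually_eq_of_mvfderiv_eq_zero hVo
      (O.bundle.vol_holomorphic _ hVo b hol') (fun y hy v => by
        rw [O.connection.D_vol _ hVo b hol' y hy v]
        refine Finset.sum_eq_zero fun i _ => ?_
        rw [hflat' i y hy]
        exact (O.bundle.vol y).map_update_zero _ _) hxVi
    filter_upwards [this] with y hy
    rw [hy, ← hav]
    congr 1
    exact funext hb0
  obtain ⟨U₁, hU₁p, hU₁, hxU₁⟩ := eventually_nhds_iff.1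
    (((eventually_all.2 fun i => eventually_all.2 (hBc i)).and hvc).and (hVo.mem_nhds hxVi))
  have hfr : IsFlatFrame O U₁ b :=
    { isOpen := hU₁
      hol := fun i => (hol' i).mono fun y hy => (hU₁p y hy).2
      killing_eq := fun y hy w w' => by
        have h : ∀ i j, O.bundle.B y (b i y) (b j y) = killing (Pi.single i 1) (Pi.single j 1) :=
          (hU₁p y hy).1.1
        simp only [comb_apply, map_sum, map_smul, LinearMap.sum_apply, LinearMap.smul_apply,
          smul_eq_mul, Fin.sum_univ_three, map_add, LinearMap.add_apply]
        rw [h, h, h, h, h, h, h, h, h]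
        simp [killing_apply]
        ring
      flat := fun i y hy => hflat' i y (hU₁p y hy).2 }
  obtain ⟨U₂, hU₂, hxU₂, e, he, hes⟩ := O.filtration.F₁_subbundle x₀
  have ho := hU₁.inter hU₂
  have hfr' := hfr.mono ho inter_subset_left
  let w := IsKillingFrame.coef O.bundle b (e 0)
  have hw := hfr'.contMDiffOn_coef (SO3Bundle.Hol.mono (he 0) (inter_subset_right (s := U₁)))
  have hmem : ∀ y ∈ U₁ ∩ U₂, ∀ u, comb b y u ∈ O.filtration.F₁ y ↔ ∃ c : ℂ, u = c • w y :=
    fun y hy u => by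
    have hsp : O.filtration.F₁ y = Submodule.span ℂ {e 0 y} := by
      rw [← (hes y hy.2).2]
      congr 1
      ext q
      simp [eq_comm]
    rw [hsp, Submodule.mem_span_singleton]
    refine exists_congr fun c => ?_
    rw [← hfr'.comb_coef hy (e 0), ← map_smul, (hfr'.comb_injective hy).eq_iff, eq_comm]
  have hwnull : ∀ y ∈ U₁ ∩ U₂, IsNull (w y) := fun y hy => by
    have h1 : comb b y (w y) ∈ O.filtration.F₁ y := (hmem y hy _).2 ⟨1, (one_smul _ _).symm⟩
    have h2 := O.filtration.isotropic y _ h1 _ h1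
    rw [hfr'.killing_eq y hy] at h2
    exact isNull_iff.2 h2
  -- At `x₀` the line `F₁` contains the last basis vector, so the last coordinate of its generator
  -- is nonzero there and nearby; this keeps the developing map away from `∞`.
  have hw0 : w x₀ 2 ≠ 0 := fun h => by
    rw [← hb0, ← comb_single b x₀ 2, hmem x₀ ⟨hxU₁, hxU₂⟩] at haF
    obtain ⟨c, hc⟩ := haF
    have := congrFun hc 2
    simp [h] at this
  obtain ⟨U, hUp, hU, hxU⟩ := eventually_nhds_iff.1
    (((hw 2).contMDiffAt (ho.mem_nhds ⟨hxU₁, hxU₂⟩)).continuousAt.eventually_ne hw0 |>.and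
      (ho.mem_nhds ⟨hxU₁, hxU₂⟩))
  have hUs : U ⊆ U₁ ∩ U₂ := fun y hy => (hUp y hy).2
  refine ⟨U, b, fun y => -(w y 1) / (2 * w y 2), hxU, hfr'.mono hU hUs,
    fun y hy => (hU₁p y (hUs hy).1).1.2, fun y hy => ?_, fun y hy u => ?_⟩
  · refine ContMDiffAt.contMDiffWithinAt ?_
    have h := fun i => (hw i).contMDiffAt (ho.mem_nhds (hUs hy))
    exact (h 1).neg.div₀ (contMDiffAt_const.mul (h 2)) (mul_ne_zero two_ne_zero (hUp y hy).1)
  · rw [hmem y (hUs hy)]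
    have h2 : w y 2 ≠ 0 := (hUp y hy).1
    have hnul : IsNull (w y) := hwnull y (hUs hy)
    change _ ↔ ∃ c : ℂ, u = c • CP1.nulC (-(w y 1) / (2 * w y 2))
    generalize w y = u' at h2 hnul ⊢
    have key : u' = u' 2 • CP1.nulC (-(u' 1) / (2 * u' 2)) := by
      have hq : u' 1 ^ 2 = 4 * u' 0 * u' 2 := hnul
      refine eq_smul_nulC ?_ ?_
      · have h3 : u' 0 = u' 1 ^ 2 / (4 * u' 2) := by
          rw [hq]
          field_simp
        rw [quad, h3]
        field_simp
        ring
      · have h3 : 2 * u' 2 * (-(u' 1) / (2 * u' 2)) = -(u' 1) :=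
          mul_div_cancel₀ _ (mul_ne_zero two_ne_zero h2)
        rw [h3, add_neg_cancel]
    constructor
    · rintro ⟨c, rfl⟩
      exact ⟨c * u' 2, by rw [mul_smul, ← key]⟩
    · rintro ⟨c, rfl⟩
      refine ⟨c / u' 2, ?_⟩
      have := congrArg (fun u => (c / u' 2) • u) key
      simp only [smul_smul, div_mul_cancel₀ _ h2] at this
      exact this.symm

/-! ### The projective structure of an oper -/

lemma CP1.nulC_ne_zero (z : ℂ) : CP1.nulC z ≠ 0 := fun h => by
  simpa [CP1.nulC] using congrFun h 2

lemma IsFlatFrame.coef_comb {O : BranchedOper X S} {U : Set X} {b : Fin 3 → ∀ x, O.bundle.W x}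
    (h : IsFlatFrame O U b) {x : X} (hx : x ∈ U) {σ : ∀ x, O.bundle.W x} {w : Fin 3 → ℂ}
    (hσ : σ x = comb b x w) : IsKillingFrame.coef O.bundle b σ x = w :=
  h.comb_injective hx (by rw [h.comb_coef hx, hσ])

lemma IsFlatFrame.D_eq_of_comb {O : BranchedOper X S} {U : Set X} {b : Fin 3 → ∀ x, O.bundle.W x}
    (h : IsFlatFrame O U b) {σ : ∀ x, O.bundle.W x} (hσ : O.bundle.Hol σ U) {a : X → Fin 3 → ℂ}
    (ha : ∀ y ∈ U, σ y = comb b y (a y)) {x : X} (hx : x ∈ U) (v : TangentSpace 𝓘(ℂ) x) :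
    O.connection.D σ x v = comb b x fun i => mvfderiv 𝓘(ℂ) (fun y => a y i) x v := by
  rw [h.D_eq hσ hx v]
  congr 1
  funext i
  refine mvfderiv_congr ?_ v
  filter_upwards [h.isOpen.mem_nhds hx] with y hy
  rw [h.coef_comb hy (ha y hy)]

lemma CP1.hasDerivAt_nulC (t : ℂ) (i : Fin 3) :
    HasDerivAt (fun t => CP1.nulC t i) ((![2 * t, -2, 0] : Fin 3 → ℂ) i) t := by
  fin_cases i
  · simpa [CP1.nulC] using hasDerivAt_pow 2 t
  · simpa [CP1.nulC] using (hasDerivAt_id t).const_mul (-2)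
  · simpa [CP1.nulC] using hasDerivAt_const t (1 : ℂ)

lemma mvfderiv_nulC {z : X → ℂ} {x : X} (hz : MDifferentiableAt 𝓘(ℂ) 𝓘(ℂ) z x)
    (v : TangentSpace 𝓘(ℂ) x) (i : Fin 3) :
    mvfderiv 𝓘(ℂ) (fun y => CP1.nulC (z y) i) x v
      = mvfderiv 𝓘(ℂ) z x v * (![2 * z x, -2, 0] : Fin 3 → ℂ) i := by
  rw [mul_comm]
  exact mvfderiv_deriv_comp (g := fun t => CP1.nulC t i) hz (CP1.hasDerivAt_nulC (z x) i) v

open Classical in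
/-- The affine developing map of an oper branches exactly over `S`. -/
lemma IsFlatFrame.analyticOrderAt_deriv [T2Space X] {O : BranchedOper X S} {U : Set X}
    {b : Fin 3 → ∀ x, O.bundle.W x} (h : IsFlatFrame O U b) {z : X → ℂ}
    (hz : ContMDiffOn 𝓘(ℂ) 𝓘(ℂ) ω z U)
    (hF : ∀ y ∈ U, ∀ w, comb b y w ∈ O.filtration.F₁ y ↔ ∃ c : ℂ, w = c • CP1.nulC (z y))
    {x : X} (hx : x ∈ U) :
    analyticOrderAt (deriv (z ∘ (chartAt ℂ x).symm)) (chartAt ℂ x x) = if x ∈ S then 1 else 0 := by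
  have hφ := isHolChart_chartAt (E := ℂ) x
  have hxφ := mem_chart_source ℂ x
  set φ := chartAt ℂ x with hφd
  obtain ⟨v, hv, hvφ⟩ := hφ.exists_coordField
  set n : ℕ := if x ∈ S then 1 else 0 with hn
  -- The other points of the finite set `S` are removed, so that a form on `W` only has to vanish at
  -- `x`, and only if `x` lies in `S`.
  let W : Set X := (U ∩ φ.source) ∩ ((↑(S.erase x) : Set X))ᶜ
  have hW : IsOpen W := (h.isOpen.inter φ.open_source).inter
    (S.erase x).finite_toSet.isClosed.isOpen_compl
  have hxW : x ∈ W := ⟨⟨hx, hxφ⟩, by simp⟩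
  have hWU : W ⊆ U := fun y hy => hy.1.1
  have hWφ : W ⊆ φ.source := fun y hy => hy.1.2
  have hWS : ∀ y ∈ W, y ∈ S → y = x := fun y hy hyS => by
    by_contra hne
    exact hy.2 (by simp [hne, hyS])
  have hb := h.mono hW hWU
  have hzW := hz.mono hWU
  have hnul : ∀ y ∈ W, comb b y (CP1.nulC (z y)) ∈ O.filtration.F₁ y := fun y hy =>
    (hF y (hWU hy) _).2 ⟨1, (one_smul _ _).symm⟩
  have hdir : ∀ y ∈ W, comb b y ![2 * z y, -2, 0] ∈ O.filtration.F₂ y := fun y hy => by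
    rw [hb.comb_mem_F₂ hy (CP1.nulC_ne_zero _) (hnul y hy), CP1.killing_nulC, quad]
    simp
  -- `σ` generates `F₁`, and `κ` is its derivative with respect to the developing map. `κ` lies in
  -- `F₂` but not in `F₁`, so its image under `β` has no zeros.
  let σ : ∀ y, O.filtration.F₁ y := fun y =>
    if hy : y ∈ W then ⟨comb b y (CP1.nulC (z y)), hnul y hy⟩ else 0
  let κ : ∀ y, O.filtration.F₂ y := fun y =>
    if hy : y ∈ W then ⟨comb b y ![2 * z y, -2, 0], hdir y hy⟩ else 0
  have hσe : ∀ y ∈ W, (σ y : O.bundle.W y) = comb b y (CP1.nulC (z y)) := fun y hy => by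
    simp only [σ, dif_pos hy]
  have hκe : ∀ y ∈ W, (κ y : O.bundle.W y) = comb b y ![2 * z y, -2, 0] := fun y hy => by
    simp only [κ, dif_pos hy]
  have hσ : O.bundle.Hol (fun y => σ y) W := by
    refine ContMDiffOn.congr (hol_comb (a := fun y => CP1.nulC (z y)) hb.hol fun k => ?_)
      fun y hy => congrArg (TotalSpace.mk' (Fin 3 → ℂ) y) (hσe y hy)
    fin_cases k
    · exact hzW.pow 2
    · exact contMDiffOn_const.mul hzW
    · exact contMDiffOn_const
  have hκ : O.bundle.Hol (fun y => κ y) W := by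
    refine ContMDiffOn.congr (hol_comb (a := fun y => ![2 * z y, -2, 0]) hb.hol fun k => ?_)
      fun y hy => congrArg (TotalSpace.mk' (Fin 3 → ℂ) y) (hκe y hy)
    fin_cases k
    · exact contMDiffOn_const.mul hzW
    · exact contMDiffOn_const
    · exact contMDiffOn_const
  let k : X → ℂ := fun y => O.filtration.β y (κ y)
  have hk : ContMDiffOn 𝓘(ℂ) 𝓘(ℂ) ω k W := O.filtration.β_holomorphic W hW κ hκ
  have hk0 : ∀ y ∈ W, k y ≠ 0 := fun y hy h0 => by
    have h1 := (O.filtration.β_ker y _).1 h0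
    rw [hκe y hy, hF y (hWU hy)] at h1
    obtain ⟨c, hc⟩ := h1
    have h2 := congrFun hc 2
    have h3 := congrFun hc 1
    simp [CP1.nulC] at h2 h3
    simp [← h2] at h3
  have hzd : ∀ y ∈ W, MDifferentiableAt 𝓘(ℂ) 𝓘(ℂ) z y := fun y hy =>
    (hzW.contMDiffAt (hW.mem_nhds hy)).mdifferentiableAt (by simp)
  let d : X → ℂ := fun y => deriv (z ∘ φ.symm) (φ y)
  have hd : ∀ y ∈ W, mvfderiv 𝓘(ℂ) z y (v y) = d y := fun y hy => by
    rw [(mvfderiv_eq_deriv_mul hφ (hWφ hy) (hzd y hy) (v y)).2, hvφ y (hWφ hy), mul_one]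
  -- The second fundamental form identifies `α(σ)` with the class of `D σ`, which is `d κ`. Up to a
  -- unit, `α(σ)` is therefore the derivative `d` of the developing map.
  have hα : ∀ y ∈ W, O.filtration.α y (σ y) (v y) = d y * k y := fun y hy => by
    rw [← O.connection.secondFundamentalForm_eq_one W hW σ hσ y hy (v y)]
    change _ = d y • O.filtration.β y (κ y)
    rw [← map_smul]
    congr 1
    refine Subtype.ext ?_
    change O.connection.D (fun y => σ y) y (v y) = d y • (κ y : O.bundle.W y)
    rw [hb.D_eq_of_comb hσ hσe hy, hκe y hy, ← map_smul]
    congr 1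
    funext i
    rw [mvfderiv_nulC (hzd y hy), hd y hy]
    rfl
  -- This form has order exactly `n` at `x` and lies in the image of `α`, so it is a multiple of
  -- `α(σ)` and the order of `d` is at most `n`. If `x` lies in `S`, vanishing of `α` at `x` makes
  -- the order at least one.
  let θ : ∀ y : X, TangentSpace 𝓘(ℂ) y →ₗ[ℂ] ℂ := fun y =>
    (φ y - φ x) ^ n • (mvfderiv 𝓘(ℂ) φ y).toLinearMap
  have hθ : HolOneForm θ W := fun V hVW hV u hu y hy => by
    have h1 := hφ.contMDiffAt (hWφ (hVW hy))
    exact (((h1.sub contMDiffAt_const).pow n).mul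
      (contMDiffAt_mvfderiv_apply h1 (hu.contMDiffAt (hV.mem_nhds hy)))).contMDiffWithinAt
  obtain ⟨τ, hτ, hτθ⟩ := O.filtration.α_surjective W hW θ hθ fun y hyS hyW => by
    obtain rfl := hWS y hyW hyS
    simp [θ, hn, hyS]
  let c : X → ℂ := fun y => IsKillingFrame.coef O.bundle b (fun y => τ y) y 2
  have hc : ContMDiffOn 𝓘(ℂ) 𝓘(ℂ) ω c W := hb.contMDiffOn_coef hτ 2
  have hτe : ∀ y ∈ W, τ y = c y • σ y := fun y hy => by
    have h1 := (τ y).2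
    rw [← hb.comb_coef hy (fun y => (τ y : O.bundle.W y)), hF y (hWU hy)] at h1
    obtain ⟨e, he⟩ := h1
    have h2 : c y = e := by
      change IsKillingFrame.coef O.bundle b (fun y => (τ y : O.bundle.W y)) y 2 = e
      rw [he]
      simp [CP1.nulC]
    refine Subtype.ext ?_
    rw [h2, Submodule.coe_smul, hσe y hy, ← map_smul, ← he, hb.comb_coef hy]
  have hmain : ∀ y ∈ W, (φ y - φ x) ^ n = c y * (d y * k y) := fun y hy => by
    rw [← hα y hy, ← smul_eq_mul, ← LinearMap.smul_apply, ← map_smul, ← hτe y hy, hτθ y hy]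
    change _ = (φ y - φ x) ^ n * mvfderiv 𝓘(ℂ) φ y (v y)
    rw [hvφ y (hWφ hy), mul_one]
  have hsymm : Tendsto φ.symm (𝓝 (φ x)) (𝓝 x) := by
    have := (φ.continuousAt_symm (φ.map_source hxφ)).tendsto
    rwa [φ.left_inv hxφ] at this
  have han : ∀ f : X → ℂ, ContMDiffOn 𝓘(ℂ) 𝓘(ℂ) ω f W → AnalyticAt ℂ (f ∘ φ.symm) (φ x) :=
    fun f hf => (contDiffAt_comp_symm hφ hxφ (hf.contMDiffAt (hW.mem_nhds hxW))).analyticAt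
  have hd' : AnalyticAt ℂ (deriv (z ∘ φ.symm)) (φ x) := (han z hzW).deriv
  have hk' := han k hk
  have hko : analyticOrderAt (k ∘ φ.symm) (φ x) = 0 := hk'.analyticOrderAt_eq_zero.2 (by
    rw [Function.comp_apply, φ.left_inv hxφ]
    exact hk0 x hxW)
  have hsum : (n : ℕ∞) = analyticOrderAt (c ∘ φ.symm) (φ x)
      + analyticOrderAt (deriv (z ∘ φ.symm)) (φ x) := by
    rw [← add_zero (analyticOrderAt (deriv (z ∘ φ.symm)) (φ x)), ← hko,
      ← analyticOrderAt_mul hd' hk', ← analyticOrderAt_mul (han c hc) (hd'.mul hk')]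
    have h1 : AnalyticAt ℂ (fun t => (t - φ x) ^ n) (φ x) := by fun_prop
    rw [eq_comm, ← h1.analyticOrderAt_eq_natCast.2 ⟨fun _ => 1, analyticAt_const, one_ne_zero,
      Eventually.of_forall fun t => by simp⟩]
    refine analyticOrderAt_congr ?_
    filter_upwards [hsymm.eventually (hW.mem_nhds hxW),
      φ.open_target.mem_nhds (φ.map_source hxφ)] with t ht htφ
    have := hmain _ ht
    simp only [d, φ.right_inv htφ] at this
    exact this.symm
  by_cases hxS : x ∈ S
  · rw [if_pos hxS]
    have hn1 : (n : ℕ∞) = 1 := by simp [hn, hxS]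
    rw [hn1] at hsum
    refine le_antisymm (hsum ▸ le_add_self) (Order.one_le_iff_pos.2 (pos_iff_ne_zero.2
      (hd'.analyticOrderAt_ne_zero.2 ?_)))
    have h1 := hα x hxW
    rw [O.filtration.α_vanishes x hxS] at h1
    exact (mul_eq_zero.1 h1.symm).resolve_right (hk0 x hxW)
  · rw [if_neg hxS]
    have hn0 : (n : ℕ∞) = 0 := by simp [hn, hxS]
    rw [hn0] at hsum
    exact (add_eq_zero.1 hsum.symm).2

/-- The transition matrices of adapted frames. -/
lemma IsFlatFrame.exists_isSO {O : BranchedOper X S} {U U' : Set X}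
    {b b' : Fin 3 → ∀ x, O.bundle.W x} (h : IsFlatFrame O U b) (h' : IsFlatFrame O U' b')
    (hv : ∀ y ∈ U, O.bundle.vol y (fun i => b i y) = volConst)
    (hv' : ∀ y ∈ U', O.bundle.vol y (fun i => b' i y) = volConst) {x : X} (hx : x ∈ U)
    (hx' : x ∈ U') :
    ∃ A, IsSO A ∧ ∀ᶠ y in 𝓝 x, ∀ w, comb b' y w = comb b y (A.mulVec w) := by
  obtain ⟨A, hA, he⟩ := h.exists_const_matrix h' hx hx'
  refine ⟨A, ⟨hA, ?_⟩, he⟩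
  -- Both frames have volume `volConst`, so the transition matrix has determinant one and not only
  -- `±1`.
  have h1 := vol_comb h.toIsKillingFrame hx (fun i => A.mulVec (Pi.single i 1))
  simp only [← he.self_of_nhds, comb_single] at h1
  rw [hv x hx, hv' x hx'] at h1
  have hvc : volConst ≠ 0 := fun h0 => by
    have := volConst_sq
    rw [h0] at this
    norm_num at this
  have h2 : (Matrix.of fun i => A.mulVec (Pi.single i 1)) = A.transpose := by
    ext i j
    simp
  rw [h2, Matrix.det_transpose] at h1
  exact mul_left_cancel₀ hvc (by rw [← h1, mul_one])

/-- The cocycle and the developing map of an oper. -/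
theorem BranchedOper.exists_developing [T2Space X] (O : BranchedOper X S) :
    ∃ (C : SOCocycle X) (Z : C.Developing S) (b : X → Fin 3 → ∀ x, O.bundle.W x),
      (∀ i, IsFlatFrame O (C.U i) (b i)) ∧
      (∀ i j x, x ∈ C.U i → x ∈ C.U j → ∀ w,
        comb (b j) x w = comb (b i) x ((C.g i j x).mulVec w)) ∧
      ∀ i, ∀ x ∈ C.U i, ∀ w, comb (b i) x w ∈ O.filtration.F₁ x ↔
        ∃ c : ℂ, w = c • CP1.nulC (Z.z i x) := by
  choose U b z hxU hb hvol hz hF using O.exists_adapted_frame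
  have hex : ∀ i j x, ∃ A, x ∈ U i → x ∈ U j → IsSO A ∧
      ∀ᶠ y in 𝓝 x, ∀ w, comb (b j) y w = comb (b i) y (A.mulVec w) := fun i j x => by
    by_cases h : x ∈ U i ∧ x ∈ U j
    · obtain ⟨A, hA⟩ := (hb i).exists_isSO (hb j) (hvol i) (hvol j) h.1 h.2
      exact ⟨A, fun _ _ => hA⟩
    · exact ⟨1, fun hi hj => absurd ⟨hi, hj⟩ h⟩
  choose g hg using hex
  have hact : ∀ i j x, x ∈ U i → x ∈ U j → ∀ w, comb (b j) x w = comb (b i) x ((g i j x).mulVec w) :=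
    fun i j x hi hj => (hg i j x hi hj).2.self_of_nhds
  have huniq : ∀ i x, x ∈ U i → ∀ A B : Matrix (Fin 3) (Fin 3) ℂ,
      (∀ w, comb (b i) x (A.mulVec w) = comb (b i) x (B.mulVec w)) → A = B := fun i x hi A B h =>
    Matrix.mulVec_injective (funext fun w => (hb i).comb_injective hi (h w))
  let C : SOCocycle X :=
    { U := U
      isOpen := fun i => (hb i).isOpen
      mem := hxU
      g := g
      isSO := fun hi hj => (hg _ _ _ hi hj).1
      self := fun {i x} hi => huniq i x hi _ _ fun w => by
        rw [← hact i i x hi hi w, Matrix.one_mulVec]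
      comp := fun {i j k x} hi hj hk => huniq i x hi _ _ fun w => by
        rw [← Matrix.mulVec_mulVec, ← hact i j x hi hj, ← hact j k x hj hk, ← hact i k x hi hk]
      const := fun {i j x} hi hj => by
        filter_upwards [(hg i j x hi hj).2, (hb i).isOpen.mem_nhds hi, (hb j).isOpen.mem_nhds hj]
          with y hy hyi hyj
        refine huniq i y hyi _ _ fun w => ?_
        rw [← hact i j y hyi hyj, hy] }
  let Z : C.Developing S :=
    { z := z
      hol := hz
      change := fun {i j x} hi hj => by
        have h1 := (hF j x hj (CP1.nulC (z j x))).2 ⟨1, (one_smul _ _).symm⟩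
        rw [hact i j x hi hj, hF i x hi] at h1
        obtain ⟨c, hc⟩ := h1
        have hc0 : c ≠ 0 := by
          rintro rfl
          rw [zero_smul] at hc
          exact (hg i j x hi hj).1.mulVec_ne_zero (CP1.nulC_ne_zero _) hc
        change CP1.pt ((g i j x).mulVec (CP1.nulC (z j x))) = _
        rw [hc, CP1.pt_smul hc0, ← CP1.nul_ofComplex, CP1.pt_nul]
      order := fun {i x} hx => by
        convert (hb i).analyticOrderAt_deriv (hz i) (hF i) hx }
  exact ⟨C, Z, b, hb, hact, hF⟩

/-- Every oper is associated to a projective structure. -/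
theorem BranchedOper.exists_isAssociatedOper [T2Space X] (O : BranchedOper X S) :
    ∃ T : BranchedTriple X S, T.IsAssociatedOper O := by
  obtain ⟨C, Z, b, hb, hg, hF⟩ := O.exists_developing
  refine ⟨Z.triple, isAssociatedOper_of_cocycle (C := C) (ζ := C.projCoord) (b := b)
    (fun i => C.isFlatCoord_projCoord i) hb (fun i j p hi hj => SOCocycle.projCoord_change hi hj) hg
    fun i x hx w => ?_⟩
  rw [hF i x hx]
  have : C.projCoord i (Z.triple.s x) = CP1.ofComplex (Z.z i x) := Z.projCoord_projSection hx
  rw [this, CP1.nul_ofComplex]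

end AdaptedFrames

end

theorem theorem6p1 (X : Type u) [TopologicalSpace X] [T2Space X] [ConnectedSpace X]
    [ChartedSpace ℂ X] [IsManifold 𝓘(ℂ) ω X] (S : Finset X) :
    ∃ Φ : BranchedProjectiveStructure X S ≃ BranchedOperClass X S,
      ∀ (T : BranchedTriple X S) (O : BranchedOper X S),
        Φ T.toStructure = O.toClass ↔ T.IsAssociatedOper O := by
  choose op hop using fun T : BranchedTriple X S => T.exists_isAssociatedOper
  have hwd : ∀ T₁ T₂ : BranchedTriple X S, T₁.Equivalent T₂ → (op T₁).toClass = (op T₂).toClass :=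
    fun T₁ T₂ h => Quotient.sound ((h.isAssociatedOper (hop T₁)).isomorphic (hop T₂))
  -- The opers associated with a triple form exactly one isomorphism class: association passes along
  -- isomorphisms, and any two associated opers are isomorphic.
  have hiff : ∀ (T : BranchedTriple X S) (O : BranchedOper X S),
      (op T).toClass = O.toClass ↔ T.IsAssociatedOper O := fun T O =>
    ⟨fun h => (show (op T).Isomorphic O from Quotient.exact h).isAssociatedOper (hop T),
      fun h => Quotient.sound ((hop T).isomorphic h)⟩
  let F : BranchedProjectiveStructure X S → BranchedOperClass X S :=
    Quotient.lift (fun T => (op T).toClass) hwd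
  have hF : Function.Bijective F := by
    constructor
    · intro P₁ P₂
      induction P₁ using Quotient.inductionOn with | _ T₁ => ?_
      induction P₂ using Quotient.inductionOn with | _ T₂ => ?_
      intro h
      exact Quotient.sound (((hiff T₁ (op T₂)).1 h).equivalent (hop T₂))
    · intro Q
      induction Q using Quotient.inductionOn with | _ O => ?_
      obtain ⟨T, hT⟩ := O.exists_isAssociatedOper
      exact ⟨T.toStructure, (hiff T O).2 hT⟩
  exact ⟨Equiv.ofBijective F hF, hiff⟩
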